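/- **Setting.** Let $r\ge 1$, $Y=\mathbb R^n$, $P=\mathbb R^m$, $\mathbb Y=\ell_\infty(\mathbb Z;Y)$, $\mathbb P=\ell_\infty(\mathbb Z;P)$, $\Psi=\ell_\infty(\mathbb Z;\mathbb R)$ with supremum norms. "$C^r$" for a map between Banach spaces means that all derivatives of orders $0,\dots,r$ exist, are bounded and uniformly continuous. Let $f_k:Y\to Y$, $g_k:Y\to P$ ($k\in\mathbb Z$) be $r$ times continuously differentiable, with derivatives of orders $1,\dots,r$ bounded and uniformly continuous, uniformly in $k$, and with $\sup_k(|f_k(0)|+|g_k(0)|)<\infty$. Let $\Lambda_k\subset Y$ be invariant sets of $y'=f_k(y)$, bounded uniformly in $k$ and uniformly hyperbolic in the following sense. On each $\Lambda_k$ there are continuous families of subspaces $N^s(y),N^u(y)$ with $Y=N^s(y)\oplus N^u(y)\oplus \mathrm{Span}\, f_k(y)$, invariant under the linearized flow $v'=f_k'(y(t))v$ along every orbit $y(t)$ in $\Lambda_k$, the linearized flow being exponentially contracting on $N^s$ as $t\to+\infty$ and on $N^u$ as $t\to-\infty$. For a constant $C_\Lambda$ independent of $k$ and of the orbit $y(t)$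 in $\Lambda_k$, there is a solution $y^*(t)$ of $v'=-f_k'(y(t))^{\top}v$ with $\langle y^*,\dot y\rangle\equiv1$ and $|y^*(t)|\le C_\Lambda$ (in particular $\Lambda_k$ contains no equilibria), and all bounded solutions $v$ of $v'-f_k'(y)v+\langle y^*,v\rangle\dot y=h$ with $h$ bounded and continuous satisfy $\sup_t|v(t)|\le C_\Lambda\sup_t|h(t)|$. Let $\mathbf f(\mathbf y)=\{f_k(y_k)\}_k$, $\mathbf g(\mathbf y)=\{g_k(y_k)\}_k$, and let $\mathbf F_\varepsilon:\mathbb Y\times\mathbb P\to\mathbb Y$, $\mathbf G_\varepsilon:\mathbb Y\times\mathbb P\to\mathbb P$ be $C^r$ maps, given for $|\varepsilon|<a$ and depending continuously on $\varepsilon$ in the $C^r$-norm. Consider the coupled lattice dynamical system $$\mathbf y'=\mathbf f(\mathbf y)+\varepsilon\mathbf F_\varepsilon(\mathbf y,\mathbf p),\qquad \mathbf p'=\mathbf g(\mathbf y)+\varepsilon\mathbf G_\varepsilon(\mathbf y,\mathbf p).\qquad(*)$$ An orbit of $\Lambda^\infty$ is a sequence $\mathbf y^0=\{y^0_k(t)\}_k$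 of arbitrary orbits $y_k^0$ of $y'=f_k(y)$ in $\Lambda_k$. Let $\mathbb W^0_{\mathbf y^0}=\{(\mathbf y,\mathbf p): y_k=y_k^0(\phi_k)\ \forall k,\ \phi_k\in\mathbb R\}$ be the product of the orbit curves times $\mathbb P$. **Theorem.** There are $\varepsilon_0>0$ and $\delta>0$ such that for all $|\varepsilon|<\varepsilon_0$ and every orbit $\mathbf y^0$ of $\Lambda^\infty$ there is a manifold $\mathbb W_{\mathbf y^0,\varepsilon}\subset\mathbb Y\times\mathbb P$, given by $$y_k=y_k^0(\phi_k)+\mathbb V_k(\Phi,\mathbf p,\varepsilon),\qquad k\in\mathbb Z,\ \Phi=\{\phi_k\}_k\in\mathbb R^{\mathbb Z},\ \mathbf p\in\mathbb P,$$ with the following properties, where smoothness and $C^j$-norms of $\mathbb V=\{\mathbb V_k\}_k$ refer to the maps $\Psi\times\mathbb P\ni(\Phi,\mathbf p)\mapsto\mathbb V(\theta+\Phi,\mathbf p,\varepsilon)\in\mathbb Y$ for arbitrary $\theta\in\mathbb R^{\mathbb Z}$ ($\theta=0$ gives the bounded phase sequences). 1. $\mathbb V$ is $C^r$, and $(\Phi,\mathbf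 p)\mapsto(\mathbf y^0(\theta+\Phi)+\mathbb V(\theta+\Phi,\mathbf p,\varepsilon),\mathbf p)$ is an $r$ times continuously differentiable immersion of $\Psi\times\mathbb P$ whose derivatives have continuous left inverses. 2. $\mathbb W_{\mathbf y^0,\varepsilon}$ is invariant with respect to $(*)$: through each of its points, with any phases and $\mathbf p$, passes a solution defined for all $t\in\mathbb R$ which stays on it, with phases $\theta+\Phi(t)$, $\Phi(t)\in\Psi$ continuous in $t$. 3. It is uniquely defined: it is the set of initial points of all solutions of $(*)$ on $\mathbb R$ for which there are continuous functions $\psi_k(t)$ with $|y_k(t)-y^0_k(\psi_k(t))|\le\delta$ for all $k$ and $t$; and any manifold $y_k=y_k^0(\phi_k)+\mathbb V'_k(\Phi,\mathbf p)$, invariant in the sense of 2, with $\mathbb V'$ of class $C^r$ and with $\mathbb V'$ and its first derivative bounded by $\delta$ in norm, coincides with it. 4. $\mathbb W_{\mathbf y^0,0}=\mathbb W^0_{\mathbf y^0}$, and $\mathbb V$ depends continuously on $\varepsilon$ in the $C^r$-norm, uniformly with respect to $\mathbf y^0$. 5. $\|\mathbb V_k\|_{C^{r-1}}=O(\varepsilon)$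 and $\|\mathbb V_k\|_{C^{r}}=o(1)$ as $\varepsilon\to0$, uniformly for all $k\in\mathbb Z$ and all orbits $\mathbf y^0$ of $\Lambda^\infty$. -/

import Mathlib

open scoped ENNReal

noncomputable section

namespace LDS

/-- Bounded bi-infinite sequences in `E` with the supremum norm. -/
abbrev Linf (E : Type*) [NormedAddCommGroup E] : Type _ := lp (fun _ : ℤ => E) ∞

/-- A bounded sequence viewed as an element of `Linf E` (unbounded sequences are sent to `0`). -/
def toLinf {E : Type*} [NormedAddCommGroup E] (u : ℤ → E) : Linf E := by
  classical
  exact if h : Memℓp u ∞ then ⟨u, h⟩ else 0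

theorem toLinf_apply {E : Type*} [NormedAddCommGroup E] {u : ℤ → E}
    (h : ∃ C : ℝ, ∀ k, ‖u k‖ ≤ C) (k : ℤ) : toLinf u k = u k := by
  have hm : Memℓp u ∞ := by
    obtain ⟨C, hC⟩ := h
    refine memℓp_infty ⟨C, ?_⟩
    rintro _ ⟨i, rfl⟩
    exact hC i
  simp [toLinf, hm]

section Smoothness

variable {E : Type*} [NormedAddCommGroup E] [NormedSpace ℝ E]
variable {F : Type*} [NormedAddCommGroup F] [NormedSpace ℝ F]

/-- `C^r` in the uniform sense: all derivatives of orders `0, …, r` exist, are bounded and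
uniformly continuous on the whole space. -/
structure IsCr (r : ℕ) (h : E → F) : Prop where
  contDiff : ContDiff ℝ r h
  bounded : ∃ C : ℝ, ∀ j ≤ r, ∀ x, ‖iteratedFDeriv ℝ j h x‖ ≤ C
  unifCont : ∀ j ≤ r, UniformContinuous (iteratedFDeriv ℝ j h)

/-- A sequence of `C^r` maps whose derivatives are bounded and uniformly continuous, uniformly in
the index.  The maps themselves need not be bounded on the whole space: only their values at the
origin are required to be bounded, so that `y ↦ (h k (y k))` maps bounded sequences to bounded
sequences. -/
structure IsUniformFamily (r : ℕ) (h : ℤ → E → F) : Prop where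
  contDiff : ∀ k, ContDiff ℝ r (h k)
  bounded_zero : ∃ C : ℝ, ∀ k, ‖h k 0‖ ≤ C
  bounded_deriv : ∃ C : ℝ, ∀ k, ∀ j, 1 ≤ j → j ≤ r → ∀ x, ‖iteratedFDeriv ℝ j (h k) x‖ ≤ C
  unifCont : ∀ j ≤ r, UniformEquicontinuous (fun k => iteratedFDeriv ℝ j (h k))

/-- A family `h ε` of `C^r` maps, defined for `|ε| < a`, that depends continuously on `ε` in the
`C^r`-norm. (Hence the `C^r`-norm of `h ε` is bounded for `ε` near `0`.) -/
structure IsCrContinuousFamily (r : ℕ) (a : ℝ) (h : ℝ → E → F) : Prop where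
  isCr : ∀ ε, |ε| < a → IsCr r (h ε)
  continuous : ∀ ε₁, |ε₁| < a → ∀ η > 0, ∃ ρ > 0, ∀ ε, |ε| < a → |ε - ε₁| < ρ →
    ∀ j ≤ r, ∀ x, ‖iteratedFDeriv ℝ j (h ε) x - iteratedFDeriv ℝ j (h ε₁) x‖ ≤ η

/-- A `C^r` immersion with complemented tangent spaces: the derivative has a continuous linear left
inverse at every point. -/
def IsCrImmersion (r : ℕ) (U : E → F) : Prop :=
  ContDiff ℝ r U ∧
    ∀ z, ∃ L : F →L[ℝ] E, L.comp (fderiv ℝ U z) = ContinuousLinearMap.id ℝ E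

/-- `x` is a solution, on the whole time axis, of the autonomous equation `x' = X(x)`. -/
def IsSolution (X : E → E) (x : ℝ → E) : Prop := ∀ t, HasDerivAt x (X (x t)) t

/-- `v` solves the linearization `v' = f'(y(t)) v` along `y`. -/
def IsLinearizedSolution (f : E → E) (y v : ℝ → E) : Prop :=
  ∀ t, HasDerivAt v (fderiv ℝ f (y t) (v t)) t

end Smoothness

section Hyperbolicity

variable {n : ℕ}

/-- `Λ` is invariant under the flow of `y' = f(y)`. -/
def IsInvariantSet (f : EuclideanSpace ℝ (Fin n) → EuclideanSpace ℝ (Fin n))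
    (Λ : Set (EuclideanSpace ℝ (Fin n))) : Prop :=
  ∀ y, IsSolution f y → y 0 ∈ Λ → ∀ t, y t ∈ Λ

/-- The orbit `y` of `y' = f(y)` lies in `Λ`. -/
def IsOrbitIn (f : EuclideanSpace ℝ (Fin n) → EuclideanSpace ℝ (Fin n))
    (Λ : Set (EuclideanSpace ℝ (Fin n))) (y : ℝ → EuclideanSpace ℝ (Fin n)) : Prop :=
  IsSolution f y ∧ ∀ t, y t ∈ Λ

/-- A hyperbolic splitting over `Λ`: stable and unstable subspaces, continuous in the base point,
complementary together with the direction of the flow, invariant under the linearized flow, and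
exponentially contracted by it forward, respectively backward, in time. -/
structure IsHyperbolicSplitting (f : EuclideanSpace ℝ (Fin n) → EuclideanSpace ℝ (Fin n))
    (Λ : Set (EuclideanSpace ℝ (Fin n)))
    (Ns Nu : EuclideanSpace ℝ (Fin n) → Submodule ℝ (EuclideanSpace ℝ (Fin n))) : Prop where
  continuous_stable : ContinuousOn (fun y => (Ns y).starProjection) Λ
  continuous_unstable : ContinuousOn (fun y => (Nu y).starProjection) Λ
  directSum : ∀ y ∈ Λ, DirectSum.IsInternal ![Ns y, Nu y, Submodule.span ℝ {f y}]
  invariant_stable : ∀ y, IsOrbitIn f Λ y → ∀ v, IsLinearizedSolution f y v →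
    ∀ s, v s ∈ Ns (y s) → ∀ t, v t ∈ Ns (y t)
  invariant_unstable : ∀ y, IsOrbitIn f Λ y → ∀ v, IsLinearizedSolution f y v →
    ∀ s, v s ∈ Nu (y s) → ∀ t, v t ∈ Nu (y t)
  contracts_stable : ∀ y, IsOrbitIn f Λ y → ∃ C : ℝ, ∃ a > 0, ∀ v, IsLinearizedSolution f y v →
    (∀ t, v t ∈ Ns (y t)) → ∀ s t, s ≤ t → ‖v t‖ ≤ C * Real.exp (-a * (t - s)) * ‖v s‖
  contracts_unstable : ∀ y, IsOrbitIn f Λ y → ∃ C : ℝ, ∃ a > 0, ∀ v, IsLinearizedSolution f y v →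
    (∀ t, v t ∈ Nu (y t)) → ∀ s t, s ≤ t → ‖v s‖ ≤ C * Real.exp (-a * (t - s)) * ‖v t‖

/-- `ys` is the solution of the conjugate equation `v' = -f'(y(t))ᵀ v` along the orbit `y`,
normalized by `⟨ys, y'⟩ = 1`, and bounded by `C`. -/
structure IsNormalizedAdjoint (f : EuclideanSpace ℝ (Fin n) → EuclideanSpace ℝ (Fin n))
    (C : ℝ) (y ys : ℝ → EuclideanSpace ℝ (Fin n)) : Prop where
  solves : ∀ t, HasDerivAt ys (-(ContinuousLinearMap.adjoint (fderiv ℝ f (y t)) (ys t))) t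
  normalized : ∀ t, inner ℝ (ys t) (f (y t)) = 1
  bounded : ∀ t, ‖ys t‖ ≤ C

/-- The sets `Λ k` are hyperbolic for `y' = f k (y)`, uniformly over all `k` and all orbits: the
normalized bounded solutions `ys` of the conjugate equations are bounded by one constant, and
bounded solutions of `v' - f'(y) v + ⟨ys, v⟩ y' = h` satisfy `sup ‖v‖ ≤ C sup ‖h‖` with one
constant.  (For each orbit, existence and uniqueness of a bounded `v` for every bounded `h` is a
consequence of the splitting; only the uniformity of the constant is required here.) -/
def UniformlyHyperbolic (f : ℤ → EuclideanSpace ℝ (Fin n) → EuclideanSpace ℝ (Fin n))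
    (Λ : ℤ → Set (EuclideanSpace ℝ (Fin n))) : Prop :=
  (∀ k, ∃ Ns Nu, IsHyperbolicSplitting (f k) (Λ k) Ns Nu) ∧
  ∃ C : ℝ, ∀ k y, IsOrbitIn (f k) (Λ k) y → ∃ ys, IsNormalizedAdjoint (f k) C y ys ∧
    ∀ (h v : ℝ → EuclideanSpace ℝ (Fin n)) (M : ℝ), Continuous h → (∀ t, ‖h t‖ ≤ M) →
      (∃ B : ℝ, ∀ t, ‖v t‖ ≤ B) →
      (∀ t, HasDerivAt v
        (fderiv ℝ (f k) (y t) (v t) - inner ℝ (ys t) (v t) • f k (y t) + h t) t) →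
      ∀ t, ‖v t‖ ≤ C * M

end Hyperbolicity

section Lattice

variable {n m : ℕ}

/-- The right-hand side of the coupled system
`y' = f(y) + ε F_ε(y, p)`, `p' = g(y) + ε G_ε(y, p)` on `ℓ∞(Y) × ℓ∞(P)`. -/
def coupledField (f : ℤ → EuclideanSpace ℝ (Fin n) → EuclideanSpace ℝ (Fin n))
    (g : ℤ → EuclideanSpace ℝ (Fin n) → EuclideanSpace ℝ (Fin m))
    (F : ℝ → Linf (EuclideanSpace ℝ (Fin n)) × Linf (EuclideanSpace ℝ (Fin m)) →
      Linf (EuclideanSpace ℝ (Fin n)))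
    (G : ℝ → Linf (EuclideanSpace ℝ (Fin n)) × Linf (EuclideanSpace ℝ (Fin m)) →
      Linf (EuclideanSpace ℝ (Fin m))) (ε : ℝ)
    (x : Linf (EuclideanSpace ℝ (Fin n)) × Linf (EuclideanSpace ℝ (Fin m))) :
    Linf (EuclideanSpace ℝ (Fin n)) × Linf (EuclideanSpace ℝ (Fin m)) :=
  (toLinf (fun k => f k (x.1 k)) + ε • F ε x, toLinf (fun k => g k (x.1 k)) + ε • G ε x)

/-- `y0` is an orbit from `Λ^∞`: a sequence of arbitrary orbits `y0 k` in `Λ k`. -/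
def IsProductOrbit (f : ℤ → EuclideanSpace ℝ (Fin n) → EuclideanSpace ℝ (Fin n))
    (Λ : ℤ → Set (EuclideanSpace ℝ (Fin n))) (y0 : ℤ → ℝ → EuclideanSpace ℝ (Fin n)) : Prop :=
  ∀ k, IsOrbitIn (f k) (Λ k) (y0 k)

/-- The product of the curves `y0 k`, times `ℓ∞(P)`. -/
def orbitProduct (y0 : ℤ → ℝ → EuclideanSpace ℝ (Fin n)) :
    Set (Linf (EuclideanSpace ℝ (Fin n)) × Linf (EuclideanSpace ℝ (Fin m))) :=
  {x | ∃ φ : ℤ → ℝ, ∀ k, x.1 k = y0 k (φ k)}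

/-- The set `{(y, p) : y_k = y0_k(φ_k) + V_k(φ, p) for all k, for some phases φ}`. -/
def phaseGraph (y0 : ℤ → ℝ → EuclideanSpace ℝ (Fin n))
    (V : (ℤ → ℝ) → Linf (EuclideanSpace ℝ (Fin m)) → Linf (EuclideanSpace ℝ (Fin n))) :
    Set (Linf (EuclideanSpace ℝ (Fin n)) × Linf (EuclideanSpace ℝ (Fin m))) :=
  {x | ∃ φ : ℤ → ℝ, ∀ k, x.1 k = y0 k (φ k) + V φ x.2 k}

/-- `V` in the Banach chart of phase sequences at bounded distance from `θ`:
`(Φ, p) ↦ V(θ + Φ, p)` on `ℓ∞(ℝ) × ℓ∞(P)`.  For `θ = 0` these are the bounded phase sequences. -/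
def phaseChart
    (V : (ℤ → ℝ) → Linf (EuclideanSpace ℝ (Fin m)) → Linf (EuclideanSpace ℝ (Fin n)))
    (θ : ℤ → ℝ) (z : Linf ℝ × Linf (EuclideanSpace ℝ (Fin m))) :
    Linf (EuclideanSpace ℝ (Fin n)) :=
  V (fun k => θ k + z.1 k) z.2

/-- The parametrization `(Φ, p) ↦ (y0(θ + Φ) + V(θ + Φ, p), p)` of `phaseGraph y0 V`. -/
def graphParam (y0 : ℤ → ℝ → EuclideanSpace ℝ (Fin n))
    (V : (ℤ → ℝ) → Linf (EuclideanSpace ℝ (Fin m)) → Linf (EuclideanSpace ℝ (Fin n)))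
    (θ : ℤ → ℝ) (z : Linf ℝ × Linf (EuclideanSpace ℝ (Fin m))) :
    Linf (EuclideanSpace ℝ (Fin n)) × Linf (EuclideanSpace ℝ (Fin m)) :=
  (toLinf (fun k => y0 k (θ k + z.1 k)) + phaseChart V θ z, z.2)

/-- Invariance of the parametrized manifold: through each of its points there is a solution, defined
for all times, that stays on it, with phases that move continuously in the uniform norm. -/
def IsInvariantGraph
    (X : Linf (EuclideanSpace ℝ (Fin n)) × Linf (EuclideanSpace ℝ (Fin m)) →
      Linf (EuclideanSpace ℝ (Fin n)) × Linf (EuclideanSpace ℝ (Fin m)))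
    (y0 : ℤ → ℝ → EuclideanSpace ℝ (Fin n))
    (V : (ℤ → ℝ) → Linf (EuclideanSpace ℝ (Fin m)) → Linf (EuclideanSpace ℝ (Fin n))) : Prop :=
  ∀ (θ : ℤ → ℝ) (p : Linf (EuclideanSpace ℝ (Fin m))),
    ∃ (x : ℝ → Linf (EuclideanSpace ℝ (Fin n)) × Linf (EuclideanSpace ℝ (Fin m)))
      (Φ : ℝ → Linf ℝ), IsSolution X x ∧ Continuous Φ ∧ Φ 0 = 0 ∧ (x 0).2 = p ∧
      ∀ t, x t = graphParam y0 V θ (Φ t, (x t).2)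

/-- The initial points of all solutions of `x' = X(x)` that stay, for all times and in every
component, within `δ` of the orbit `y0` up to a continuous reparametrization of time in each
component. -/
def shadowingSet
    (X : Linf (EuclideanSpace ℝ (Fin n)) × Linf (EuclideanSpace ℝ (Fin m)) →
      Linf (EuclideanSpace ℝ (Fin n)) × Linf (EuclideanSpace ℝ (Fin m)))
    (y0 : ℤ → ℝ → EuclideanSpace ℝ (Fin n)) (δ : ℝ) :
    Set (Linf (EuclideanSpace ℝ (Fin n)) × Linf (EuclideanSpace ℝ (Fin m))) :=
  {x₀ | ∃ x, IsSolution X x ∧ x 0 = x₀ ∧ ∃ ψ : ℤ → ℝ → ℝ, (∀ k, Continuous (ψ k)) ∧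
    ∀ t k, ‖(x t).1 k - y0 k (ψ k t)‖ ≤ δ}

end Lattice

end LDS

end

noncomputable section

namespace LDS

open Set Filter Topology Metric

set_option linter.unusedSectionVars false

/-! ### Exponentially growing weights and absorption of small terms -/

section Weights

variable {E : Type*} [NormedAddCommGroup E] [NormedSpace ℝ E]

/-! The proof introduces phase coordinates along the product of orbits in which the lattice becomes
a slow-fast system, and obtains the manifold as the slow graph of that system by a Lyapunov-Perron
argument.

Coordinates. Write `y_k = y0_k(φ_k) + v_k` and let the phases move by `φ_k' = 1 + ⟨y*_k(φ_k), v_k⟩`.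
The equation left for `v` is `v' = f(y0(φ) + v) - (1 + ⟨y*, v⟩) f(y0(φ)) + ε F`, and its
linearization at `v = 0` is `f'(y) v - ⟨y*, v⟩ y'`, the operator of the hyperbolicity hypothesis: it
has no neutral direction, because a multiple `c y'` now decays like `c' = -c`. Along a single orbit
it is boundedly invertible on bounded functions (`isDich_normalOp`). The inverse survives phase
speeds near `1`, and it passes to the lattice with a uniform constant, because the linearization is
diagonal there (`isDich_linf`, `HypFamily.exists_lattice_dich`).

Slow variables. The slow field depends only weakly on the phase, since its phase-dependent part
vanishes at `v = 0`. The parameters are rescaled to `q = μ p`, which makes their velocity small. The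
factor `ε` in front of the coupling is written `ε₁ sin η` with a further slow variable, `η' = 0`. In
`F_ε` and `G_ε`, which are only continuous in `ε`, the parameter is kept as an index, together with
the sequence of orbits. `exists_slowFast` chooses the constants.

The graph. Along any admissible slow curve there is a small bounded solution `v` on the whole line,
unique by comparison. It depends on the past and the future of the curve, so the slow equation
becomes a functional equation, solved by contraction in a `cosh` weight (`SlowFast.exists_section`).
The value of `v` at time `0` is the section. Comparison of orbits (`SlowFast.compare_orbits`) shows
that every orbit in the tube lies on it.

Smoothness. The derivative of the section along orbits solves a Riccati-type equation that is again
a slow-fast system with the same constant `C`; `SlowFast.section_deriv` and the induction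
`SlowFast.section_UC` yield all derivatives, each at the price of a factor `10` in the smallness
condition. All moduli are uniform in the index, which gives uniformity in the orbits and continuity
in `ε`. The section vanishes at `η = 0`, so derivatives below the top order are `O(ε)`, one order
being spent on Lipschitz continuity in `η`.

Uniqueness. A solution that shadows the orbits can be assigned phases obeying the phase equation
(`HypFamily.exists_tracking`), hence it is an orbit of the slow-fast system and lies on the section.
A competing invariant graph consists of shadowing solutions and is therefore contained in the
manifold; a fixed point argument with the projection `⟨y*, ·⟩` shows that it covers it
(`NormalForm.exists_phase_of_subset`). -/

theorem norm_sub_le_cosh {f f' : ℝ → E} {γ D : ℝ} (hγ : 0 < γ)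
    (h : ∀ t, HasDerivAt f (f' t) t) (hD : ∀ t, ‖f' t‖ ≤ D * Real.cosh (γ * t)) (t : ℝ) :
    ‖f t - f 0‖ ≤ D / γ * Real.cosh (γ * t) := by
  have hD0 : 0 ≤ D := by simpa using (norm_nonneg _).trans (hD 0)
  have key : ∀ (g g' : ℝ → E), (∀ t, HasDerivAt g (g' t) t) →
      (∀ t, ‖g' t‖ ≤ D * Real.cosh (γ * t)) → ∀ t, 0 ≤ t →
      ‖g t - g 0‖ ≤ D / γ * Real.cosh (γ * t) := by
    intro g g' hg hg' t ht
    have hB : ∀ x, HasDerivAt (fun s => D / γ * Real.sinh (γ * s)) (D * Real.cosh (γ * x)) x := by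
      intro x
      have h1 : HasDerivAt (fun s : ℝ => γ * s) γ x := by
        simpa using (hasDerivAt_id x).const_mul γ
      have h2 := (h1.sinh).const_mul (D / γ)
      have h3 : D / γ * (Real.cosh (γ * x) * γ) = D * Real.cosh (γ * x) := by field_simp
      rw [h3] at h2
      exact h2
    have := image_norm_le_of_norm_deriv_right_le_deriv_boundary (a := 0) (b := t)
      (f := fun s => g s - g 0) (f' := g')
      (fun x _ => ((hg x).continuousAt.continuousWithinAt.sub continuousWithinAt_const))
      (fun x _ => ((hg x).sub_const _).hasDerivWithinAt)
      (B := fun s => D / γ * Real.sinh (γ * s)) (by simp) hB (fun x _ => hg' x)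
      (right_mem_Icc.2 ht)
    refine this.trans ?_
    gcongr
    exact (Real.sinh_lt_cosh _).le
  rcases le_total 0 t with ht | ht
  · exact key f f' h hD t ht
  · have := key (fun s => f (-s)) (fun s => -f' (-s)) (fun s => by
      simpa [Function.comp_def] using HasDerivAt.scomp (𝕜 := ℝ) s (h (-s)) (hasDerivAt_neg s))
      (fun s => by simpa using hD (-s)) (-t) (by linarith)
    simpa using this

/-- Iterating the implication gives the constants `|X₀| / 2 ^ n + 2 c`. The finite bound to start
from is indispensable; the result no longer depends on it. The comparison estimates below absorb
their small terms through this lemma. -/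
theorem le_of_forall_le_half {g w : ℝ → ℝ} {c : ℝ} (hw : ∀ t, 0 < w t)
    (h0 : ∃ X, ∀ t, g t ≤ X * w t)
    (h : ∀ X, 0 ≤ X → (∀ t, g t ≤ X * w t) → ∀ t, g t ≤ (X / 2 + c) * w t) (hc : 0 ≤ c) (t : ℝ) :
    g t ≤ 2 * c * w t := by
  obtain ⟨X₀, hX₀⟩ := h0
  have hX₁ : ∀ t, g t ≤ |X₀| * w t := fun t => (hX₀ t).trans (by
    have := hw t
    gcongr
    exact le_abs_self _)
  have key : ∀ n : ℕ, ∀ t, g t ≤ (|X₀| / 2 ^ n + 2 * c) * w t := by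
    intro n
    induction n with
    | zero =>
      intro t
      refine (hX₁ t).trans ?_
      have := hw t
      gcongr
      simp only [pow_zero, div_one]
      linarith
    | succ n ih =>
      intro t
      refine (h _ (by positivity) ih t).trans (le_of_eq ?_)
      rw [pow_succ]
      ring
  have hlim : Tendsto (fun n : ℕ => (|X₀| / 2 ^ n + 2 * c) * w t) atTop
      (𝓝 ((0 + 2 * c) * w t)) := by
    refine Tendsto.mul_const _ (Tendsto.add_const _ ?_)
    have := (tendsto_pow_atTop_nhds_zero_of_lt_one (r := (1 / 2 : ℝ)) (by norm_num)
      (by norm_num)).const_mul |X₀|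
    simpa [div_eq_mul_inv] using this
  have := ge_of_tendsto' hlim (fun n => key n t)
  simpa using this

theorem one_le_cosh_mul (γ t : ℝ) : 1 ≤ Real.cosh (γ * t) := Real.one_le_cosh _

/-- Quadratic remainders of quantities growing at rate `γ` are measured at rate `2 γ`. -/
theorem cosh_sq_le (γ t : ℝ) : Real.cosh (γ * t) ^ 2 ≤ Real.cosh (2 * γ * t) := by
  have h1 := Real.cosh_two_mul (γ * t)
  rw [show 2 * γ * t = 2 * (γ * t) by ring]
  nlinarith [sq_nonneg (Real.sinh (γ * t))]

theorem continuous_cosh_mul (γ : ℝ) : Continuous fun t : ℝ => Real.cosh (γ * t) := by fun_prop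

end Weights

/-! ### Differential equations whose right-hand side depends on the whole curve -/

section FunctionalODE

variable {Z : Type*} [NormedAddCommGroup Z] [NormedSpace ℝ Z]

/-- `z` is a curve through `z₀` with continuous velocity `q` in `S`, of controlled growth. -/
structure IsCurve (S : Set Z) (M γ : ℝ) (z₀ : Z) (z q : ℝ → Z) : Prop where
  cont : Continuous q
  mem : ∀ t, q t ∈ S
  bound : ∀ t, ‖q t‖ ≤ M * Real.cosh (γ * t)
  deriv : ∀ t, HasDerivAt z (q t) t
  init : z 0 = z₀

variable [CompleteSpace Z]

theorem exists_curve_primitive (q : ℝ → Z) (hq : Continuous q) (z₀ : Z) :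
    (∀ t, HasDerivAt (fun t => z₀ + ∫ s in (0:ℝ)..t, q s) (q t) t) := by
  intro t
  exact (intervalIntegral.integral_hasDerivAt_right (hq.intervalIntegrable _ _)
    hq.stronglyMeasurable.stronglyMeasurableAtFilter hq.continuousAt).const_add _

/-- A Picard iteration on velocities rather than on curves: integration costs `1 / γ` in the
weighted norm and `T` costs `c`, so the map contracts by `c / γ`. Working with velocities makes the
constraint `q t ∈ S` closed and lets it pass through the iteration; `T` needs to make sense only
along such curves. -/
theorem exists_solution_functional (S : Set Z) (hS : IsClosed S) {γ c M : ℝ} (hγ : 0 < γ)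
    (hc : 0 ≤ c) (hcγ : c < γ) (z₀ : Z) (hne : ∃ s ∈ S, ‖s‖ ≤ M) (T : (ℝ → Z) → ℝ → Z)
    (hT : ∀ z q, IsCurve S M γ z₀ z q → Continuous (T z) ∧ (∀ t, T z t ∈ S) ∧
      ∀ t, ‖T z t‖ ≤ M * Real.cosh (γ * t))
    (hLip : ∀ z₁ q₁ z₂ q₂, IsCurve S M γ z₀ z₁ q₁ → IsCurve S M γ z₀ z₂ q₂ → ∀ X,
      (∀ t, ‖z₁ t - z₂ t‖ ≤ X * Real.cosh (γ * t)) →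
      ∀ t, ‖T z₁ t - T z₂ t‖ ≤ c * X * Real.cosh (γ * t)) :
    ∃ z, IsCurve S M γ z₀ z (T z) := by
  classical
  set w : ℝ → ℝ := fun t => Real.cosh (γ * t) with hw
  have hwpos : ∀ t, 0 < w t := fun t => Real.cosh_pos _
  have hwc : Continuous w := continuous_cosh_mul γ
  set X : Set (BoundedContinuousFunction ℝ Z) := {u | ∀ t, w t • u t ∈ S ∧ ‖u t‖ ≤ M} with hX
  have hXc : IsClosed X := by
    have : X = ⋂ t, {u : BoundedContinuousFunction ℝ Z | w t • u t ∈ S ∧ ‖u t‖ ≤ M} := by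
      ext u; simp [hX]
    rw [this]
    refine isClosed_iInter fun t => IsClosed.inter ?_ ?_
    · exact hS.preimage ((continuous_eval_const t).const_smul (w t))
    · exact isClosed_le (continuous_eval_const t).norm continuous_const
  let Q : BoundedContinuousFunction ℝ Z → ℝ → Z := fun u t => w t • u t
  let C : BoundedContinuousFunction ℝ Z → ℝ → Z := fun u t => z₀ + ∫ s in (0:ℝ)..t, Q u s
  have hQc : ∀ u, Continuous (Q u) := fun u => hwc.smul u.continuous
  have hC : ∀ u ∈ X, IsCurve S M γ z₀ (C u) (Q u) := by
    intro u hu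
    refine ⟨hQc u, fun t => (hu t).1, fun t => ?_, exists_curve_primitive _ (hQc u) z₀, ?_⟩
    · simp only [Q, norm_smul, Real.norm_eq_abs, abs_of_pos (hwpos t)]
      rw [mul_comm]
      exact mul_le_mul_of_nonneg_right (hu t).2 (hwpos t).le
    · simp [C]
  -- Division by the weight brings the new velocity back into the space of bounded functions.
  have hmk : ∀ u ∈ X, ∃ u' ∈ X, ∀ t, w t • u' t = T (C u) t := by
    intro u hu
    obtain ⟨h1, h2, h3⟩ := hT _ _ (hC u hu)
    have hb : ∀ t, ‖(w t)⁻¹ • T (C u) t‖ ≤ M := by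
      intro t
      rw [norm_smul, norm_inv, Real.norm_eq_abs, abs_of_pos (hwpos t), inv_mul_le_iff₀ (hwpos t),
        mul_comm]
      exact h3 t
    have hk : ∀ t, w t • (w t)⁻¹ • T (C u) t = T (C u) t := fun t => by
      rw [smul_smul, mul_inv_cancel₀ (hwpos t).ne', one_smul]
    refine ⟨BoundedContinuousFunction.ofNormedAddCommGroup (fun t => (w t)⁻¹ • T (C u) t)
      ((hwc.inv₀ fun t => (hwpos t).ne').smul h1) M hb, fun t => ⟨?_, ?_⟩, fun t => ?_⟩
    · simpa [hk] using h2 t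
    · simpa using hb t
    · simpa using hk t
  choose! R hRX hR using hmk
  let Φ : X → X := fun u => ⟨R u.1, hRX u.1 u.2⟩
  have hΦ : ContractingWith (Real.toNNReal (c / γ)) Φ := by
    refine ⟨?_, LipschitzWith.of_dist_le_mul ?_⟩
    · rw [← NNReal.coe_lt_coe, Real.coe_toNNReal _ (by positivity), NNReal.coe_one, div_lt_one hγ]
      exact hcγ
    · intro u v
      rw [Real.coe_toNNReal _ (by positivity)]
      set D := dist u v with hD
      have hD' : ∀ t, ‖u.1 t - v.1 t‖ ≤ D := fun t => by
        rw [← dist_eq_norm]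
        exact BoundedContinuousFunction.dist_coe_le_dist t
      have h1 : ∀ t, ‖C u.1 t - C v.1 t‖ ≤ D / γ * w t := by
        intro t
        have := norm_sub_le_cosh (f := fun t => C u.1 t - C v.1 t) (D := D) hγ
          (fun t => ((hC _ u.2).deriv t).sub ((hC _ v.2).deriv t)) (fun t => by
            simp only [Q]
            rw [← smul_sub, norm_smul, Real.norm_eq_abs, abs_of_pos (hwpos t), mul_comm]
            exact mul_le_mul_of_nonneg_right (hD' t) (hwpos t).le) t
        simpa [C] using this
      have h2 := hLip _ _ _ _ (hC _ u.2) (hC _ v.2) _ h1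
      change dist (R u.1) (R v.1) ≤ _
      rw [BoundedContinuousFunction.dist_le (by positivity)]
      intro t
      have h3 := h2 t
      rw [← hR _ u.2, ← hR _ v.2, ← smul_sub, norm_smul, Real.norm_eq_abs, abs_of_pos (hwpos t),
        mul_comm] at h3
      rw [dist_eq_norm]
      have := le_of_mul_le_mul_right h3 (hwpos t)
      calc _ ≤ _ := this
        _ = _ := by ring
  obtain ⟨s, hsS, hsM⟩ := hne
  have : Nonempty X := by
    refine ⟨⟨BoundedContinuousFunction.ofNormedAddCommGroup (fun t => (w t)⁻¹ • s)
      ((hwc.inv₀ fun t => (hwpos t).ne').smul continuous_const) M fun t => ?_, fun t => ⟨?_, ?_⟩⟩⟩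
    · rw [norm_smul, norm_inv, Real.norm_eq_abs, abs_of_pos (hwpos t), inv_mul_le_iff₀ (hwpos t)]
      nlinarith [one_le_cosh_mul γ t, norm_nonneg s]
    · simpa [smul_smul, mul_inv_cancel₀ (hwpos t).ne'] using hsS
    · simp only [BoundedContinuousFunction.coe_ofNormedAddCommGroup]
      rw [norm_smul, norm_inv, Real.norm_eq_abs, abs_of_pos (hwpos t), inv_mul_le_iff₀ (hwpos t)]
      nlinarith [one_le_cosh_mul γ t, norm_nonneg s]
  have : CompleteSpace X := hXc.completeSpace_coe
  obtain ⟨u, hu⟩ : ∃ u : X, Φ u = u := ⟨_, hΦ.fixedPoint_isFixedPt⟩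
  refine ⟨C u.1, ?_⟩
  have : T (C u.1) = Q u.1 := by
    funext t
    rw [← hR _ u.2]
    have h4 : R u.1 = u.1 := congrArg Subtype.val hu
    simp only [Q, h4]
  rw [this]
  exact hC _ u.2

/-- Global solutions of `x' = B(t, x)` for a globally Lipschitz right-hand side. -/
theorem exists_global_solution (B : ℝ → Z → Z) (hB : Continuous fun p : ℝ × Z => B p.1 p.2)
    {K B₀ : ℝ} (hK : 0 ≤ K) (hLip : ∀ t x y, ‖B t x - B t y‖ ≤ K * ‖x - y‖)
    (hB₀ : ∀ t, ‖B t 0‖ ≤ B₀) (z₀ : Z) :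
    ∃ z : ℝ → Z, z 0 = z₀ ∧ ∀ t, HasDerivAt z (B t (z t)) t := by
  have hB₀' : 0 ≤ B₀ := (norm_nonneg _).trans (hB₀ 0)
  -- With this rate `K * (M / γ) ≤ M / 2`, and `M` is twice the bound of the remaining terms, so the
  -- velocity bound reproduces itself.
  set γ := 2 * K + 1
  have hγ : 0 < γ := by positivity
  set M := 2 * (B₀ + K * ‖z₀‖)
  have hM : 0 ≤ M := by positivity
  obtain ⟨z, hz⟩ := exists_solution_functional (univ : Set Z) isClosed_univ (γ := γ) (c := K)
    (M := M) hγ hK (by simp only [γ]; linarith) z₀ ⟨0, mem_univ _, by simpa using hM⟩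
    (fun z t => B t (z t))
    (by
      intro z q hz
      have hzc : Continuous z := continuous_iff_continuousAt.2 fun t => (hz.deriv t).continuousAt
      refine ⟨hB.comp (continuous_id.prodMk hzc), fun _ => mem_univ _, fun t => ?_⟩
      have h1 := norm_sub_le_cosh hγ hz.deriv hz.bound t
      rw [hz.init] at h1
      have h2 := hLip t (z t) 0
      have h3 : ‖z t‖ ≤ ‖z₀‖ + M / γ * Real.cosh (γ * t) := by
        calc ‖z t‖ = ‖z₀ + (z t - z₀)‖ := by simp
          _ ≤ _ := (norm_add_le _ _).trans (by gcongr)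
      have h4 : ‖B t (z t)‖ ≤ B₀ + K * ‖z t‖ := by
        calc ‖B t (z t)‖ = ‖B t 0 + (B t (z t) - B t 0)‖ := by simp
          _ ≤ _ := (norm_add_le _ _).trans (by
            have := hB₀ t
            rw [sub_zero] at h2
            gcongr)
      have h5 := one_le_cosh_mul γ t
      have h6 : K * (M / γ) ≤ M / 2 := by
        rw [← mul_div_assoc, div_le_div_iff₀ hγ (by norm_num)]
        simp only [γ]; nlinarith
      calc _ ≤ _ := h4
        _ ≤ B₀ + K * (‖z₀‖ + M / γ * Real.cosh (γ * t)) := by gcongr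
        _ = (B₀ + K * ‖z₀‖) * 1 + K * (M / γ) * Real.cosh (γ * t) := by ring
        _ ≤ (B₀ + K * ‖z₀‖) * Real.cosh (γ * t) + M / 2 * Real.cosh (γ * t) := by gcongr
        _ = _ := by simp only [M]; ring)
    (by
      intro z₁ q₁ z₂ q₂ _ _ X hX t
      calc _ ≤ _ := hLip t _ _
        _ ≤ K * (X * Real.cosh (γ * t)) := by gcongr; exact hX t
        _ = _ := by ring)
  exact ⟨z, hz.init, hz.deriv⟩

end FunctionalODE

/-! ### Bounded invertibility of `v' - A(t) v` and its consequences -/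

section Dichotomy

variable {E : Type*} [NormedAddCommGroup E] [NormedSpace ℝ E]

/-- `v ↦ v' - A(t) v` is boundedly invertible on bounded continuous functions, with inverse of norm
at most `C`. -/
structure IsDich (A : ℝ → E →L[ℝ] E) (C : ℝ) : Prop where
  cont : Continuous A
  bdd : ∃ K, ∀ t, ‖A t‖ ≤ K
  est : ∀ (h v : ℝ → E) (M : ℝ), Continuous h → (∀ t, ‖h t‖ ≤ M) → (∃ B, ∀ t, ‖v t‖ ≤ B) →
    (∀ t, HasDerivAt v (A t (v t) + h t) t) → ∀ t, ‖v t‖ ≤ C * M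
  exist : ∀ (h : ℝ → E) (M : ℝ), Continuous h → (∀ t, ‖h t‖ ≤ M) →
    ∃ v : ℝ → E, (∃ B, ∀ t, ‖v t‖ ≤ B) ∧ ∀ t, HasDerivAt v (A t (v t) + h t) t

theorem continuous_of_hasDerivAt {v v' : ℝ → E} (h : ∀ t, HasDerivAt v (v' t) t) : Continuous v :=
  continuous_iff_continuousAt.2 fun t => (h t).continuousAt

variable {A : ℝ → E →L[ℝ] E} {C : ℝ}

theorem IsDich.unique (hA : IsDich A C) {h v₁ v₂ : ℝ → E} (hb₁ : ∃ B, ∀ t, ‖v₁ t‖ ≤ B)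
    (hb₂ : ∃ B, ∀ t, ‖v₂ t‖ ≤ B) (h₁ : ∀ t, HasDerivAt v₁ (A t (v₁ t) + h t) t)
    (h₂ : ∀ t, HasDerivAt v₂ (A t (v₂ t) + h t) t) : v₁ = v₂ := by
  obtain ⟨B₁, hB₁⟩ := hb₁
  obtain ⟨B₂, hB₂⟩ := hb₂
  funext t
  have := hA.est (fun _ => 0) (fun t => v₁ t - v₂ t) 0 continuous_const (by simp)
    ⟨B₁ + B₂, fun t => (norm_sub_le _ _).trans (add_le_add (hB₁ t) (hB₂ t))⟩ (fun t => by
      refine HasDerivAt.congr_deriv ((h₁ t).sub (h₂ t)) ?_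
      simp) t
  rw [mul_zero] at this
  exact sub_eq_zero.1 (norm_le_zero_iff.1 this)

/-- Dividing by the weight produces the extra term `-γ tanh(γ t) u`, which is absorbed as long as `C
γ ≤ 1 / 2`. Thus the inverse also controls solutions that grow at a slow exponential rate. -/
theorem IsDich.weighted (hA : IsDich A C) (hC : 0 < C) {γ B H : ℝ} (hγ : 0 ≤ γ)
    (hCγ : C * γ ≤ 1 / 2) {h v : ℝ → E} (hh : Continuous h)
    (hH : ∀ t, ‖h t‖ ≤ H * Real.cosh (γ * t)) (hB : ∀ t, ‖v t‖ ≤ B * Real.cosh (γ * t))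
    (hv : ∀ t, HasDerivAt v (A t (v t) + h t) t) (t : ℝ) :
    ‖v t‖ ≤ 2 * (C * H) * Real.cosh (γ * t) := by
  have hH0 : 0 ≤ H := by simpa using (norm_nonneg _).trans (hH 0)
  set w : ℝ → ℝ := fun t => Real.cosh (γ * t)
  have hw : ∀ t, 0 < w t := fun t => Real.cosh_pos _
  have hwc : Continuous w := continuous_cosh_mul γ
  refine le_of_forall_le_half (w := w) hw ⟨B, hB⟩ ?_ (by positivity) t
  intro X hX0 hX t
  set u : ℝ → E := fun t => (w t)⁻¹ • v t with hu
  have hux : ∀ t, ‖u t‖ ≤ X := fun t => by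
    rw [hu]
    simp only
    rw [norm_smul, norm_inv, Real.norm_eq_abs, abs_of_pos (hw t), inv_mul_le_iff₀ (hw t), mul_comm]
    exact hX t
  set k : ℝ → E := fun t => (w t)⁻¹ • h t - (γ * (Real.sinh (γ * t) / w t)) • u t with hk
  have hvc := continuous_of_hasDerivAt hv
  have huc : Continuous u := (hwc.inv₀ fun t => (hw t).ne').smul hvc
  have hkc : Continuous k := by
    refine ((hwc.inv₀ fun t => (hw t).ne').smul hh).sub (Continuous.smul ?_ huc)
    exact continuous_const.mul (Continuous.div (by fun_prop) hwc fun t => (hw t).ne')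
  have hud : ∀ t, HasDerivAt u (A t (u t) + k t) t := by
    intro t
    have h1 : HasDerivAt w (Real.sinh (γ * t) * γ) t := by
      have h2 : HasDerivAt (fun s : ℝ => γ * s) γ t := by
        simpa using (hasDerivAt_id t).const_mul γ
      exact h2.cosh
    refine HasDerivAt.congr_deriv ((h1.inv (hw t).ne').smul (hv t)) ?_
    simp only [hk, hu, map_smul, smul_add, smul_smul, neg_div, neg_smul]
    have : γ * (Real.sinh (γ * t) / w t) * (w t)⁻¹ = Real.sinh (γ * t) * γ / w t ^ 2 := by
      have := (hw t).ne'
      field_simp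
    rw [this, Pi.inv_apply]
    abel
  have hkb : ∀ t, ‖k t‖ ≤ H + γ * X := by
    intro t
    refine (norm_sub_le _ _).trans (add_le_add ?_ ?_)
    · rw [norm_smul, norm_inv, Real.norm_eq_abs, abs_of_pos (hw t), inv_mul_le_iff₀ (hw t),
        mul_comm]
      exact hH t
    · rw [norm_smul, norm_mul, Real.norm_eq_abs, Real.norm_eq_abs, abs_of_nonneg hγ]
      have : |Real.sinh (γ * t) / w t| ≤ 1 := by
        rw [abs_div, abs_of_pos (hw t), div_le_one (hw t)]
        exact abs_le.2 ⟨by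
          have := (Real.sinh_lt_cosh (-(γ * t))).le
          simp only [Real.sinh_neg, Real.cosh_neg] at this
          simp only [w]; linarith, (Real.sinh_lt_cosh _).le⟩
      calc _ ≤ γ * 1 * X := by gcongr; exact hux t
        _ = _ := by ring
  have h3 := hA.est k u _ hkc hkb ⟨X, hux⟩ hud t
  have h4 : ‖v t‖ = ‖u t‖ * w t := by
    rw [hu]
    simp only
    rw [norm_smul, norm_inv, Real.norm_eq_abs, abs_of_pos (hw t)]
    have := (hw t).ne'
    field_simp
  rw [h4]
  refine mul_le_mul_of_nonneg_right (h3.trans ?_) (hw t).le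
  nlinarith

/-- The difference solves the linear equation with inhomogeneity of size `κ X + H`, if `X` bounds
the difference itself. Since `2 C κ ≤ 1 / 2`, the first part is absorbed. -/
theorem IsDich.compare (hA : IsDich A C) (hC : 0 < C) {γ κ B H : ℝ} (hγ : 0 ≤ γ)
    (hCγ : C * γ ≤ 1 / 2) (hκ : 0 ≤ κ) (hCκ : C * κ ≤ 1 / 4) {N : ℝ → E → E} {s : Set E} {h v₁ v₂ : ℝ → E}
    (hLip : ∀ t, ∀ x ∈ s, ∀ y ∈ s, ‖N t x - N t y - A t (x - y)‖ ≤ κ * ‖x - y‖)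
    (hs₁ : ∀ t, v₁ t ∈ s) (hs₂ : ∀ t, v₂ t ∈ s)
    (hN₁ : Continuous fun t => N t (v₁ t)) (hN₂ : Continuous fun t => N t (v₂ t))
    (hh : Continuous h) (hH : ∀ t, ‖h t‖ ≤ H * Real.cosh (γ * t))
    (hB : ∀ t, ‖v₁ t - v₂ t‖ ≤ B * Real.cosh (γ * t))
    (h₁ : ∀ t, HasDerivAt v₁ (N t (v₁ t)) t) (h₂ : ∀ t, HasDerivAt v₂ (N t (v₂ t) + h t) t)
    (t : ℝ) : ‖v₁ t - v₂ t‖ ≤ 4 * (C * H) * Real.cosh (γ * t) := by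
  have hH0 : 0 ≤ H := by simpa using (norm_nonneg _).trans (hH 0)
  have c₁ := continuous_of_hasDerivAt h₁
  have c₂ := continuous_of_hasDerivAt h₂
  have key := le_of_forall_le_half (g := fun t => ‖v₁ t - v₂ t‖)
    (w := fun t => Real.cosh (γ * t)) (c := 2 * (C * H)) (fun t => Real.cosh_pos _) ⟨B, hB⟩ ?_
    (by positivity) t
  · refine key.trans (le_of_eq (by ring))
  intro X hX0 hX t
  have := hA.weighted hC hγ hCγ (B := X) (H := κ * X + H) (v := fun t => v₁ t - v₂ t)
    (h := fun t => (N t (v₁ t) - N t (v₂ t) - A t (v₁ t - v₂ t)) - h t)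
    (((hN₁.sub hN₂).sub (hA.cont.clm_apply (c₁.sub c₂))).sub hh) (fun t => by
      refine (norm_sub_le _ _).trans ?_
      rw [add_mul]
      refine add_le_add ((hLip t _ (hs₁ t) _ (hs₂ t)).trans ?_) (hH t)
      rw [mul_assoc]
      exact mul_le_mul_of_nonneg_left (hX t) hκ) hX
    (fun t => by
      refine HasDerivAt.congr_deriv ((h₁ t).sub (h₂ t)) ?_
      abel) t
  refine this.trans ?_
  have := Real.cosh_pos (γ * t)
  gcongr
  nlinarith

/-- Contraction for the map that sends `u` to the bounded solution of `v' = A v + (N(u) - A u)`. The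
`ρ`-ball is preserved because `C (κ ρ + ν) ≤ ρ`, and the contraction factor is `C κ ≤ 1 / 2`. -/
theorem IsDich.exists_nonlinear [CompleteSpace E] (hA : IsDich A C) {ρ κ ν : ℝ}
    (hρ : 0 ≤ ρ) (hκ : 0 ≤ κ) (hCκ : C * κ ≤ 1 / 2) (hCν : C * ν ≤ ρ / 2) {N : ℝ → E → E}
    (hN : ∀ v : ℝ → E, Continuous v → (∀ t, ‖v t‖ ≤ ρ) → Continuous fun t => N t (v t))
    (hLip : ∀ t, ∀ x ∈ closedBall (0 : E) ρ, ∀ y ∈ closedBall (0 : E) ρ,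
      ‖N t x - N t y - A t (x - y)‖ ≤ κ * ‖x - y‖)
    (h₀ : ∀ t, ‖N t 0‖ ≤ ν) :
    ∃ v : ℝ → E, (∀ t, ‖v t‖ ≤ ρ) ∧ ∀ t, HasDerivAt v (N t (v t)) t := by
  set X : Set (BoundedContinuousFunction ℝ E) := {u | ∀ t, ‖u t‖ ≤ ρ} with hX
  have hXc : IsClosed X := by
    have : X = ⋂ t, {u : BoundedContinuousFunction ℝ E | ‖u t‖ ≤ ρ} := by
      ext u; simp [hX]
    rw [this]
    exact isClosed_iInter fun t => isClosed_le (continuous_eval_const t).norm continuous_const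
  have hmk : ∀ u ∈ X, ∃ u' ∈ X, ∀ t, HasDerivAt u' (A t (u' t) + (N t (u t) - A t (u t))) t := by
    intro u hu
    have hc : Continuous fun t => N t (u t) - A t (u t) :=
      (hN u u.continuous hu).sub (hA.cont.clm_apply u.continuous)
    have hb : ∀ t, ‖N t (u t) - A t (u t)‖ ≤ κ * ρ + ν := by
      intro t
      have h1 := hLip t (u t) (by simpa using hu t) 0 (by simpa using hρ)
      simp only [sub_zero] at h1
      calc ‖N t (u t) - A t (u t)‖ = ‖(N t (u t) - N t 0 - A t (u t)) + N t 0‖ := by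
            congr 1; abel
        _ ≤ κ * ‖u t‖ + ν := (norm_add_le _ _).trans (add_le_add h1 (h₀ t))
        _ ≤ _ := by gcongr; exact hu t
    obtain ⟨v, hvb, hv⟩ := hA.exist _ _ hc hb
    have hv' := hA.est _ v _ hc hb hvb hv
    have hvρ : ∀ t, ‖v t‖ ≤ ρ := fun t => (hv' t).trans (by nlinarith)
    exact ⟨BoundedContinuousFunction.ofNormedAddCommGroup v (continuous_of_hasDerivAt hv) ρ hvρ,
      hvρ, hv⟩
  choose! R hRX hR using hmk
  let Φ : X → X := fun u => ⟨R u.1, hRX u.1 u.2⟩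
  have hΦ : ContractingWith (1 / 2) Φ := by
    refine ⟨by rw [← NNReal.coe_lt_coe]; norm_num, LipschitzWith.of_dist_le_mul fun u v => ?_⟩
    change dist (R u.1) (R v.1) ≤ _
    rw [BoundedContinuousFunction.dist_le (by positivity)]
    intro t
    have h1 := hA.est (fun t => (N t (u.1 t) - A t (u.1 t)) - (N t (v.1 t) - A t (v.1 t)))
      (fun t => R u.1 t - R v.1 t) (κ * dist u.1 v.1)
      (((hN _ u.1.continuous u.2).sub (hA.cont.clm_apply u.1.continuous)).sub
        ((hN _ v.1.continuous v.2).sub (hA.cont.clm_apply v.1.continuous)))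
      (fun t => by
        have h2 := hLip t (u.1 t) (by simpa using u.2 t) (v.1 t) (by simpa using v.2 t)
        have h3 : ‖u.1 t - v.1 t‖ ≤ dist u.1 v.1 := by
          rw [← dist_eq_norm]
          exact BoundedContinuousFunction.dist_coe_le_dist t
        have h4 : (N t (u.1 t) - A t (u.1 t)) - (N t (v.1 t) - A t (v.1 t))
            = N t (u.1 t) - N t (v.1 t) - A t (u.1 t - v.1 t) := by
          rw [map_sub]; abel
        rw [h4]
        exact h2.trans (by gcongr))
      ⟨ρ + ρ, fun t => (norm_sub_le _ _).trans (add_le_add (hRX _ u.2 t) (hRX _ v.2 t))⟩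
      (fun t => by
        refine HasDerivAt.congr_deriv ((hR _ u.2 t).sub (hR _ v.2 t)) ?_
        rw [map_sub]; abel) t
    rw [dist_eq_norm]
    refine h1.trans ?_
    rw [← mul_assoc]
    have : ((1 / 2 : NNReal) : ℝ) = 1 / 2 := by norm_num
    rw [this]
    exact mul_le_mul_of_nonneg_right hCκ dist_nonneg
  have : Nonempty X := ⟨⟨0, fun t => by simpa using hρ⟩⟩
  have : CompleteSpace X := hXc.completeSpace_coe
  obtain ⟨u, hu⟩ : ∃ u : X, Φ u = u := ⟨_, hΦ.fixedPoint_isFixedPt⟩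
  refine ⟨u.1, u.2, fun t => ?_⟩
  have h4 : R u.1 = u.1 := congrArg Subtype.val hu
  have h5 := hR _ u.2 t
  rw [h4] at h5
  refine HasDerivAt.congr_deriv (h5) ?_
  abel

theorem IsDich.perturb [CompleteSpace E] (hA : IsDich A C) (hC : 0 < C) {A' : ℝ → E →L[ℝ] E}
    {κ : ℝ} (hA'c : Continuous A') (hA'b : ∃ K, ∀ t, ‖A' t‖ ≤ K) (hκ : ∀ t, ‖A' t - A t‖ ≤ κ)
    (hCκ : C * κ ≤ 1 / 2) : IsDich A' (2 * C) := by
  have hκ0 : 0 ≤ κ := (norm_nonneg _).trans (hκ 0)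
  have hd : ∀ t v, ‖A' t v - A t v‖ ≤ κ * ‖v‖ := fun t v => by
    rw [← sub_apply]
    exact ContinuousLinearMap.le_of_opNorm_le _ (hκ t) v
  refine ⟨hA'c, hA'b, ?_, ?_⟩
  · intro h v M hh hM hB hv t
    have hM0 : 0 ≤ M := (norm_nonneg _).trans (hM 0)
    have hvc := continuous_of_hasDerivAt hv
    have := le_of_forall_le_half (g := fun t => ‖v t‖) (w := fun _ => 1) (c := C * M) (by simp)
      (by simpa using hB) (fun X hX0 hX t => by
        simp only [mul_one] at hX ⊢
        have h1 := hA.est (fun t => A' t (v t) - A t (v t) + h t) v (κ * X + M)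
          (((hA'c.clm_apply hvc).sub (hA.cont.clm_apply hvc)).add hh)
          (fun t => (norm_add_le _ _).trans (add_le_add ((hd t _).trans (by
            gcongr; exact hX t)) (hM t))) hB (fun t => by
            refine HasDerivAt.congr_deriv (hv t) ?_
            abel) t
        nlinarith) (by positivity) t
    simpa [mul_assoc] using this
  · intro h M hh hM
    have hM0 : 0 ≤ M := (norm_nonneg _).trans (hM 0)
    obtain ⟨v, h1, h2⟩ := hA.exists_nonlinear (ρ := 2 * (C * M)) (κ := κ) (ν := M)
      (by positivity) hκ0 hCκ (by linarith) (N := fun t v => A' t v + h t)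
      (fun v hv _ => (hA'c.clm_apply hv).add hh)
      (fun t x _ y _ => by
        convert hd t (x - y) using 2
        simp only [map_sub]; abel)
      (fun t => by simpa using hM t)
    exact ⟨v, ⟨_, h1⟩, h2⟩

/-- In the time `s = φ(t)` the equation is the original one with inhomogeneity `h / q`; as `1 / q ≤
2`, the constant doubles. -/
theorem IsDich.timeChange (hA : IsDich A C) {φ q : ℝ → ℝ} (hq : Continuous q)
    (hφ : ∀ t, HasDerivAt φ (q t) t) (hq₁ : ∀ t, 1 / 2 ≤ q t) (hq₂ : ∀ t, q t ≤ 2) :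
    IsDich (fun t => q t • A (φ t)) (2 * C) := by
  have hqpos : ∀ t, 0 < q t := fun t => by linarith [hq₁ t]
  have hφc := continuous_of_hasDerivAt hφ
  have hmono : StrictMono φ := strictMono_of_deriv_pos fun t => by
    rw [(hφ t).deriv]; exact hqpos t
  -- Speed at least `1 / 2` makes `φ` unbounded in both directions, hence bijective.
  have hgrow : Monotone fun t => φ t - t / 2 := by
    refine monotone_of_deriv_nonneg (fun t => ?_) fun t => ?_
    · exact ((hφ t).sub ((hasDerivAt_id t).div_const 2)).differentiableAt
    · have := ((hφ t).sub ((hasDerivAt_id t).div_const 2)).deriv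
      change 0 ≤ deriv (φ - fun x => id x / 2) t
      rw [this]
      linarith [hq₁ t]
  have hsurj : Function.Surjective φ := by
    refine hφc.surjective ?_ ?_
    · refine tendsto_atTop_mono' _ (f₁ := fun t => φ 0 + t / 2) ?_ ?_
      · filter_upwards [eventually_ge_atTop 0] with t ht
        have := hgrow ht
        simp only [zero_div, sub_zero] at this
        linarith
      · exact tendsto_atTop_add_const_left _ _ (tendsto_id.atTop_div_const (by norm_num))
    · refine tendsto_atBot_mono' _ (f₁ := fun t => φ 0 + t / 2) ?_ ?_
      · filter_upwards [eventually_le_atBot 0] with t ht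
        have := hgrow ht
        simp only [zero_div, sub_zero] at this
        linarith
      · exact tendsto_atBot_add_const_left _ _ (tendsto_id.atBot_div_const (by norm_num))
  set e := hmono.orderIsoOfSurjective φ hsurj with he
  set τ : ℝ → ℝ := fun s => e.symm s with hτ
  have hτφ : ∀ t, τ (φ t) = t := fun t => e.symm_apply_apply t
  have hφτ : ∀ s, φ (τ s) = s := fun s => e.apply_symm_apply s
  have hτc : Continuous τ := e.symm.continuous
  have hτd : ∀ s, HasDerivAt τ (q (τ s))⁻¹ s := fun s =>
    HasDerivAt.of_local_left_inverse hτc.continuousAt (hφ (τ s)) (hqpos _).ne'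
      (Eventually.of_forall hφτ)
  have hscale : ∀ {h : ℝ → E} {M : ℝ}, (∀ t, ‖h t‖ ≤ M) → ∀ s, ‖(q (τ s))⁻¹ • h (τ s)‖ ≤ 2 * M := by
    intro h M hM s
    rw [norm_smul, norm_inv, Real.norm_eq_abs, abs_of_pos (hqpos _)]
    have h1 : (q (τ s))⁻¹ ≤ 2 := by
      rw [inv_le_comm₀ (hqpos _) (by norm_num)]
      linarith [hq₁ (τ s)]
    exact mul_le_mul h1 (hM _) (norm_nonneg _) (by norm_num)
  have hcont : ∀ {h : ℝ → E}, Continuous h → Continuous fun s => (q (τ s))⁻¹ • h (τ s) := fun hh =>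
    ((hq.comp hτc).inv₀ fun s => (hqpos _).ne').smul (hh.comp hτc)
  refine ⟨hq.smul (hA.cont.comp hφc), ?_, ?_, ?_⟩
  · obtain ⟨K, hK⟩ := hA.bdd
    refine ⟨2 * K, fun t => ?_⟩
    rw [norm_smul, Real.norm_eq_abs, abs_of_pos (hqpos _)]
    exact mul_le_mul (hq₂ t) (hK _) (norm_nonneg _) (by norm_num)
  · intro h v M hh hM ⟨B, hB⟩ hv t
    have h1 := hA.est (fun s => (q (τ s))⁻¹ • h (τ s)) (fun s => v (τ s)) (2 * M) (hcont hh)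
      (hscale hM) ⟨B, fun s => hB _⟩ (fun s => by
        refine HasDerivAt.congr_deriv (HasDerivAt.scomp s (hv (τ s)) (hτd s)) ?_
        rw [smul_add, smul_apply, smul_smul, inv_mul_cancel₀ (hqpos _).ne',
          one_smul, hφτ]) (φ t)
    simp only [hτφ] at h1
    linarith
  · intro h M hh hM
    obtain ⟨v, ⟨B, hB⟩, hv⟩ := hA.exist _ _ (hcont hh) (hscale hM)
    refine ⟨fun t => v (φ t), ⟨B, fun t => hB _⟩, fun t => ?_⟩
    refine HasDerivAt.congr_deriv (HasDerivAt.scomp t (hv (φ t)) (hφ t)) ?_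
    simp only [hτφ]
    rw [smul_add, smul_apply, smul_smul, mul_inv_cancel₀ (hqpos _).ne',
      one_smul]

/-- A map is differentiable if a separating family of functionals sees the right derivative and
the derivative is continuous. -/
theorem hasDerivAt_of_separating [CompleteSpace E] {ι : Type*} {G : Type*} [NormedAddCommGroup G]
    [NormedSpace ℝ G] [CompleteSpace G] (e : ι → E →L[ℝ] G) (hsep : ∀ x, (∀ i, e i x = 0) → x = 0)
    {w r : ℝ → E} (hr : Continuous r) (h : ∀ i t, HasDerivAt (fun s => e i (w s)) (e i (r t)) t)
    (t : ℝ) : HasDerivAt w (r t) t := by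
  have h1 := exists_curve_primitive r hr (w 0)
  have h2 : w = fun t => w 0 + ∫ s in (0:ℝ)..t, r s := by
    funext t
    refine sub_eq_zero.1 (hsep _ fun i => ?_)
    have h3 : ∀ s, HasDerivAt (fun s => e i (w s) - e i (w 0 + ∫ u in (0:ℝ)..s, r u)) 0 s := by
      intro s
      have := (h i s).sub ((e i).hasFDerivAt.comp_hasDerivAt s (h1 s))
      exact this.congr_deriv (sub_self _)
    have h4 := is_const_of_deriv_eq_zero (fun s => (h3 s).differentiableAt)
      (fun s => (h3 s).deriv) t 0
    simpa using h4
  rw [h2]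
  exact h1 t

theorem lipschitz_of_deriv_bound {v v' : ℝ → E} {L : ℝ} (hv : ∀ t, HasDerivAt v (v' t) t)
    (hL : ∀ t, ‖v' t‖ ≤ L) (s t : ℝ) : ‖v t - v s‖ ≤ L * |t - s| := by
  have := Convex.norm_image_sub_le_of_norm_hasDerivWithin_le (s := univ) (f := v) (f' := v')
    (fun x _ => (hv x).hasDerivWithinAt) (fun x _ => hL x) convex_univ (mem_univ s) (mem_univ t)
  simpa using this

theorem continuous_of_lipschitz_bound {G : Type*} [SeminormedAddCommGroup G] {v : ℝ → G} {L : ℝ}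
    (h : ∀ s t, ‖v t - v s‖ ≤ L * |t - s|) : Continuous v := by
  have hL : 0 ≤ L := by simpa using (norm_nonneg _).trans (h 0 1)
  have : LipschitzWith (Real.toNNReal L) v := LipschitzWith.of_dist_le_mul fun x y => by
    rw [Real.coe_toNNReal _ hL, dist_eq_norm, Real.dist_eq]
    exact h y x
  exact this.continuous

/-- The equation `W' = A W + h` is solved separately on each vector `ξ`; uniqueness makes the result
linear in `ξ`, and the estimate makes it bounded with the same constant. This is the dichotomy for
derivatives of the section. -/
theorem IsDich.operator [CompleteSpace E] (hA : IsDich A C) (Z : Type*) [NormedAddCommGroup Z]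
    [NormedSpace ℝ Z] (hC : 0 < C) :
    IsDich (fun t => ContinuousLinearMap.compL ℝ Z E E (A t)) C := by
  obtain ⟨K, hK⟩ := hA.bdd
  have hev : ∀ ξ : Z, ∀ {v : ℝ → Z →L[ℝ] E} {v' : Z →L[ℝ] E} {t : ℝ}, HasDerivAt v v' t →
      HasDerivAt (fun s => v s ξ) (v' ξ) t := fun ξ v v' t hv =>
    (ContinuousLinearMap.apply ℝ E ξ).hasFDerivAt.comp_hasDerivAt t hv
  refine ⟨(ContinuousLinearMap.compL ℝ Z E E).continuous.comp hA.cont, ⟨K, fun t => ?_⟩, ?_, ?_⟩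
  · refine (ContinuousLinearMap.opNorm_le_bound _ ((norm_nonneg _).trans (hK t)) fun W => ?_)
    simp only [ContinuousLinearMap.compL_apply]
    exact (ContinuousLinearMap.opNorm_comp_le _ _).trans (by gcongr; exact hK t)
  · intro h v M hh hM ⟨B, hB⟩ hv t
    have hM0 : 0 ≤ M := (norm_nonneg _).trans (hM 0)
    refine ContinuousLinearMap.opNorm_le_bound _ (by positivity) fun ξ => ?_
    have := hA.est (fun t => h t ξ) (fun t => v t ξ) (M * ‖ξ‖) (hh.clm_apply continuous_const)
      (fun t => ContinuousLinearMap.le_of_opNorm_le _ (hM t) ξ)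
      ⟨B * ‖ξ‖, fun t => ContinuousLinearMap.le_of_opNorm_le _ (hB t) ξ⟩
      (fun t => by simpa using hev ξ (hv t)) t
    linarith
  · intro h M hh hM
    have hM0 : 0 ≤ M := (norm_nonneg _).trans (hM 0)
    have hc : ∀ ξ : Z, Continuous fun t => h t ξ := fun ξ => hh.clm_apply continuous_const
    have hb : ∀ (ξ : Z) t, ‖h t ξ‖ ≤ M * ‖ξ‖ := fun ξ t =>
      ContinuousLinearMap.le_of_opNorm_le _ (hM t) ξ
    choose v hvb hv using fun ξ : Z => hA.exist (fun t => h t ξ) (M * ‖ξ‖) (hc ξ) (hb ξ)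
    have hvC : ∀ ξ t, ‖v ξ t‖ ≤ C * M * ‖ξ‖ := fun ξ t => by
      have := hA.est _ _ _ (hc ξ) (hb ξ) (hvb ξ) (hv ξ) t
      linarith
    have hadd : ∀ ξ η, v (ξ + η) = fun t => v ξ t + v η t := fun ξ η => by
      refine hA.unique (hvb _) ?_ (hv _) fun t => ?_
      · exact ⟨_, fun t => (norm_add_le _ _).trans (add_le_add (hvC ξ t) (hvC η t))⟩
      · refine HasDerivAt.congr_deriv ((hv ξ t).add (hv η t)) ?_
        simp only [map_add]; abel
    have hsmul : ∀ (a : ℝ) ξ, v (a • ξ) = fun t => a • v ξ t := fun a ξ => by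
      refine hA.unique (hvb _) ?_ (hv _) fun t => ?_
      · refine ⟨|a| * (C * M * ‖ξ‖), fun t => ?_⟩
        rw [norm_smul, Real.norm_eq_abs]
        gcongr
        exact hvC ξ t
      · refine HasDerivAt.congr_deriv ((hv ξ t).const_smul a) ?_
        simp only [map_smul, smul_add]
    let W : ℝ → Z →L[ℝ] E := fun t => LinearMap.mkContinuous
      { toFun := fun ξ => v ξ t
        map_add' := fun ξ η => by rw [hadd]
        map_smul' := fun a ξ => by rw [hsmul]; rfl } (C * M) (fun ξ => hvC ξ t)
    have hWv : ∀ t ξ, W t ξ = v ξ t := fun t ξ => rfl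
    have hWb : ∀ t, ‖W t‖ ≤ C * M := fun t => LinearMap.mkContinuous_norm_le _ (by positivity) _
    have hK0 : 0 ≤ K := (norm_nonneg _).trans (hK 0)
    -- The velocities are bounded by a constant times `‖ξ‖`, so `W` is Lipschitz in operator norm.
    -- With a continuous candidate for the derivative, pointwise differentiability then suffices.
    have hWc : Continuous W := by
      refine continuous_of_lipschitz_bound (L := K * (C * M) + M) fun s t => ?_
      refine ContinuousLinearMap.opNorm_le_bound _ (by positivity) fun ξ => ?_
      rw [sub_apply, hWv, hWv]
      refine (lipschitz_of_deriv_bound (hv ξ) (L := (K * (C * M) + M) * ‖ξ‖) (fun t => ?_)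
        s t).trans (le_of_eq (by ring))
      refine (norm_add_le _ _).trans ?_
      have h1 := ContinuousLinearMap.le_of_opNorm_le _ (hK t) (v ξ t)
      have h2 := hvC ξ t
      have h3 := hb ξ t
      calc _ ≤ K * (C * M * ‖ξ‖) + M * ‖ξ‖ := add_le_add (h1.trans (by gcongr)) h3
        _ = _ := by ring
    refine ⟨W, ⟨_, hWb⟩, fun t => ?_⟩
    refine hasDerivAt_of_separating (fun ξ : Z => ContinuousLinearMap.apply ℝ E ξ)
      (fun x hx => ContinuousLinearMap.ext hx)
      (r := fun t => ContinuousLinearMap.compL ℝ Z E E (A t) (W t) + h t)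
      ((((ContinuousLinearMap.compL ℝ Z E E).continuous.comp hA.cont).clm_apply hWc).add hh)
      (fun ξ t => by simpa [hWv] using hv ξ t) t

end Dichotomy

/-! ### Bounded sequences: coordinates and componentwise dichotomies -/

section Lattice

variable {E : Type*} [NormedAddCommGroup E]

/-- Evaluation of a bounded sequence at an index. -/
def evalL (E : Type*) [NormedAddCommGroup E] [NormedSpace ℝ E] (k : ℤ) : Linf E →L[ℝ] E :=
  LinearMap.mkContinuous
    { toFun := fun u => u k
      map_add' := fun _ _ => rfl
      map_smul' := fun _ _ => rfl } 1
    (fun u => by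
      rw [one_mul]
      exact lp.norm_apply_le_norm ENNReal.top_ne_zero u k)

theorem linf_norm_apply_le (u : Linf E) (k : ℤ) : ‖u k‖ ≤ ‖u‖ :=
  lp.norm_apply_le_norm ENNReal.top_ne_zero u k

theorem linf_norm_le {u : Linf E} {C : ℝ} (h : ∀ k, ‖u k‖ ≤ C) : ‖u‖ ≤ C :=
  lp.norm_le_of_forall_le ((norm_nonneg _).trans (h 0)) h

theorem linf_ext {u v : Linf E} (h : ∀ k, u k = v k) : u = v := lp.ext (funext h)

variable [NormedSpace ℝ E]

theorem hasDerivAt_linf [CompleteSpace E] {w r : ℝ → Linf E} (hr : Continuous r)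
    (h : ∀ k t, HasDerivAt (fun s => w s k) (r t k) t) (t : ℝ) : HasDerivAt w (r t) t :=
  hasDerivAt_of_separating (evalL E) (fun _ hx => linf_ext fun k => hx k) hr h t

theorem hasDerivAt_linf_apply {w : ℝ → Linf E} {r : Linf E} {t : ℝ} (h : HasDerivAt w r t) (k : ℤ) :
    HasDerivAt (fun s => w s k) (r k) t :=
  (evalL E k).hasFDerivAt.comp_hasDerivAt t h

/-- In the supremum norm a diagonal equation inherits the common constant of its components.
Coordinatewise solutions form a Lipschitz curve of sequences, and its differentiability is tested by
the coordinate functionals. -/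
theorem isDich_linf [CompleteSpace E] {A : ℤ → ℝ → E →L[ℝ] E} {C K : ℝ}
    (hA : ∀ k, IsDich (A k) C) {B : ℝ → Linf E →L[ℝ] Linf E} (hB : Continuous B)
    (hK : ∀ t, ‖B t‖ ≤ K) (hBA : ∀ t v k, B t v k = A k t (v k)) : IsDich B C := by
  have hK0 : 0 ≤ K := (norm_nonneg _).trans (hK 0)
  refine ⟨hB, ⟨K, hK⟩, ?_, ?_⟩
  · intro h v M hh hM ⟨b, hb⟩ hv t
    refine linf_norm_le fun k => ?_
    refine (hA k).est (fun t => h t k) (fun t => v t k) M ((evalL E k).continuous.comp hh)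
      (fun t => (linf_norm_apply_le _ k).trans (hM t))
      ⟨b, fun t => (linf_norm_apply_le _ k).trans (hb t)⟩ (fun t => ?_) t
    have := hasDerivAt_linf_apply (hv t) k
    simpa [hBA] using this
  · intro h M hh hM
    have hM0 : 0 ≤ M := (norm_nonneg _).trans (hM 0)
    have hc : ∀ k, Continuous fun t => h t k := fun k => (evalL E k).continuous.comp hh
    have hb : ∀ k t, ‖h t k‖ ≤ M := fun k t => (linf_norm_apply_le _ k).trans (hM t)
    choose v hvb hv using fun k => (hA k).exist (fun t => h t k) M (hc k) (hb k)
    have hvC : ∀ k t, ‖v k t‖ ≤ C * M := fun k t => (hA k).est _ _ _ (hc k) (hb k) (hvb k) (hv k) t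
    let W : ℝ → Linf E := fun t => toLinf fun k => v k t
    have hWv : ∀ t k, W t k = v k t := fun t k => toLinf_apply ⟨_, fun k => hvC k t⟩ k
    have hWb : ∀ t, ‖W t‖ ≤ C * M := fun t => linf_norm_le fun k => by rw [hWv]; exact hvC k t
    have hBk : ∀ k t, ‖A k t (v k t)‖ ≤ K * (C * M) := fun k t => by
      rw [← hWv, ← hBA]
      refine (linf_norm_apply_le _ k).trans ((ContinuousLinearMap.le_of_opNorm_le _ (hK t) _).trans
        ?_)
      gcongr
      exact hWb t
    have hWc : Continuous W := by
      refine continuous_of_lipschitz_bound (L := K * (C * M) + M) fun s t => ?_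
      refine linf_norm_le fun k => ?_
      change ‖W t k - W s k‖ ≤ _
      rw [hWv, hWv]
      exact lipschitz_of_deriv_bound (hv k) (fun t => (norm_add_le _ _).trans
        (add_le_add (hBk k t) (hb k t))) s t
    refine ⟨W, ⟨_, hWb⟩, fun t => ?_⟩
    refine hasDerivAt_linf (r := fun t => B t (W t) + h t) ((hB.clm_apply hWc).add hh)
      (fun k t => ?_) t
    have := hv k t
    simp only [hWv]
    convert this using 1
    change B t (W t) k + h t k = _
    rw [hBA, hWv]

end Lattice

/-! ### Calculus of families with derivatives uniformly continuous in index and variable -/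

section UniformSmoothness

variable {ι : Type} [PseudoMetricSpace ι]
variable {Z : Type} [NormedAddCommGroup Z] [NormedSpace ℝ Z]
variable {E F G : Type} [NormedAddCommGroup E] [NormedSpace ℝ E] [NormedAddCommGroup F]
  [NormedSpace ℝ F] [NormedAddCommGroup G] [NormedSpace ℝ G]

/-- Joint uniform continuity in the index and the variable. -/
def UCont {Z E : Type} [PseudoMetricSpace Z] [SeminormedAddCommGroup E] (S : Set Z)
    (h : ι → Z → E) : Prop :=
  ∀ η > 0, ∃ d > 0, ∀ i i' z z', z ∈ S → z' ∈ S → dist i i' < d → dist z z' < d →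
    ‖h i z - h i' z'‖ ≤ η

/-- Uniform boundedness of a family on a set. -/
def UBdd {ι Z E : Type} [SeminormedAddCommGroup E] (S : Set Z) (h : ι → Z → E) : Prop :=
  ∃ C, ∀ i, ∀ z ∈ S, ‖h i z‖ ≤ C

/-- A family is `UG S n` if its derivatives of orders `0, …, n` on `S` are jointly uniformly
continuous and those of orders `1, …, n` are bounded, uniformly in the index. -/
def UG (S : Set Z) : ℕ → ∀ {E : Type} [NormedAddCommGroup E] [NormedSpace ℝ E],
    (ι → Z → E) → Prop
  | 0, _, _, _, h => UCont S h
  | n + 1, E, _, _, h => UCont S h ∧ ∃ h' : ι → Z → Z →L[ℝ] E,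
      (∀ i, ∀ z ∈ S, HasFDerivAt (h i) (h' i z) z) ∧ UBdd S h' ∧ UG S n h'

/-- `UG` together with a bound on the values. -/
def UC (S : Set Z) (n : ℕ) (h : ι → Z → E) : Prop := UBdd S h ∧ UG S n h

variable {S : Set Z} {n : ℕ} {h : ι → Z → E}

theorem UG.ucont : ∀ {n : ℕ}, UG S n h → UCont S h
  | 0, hh => hh
  | _ + 1, hh => hh.1

theorem UG.of_succ : ∀ {n : ℕ} {E : Type} [NormedAddCommGroup E] [NormedSpace ℝ E]
    {h : ι → Z → E}, UG S (n + 1) h → UG S n h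
  | 0, _, _, _, _, hh => hh.1
  | _ + 1, _, _, _, _, ⟨h1, h', h2, h3, h4⟩ => ⟨h1, h', h2, h3, h4.of_succ⟩

theorem UG.of_le {m n : ℕ} (hmn : m ≤ n) (hh : UG S n h) : UG S m h := by
  induction n, hmn using Nat.le_induction with
  | base => exact hh
  | succ n _ ih => exact ih hh.of_succ

theorem UC.of_le {m n : ℕ} (hmn : m ≤ n) (hh : UC S n h) : UC S m h := ⟨hh.1, hh.2.of_le hmn⟩

theorem UC.succ {h' : ι → Z → Z →L[ℝ] E} (hh : UC S 0 h)
    (hd : ∀ i, ∀ z ∈ S, HasFDerivAt (h i) (h' i z) z) (hh' : UC S n h') : UC S (n + 1) h :=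
  ⟨hh.1, hh.2, h', hd, hh'.1, hh'.2⟩

theorem UC.exists_deriv (hh : UC S (n + 1) h) : ∃ h' : ι → Z → Z →L[ℝ] E,
    (∀ i, ∀ z ∈ S, HasFDerivAt (h i) (h' i z) z) ∧ UC S n h' :=
  let ⟨_, _, h', h2, h3, h4⟩ := hh
  ⟨h', h2, h3, h4⟩

theorem UCont.mono {S' : Set Z} (hS : S' ⊆ S) (hh : UCont S h) : UCont S' h := fun η hη =>
  let ⟨d, hd, H⟩ := hh η hη
  ⟨d, hd, fun i i' z z' hz hz' => H i i' z z' (hS hz) (hS hz')⟩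

theorem UBdd.mono {S' : Set Z} (hS : S' ⊆ S) (hh : UBdd S h) : UBdd S' h :=
  let ⟨C, hC⟩ := hh
  ⟨C, fun i z hz => hC i z (hS hz)⟩

theorem UG.mono {S' : Set Z} (hS : S' ⊆ S) : ∀ {n : ℕ} {E : Type} [NormedAddCommGroup E]
    [NormedSpace ℝ E] {h : ι → Z → E}, UG S n h → UG S' n h
  | 0, _, _, _, _, hh => UCont.mono hS hh
  | _ + 1, _, _, _, _, ⟨h1, h', h2, h3, h4⟩ =>
    ⟨h1.mono hS, h', fun i z hz => h2 i z (hS hz), h3.mono hS, h4.mono hS⟩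

theorem UC.mono {S' : Set Z} (hS : S' ⊆ S) (hh : UC S n h) : UC S' n h :=
  ⟨hh.1.mono hS, hh.2.mono hS⟩

/-- Uniform continuity of a map between index sets. -/
def UIndex {ι' ι : Type} [PseudoMetricSpace ι'] [PseudoMetricSpace ι] (e : ι' → ι) : Prop :=
  ∀ η > 0, ∃ d > 0, ∀ i i', dist i i' < d → dist (e i) (e i') < η

theorem UCont.reindex {ι' : Type} [PseudoMetricSpace ι'] {e : ι' → ι} (he : UIndex e)
    (hh : UCont S h) : UCont S fun i => h (e i) := fun η hη => by
  obtain ⟨d, hd, H⟩ := hh η hη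
  obtain ⟨d', hd', H'⟩ := he d hd
  exact ⟨min d d', lt_min hd hd', fun i i' z z' hz hz' h1 h2 =>
    H _ _ z z' hz hz' (H' i i' (h1.trans_le (min_le_right _ _))) (h2.trans_le (min_le_left _ _))⟩

theorem UBdd.reindex {ι' ι Z E : Type} [SeminormedAddCommGroup E] {S : Set Z} {h : ι → Z → E}
    (e : ι' → ι) (hh : UBdd S h) : UBdd S fun i => h (e i) :=
  let ⟨C, hC⟩ := hh
  ⟨C, fun _ z hz => hC _ z hz⟩

theorem UG.reindex {ι' : Type} [PseudoMetricSpace ι'] {e : ι' → ι} (he : UIndex e) :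
    ∀ {n : ℕ} {E : Type} [NormedAddCommGroup E] [NormedSpace ℝ E] {h : ι → Z → E},
    UG S n h → UG S n fun i => h (e i)
  | 0, _, _, _, _, hh => UCont.reindex he hh
  | _ + 1, _, _, _, _, ⟨h1, h', h2, h3, h4⟩ =>
    ⟨h1.reindex he, fun i => h' (e i), fun _ z hz => h2 _ z hz, h3.reindex e, h4.reindex he⟩

theorem UC.reindex {ι' : Type} [PseudoMetricSpace ι'] {e : ι' → ι} (he : UIndex e)
    (hh : UC S n h) : UC S n fun i => h (e i) := ⟨hh.1.reindex e, hh.2.reindex he⟩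

theorem UCont.clm (L : E →L[ℝ] F) (hh : UCont S h) : UCont S fun i z => L (h i z) := by
  intro η hη
  obtain ⟨d, hd, H⟩ := hh (η / (‖L‖ + 1)) (by positivity)
  refine ⟨d, hd, fun i i' z z' hz hz' h1 h2 => ?_⟩
  rw [← map_sub]
  refine (L.le_opNorm _).trans ?_
  calc _ ≤ (‖L‖ + 1) * (η / (‖L‖ + 1)) := by
        gcongr
        · linarith
        · exact H i i' z z' hz hz' h1 h2
    _ = η := by field_simp

theorem UBdd.clm (L : E →L[ℝ] F) {h : ι → Z → E} (hh : UBdd S h) :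
    UBdd S fun i z => L (h i z) :=
  let ⟨C, hC⟩ := hh
  ⟨‖L‖ * C, fun i z hz => (L.le_opNorm _).trans (by gcongr; exact hC i z hz)⟩

theorem UG.clm : ∀ {n : ℕ} {E F : Type} [NormedAddCommGroup E] [NormedSpace ℝ E]
    [NormedAddCommGroup F] [NormedSpace ℝ F] (L : E →L[ℝ] F) {h : ι → Z → E},
    UG S n h → UG S n fun i z => L (h i z)
  | 0, _, _, _, _, _, _, L, _, hh => UCont.clm L hh
  | _ + 1, _, _, _, _, _, _, L, _, ⟨h1, _, h2, h3, h4⟩ =>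
    ⟨h1.clm L, _, fun i z hz => L.hasFDerivAt.comp z (h2 i z hz),
      h3.clm (ContinuousLinearMap.compL ℝ Z _ _ L), h4.clm (ContinuousLinearMap.compL ℝ Z _ _ L)⟩

theorem UC.clm (L : E →L[ℝ] F) (hh : UC S n h) : UC S n fun i z => L (h i z) :=
  ⟨hh.1.clm L, hh.2.clm L⟩

theorem UCont.add {g : ι → Z → E} (hh : UCont S h) (hg : UCont S g) :
    UCont S fun i z => h i z + g i z := by
  intro η hη
  obtain ⟨d, hd, H⟩ := hh (η / 2) (by positivity)
  obtain ⟨d', hd', H'⟩ := hg (η / 2) (by positivity)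
  refine ⟨min d d', lt_min hd hd', fun i i' z z' hz hz' h1 h2 => ?_⟩
  have a := H i i' z z' hz hz' (h1.trans_le (min_le_left _ _)) (h2.trans_le (min_le_left _ _))
  have b := H' i i' z z' hz hz' (h1.trans_le (min_le_right _ _)) (h2.trans_le (min_le_right _ _))
  calc _ = ‖(h i z - h i' z') + (g i z - g i' z')‖ := by rw [add_sub_add_comm]
    _ ≤ _ := (norm_add_le _ _).trans (by linarith)

theorem UBdd.add {ι Z E : Type} [SeminormedAddCommGroup E] {S : Set Z} {h g : ι → Z → E}
    (hh : UBdd S h) (hg : UBdd S g) : UBdd S fun i z => h i z + g i z :=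
  let ⟨C, hC⟩ := hh
  let ⟨C', hC'⟩ := hg
  ⟨C + C', fun i z hz => (norm_add_le _ _).trans (add_le_add (hC i z hz) (hC' i z hz))⟩

theorem UG.add : ∀ {n : ℕ} {E : Type} [NormedAddCommGroup E] [NormedSpace ℝ E]
    {h g : ι → Z → E}, UG S n h → UG S n g → UG S n fun i z => h i z + g i z
  | 0, _, _, _, _, _, hh, hg => UCont.add hh hg
  | _ + 1, _, _, _, _, _, ⟨h1, _, h2, h3, h4⟩, ⟨g1, _, g2, g3, g4⟩ =>
    ⟨h1.add g1, _, fun i z hz => (h2 i z hz).add (g2 i z hz), h3.add g3, h4.add g4⟩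

theorem UC.add {g : ι → Z → E} (hh : UC S n h) (hg : UC S n g) :
    UC S n fun i z => h i z + g i z := ⟨hh.1.add hg.1, hh.2.add hg.2⟩

theorem UC.sub {g : ι → Z → E} (hh : UC S n h) (hg : UC S n g) :
    UC S n fun i z => h i z - g i z := by
  have := hh.add (hg.clm (-ContinuousLinearMap.id ℝ E))
  simpa [sub_eq_add_neg] using this

theorem UG.prodMk {g : ι → Z → F} (hh : UG S n h) (hg : UG S n g) :
    UG S n fun i z => (h i z, g i z) := by
  have := (hh.clm (ContinuousLinearMap.inl ℝ E F)).add (hg.clm (ContinuousLinearMap.inr ℝ E F))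
  simpa using this

theorem UC.prodMk {g : ι → Z → F} (hh : UC S n h) (hg : UC S n g) :
    UC S n fun i z => (h i z, g i z) := by
  have := (hh.clm (ContinuousLinearMap.inl ℝ E F)).add (hg.clm (ContinuousLinearMap.inr ℝ E F))
  simpa using this

theorem UC.const_index {c : ι → E} (hb : ∃ C, ∀ i, ‖c i‖ ≤ C)
    (hc : ∀ η > 0, ∃ d > 0, ∀ i i', dist i i' < d → ‖c i - c i'‖ ≤ η) :
    UC S n fun i (_ : Z) => c i := by
  obtain ⟨C, hC⟩ := hb
  have h0 : ∀ {E : Type} [NormedAddCommGroup E] [NormedSpace ℝ E] (n : ℕ),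
      UC S n fun (_ : ι) (_ : Z) => (0 : E) := by
    intro E _ _ n
    induction n generalizing E with
    | zero => exact ⟨⟨0, by simp⟩, fun η hη => ⟨1, one_pos, by simp [hη.le]⟩⟩
    | succ n ih =>
      exact UC.succ (h' := fun _ _ => 0) (ih.of_le (Nat.zero_le n))
        (fun i z _ => hasFDerivAt_const _ _) ih
  have h1 : UC S 0 fun i (_ : Z) => c i := ⟨⟨C, fun i _ _ => hC i⟩, fun η hη => by
    obtain ⟨d, hd, H⟩ := hc η hη
    exact ⟨d, hd, fun i i' _ _ _ _ h _ => H i i' h⟩⟩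
  cases n with
  | zero => exact h1
  | succ n => exact UC.succ h1 (fun i z _ => hasFDerivAt_const _ _) (h0 n)

theorem UC.const (c : E) : UC S n fun (_ : ι) (_ : Z) => c :=
  UC.const_index ⟨‖c‖, fun _ => le_rfl⟩ fun η hη => ⟨1, one_pos, by simp [hη.le]⟩

theorem UG.linear (L : Z →L[ℝ] E) : UG S n fun (_ : ι) (z : Z) => L z := by
  have h0 : UCont S fun (_ : ι) (z : Z) => L z := by
    intro η hη
    refine ⟨η / (‖L‖ + 1), by positivity, fun i i' z z' _ _ _ hz => ?_⟩
    rw [← map_sub]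
    rw [dist_eq_norm] at hz
    refine (L.le_opNorm _).trans ?_
    calc _ ≤ (‖L‖ + 1) * (η / (‖L‖ + 1)) := by
          gcongr
          linarith
      _ = η := by field_simp
  cases n with
  | zero => exact h0
  | succ n =>
    have := UC.const (ι := ι) (S := S) (n := n) L
    exact ⟨h0, _, fun i z _ => L.hasFDerivAt, this.1, this.2⟩

theorem UC.linear (L : Z →L[ℝ] E) (hb : ∃ C, ∀ z ∈ S, ‖L z‖ ≤ C) :
    UC S n fun (_ : ι) (z : Z) => L z :=
  ⟨let ⟨C, hC⟩ := hb; ⟨C, fun _ => hC⟩, UG.linear L⟩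

/-- The product rule, by induction on the order. Boundedness of the values of both factors is needed
already for uniform continuity of the product, hence `UC` and not `UG`. -/
theorem UC.bilin : ∀ {n : ℕ} {E F G : Type} [NormedAddCommGroup E] [NormedSpace ℝ E]
    [NormedAddCommGroup F] [NormedSpace ℝ F] [NormedAddCommGroup G] [NormedSpace ℝ G]
    (B : E →L[ℝ] F →L[ℝ] G) {h : ι → Z → E} {g : ι → Z → F},
    UC S n h → UC S n g → UC S n fun i z => B (h i z) (g i z)
  | 0, E, F, G, _, _, _, _, _, _, B, h, g, hh, hg => by
    obtain ⟨⟨C, hC⟩, hu⟩ := hh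
    obtain ⟨⟨C', hC'⟩, hu'⟩ := hg
    constructor
    · refine ⟨‖B‖ * C * C', fun i z hz => (B.le_opNorm₂ _ _).trans ?_⟩
      have := hC i z hz
      have h0 := (norm_nonneg _).trans this
      have := hC' i z hz
      gcongr
    · intro η hη
      by_cases hS : ∃ i : ι, ∃ z, z ∈ S
      · obtain ⟨i₀, z₀, hz₀⟩ := hS
        have hC0 : 0 ≤ C := (norm_nonneg _).trans (hC i₀ z₀ hz₀)
        have hC0' : 0 ≤ C' := (norm_nonneg _).trans (hC' i₀ z₀ hz₀)
        set K := ‖B‖ * (C + C') + 1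
        have hK : 0 < K := by positivity
        obtain ⟨d, hd, H⟩ := hu (η / K) (by positivity)
        obtain ⟨d', hd', H'⟩ := hu' (η / K) (by positivity)
        refine ⟨min d d', lt_min hd hd', fun i i' z z' hz hz' h1 h2 => ?_⟩
        have a := H i i' z z' hz hz' (h1.trans_le (min_le_left _ _))
          (h2.trans_le (min_le_left _ _))
        have b := H' i i' z z' hz hz' (h1.trans_le (min_le_right _ _))
          (h2.trans_le (min_le_right _ _))
        have e : B (h i z) (g i z) - B (h i' z') (g i' z') =
            B (h i z) (g i z - g i' z') + B (h i z - h i' z') (g i' z') := by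
          simp only [map_sub, sub_apply]; abel
        rw [e]
        have e1 := (B.le_opNorm₂ (h i z) (g i z - g i' z'))
        have e2 := (B.le_opNorm₂ (h i z - h i' z') (g i' z'))
        have c1 := hC i z hz
        have c2 := hC' i' z' hz'
        calc _ ≤ ‖B‖ * C * (η / K) + ‖B‖ * (η / K) * C' :=
              (norm_add_le _ _).trans (add_le_add (e1.trans (by gcongr)) (e2.trans (by gcongr)))
          _ = (‖B‖ * (C + C')) * (η / K) := by ring
          _ ≤ K * (η / K) := by
              gcongr
              simp only [K]; linarith
          _ = η := by field_simp
      · exact ⟨1, one_pos, fun i _ z _ hz => absurd ⟨i, z, hz⟩ hS⟩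
  | n + 1, E, F, G, _, _, _, _, _, _, B, h, g, hh, hg => by
    obtain ⟨h', h2, h3⟩ := hh.exists_deriv
    obtain ⟨g', g2, g3⟩ := hg.exists_deriv
    refine UC.succ (UC.bilin B (hh.of_le (Nat.zero_le _)) (hg.of_le (Nat.zero_le _)))
      (fun i z hz => B.hasFDerivAt_of_bilinear (h2 i z hz) (g2 i z hz)) ?_
    exact (UC.bilin (B.precompR Z) (hh.of_le n.le_succ) g3).add
      (UC.bilin (B.precompL Z) h3 (hg.of_le n.le_succ))

theorem UCont.comp {X : Type} [PseudoMetricSpace X] {F : Type} [SeminormedAddCommGroup F]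
    {T : Set E} {S : Set X} {g : ι → E → F} {h : ι → X → E}
    (hg : UCont T g) (hh : UCont S h) (hm : ∀ i, ∀ z ∈ S, h i z ∈ T) :
    UCont S fun i z => g i (h i z) := by
  intro η hη
  obtain ⟨d, hd, H⟩ := hg η hη
  obtain ⟨d', hd', H'⟩ := hh (d / 2) (by positivity)
  refine ⟨min d d', lt_min hd hd', fun i i' z z' hz hz' h1 h2 => ?_⟩
  refine H _ _ _ _ (hm i z hz) (hm i' z' hz') (h1.trans_le (min_le_left _ _)) ?_
  rw [dist_eq_norm]
  exact (H' i i' z z' hz hz' (h1.trans_le (min_le_right _ _))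
    (h2.trans_le (min_le_right _ _))).trans_lt (by linarith)

theorem UBdd.comp {T : Set E} {g : ι → E → F} (hg : UBdd T g) (hm : ∀ i, ∀ z ∈ S, h i z ∈ T) :
    UBdd S fun i z => g i (h i z) :=
  let ⟨C, hC⟩ := hg
  ⟨C, fun i z hz => hC i _ (hm i z hz)⟩

/-- The chain rule, by induction on the order. The inner map may be unbounded, as linear projections
are; only its derivatives enter products. -/
theorem UG.comp {T : Set E} : ∀ {n : ℕ} {F : Type} [NormedAddCommGroup F] [NormedSpace ℝ F]
    {g : ι → E → F} {h : ι → Z → E}, UG T n g → UG S n h → (∀ i, ∀ z ∈ S, h i z ∈ T) →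
    UG S n fun i z => g i (h i z)
  | 0, _, _, _, _, _, hg, hh, hm => UCont.comp hg hh hm
  | n + 1, F, _, _, g, h, hg, hh, hm => by
    obtain ⟨g1, g', g2, g3, g4⟩ := hg
    obtain ⟨h1, h', h2, h3, h4⟩ := id hh
    have := UC.bilin (ContinuousLinearMap.compL ℝ Z E F) (h := fun i z => g' i (h i z))
      ⟨g3.comp hm, UG.comp g4 hh.of_succ hm⟩ ⟨h3, h4⟩
    exact ⟨g1.comp h1 hm, _, fun i z hz => (g2 i _ (hm i z hz)).comp z (h2 i z hz),
      this.1, this.2⟩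

theorem UC.comp {T : Set E} {g : ι → E → F} (hg : UC T n g) (hh : UG S n h)
    (hm : ∀ i, ∀ z ∈ S, h i z ∈ T) : UC S n fun i z => g i (h i z) :=
  ⟨hg.1.comp hm, hg.2.comp hh hm⟩

theorem UC.smul {c : ι → Z → ℝ} (hc : UC S n c) (hh : UC S n h) :
    UC S n fun i z => c i z • h i z :=
  UC.bilin (ContinuousLinearMap.lsmul ℝ ℝ) hc hh

theorem UG.succ_of_hasDerivAt {S : Set ℝ} {h h' : ι → ℝ → E} (h0 : UCont S h)
    (hd : ∀ i, ∀ t ∈ S, HasDerivAt (h i) (h' i t) t) (hh' : UC S n h') : UG S (n + 1) h := by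
  have := hh'.clm (ContinuousLinearMap.smulRightL ℝ ℝ E (1 : ℝ →L[ℝ] ℝ))
  refine ⟨h0, _, fun i t ht => ?_, this.1, this.2⟩
  refine (hd i t ht).hasFDerivAt.congr_fderiv ?_
  ext
  simp

/-- The mean value inequality on the convex set `S ∩ ball x d`, where `h'` varies by at most `η`;
the radius is the same for all indices and base points. -/
theorem uniform_remainder (hS : Convex ℝ S) {h' : ι → Z → Z →L[ℝ] E}
    (hd : ∀ i, ∀ z ∈ S, HasFDerivAt (h i) (h' i z) z) (hu : UCont S h') (η : ℝ) (hη : 0 < η) :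
    ∃ d > 0, ∀ i, ∀ x ∈ S, ∀ y ∈ S, ‖y - x‖ < d →
      ‖h i y - h i x - h' i x (y - x)‖ ≤ η * ‖y - x‖ := by
  obtain ⟨d, hd0, H⟩ := hu η hη
  refine ⟨d, hd0, fun i x hx y hy hxy => ?_⟩
  refine Convex.norm_image_sub_le_of_norm_hasFDerivWithin_le' (s := S ∩ ball x d)
    (f := h i) (f' := h' i) (fun z hz => (hd i z hz.1).hasFDerivWithinAt)
    (fun z hz => H i i z x hz.1 hx (by simpa using hd0) hz.2) (hS.inter (convex_ball _ _))
    ⟨hx, mem_ball_self hd0⟩ ⟨hy, by rwa [mem_ball, dist_eq_norm]⟩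

theorem lipschitz_of_deriv_le (hS : Convex ℝ S) {f : Z → E} {f' : Z → Z →L[ℝ] E} {C : ℝ}
    (hd : ∀ z ∈ S, HasFDerivAt f (f' z) z) (hC : ∀ z ∈ S, ‖f' z‖ ≤ C) {x y : Z}
    (hx : x ∈ S) (hy : y ∈ S) : ‖f y - f x‖ ≤ C * ‖y - x‖ :=
  Convex.norm_image_sub_le_of_norm_hasFDerivWithin_le
    (fun z hz => (hd z hz).hasFDerivWithinAt) hC hS hx hy

theorem UG.exists_lipschitz (hS : Convex ℝ S) (hh : UG S (n + 1) h) :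
    ∃ C, 0 ≤ C ∧ ∀ i, ∀ x ∈ S, ∀ y ∈ S, ‖h i y - h i x‖ ≤ C * ‖y - x‖ := by
  obtain ⟨_, h', h2, ⟨C, hC⟩, _⟩ := hh
  refine ⟨max C 0, le_max_right _ _, fun i x hx y hy => ?_⟩
  exact lipschitz_of_deriv_le hS (h2 i) (fun z hz => (hC i z hz).trans (le_max_left _ _)) hx hy

/-! ### Superposition operators on bounded sequences -/

section Superposition

variable {X Y : Type} [NormedAddCommGroup X] [NormedSpace ℝ X] [NormedAddCommGroup Y]
  [NormedSpace ℝ Y]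

/-- The diagonal operator defined by a bounded sequence of operators. -/
def diagL (X Y : Type) [NormedAddCommGroup X] [NormedSpace ℝ X] [NormedAddCommGroup Y]
    [NormedSpace ℝ Y] : Linf (X →L[ℝ] Y) →L[ℝ] Linf X →L[ℝ] Linf Y :=
  have hb : ∀ (T : Linf (X →L[ℝ] Y)) (u : Linf X) k, ‖T k (u k)‖ ≤ ‖T‖ * ‖u‖ := fun T u k =>
    ((T k).le_opNorm _).trans (mul_le_mul (linf_norm_apply_le T k) (linf_norm_apply_le u k)
      (norm_nonneg _) (norm_nonneg _))
  have ha : ∀ (T : Linf (X →L[ℝ] Y)) (u : Linf X) k,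
      toLinf (fun k => T k (u k)) k = T k (u k) := fun T u k => toLinf_apply ⟨_, hb T u⟩ k
  LinearMap.mkContinuous₂ (LinearMap.mk₂ ℝ (fun T u => toLinf fun k => T k (u k))
    (fun T T' u => linf_ext fun k => by
      change _ = toLinf (fun k => T k (u k)) k + toLinf (fun k => T' k (u k)) k
      rw [ha, ha, ha]; rfl)
    (fun c T u => linf_ext fun k => by
      change _ = c • toLinf (fun k => T k (u k)) k
      rw [ha, ha]; rfl)
    (fun T u u' => linf_ext fun k => by
      change _ = toLinf (fun k => T k (u k)) k + toLinf (fun k => T k (u' k)) k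
      rw [ha, ha, ha]
      exact map_add (T k) _ _)
    (fun c T u => linf_ext fun k => by
      change _ = c • toLinf (fun k => T k (u k)) k
      rw [ha, ha]
      exact map_smul (T k) _ _)) 1
    (fun T u => by
      rw [one_mul]
      exact linf_norm_le fun k => (congrArg norm (ha T u k)).trans_le (hb T u k))

theorem diagL_apply (T : Linf (X →L[ℝ] Y)) (u : Linf X) (k : ℤ) :
    diagL X Y T u k = T k (u k) :=
  toLinf_apply ⟨‖T‖ * ‖u‖, fun k => ((T k).le_opNorm _).trans (mul_le_mul (linf_norm_apply_le T k)
    (linf_norm_apply_le u k) (norm_nonneg _) (norm_nonneg _))⟩ k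

/-- The superposition operator of a family of maps. -/
def superpos (h : ι × ℤ → X → Y) (i : ι) (u : Linf X) : Linf Y := toLinf fun k => h (i, k) (u k)

theorem superpos_apply {S : Set X} {h : ι × ℤ → X → Y} (hb : UBdd S h) {i : ι} {u : Linf X}
    (hu : ∀ k, u k ∈ S) (k : ℤ) : superpos h i u k = h (i, k) (u k) :=
  let ⟨C, hC⟩ := hb
  toLinf_apply ⟨C, fun k => hC _ _ (hu k)⟩ k

/-- Differentiability in the supremum norm requires first-order remainders that are small uniformly
in the component, which is what the joint moduli provide. The derivative is a diagonal operator,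
itself a superposition of lower order, and the induction continues with it. -/
theorem UC.superpos {S : Set X} (hS : Convex ℝ S) {T : Set (Linf X)} (hT : IsOpen T)
    (hTS : ∀ u ∈ T, ∀ k, u k ∈ S) : ∀ {n : ℕ} {Y : Type} [NormedAddCommGroup Y]
    [NormedSpace ℝ Y] {h : ι × ℤ → X → Y}, UC S n h → UC T n (LDS.superpos h)
  | 0, Y, _, _, h, hh => by
    have hap := fun {i u} (hu : u ∈ T) k => superpos_apply hh.1 (i := i) (hTS u hu) k
    obtain ⟨⟨C, hC⟩, hu⟩ := hh
    refine ⟨⟨C, fun i u hu => linf_norm_le fun k => ?_⟩, fun η hη => ?_⟩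
    · rw [hap hu]
      exact hC _ _ (hTS u hu k)
    · obtain ⟨d, hd, H⟩ := hu η hη
      refine ⟨d, hd, fun i i' u u' hu hu' h1 h2 => linf_norm_le fun k => ?_⟩
      change ‖LDS.superpos h i u k - LDS.superpos h i' u' k‖ ≤ η
      rw [hap hu, hap hu']
      refine H _ _ _ _ (hTS u hu k) (hTS u' hu' k) ?_ ?_
      · simpa [Prod.dist_eq] using h1
      · rw [dist_eq_norm] at h2 ⊢
        exact (linf_norm_apply_le (u - u') k).trans_lt h2
  | n + 1, Y, _, _, h, hh => by
    obtain ⟨h', h2, h3⟩ := hh.exists_deriv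
    have hap := fun {i u} (hu : u ∈ T) k => superpos_apply hh.1 (i := i) (hTS u hu) k
    have hap' := fun {i u} (hu : u ∈ T) k => superpos_apply h3.1 (i := i) (hTS u hu) k
    refine UC.succ (UC.superpos hS hT hTS (hh.of_le (Nat.zero_le _))) (fun i u hu => ?_)
      ((UC.superpos hS hT hTS h3).clm (diagL X Y))
    rw [hasFDerivAt_iff_isLittleO, Asymptotics.isLittleO_iff]
    intro η hη
    obtain ⟨d, hd, H⟩ := uniform_remainder hS h2 h3.2.ucont η hη
    filter_upwards [hT.mem_nhds hu, ball_mem_nhds u hd] with u' hu' hd'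
    rw [mem_ball, dist_eq_norm] at hd'
    refine linf_norm_le fun k => ?_
    change ‖LDS.superpos h i u' k - LDS.superpos h i u k - diagL X Y _ (u' - u) k‖ ≤ _
    rw [diagL_apply, hap hu, hap hu', hap' hu]
    have h5 : ‖u' k - u k‖ ≤ ‖u' - u‖ := linf_norm_apply_le (u' - u) k
    exact (H (i, k) _ (hTS u hu k) _ (hTS u' hu' k) (h5.trans_lt hd')).trans (by gcongr)

end Superposition

/-! ### Translation to and from `iteratedFDeriv` -/

section IteratedDerivatives

theorem norm_iteratedFDeriv_succ_sub (f g : Z → E) (j : ℕ) (z z' : Z) :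
    ‖iteratedFDeriv ℝ (j + 1) f z - iteratedFDeriv ℝ (j + 1) g z'‖ =
      ‖iteratedFDeriv ℝ j (fderiv ℝ f) z - iteratedFDeriv ℝ j (fderiv ℝ g) z'‖ := by
  rw [← dist_eq_norm, ← dist_eq_norm, iteratedFDeriv_succ_eq_comp_right,
    iteratedFDeriv_succ_eq_comp_right]
  exact LinearIsometryEquiv.dist_map _ _ _

theorem UG.fderiv_eq {h : ι → Z → E} {h' : ι → Z → Z →L[ℝ] E}
    (hd : ∀ i, ∀ z ∈ (univ : Set Z), HasFDerivAt (h i) (h' i z) z) (i : ι) :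
    fderiv ℝ (h i) = h' i := funext fun z => (hd i z (mem_univ z)).fderiv

theorem UG.contDiff : ∀ {n : ℕ} {E : Type} [NormedAddCommGroup E] [NormedSpace ℝ E]
    {h : ι → Z → E}, UG (univ : Set Z) n h → ∀ i, ContDiff ℝ n (h i)
  | 0, _, _, _, h, hh, i => by
    rw [Nat.cast_zero, contDiff_zero]
    refine (Metric.uniformContinuous_iff.2 fun η hη => ?_).continuous
    obtain ⟨d, hd, H⟩ := hh (η / 2) (by positivity)
    refine ⟨d, hd, fun {a b} hab => ?_⟩
    rw [dist_eq_norm]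
    exact (H i i a b (mem_univ _) (mem_univ _) (by simpa using hd) hab).trans_lt (by linarith)
  | n + 1, _, _, _, h, ⟨_, h', h2, _, h4⟩, i => by
    have := contDiff_succ_iff_hasFDerivAt (𝕜 := ℝ) (n := n) (f := h i)
    push_cast
    exact this.2 ⟨h' i, UG.contDiff h4 i, fun z => h2 i z (mem_univ z)⟩

theorem UG.iteratedFDeriv_ucont : ∀ {n : ℕ} {E : Type} [NormedAddCommGroup E] [NormedSpace ℝ E]
    {h : ι → Z → E}, UG (univ : Set Z) n h → ∀ j ≤ n,
    UCont (univ : Set Z) fun i z => iteratedFDeriv ℝ j (h i) z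
  | n, _, _, _, h, hh, 0, _ => by
    intro η hη
    obtain ⟨d, hd, H⟩ := hh.ucont η hη
    refine ⟨d, hd, fun i i' z z' hz hz' h1 h2 => ?_⟩
    simp only [iteratedFDeriv_zero_eq_comp, Function.comp]
    rw [← map_sub, LinearIsometryEquiv.norm_map]
    exact H i i' z z' hz hz' h1 h2
  | n + 1, _, _, _, h, ⟨_, h', h2, _, h4⟩, j + 1, hj => by
    intro η hη
    obtain ⟨d, hd, H⟩ := UG.iteratedFDeriv_ucont h4 j (by omega) η hη
    refine ⟨d, hd, fun i i' z z' hz hz' h1 h2' => ?_⟩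
    rw [norm_iteratedFDeriv_succ_sub, UG.fderiv_eq h2, UG.fderiv_eq h2]
    exact H i i' z z' hz hz' h1 h2'

theorem UC.iteratedFDeriv_bdd : ∀ {n : ℕ} {E : Type} [NormedAddCommGroup E] [NormedSpace ℝ E]
    {h : ι → Z → E}, UC (univ : Set Z) n h → ∀ j ≤ n,
    ∃ C, ∀ i z, ‖iteratedFDeriv ℝ j (h i) z‖ ≤ C
  | n, _, _, _, h, hh, 0, _ => by
    obtain ⟨C, hC⟩ := hh.1
    refine ⟨C, fun i z => ?_⟩
    rw [norm_iteratedFDeriv_zero]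
    exact hC i z (mem_univ z)
  | n + 1, _, _, _, h, ⟨_, _, h', h2, h3, h4⟩, j + 1, hj => by
    obtain ⟨C, hC⟩ := UC.iteratedFDeriv_bdd ⟨h3, h4⟩ j (by omega)
    refine ⟨C, fun i z => ?_⟩
    rw [← norm_iteratedFDeriv_fderiv, UG.fderiv_eq h2]
    exact hC i z

theorem UC.exists_bound_of_le {n : ℕ} {h : ι → Z → E} (hh : UC (univ : Set Z) n h) :
    ∃ C, ∀ j ≤ n, ∀ i z, ‖iteratedFDeriv ℝ j (h i) z‖ ≤ C := by
  have := fun j : Fin (n + 1) => hh.iteratedFDeriv_bdd j (by omega)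
  choose C hC using this
  refine ⟨∑ j, |C j|, fun j hj i z => (hC ⟨j, by omega⟩ i z).trans ?_⟩
  exact (le_abs_self _).trans (Finset.single_le_sum (f := fun j => |C j|)
    (fun j _ => abs_nonneg _) (Finset.mem_univ _))

theorem UC.isCr {n : ℕ} {h : ι → Z → E} (hh : UC (univ : Set Z) n h) (i : ι) : IsCr n (h i) := by
  refine ⟨hh.2.contDiff i, ?_, fun j hj => Metric.uniformContinuous_iff.2 fun η hη => ?_⟩
  · obtain ⟨C, hC⟩ := hh.exists_bound_of_le
    exact ⟨C, fun j hj z => hC j hj i z⟩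
  · obtain ⟨d, hd, H⟩ := hh.2.iteratedFDeriv_ucont j hj (η / 2) (by positivity)
    refine ⟨d, hd, fun {a b} hab => ?_⟩
    rw [dist_eq_norm]
    exact (H i i a b (mem_univ _) (mem_univ _) (by simpa using hd) hab).trans_lt (by linarith)

theorem UG.of_iteratedFDeriv : ∀ {n : ℕ} {E : Type} [NormedAddCommGroup E] [NormedSpace ℝ E]
    {h : ι → Z → E}, (∀ i, ContDiff ℝ n (h i)) →
    (∀ j ≤ n, 1 ≤ j → ∃ C, ∀ i z, ‖iteratedFDeriv ℝ j (h i) z‖ ≤ C) →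
    (∀ j ≤ n, UCont (univ : Set Z) fun i z => iteratedFDeriv ℝ j (h i) z) →
    UG (univ : Set Z) n h
  | n, _, _, _, h, hc, hb, hu => by
    have h0 : UCont (univ : Set Z) h := by
      intro η hη
      obtain ⟨d, hd, H⟩ := hu 0 (Nat.zero_le _) η hη
      refine ⟨d, hd, fun i i' z z' hz hz' h1 h2 => ?_⟩
      have := H i i' z z' hz hz' h1 h2
      simp only [iteratedFDeriv_zero_eq_comp, Function.comp] at this
      rwa [← map_sub, LinearIsometryEquiv.norm_map] at this
    cases n with
    | zero => exact h0
    | succ n =>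
      have hc' : ∀ i, ContDiff ℝ n (fun z => fderiv ℝ (h i) z) := fun i =>
        (hc i).fderiv_right (by push_cast; exact le_rfl)
      have hdiff : ∀ i, Differentiable ℝ (h i) := fun i =>
        (hc i).differentiable (by push_cast; exact ne_of_gt (by positivity))
      refine ⟨h0, fun i z => fderiv ℝ (h i) z, fun i z _ => (hdiff i z).hasFDerivAt, ?_,
        UG.of_iteratedFDeriv hc' (fun j hj hj1 => ?_) fun j hj => ?_⟩
      · obtain ⟨C, hC⟩ := hb 1 (by omega) le_rfl
        refine ⟨C, fun i z _ => ?_⟩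
        have := hC i z
        rwa [← norm_iteratedFDeriv_fderiv, norm_iteratedFDeriv_zero] at this
      · obtain ⟨C, hC⟩ := hb (j + 1) (by omega) (by omega)
        refine ⟨C, fun i z => ?_⟩
        have := hC i z
        rwa [← norm_iteratedFDeriv_fderiv] at this
      · intro η hη
        obtain ⟨d, hd, H⟩ := hu (j + 1) (by omega) η hη
        refine ⟨d, hd, fun i i' z z' hz hz' h1 h2 => ?_⟩
        have := H i i' z z' hz hz' h1 h2
        rwa [norm_iteratedFDeriv_succ_sub] at this

end IteratedDerivatives

end UniformSmoothness

/-! ### Slow-fast systems: comparison of orbits and the invariant section -/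

section SlowFastSystems

variable {ι : Type} [PseudoMetricSpace ι]
variable {Z E : Type} [NormedAddCommGroup Z] [NormedSpace ℝ Z] [NormedAddCommGroup E]
  [NormedSpace ℝ E]

theorem UCont.continuous_comp {X Y W : Type} [PseudoMetricSpace X] [NormedAddCommGroup Y]
    [TopologicalSpace W] {S : Set X} {h : ι → X → Y} (hh : UCont S h) (i : ι) {x : W → X}
    (hx : Continuous x) (hm : ∀ t, x t ∈ S) : Continuous fun t => h i (x t) := by
  refine continuous_iff_continuousAt.2 fun t => Metric.tendsto_nhds.2 fun η hη => ?_
  obtain ⟨d, hd, H⟩ := hh (η / 2) (by positivity)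
  filter_upwards [Metric.tendsto_nhds.1 (hx.tendsto t) d hd] with s hs
  rw [dist_eq_norm]
  exact (H i i _ _ (hm s) (hm t) (by simpa using hd) hs).trans_lt (by linarith)

/-- Two orbits separate exponentially, so a remainder estimate valid only at small distance is
useless over all times. At distance at least `d` the crude linear bound is dominated by a quadratic
one, and the sum holds everywhere. -/
theorem UC.remainder {F : Type} [NormedAddCommGroup F] [NormedSpace ℝ F] {S : Set Z}
    {h : ι → Z → F} {h' : ι → Z → Z →L[ℝ] F} (hS : Convex ℝ S)
    (hd : ∀ i, ∀ z ∈ S, HasFDerivAt (h i) (h' i z) z) (hh' : UC S 0 h') (η : ℝ) (hη : 0 < η) :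
    ∃ Q, 0 ≤ Q ∧ ∀ i, ∀ x ∈ S, ∀ y ∈ S,
      ‖h i y - h i x - h' i x (y - x)‖ ≤ η * ‖y - x‖ + Q * ‖y - x‖ ^ 2 := by
  obtain ⟨d, hd0, H⟩ := uniform_remainder hS hd hh'.2 η hη
  obtain ⟨C, hC⟩ := hh'.1
  refine ⟨2 * |C| / d, by positivity, fun i x hx y hy => ?_⟩
  by_cases hxy : ‖y - x‖ < d
  · exact (H i x hx y hy hxy).trans (le_add_of_nonneg_right (by positivity))
  · push Not at hxy
    have hC' : ∀ z ∈ S, ‖h' i z‖ ≤ |C| := fun z hz => (hC i z hz).trans (le_abs_self _)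
    have h1 := lipschitz_of_deriv_le hS (hd i) hC' hx hy
    have h2 := ContinuousLinearMap.le_of_opNorm_le _ (hC' x hx) (y - x)
    have h3 : 2 * |C| * ‖y - x‖ ≤ 2 * |C| / d * ‖y - x‖ ^ 2 := by
      rw [div_mul_eq_mul_div, le_div_iff₀ hd0, pow_two, ← mul_assoc]
      gcongr
    calc _ ≤ |C| * ‖y - x‖ + |C| * ‖y - x‖ := (norm_sub_le _ _).trans (add_le_add h1 h2)
      _ = 2 * |C| * ‖y - x‖ := by ring
      _ ≤ _ := h3.trans (le_add_of_nonneg_left (by positivity))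

/-- The analogue for values: a modulus of continuity turned into an affine bound without restriction
on the distance. -/
theorem UC.modulus {X F : Type} [NormedAddCommGroup X] [NormedAddCommGroup F] {S : Set X}
    {h : ι → X → F} (hb : UBdd S h) (hu : UCont S h) (η : ℝ) (hη : 0 < η) :
    ∃ Q, 0 ≤ Q ∧ ∃ d > 0, ∀ i i', dist i i' < d → ∀ x ∈ S, ∀ y ∈ S,
      ‖h i x - h i' y‖ ≤ η + Q * ‖x - y‖ := by
  obtain ⟨d, hd0, H⟩ := hu η hη
  obtain ⟨C, hC⟩ := hb
  refine ⟨2 * |C| / d, by positivity, d, hd0, fun i i' hi x hx y hy => ?_⟩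
  by_cases hxy : ‖x - y‖ < d
  · exact (H i i' x y hx hy hi (by rwa [dist_eq_norm])).trans
      (le_add_of_nonneg_right (by positivity))
  · push Not at hxy
    have h3 : 2 * |C| ≤ 2 * |C| / d * ‖x - y‖ := by
      rw [div_mul_eq_mul_div, le_div_iff₀ hd0]
      gcongr
    calc _ ≤ |C| + |C| := (norm_sub_le _ _).trans (add_le_add ((hC i x hx).trans (le_abs_self _))
          ((hC i' y hy).trans (le_abs_self _)))
      _ = 2 * |C| := by ring
      _ ≤ _ := h3.trans (le_add_of_nonneg_left hη.le)

theorem norm_deriv_apply_sub_le {f : Z → E} {f' : Z →L[ℝ] E} {x u : Z} {a : E} {c : ℝ}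
    (hf : HasFDerivAt f f' x) (hc : 0 ≤ c)
    (hb : ∀ᶠ t in 𝓝 (0 : ℝ), ‖f (x + t • u) - f x - t • a‖ ≤ c * |t|) : ‖f' u - a‖ ≤ c := by
  have h1 : HasDerivAt (fun t : ℝ => x + t • u) u 0 := by
    simpa using ((hasDerivAt_id (0 : ℝ)).smul_const u).const_add x
  have h2 : HasDerivAt (fun t : ℝ => f (x + t • u) - t • a) (f' u - a) 0 := by
    have h3 : HasFDerivAt f f' (x + (0 : ℝ) • u) := by simpa using hf
    have h4 := ((hasDerivAt_id (0 : ℝ)).smul_const a)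
    simp only [one_smul] at h4
    exact (h3.comp_hasDerivAt (0 : ℝ) h1).sub h4
  refine h2.le_of_lip' hc ?_
  filter_upwards [hb] with t ht
  simp only [zero_smul, add_zero, sub_zero, Real.norm_eq_abs]
  convert ht using 2
  abel

/-- The region `Z × ball 0 ρ`. -/
def tube (Z E : Type) [NormedAddCommGroup E] (ρ : ℝ) : Set (Z × E) := univ ×ˢ ball 0 ρ

theorem mem_tube {ρ : ℝ} {x : Z × E} : x ∈ tube Z E ρ ↔ ‖x.2‖ < ρ := by
  simp [tube]

theorem convex_tube (ρ : ℝ) : Convex ℝ (tube Z E ρ) := convex_univ.prod (convex_ball _ _)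

theorem isOpen_tube (ρ : ℝ) : IsOpen (tube Z E ρ) := isOpen_univ.prod isOpen_ball

/-- A family of systems `z' = b(z, v)`, `v' = N(z, v)` on `Z × ball 0 ρ` in which `z` is slow and
`v` is uniformly hyperbolic with linear part close to `A(z)`. -/
structure SlowFast (b : ι → Z × E → Z) (N : ι → Z × E → E) (A : ι → Z → E →L[ℝ] E) (S : Set Z)
    (C ρ κ σz σv K ν c : ℝ) : Prop where
  C_pos : 0 < C
  ρ_pos : 0 < ρ
  κ_nonneg : 0 ≤ κ
  σz_nonneg : 0 ≤ σz
  σv_nonneg : 0 ≤ σv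
  K_pos : 0 < K
  closed : IsClosed S
  b_mem : ∀ i, ∀ x ∈ tube Z E ρ, b i x ∈ S
  b_bdd : UBdd (tube Z E ρ) b
  b_ucont : UCont (tube Z E ρ) b
  N_ucont : UCont (tube Z E ρ) N
  dich : ∀ i (z q : ℝ → Z), Continuous q → (∀ t, q t ∈ S) → (∀ t, HasDerivAt z (q t) t) →
    IsDich (fun t => A i (z t)) C
  lip_b : ∀ i, ∀ x ∈ tube Z E ρ, ∀ y ∈ tube Z E ρ,
    ‖b i x - b i y‖ ≤ σz * ‖x.1 - y.1‖ + σv * ‖x.2 - y.2‖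
  lip_z : ∀ i z z', ∀ v ∈ ball (0 : E) ρ, ‖N i (z, v) - N i (z', v)‖ ≤ K * ‖z - z'‖
  lip_v : ∀ i z, ∀ v ∈ ball (0 : E) ρ, ∀ v' ∈ ball (0 : E) ρ,
    ‖N i (z, v) - N i (z, v') - A i z (v - v')‖ ≤ κ * ‖v - v'‖
  zero : ∀ i z, ‖N i (z, 0)‖ ≤ ν
  small_κ : C * κ ≤ c
  small_σz : C * σz ≤ c
  small_σv : C * (C * (σv * K)) ≤ c
  small_ν : C * ν ≤ ρ / 4

/-- A solution on the whole time axis that stays in the tube. -/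
structure IsOrbit (b : ι → Z × E → Z) (N : ι → Z × E → E) (ρ : ℝ) (i : ι) (z : ℝ → Z)
    (v : ℝ → E) : Prop where
  mem : ∀ t, ‖v t‖ < ρ
  dz : ∀ t, HasDerivAt z (b i (z t, v t)) t
  dv : ∀ t, HasDerivAt v (N i (z t, v t)) t

/-- `V` is the section whose graph carries the orbits that stay in the tube. -/
def IsSection (b : ι → Z × E → Z) (N : ι → Z × E → E) (ρ : ℝ) (V : ι → Z → E) : Prop :=
  ∀ i z₀, ∃ z v, IsOrbit b N ρ i z v ∧ z 0 = z₀ ∧ ∀ t, v t = V i (z t)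

variable {b : ι → Z × E → Z} {N : ι → Z × E → E} {A : ι → Z → E →L[ℝ] E} {S : Set Z}
  {C ρ κ σz σv K ν c : ℝ}

theorem IsOrbit.mem_tube {i : ι} {z : ℝ → Z} {v : ℝ → E} (h : IsOrbit b N ρ i z v) (t : ℝ) :
    (z t, v t) ∈ tube Z E ρ := LDS.mem_tube.2 (h.mem t)

theorem IsOrbit.continuous {i : ι} {z : ℝ → Z} {v : ℝ → E} (h : IsOrbit b N ρ i z v) :
    Continuous fun t => (z t, v t) :=
  (continuous_of_hasDerivAt h.dz).prodMk (continuous_of_hasDerivAt h.dv)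

theorem IsOrbit.shift {i : ι} {z : ℝ → Z} {v : ℝ → E} (h : IsOrbit b N ρ i z v) (s : ℝ) :
    IsOrbit b N ρ i (fun t => z (t + s)) (fun t => v (t + s)) :=
  ⟨fun _ => h.mem _, fun t => (h.dz (t + s)).comp_add_const t s,
    fun t => (h.dv (t + s)).comp_add_const t s⟩

theorem SlowFast.mono {c' : ℝ} (hc : c ≤ c') (H : SlowFast b N A S C ρ κ σz σv K ν c) :
    SlowFast b N A S C ρ κ σz σv K ν c' :=
  { H with
    small_κ := H.small_κ.trans hc
    small_σz := H.small_σz.trans hc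
    small_σv := H.small_σv.trans hc }

theorem SlowFast.isDich (H : SlowFast b N A S C ρ κ σz σv K ν c) {i : ι} {z : ℝ → Z} {v : ℝ → E}
    (h : IsOrbit b N ρ i z v) : IsDich (fun t => A i (z t)) C :=
  H.dich i z _ (H.b_ucont.continuous_comp i h.continuous h.mem_tube)
    (fun t => H.b_mem i _ (h.mem_tube t)) h.dz

/-- The curve `v'` need not solve the fast equation along `z`: it may belong to another slow curve
or another index, and `D` measures the defect. -/
theorem SlowFast.compare_fast (H : SlowFast b N A S C ρ κ σz σv K ν c) (hc : c ≤ 1 / 80)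
    {i : ι} {z q : ℝ → Z} (hq : Continuous q) (hqS : ∀ t, q t ∈ S)
    (hz : ∀ t, HasDerivAt z (q t) t) {γ B D : ℝ} (hγ : 0 ≤ γ) (hCγ : C * γ ≤ 1 / 2)
    {v v' w : ℝ → E} (hv : ∀ t, ‖v t‖ < ρ) (hv' : ∀ t, ‖v' t‖ < ρ) (hw : Continuous w)
    (hB : ∀ t, ‖v t - v' t‖ ≤ B * Real.cosh (γ * t))
    (hD : ∀ t, ‖w t - N i (z t, v' t)‖ ≤ D * Real.cosh (γ * t))
    (h₁ : ∀ t, HasDerivAt v (N i (z t, v t)) t) (h₂ : ∀ t, HasDerivAt v' (w t) t) (t : ℝ) :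
    ‖v t - v' t‖ ≤ 4 * (C * D) * Real.cosh (γ * t) := by
  have hzc := continuous_of_hasDerivAt hz
  have hN : ∀ {u u' : ℝ → E}, (∀ t, ‖u t‖ < ρ) → (∀ t, HasDerivAt u (u' t) t) →
      Continuous fun t => N i (z t, u t) := fun hu hd =>
    H.N_ucont.continuous_comp i (hzc.prodMk (continuous_of_hasDerivAt hd))
      fun t => LDS.mem_tube.2 (hu t)
  refine (H.dich i z q hq hqS hz).compare H.C_pos hγ hCγ H.κ_nonneg
    (H.small_κ.trans (by linarith)) (N := fun t v => N i (z t, v)) (s := ball 0 ρ)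
    (h := fun t => w t - N i (z t, v' t)) (fun t x hx y hy => H.lip_v i _ x hx y hy)
    (fun t => by simpa using hv t) (fun t => by simpa using hv' t) (hN hv h₁) (hN hv' h₂)
    (hw.sub (hN hv' h₂)) hD hB h₁ (fun t => (h₂ t).congr_deriv (by abel)) t

/-- Growth rate used for the comparison of orbits. -/
theorem SlowFast.rate_pos (H : SlowFast b N A S C ρ κ σz σv K ν c) : 0 < 1 / (4 * C) := by
  have := H.C_pos
  positivity

/-- A closed loop of estimates: a slow difference `X` forces a fast difference `4 C (K X + d)`
through the dichotomy, which changes the slow velocity by `σz X + σv · 4 C (K X + d) + d`, and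
integration returns a slow difference. The loop has gain below `1 / 2`, so only the initial
difference and the difference `d` of the fields remain. -/
theorem SlowFast.compare_orbits (H : SlowFast b N A S C ρ κ σz σv K ν c) (hc : c ≤ 1 / 80)
    {i i' : ι} {z z' : ℝ → Z} {v v' : ℝ → E} (h : IsOrbit b N ρ i z v)
    (h' : IsOrbit b N ρ i' z' v') {d : ℝ} (hd : 0 ≤ d)
    (hb : ∀ x ∈ tube Z E ρ, ‖b i x - b i' x‖ ≤ d) (hN : ∀ x ∈ tube Z E ρ, ‖N i x - N i' x‖ ≤ d)
    (t : ℝ) :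
    ‖z t - z' t‖ ≤ 2 * (‖z 0 - z' 0‖ + 4 * C * (4 * C * σv + 1) * d) *
        Real.cosh (1 / (4 * C) * t) ∧
      ‖v t - v' t‖ ≤ 4 * (C * (K * (2 * (‖z 0 - z' 0‖ + 4 * C * (4 * C * σv + 1) * d)) + d)) *
        Real.cosh (1 / (4 * C) * t) := by
  have hC := H.C_pos
  have hK := H.K_pos
  have hσz := H.σz_nonneg
  have hσv := H.σv_nonneg
  set γ := 1 / (4 * C) with hγ
  have hγ0 : 0 < γ := H.rate_pos
  have hCγ : C * γ ≤ 1 / 2 := by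
    rw [hγ]
    have : C * (1 / (4 * C)) = 1 / 4 := by field_simp
    rw [this]; norm_num
  have hbc := H.b_ucont.continuous_comp i h.continuous h.mem_tube
  have hNc' := H.N_ucont.continuous_comp i' h'.continuous h'.mem_tube
  have hfast : ∀ X, (∀ t, ‖z t - z' t‖ ≤ X * Real.cosh (γ * t)) →
      ∀ t, ‖v t - v' t‖ ≤ 4 * (C * (K * X + d)) * Real.cosh (γ * t) := by
    intro X hX
    refine H.compare_fast hc hbc (fun t => H.b_mem i _ (h.mem_tube t)) h.dz hγ0.le hCγ
      (B := 2 * ρ) h.mem h'.mem hNc' (fun t => ?_) (fun t => ?_) h.dv h'.dv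
    · have h1 := one_le_cosh_mul γ t
      have h2 := H.ρ_pos
      calc _ ≤ 2 * ρ := (norm_sub_le _ _).trans (by linarith [h.mem t, h'.mem t])
        _ ≤ _ := le_mul_of_one_le_right (by positivity) h1
    · have h1 := one_le_cosh_mul γ t
      have h2 := hN _ (h'.mem_tube t)
      have h3 := H.lip_z i (z t) (z' t) (v' t) (by simpa using h'.mem t)
      calc ‖N i' (z' t, v' t) - N i (z t, v' t)‖
          = ‖-(N i (z' t, v' t) - N i' (z' t, v' t)) -
            (N i (z t, v' t) - N i (z' t, v' t))‖ := by congr 1; abel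
        _ ≤ d + K * ‖z t - z' t‖ := (norm_sub_le _ _).trans (by
            rw [norm_neg]; exact add_le_add h2 h3)
        _ ≤ d * Real.cosh (γ * t) + K * (X * Real.cosh (γ * t)) := by
            gcongr
            · exact le_mul_of_one_le_right hd h1
            · exact hX t
        _ = _ := by ring
  have hslow : ∀ t, ‖z t - z' t‖ ≤ 2 * (‖z 0 - z' 0‖ + 4 * C * (4 * C * σv + 1) * d) *
      Real.cosh (γ * t) := by
    intro t
    refine le_of_forall_le_half (g := fun t => ‖z t - z' t‖) (w := fun t => Real.cosh (γ * t))
      (fun t => Real.cosh_pos _) ?_ ?_ (by positivity) t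
    -- The finite bound to start from: slow velocities are bounded, so the slow difference is
    -- dominated by some multiple of the weight.
    · obtain ⟨M, hM⟩ := H.b_bdd
      refine ⟨‖z 0 - z' 0‖ + 2 * |M| / γ, fun t => ?_⟩
      have h1 := norm_sub_le_cosh (f := fun t => z t - z' t) (D := 2 * |M|) hγ0
        (fun t => (h.dz t).sub (h'.dz t)) (fun t => by
          have h1 := one_le_cosh_mul γ t
          have h2 := (hM i _ (h.mem_tube t)).trans (le_abs_self _)
          have h3 := (hM i' _ (h'.mem_tube t)).trans (le_abs_self _)
          calc _ ≤ 2 * |M| := (norm_sub_le _ _).trans (by linarith)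
            _ ≤ _ := le_mul_of_one_le_right (by positivity) h1) t
      have h2 := one_le_cosh_mul γ t
      calc ‖z t - z' t‖ = ‖(z 0 - z' 0) + (z t - z' t - (z 0 - z' 0))‖ := by congr 1; abel
        _ ≤ ‖z 0 - z' 0‖ + 2 * |M| / γ * Real.cosh (γ * t) :=
            (norm_add_le _ _).trans (by gcongr)
        _ ≤ ‖z 0 - z' 0‖ * Real.cosh (γ * t) + 2 * |M| / γ * Real.cosh (γ * t) := by
            gcongr
            exact le_mul_of_one_le_right (norm_nonneg _) h2
        _ = _ := by ring
    · intro X hX0 hX t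
      have h1 := norm_sub_le_cosh (f := fun t => z t - z' t)
        (D := σz * X + σv * (4 * (C * (K * X + d))) + d) hγ0
        (fun t => (h.dz t).sub (h'.dz t)) (fun t => by
          have h1 := one_le_cosh_mul γ t
          have h2 := hb _ (h'.mem_tube t)
          have h3 := H.lip_b i _ (h.mem_tube t) _ (h'.mem_tube t)
          have h4 := hX t
          have h5 := hfast X hX t
          calc _ = ‖(b i (z t, v t) - b i (z' t, v' t)) +
                (b i (z' t, v' t) - b i' (z' t, v' t))‖ := by congr 1; abel
            _ ≤ (σz * ‖z t - z' t‖ + σv * ‖v t - v' t‖) + d :=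
                (norm_add_le _ _).trans (add_le_add h3 h2)
            _ ≤ (σz * (X * Real.cosh (γ * t)) +
                σv * (4 * (C * (K * X + d)) * Real.cosh (γ * t))) + d * Real.cosh (γ * t) := by
                gcongr
                exact le_mul_of_one_le_right hd h1
            _ = _ := by ring) t
      have h2 := one_le_cosh_mul γ t
      -- Division by `γ = 1 / (4 C)` gives the gain `4 C σz + 16 C² σv K`, at most `20 c ≤ 1 / 4`.
      -- Only the product `σv K` has to be small.
      have h3 : (σz * X + σv * (4 * (C * (K * X + d))) + d) / γ ≤
          X / 2 + 4 * C * (4 * C * σv + 1) * d := by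
        have e : (σz * X + σv * (4 * (C * (K * X + d))) + d) / γ =
            (4 * (C * σz) + 16 * (C * (C * (σv * K)))) * X + 4 * C * (4 * C * σv + 1) * d := by
          rw [hγ]; field_simp; ring
        rw [e]
        have := H.small_σz
        have := H.small_σv
        have : (4 * (C * σz) + 16 * (C * (C * (σv * K)))) * X ≤ 1 / 2 * X := by
          gcongr; linarith
        linarith
      calc ‖z t - z' t‖ = ‖(z 0 - z' 0) + (z t - z' t - (z 0 - z' 0))‖ := by congr 1; abel
        _ ≤ ‖z 0 - z' 0‖ * 1 +
            (X / 2 + 4 * C * (4 * C * σv + 1) * d) * Real.cosh (γ * t) := by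
            rw [mul_one]
            exact (norm_add_le _ _).trans (add_le_add le_rfl (h1.trans (by gcongr)))
        _ ≤ ‖z 0 - z' 0‖ * Real.cosh (γ * t) +
            (X / 2 + 4 * C * (4 * C * σv + 1) * d) * Real.cosh (γ * t) := by gcongr
        _ = _ := by ring
  exact ⟨hslow t, hfast _ hslow t⟩

theorem SlowFast.compare_same (H : SlowFast b N A S C ρ κ σz σv K ν c) (hc : c ≤ 1 / 80)
    {i : ι} {z z' : ℝ → Z} {v v' : ℝ → E} (h : IsOrbit b N ρ i z v)
    (h' : IsOrbit b N ρ i z' v') (t : ℝ) :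
    ‖z t - z' t‖ ≤ 2 * ‖z 0 - z' 0‖ * Real.cosh (1 / (4 * C) * t) ∧
      ‖v t - v' t‖ ≤ 8 * C * K * ‖z 0 - z' 0‖ * Real.cosh (1 / (4 * C) * t) := by
  obtain ⟨h1, h2⟩ := H.compare_orbits hc h h' le_rfl (by simp) (by simp) t
  refine ⟨by simpa using h1, h2.trans (le_of_eq ?_)⟩
  ring

theorem SlowFast.orbit_unique (H : SlowFast b N A S C ρ κ σz σv K ν c) (hc : c ≤ 1 / 80)
    {i : ι} {z z' : ℝ → Z} {v v' : ℝ → E} (h : IsOrbit b N ρ i z v)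
    (h' : IsOrbit b N ρ i z' v') (h0 : z 0 = z' 0) (t : ℝ) : z t = z' t ∧ v t = v' t := by
  obtain ⟨h1, h2⟩ := H.compare_same hc h h' t
  simp only [h0, sub_self, norm_zero, mul_zero, zero_mul] at h1 h2
  exact ⟨sub_eq_zero.1 (norm_le_zero_iff.1 h1), sub_eq_zero.1 (norm_le_zero_iff.1 h2)⟩

/-- Comparison with the curve `v' = 0`, whose defect is the value of the fast field at zero, at
growth rate `γ = 0`. -/
theorem SlowFast.orbit_small (H : SlowFast b N A S C ρ κ σz σv K ν c) (hc : c ≤ 1 / 80)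
    {i : ι} {z : ℝ → Z} {v : ℝ → E} (h : IsOrbit b N ρ i z v) {ν' : ℝ}
    (hν : ∀ t, ‖N i (z t, 0)‖ ≤ ν') (t : ℝ) : ‖v t‖ ≤ 4 * (C * ν') := by
  have hρ := H.ρ_pos
  have := H.compare_fast hc (H.b_ucont.continuous_comp i h.continuous h.mem_tube)
    (fun t => H.b_mem i _ (h.mem_tube t)) h.dz (γ := 0) (B := ρ) (D := ν') le_rfl (by simp)
    (v' := fun _ => 0) (w := fun _ => 0) h.mem (by simpa using hρ) continuous_const
    (fun t => by simpa using (h.mem t).le) (fun t => by simpa using hν t) h.dv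
    (fun t => hasDerivAt_const _ _) t
  simpa using this

/-- An orbit in the tube is determined by its slow initial value, and the system is autonomous. This
is the source of all uniqueness statements about the manifold. -/
theorem SlowFast.section_eq (H : SlowFast b N A S C ρ κ σz σv K ν c) (hc : c ≤ 1 / 80)
    {V : ι → Z → E} (hV : IsSection b N ρ V) {i : ι} {z : ℝ → Z} {v : ℝ → E}
    (h : IsOrbit b N ρ i z v) (t : ℝ) : v t = V i (z t) := by
  obtain ⟨z', v', h', h0, hv'⟩ := hV i (z t)
  have h1 := (H.orbit_unique hc (h.shift t) h' (by simp [h0]) 0).2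
  have h2 := hv' 0
  rw [h0] at h2
  simpa [h2] using h1

theorem SlowFast.section_lipschitz (H : SlowFast b N A S C ρ κ σz σv K ν c) (hc : c ≤ 1 / 80)
    {V : ι → Z → E} (hV : IsSection b N ρ V) (i : ι) (z₁ z₂ : Z) :
    ‖V i z₁ - V i z₂‖ ≤ 8 * C * K * ‖z₁ - z₂‖ := by
  obtain ⟨z, v, h, h0, hv⟩ := hV i z₁
  obtain ⟨z', v', h', h0', hv'⟩ := hV i z₂
  have := (H.compare_same hc h h' 0).2
  simpa [h0, h0', hv, hv'] using this

theorem IsSection.mem {V : ι → Z → E} (hV : IsSection b N ρ V) (i : ι) (z : Z) :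
    ‖V i z‖ < ρ := by
  obtain ⟨z, v, h, h0, hv⟩ := hV i z
  have := h.mem 0
  rwa [hv 0, h0] at this

theorem SlowFast.section_ucont (H : SlowFast b N A S C ρ κ σz σv K ν c) (hc : c ≤ 1 / 80)
    {V : ι → Z → E} (hV : IsSection b N ρ V) : UCont univ V := by
  intro η hη
  have hC := H.C_pos
  have hK := H.K_pos
  have hσv := H.σv_nonneg
  set P := 4 * C * (4 * C * σv + 1) with hP
  have hP0 : 0 < P := by positivity
  set L := 4 * C * (2 * K * (1 + P) + 1) with hL
  have hL0 : 0 < L := by positivity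
  obtain ⟨d₁, hd₁, H₁⟩ := H.b_ucont (η / L) (by positivity)
  obtain ⟨d₂, hd₂, H₂⟩ := H.N_ucont (η / L) (by positivity)
  refine ⟨min (min d₁ d₂) (η / L), by positivity, fun i i' z₁ z₂ _ _ hi hz => ?_⟩
  obtain ⟨z, v, h, h0, hv⟩ := hV i z₁
  obtain ⟨z', v', h', h0', hv'⟩ := hV i' z₂
  have := (H.compare_orbits hc h h' (d := η / L) (by positivity)
    (fun x hx => H₁ i i' x x hx hx (hi.trans_le ((min_le_left _ _).trans (min_le_left _ _)))
      (by simpa using hd₁))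
    (fun x hx => H₂ i i' x x hx hx (hi.trans_le ((min_le_left _ _).trans (min_le_right _ _)))
      (by simpa using hd₂)) 0).2
  simp only [h0, h0', hv, hv', mul_zero, Real.cosh_zero, mul_one] at this
  have hz' : ‖z₁ - z₂‖ ≤ η / L := by
    rw [← dist_eq_norm]; exact (hz.trans_le (min_le_right _ _)).le
  calc _ ≤ _ := this
    _ ≤ 4 * (C * (K * (2 * (η / L + P * (η / L))) + η / L)) := by gcongr
    _ = L * (η / L) := by rw [hL]; ring
    _ = η := by field_simp

/-- Lyapunov-Perron: each slow curve determines its bounded fast response, with weighted Lipschitz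
constant `4 C K`, and the slow equation with this response inserted is a contraction at rate `γ`.
Hyperbolicity is needed along all curves of the iteration, not only along orbits. -/
theorem SlowFast.exists_section [CompleteSpace Z] [CompleteSpace E]
    (H : SlowFast b N A S C ρ κ σz σv K ν c) (hc : c ≤ 1 / 80) :
    ∃ V : ι → Z → E, IsSection b N ρ V := by
  have hC := H.C_pos
  have hK := H.K_pos
  have hρ := H.ρ_pos
  have hσz := H.σz_nonneg
  have hσv := H.σv_nonneg
  set γ := 1 / (4 * C) with hγ
  have hγ0 : 0 < γ := H.rate_pos
  have hCγ : C * γ ≤ 1 / 2 := by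
    rw [hγ]
    have : C * (1 / (4 * C)) = 1 / 4 := by field_simp
    rw [this]; norm_num
  obtain ⟨M, hM⟩ := H.b_bdd
  have hor : ∀ i z₀, ∃ z v, IsOrbit b N ρ i z v ∧ z 0 = z₀ := by
    intro i z₀
    -- The response is constructed in the closed ball of radius `ρ / 2`, which leaves room inside
    -- the open tube.
    have hex : ∀ z : ℝ → Z, (∃ q, IsCurve S M γ z₀ z q) → ∃ v : ℝ → E, (∀ t, ‖v t‖ < ρ) ∧
        ∀ t, HasDerivAt v (N i (z t, v t)) t := by
      rintro z ⟨q, hq⟩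
      have hzc := continuous_of_hasDerivAt hq.deriv
      obtain ⟨v, h1, h2⟩ := (H.dich i z q hq.cont hq.mem hq.deriv).exists_nonlinear
        (ρ := ρ / 2) (κ := κ) (ν := ν) (by positivity) H.κ_nonneg
        (H.small_κ.trans (by linarith)) (by linarith [H.small_ν]) (N := fun t v => N i (z t, v))
        (fun v hv hvρ => H.N_ucont.continuous_comp i (hzc.prodMk hv)
          fun t => LDS.mem_tube.2 ((hvρ t).trans_lt (by linarith)))
        (fun t x hx y hy => H.lip_v i _ x (closedBall_subset_ball (by linarith) hx) y
          (closedBall_subset_ball (by linarith) hy))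
        (fun t => H.zero i _)
      exact ⟨v, fun t => (h1 t).trans_lt (by linarith), h2⟩
    choose! f hf₁ hf₂ using hex
    have hmem : ∀ z q, IsCurve S M γ z₀ z q → ∀ t, (z t, f z t) ∈ tube Z E ρ :=
      fun z q hq t => LDS.mem_tube.2 (hf₁ z ⟨q, hq⟩ t)
    obtain ⟨z, hz⟩ := exists_solution_functional S H.closed (γ := γ)
      (c := σz + σv * (4 * (C * K))) (M := M) hγ0 (by positivity) (by
        rw [hγ, lt_div_iff₀ (by positivity)]
        have := H.small_σz
        have := H.small_σv
        nlinarith) z₀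
      ⟨b i (z₀, 0), H.b_mem _ _ (LDS.mem_tube.2 (by simpa using hρ)),
        hM _ _ (LDS.mem_tube.2 (by simpa using hρ))⟩
      (fun z t => b i (z t, f z t))
      (fun z q hq => by
        have hzc := continuous_of_hasDerivAt hq.deriv
        refine ⟨H.b_ucont.continuous_comp i
          (hzc.prodMk (continuous_of_hasDerivAt (hf₂ z ⟨q, hq⟩))) (hmem z q hq),
          fun t => H.b_mem _ _ (hmem z q hq t), fun t => ?_⟩
        have h0 := hM i _ (hmem z q hq t)
        exact h0.trans (le_mul_of_one_le_right ((norm_nonneg _).trans h0) (one_le_cosh_mul γ t)))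
      (fun z₁ q₁ z₂ q₂ h₁ h₂ X hX t => by
        have hz₂ := continuous_of_hasDerivAt h₂.deriv
        have key := H.compare_fast hc h₁.cont h₁.mem h₁.deriv (γ := γ) (B := 2 * ρ) (D := K * X)
          hγ0.le hCγ (hf₁ z₁ ⟨q₁, h₁⟩) (hf₁ z₂ ⟨q₂, h₂⟩)
          (H.N_ucont.continuous_comp i
            (hz₂.prodMk (continuous_of_hasDerivAt (hf₂ z₂ ⟨q₂, h₂⟩))) (hmem z₂ q₂ h₂))
          (fun t => by
            have h1 := one_le_cosh_mul γ t
            calc _ ≤ 2 * ρ := (norm_sub_le _ _).trans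
                  (by linarith [hf₁ z₁ ⟨q₁, h₁⟩ t, hf₁ z₂ ⟨q₂, h₂⟩ t])
              _ ≤ _ := le_mul_of_one_le_right (by positivity) h1)
          (fun t => by
            rw [norm_sub_rev, mul_assoc]
            exact (H.lip_z i _ _ _ (by simpa using hf₁ z₂ ⟨q₂, h₂⟩ t)).trans
              (by gcongr; exact hX t))
          (hf₂ z₁ ⟨q₁, h₁⟩) (hf₂ z₂ ⟨q₂, h₂⟩) t
        calc _ ≤ _ := H.lip_b i _ (hmem z₁ q₁ h₁ t) _ (hmem z₂ q₂ h₂ t)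
          _ ≤ σz * (X * Real.cosh (γ * t)) +
              σv * (4 * (C * (K * X)) * Real.cosh (γ * t)) := by
              gcongr
              exact hX t
          _ = _ := by ring)
    exact ⟨z, f z, ⟨hf₁ z ⟨_, hz⟩, hz.deriv, hf₂ z ⟨_, hz⟩⟩, hz.init⟩
  choose z v h h0 using hor
  -- Invariance of the graph: the shifted orbit and the orbit chosen for the point `z t` have the
  -- same slow initial value.
  refine ⟨fun i z₀ => v i z₀ 0, fun i z₀ => ⟨z i z₀, v i z₀, h i z₀, h0 i z₀, fun t => ?_⟩⟩
  have := (H.orbit_unique hc ((h i z₀).shift t) (h i (z i z₀ t)) (by simp [h0]) 0).2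
  simpa using this

end SlowFastSystems

/-! ### The equation for the derivative of a section -/

section TangentSystem

variable {ι : Type} [PseudoMetricSpace ι]
variable {Z E : Type} [NormedAddCommGroup Z] [NormedSpace ℝ Z] [NormedAddCommGroup E]
  [NormedSpace ℝ E]

/-- The graph map `ζ ↦ (ζ, W ζ)`. -/
def graphL (W : Z →L[ℝ] E) : Z →L[ℝ] Z × E := (ContinuousLinearMap.id ℝ Z).prod W

@[simp] theorem graphL_apply (W : Z →L[ℝ] E) (ζ : Z) : graphL W ζ = (ζ, W ζ) := rfl

theorem norm_graphL_le (W : Z →L[ℝ] E) : ‖graphL W‖ ≤ 1 + ‖W‖ := by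
  refine ContinuousLinearMap.opNorm_le_bound _ (by positivity) fun ζ => ?_
  rw [graphL_apply, Prod.norm_def]
  refine max_le ?_ ?_
  · exact le_mul_of_one_le_left (norm_nonneg _) (le_add_of_nonneg_right (norm_nonneg _))
  · exact (W.le_opNorm ζ).trans (by gcongr; linarith)

/-- Right-hand side of the equation for the derivative of a section, in terms of the derivatives
of the right-hand sides of the system. -/
def tangentField (Dn : Z × E →L[ℝ] E) (Db : Z × E →L[ℝ] Z) (W : Z →L[ℝ] E) : Z →L[ℝ] E :=
  Dn.comp (graphL W) - W.comp (Db.comp (graphL W))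

theorem tangentField_apply (Dn : Z × E →L[ℝ] E) (Db : Z × E →L[ℝ] Z) (W : Z →L[ℝ] E) (ζ : Z) :
    tangentField Dn Db W ζ = Dn (ζ, W ζ) - W (Db (ζ, W ζ)) := rfl

theorem tangentField_sub_le {Dn Dn' : Z × E →L[ℝ] E} {Db Db' : Z × E →L[ℝ] Z} {W : Z →L[ℝ] E}
    {R δ : ℝ} (hW : ‖W‖ ≤ R) (hn : ‖Dn - Dn'‖ ≤ δ) (hb : ‖Db - Db'‖ ≤ δ) :
    ‖tangentField Dn Db W - tangentField Dn' Db' W‖ ≤ (1 + R) ^ 2 * δ := by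
  have hR : 0 ≤ R := (norm_nonneg _).trans hW
  have hδ : 0 ≤ δ := (norm_nonneg _).trans hn
  have hg : ‖graphL W‖ ≤ 1 + R := (norm_graphL_le W).trans (by linarith)
  have e : tangentField Dn Db W - tangentField Dn' Db' W =
      (Dn - Dn').comp (graphL W) - W.comp ((Db - Db').comp (graphL W)) := by
    simp only [tangentField, ContinuousLinearMap.sub_comp, ContinuousLinearMap.comp_sub]
    abel
  rw [e]
  have h1 : ‖(Dn - Dn').comp (graphL W)‖ ≤ δ * (1 + R) :=
    (ContinuousLinearMap.opNorm_comp_le _ _).trans (by gcongr)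
  have h2 : ‖W.comp ((Db - Db').comp (graphL W))‖ ≤ R * (δ * (1 + R)) :=
    (ContinuousLinearMap.opNorm_comp_le _ _).trans (mul_le_mul hW
      ((ContinuousLinearMap.opNorm_comp_le _ _).trans (by gcongr)) (norm_nonneg _) hR)
  refine (norm_sub_le _ _).trans ((add_le_add h1 h2).trans (le_of_eq ?_))
  ring

/-- The equation is of Riccati type, with the quadratic part `W Db(0, W ·)`. On the ball of radius
`R` its deviation from `A W` has a small Lipschitz constant: `κ` from the fast part, `σz + R σv`
from varying the outer `W` and `R σv` from varying the inner one. -/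
theorem tangentField_lip {Dn : Z × E →L[ℝ] E} {Db : Z × E →L[ℝ] Z} {A : E →L[ℝ] E}
    {κ σz σv R : ℝ} (hσz : 0 ≤ σz) (hσv : 0 ≤ σv) (hκ : 0 ≤ κ)
    (hn : ∀ w, ‖Dn (0, w) - A w‖ ≤ κ * ‖w‖)
    (hb : ∀ ζ w, ‖Db (ζ, w)‖ ≤ σz * ‖ζ‖ + σv * ‖w‖) {W W' : Z →L[ℝ] E} (hW : ‖W‖ ≤ R)
    (hW' : ‖W'‖ ≤ R) :
    ‖tangentField Dn Db W - tangentField Dn Db W' - A.comp (W - W')‖ ≤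
      (κ + σz + 2 * R * σv) * ‖W - W'‖ := by
  have hR : 0 ≤ R := (norm_nonneg _).trans hW
  refine ContinuousLinearMap.opNorm_le_bound _ (by positivity) fun ζ => ?_
  have e : (tangentField Dn Db W - tangentField Dn Db W' - A.comp (W - W')) ζ =
      (Dn (0, (W - W') ζ) - A ((W - W') ζ)) - (W - W') (Db (ζ, W ζ)) -
        W' (Db (0, (W - W') ζ)) := by
    simp only [sub_apply, tangentField_apply, ContinuousLinearMap.comp_apply]
    have e1 : Dn (0, W ζ - W' ζ) = Dn (ζ, W ζ) - Dn (ζ, W' ζ) := by rw [← map_sub]; simp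
    have e2 : Db (0, W ζ - W' ζ) = Db (ζ, W ζ) - Db (ζ, W' ζ) := by rw [← map_sub]; simp
    rw [e1, e2]
    simp only [map_sub]
    abel
  rw [e]
  have h1 := (W - W').le_opNorm ζ
  have h2 := hn ((W - W') ζ)
  have h3 := (W - W').le_opNorm (Db (ζ, W ζ))
  have h4 := hb ζ (W ζ)
  have h5 := W'.le_opNorm (Db (0, (W - W') ζ))
  have h6 := hb 0 ((W - W') ζ)
  have h7 := W.le_opNorm ζ
  rw [norm_zero, mul_zero, zero_add] at h6
  calc _ ≤ ‖Dn (0, (W - W') ζ) - A ((W - W') ζ)‖ + ‖(W - W') (Db (ζ, W ζ))‖ +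
        ‖W' (Db (0, (W - W') ζ))‖ := (norm_sub_le _ _).trans (by gcongr; exact norm_sub_le _ _)
    _ ≤ κ * (‖W - W'‖ * ‖ζ‖) + ‖W - W'‖ * (σz * ‖ζ‖ + σv * (R * ‖ζ‖)) +
        R * (σv * (‖W - W'‖ * ‖ζ‖)) := by
        gcongr
        · exact h2.trans (by gcongr)
        · exact h3.trans (by gcongr; exact h4.trans (by gcongr; exact h7.trans (by gcongr)))
        · exact h5.trans (by gcongr; exact h6.trans (by gcongr))
    _ = _ := by ring

variable {b : ι → Z × E → Z} {N : ι → Z × E → E} {A : ι → Z → E →L[ℝ] E} {S : Set Z}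
  {C ρ κ σz σv K ν c : ℝ}

theorem eventually_mem_tube {ρ : ℝ} {x : Z × E} (hx : x ∈ tube Z E ρ) (u : Z × E) :
    ∀ᶠ t in 𝓝 (0 : ℝ), x + t • u ∈ tube Z E ρ := by
  have : ContinuousAt (fun t : ℝ => x + t • u) 0 := by fun_prop
  refine this.eventually_mem ?_
  simpa using (isOpen_tube ρ).mem_nhds hx

theorem SlowFast.norm_db_le (H : SlowFast b N A S C ρ κ σz σv K ν c) {i : ι} {x : Z × E}
    (hx : x ∈ tube Z E ρ) {Db : Z × E →L[ℝ] Z} (hd : HasFDerivAt (b i) Db x) (ζ : Z) (w : E) :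
    ‖Db (ζ, w)‖ ≤ σz * ‖ζ‖ + σv * ‖w‖ := by
  have h1 := H.σz_nonneg
  have h2 := H.σv_nonneg
  have := norm_deriv_apply_sub_le (u := (ζ, w)) (a := 0) (c := σz * ‖ζ‖ + σv * ‖w‖) hd
    (by positivity) (by
      filter_upwards [eventually_mem_tube hx (ζ, w)] with t ht
      rw [smul_zero, sub_zero]
      refine (H.lip_b i _ ht _ hx).trans (le_of_eq ?_)
      simp only [Prod.fst_add, Prod.snd_add, Prod.smul_fst, Prod.smul_snd, add_sub_cancel_left,
        norm_smul, Real.norm_eq_abs]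
      ring)
  simpa using this

theorem SlowFast.norm_dn_slow_le (H : SlowFast b N A S C ρ κ σz σv K ν c) {i : ι} {x : Z × E}
    (hx : x ∈ tube Z E ρ) {Dn : Z × E →L[ℝ] E} (hd : HasFDerivAt (N i) Dn x) (ζ : Z) :
    ‖Dn (ζ, 0)‖ ≤ K * ‖ζ‖ := by
  have h1 := H.K_pos
  have := norm_deriv_apply_sub_le (u := (ζ, (0 : E))) (a := 0) (c := K * ‖ζ‖) hd
    (by positivity) (Eventually.of_forall fun t => by
      rw [smul_zero, sub_zero]
      have := H.lip_z i (x.1 + t • ζ) x.1 x.2 (by simpa using mem_tube.1 hx)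
      have e : x + t • (ζ, (0 : E)) = (x.1 + t • ζ, x.2) := by ext <;> simp
      rw [e]
      refine this.trans (le_of_eq ?_)
      rw [add_sub_cancel_left, norm_smul, Real.norm_eq_abs]
      ring)
  simpa using this

theorem SlowFast.norm_dn_fast_le (H : SlowFast b N A S C ρ κ σz σv K ν c) {i : ι} {x : Z × E}
    (hx : x ∈ tube Z E ρ) {Dn : Z × E →L[ℝ] E} (hd : HasFDerivAt (N i) Dn x) (w : E) :
    ‖Dn (0, w) - A i x.1 w‖ ≤ κ * ‖w‖ := by
  have h1 := H.κ_nonneg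
  refine norm_deriv_apply_sub_le (u := ((0 : Z), w)) (c := κ * ‖w‖) hd (by positivity) ?_
  filter_upwards [eventually_mem_tube hx ((0 : Z), w)] with t ht
  have := H.lip_v i x.1 (x.2 + t • w) (by simpa using mem_tube.1 ht) x.2
    (by simpa using mem_tube.1 hx)
  have e : x + t • ((0 : Z), w) = (x.1, x.2 + t • w) := by ext <;> simp
  rw [e]
  rw [add_sub_cancel_left, map_smul, norm_smul, Real.norm_eq_abs] at this
  refine this.trans (le_of_eq ?_)
  ring

/-- The slow field of the equation for the derivative of the section `V`. -/
def tangentSlow (b : ι → Z × E → Z) (V : ι → Z → E) (i : ι) (x : Z × (Z →L[ℝ] E)) : Z :=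
  b i (x.1, V i x.1)

/-- The fast field of the equation for the derivative of the section `V`. -/
def tangentFast (b' : ι → Z × E → Z × E →L[ℝ] Z) (N' : ι → Z × E → Z × E →L[ℝ] E)
    (V : ι → Z → E) (i : ι) (x : Z × (Z →L[ℝ] E)) : Z →L[ℝ] E :=
  tangentField (N' i (x.1, V i x.1)) (b' i (x.1, V i x.1)) x.2

variable {V : ι → Z → E} {b' : ι → Z × E → Z × E →L[ℝ] Z} {N' : ι → Z × E → Z × E →L[ℝ] E}

theorem IsSection.mem_tube (hV : IsSection b N ρ V) (i : ι) (z : Z) : (z, V i z) ∈ tube Z E ρ :=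
  LDS.mem_tube.2 (hV.mem i z)

theorem SlowFast.tangentFast_lip (H : SlowFast b N A S C ρ κ σz σv K ν c)
    (hV : IsSection b N ρ V)
    (hb' : ∀ i, ∀ x ∈ tube Z E ρ, HasFDerivAt (b i) (b' i x) x)
    (hN' : ∀ i, ∀ x ∈ tube Z E ρ, HasFDerivAt (N i) (N' i x) x) (i : ι) (z : Z)
    {W W' : Z →L[ℝ] E} (hW : ‖W‖ ≤ 4 * C * K) (hW' : ‖W'‖ ≤ 4 * C * K) :
    ‖tangentFast b' N' V i (z, W) - tangentFast b' N' V i (z, W') -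
      ContinuousLinearMap.compL ℝ Z E E (A i z) (W - W')‖ ≤
      (κ + σz + 2 * (4 * C * K) * σv) * ‖W - W'‖ :=
  tangentField_lip H.σz_nonneg H.σv_nonneg H.κ_nonneg
    (H.norm_dn_fast_le (hV.mem_tube i z) (hN' i _ (hV.mem_tube i z)))
    (H.norm_db_le (hV.mem_tube i z) (hb' i _ (hV.mem_tube i z))) hW hW'

theorem SlowFast.tangentFast_zero (H : SlowFast b N A S C ρ κ σz σv K ν c)
    (hV : IsSection b N ρ V)
    (hN' : ∀ i, ∀ x ∈ tube Z E ρ, HasFDerivAt (N i) (N' i x) x) (i : ι) (z : Z) :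
    ‖tangentFast b' N' V i (z, 0)‖ ≤ K := by
  refine ContinuousLinearMap.opNorm_le_bound _ H.K_pos.le fun ζ => ?_
  simp only [tangentFast, tangentField_apply, zero_apply, sub_zero]
  exact H.norm_dn_slow_le (hV.mem_tube i z) (hN' i _ (hV.mem_tube i z)) ζ

/-- The origin of the factor `10` lost with every derivative: `c + c + 8 c`, the last term from the
radius `4 C K` of the ball for `W`. -/
theorem SlowFast.tangent_small (H : SlowFast b N A S C ρ κ σz σv K ν c) :
    C * (κ + σz + 2 * (4 * C * K) * σv) ≤ 10 * c := by
  have := H.small_κ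
  have := H.small_σz
  have := H.small_σv
  nlinarith

set_option maxHeartbeats 3200000 in
/-- The derivative of a section is a section of the tangent system. -/
theorem SlowFast.section_deriv [CompleteSpace E]
    (H : SlowFast b N A S C ρ κ σz σv K ν c) (hc : c ≤ 1 / 80) (hV : IsSection b N ρ V)
    (hb' : ∀ i, ∀ x ∈ tube Z E ρ, HasFDerivAt (b i) (b' i x) x)
    (hN' : ∀ i, ∀ x ∈ tube Z E ρ, HasFDerivAt (N i) (N' i x) x)
    (hbC : UC (tube Z E ρ) 0 b') (hNC : UC (tube Z E ρ) 0 N') :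
    ∃ W : ι → Z → Z →L[ℝ] E,
      IsSection (tangentSlow b V) (tangentFast b' N' V) (4 * C * K) W ∧ UC univ 0 W ∧
      ∀ i z, HasFDerivAt (V i) (W i z) z := by
  have hC := H.C_pos
  have hK := H.K_pos
  have hκ := H.κ_nonneg
  have hσz := H.σz_nonneg
  have hσv := H.σv_nonneg
  set R := 4 * C * K with hR
  have hR0 : 0 < R := by positivity
  set κ' := κ + σz + 2 * R * σv with hκ'
  have hκ'0 : 0 ≤ κ' := by positivity
  have hCκ' : C * κ' ≤ 10 * c := H.tangent_small
  set γ := 1 / (4 * C) with hγ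
  have hγ0 : 0 < γ := H.rate_pos
  have hCγ : C * γ = 1 / 4 := by rw [hγ]; field_simp
  choose z v hor h0 hv using hV
  have hV : IsSection b N ρ V := fun i z₀ => ⟨z i z₀, v i z₀, hor i z₀, h0 i z₀, hv i z₀⟩
  have hzc : ∀ i z₀, Continuous (z i z₀) := fun i z₀ => continuous_of_hasDerivAt (hor i z₀).dz
  have hxc : ∀ i z₀, Continuous fun t => (z i z₀ t, V i (z i z₀ t)) := fun i z₀ => by
    have := (hor i z₀).continuous
    simpa only [hv] using this
  have hgc : Continuous fun W : Z →L[ℝ] E => graphL W := by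
    unfold graphL
    exact (ContinuousLinearMap.prodₗᵢ ℝ : (Z →L[ℝ] Z) × (Z →L[ℝ] E) ≃ₗᵢ[ℝ] _).continuous.comp
      (continuous_const.prodMk continuous_id)
  have htc : ∀ i z₀ (U : ℝ → Z →L[ℝ] E), Continuous U →
      Continuous fun t => tangentFast b' N' V i (z i z₀ t, U t) := by
    intro i z₀ U hU
    have h1 := hNC.2.ucont.continuous_comp i (hxc i z₀) (fun t => hV.mem_tube i _)
    have h2 := hbC.2.ucont.continuous_comp i (hxc i z₀) (fun t => hV.mem_tube i _)
    have h3 := hgc.comp hU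
    exact (h1.clm_comp h3).sub (hU.clm_comp (h2.clm_comp h3))
  have hdich : ∀ i z₀, IsDich (fun t => ContinuousLinearMap.compL ℝ Z E E (A i (z i z₀ t))) C :=
    fun i z₀ => (H.isDich (hor i z₀)).operator Z hC
  -- The candidate for the derivative along an orbit is the bounded solution of the formally
  -- differentiated equation. At `W = 0` the field is bounded by `K`, so `C K = R / 4` keeps the
  -- solution in the ball of radius `R / 2`.
  have hexW : ∀ i z₀, ∃ U : ℝ → Z →L[ℝ] E, (∀ t, ‖U t‖ < R) ∧
      ∀ t, HasDerivAt U (tangentFast b' N' V i (z i z₀ t, U t)) t := by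
    intro i z₀
    obtain ⟨U, h1, h2⟩ := (hdich i z₀).exists_nonlinear (ρ := R / 2) (κ := κ') (ν := K)
      (by positivity) hκ'0 (by linarith) (by rw [hR]; linarith)
      (N := fun t U => tangentFast b' N' V i (z i z₀ t, U)) (fun U hU _ => htc i z₀ U hU)
      (fun t U hU U' hU' => H.tangentFast_lip hV hb' hN' i _
        ((mem_closedBall_zero_iff.1 hU).trans (by linarith))
        ((mem_closedBall_zero_iff.1 hU').trans (by linarith)))
      (fun t => H.tangentFast_zero hV hN' i _)
    exact ⟨U, fun t => (h1 t).trans_lt (by linarith), h2⟩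
  choose U hUR hU using hexW
  have hUc : ∀ i z₀, Continuous (U i z₀) := fun i z₀ => continuous_of_hasDerivAt (hU i z₀)
  have hcompare : ∀ i z₀ (U' w : ℝ → Z →L[ℝ] E) (γ' D : ℝ), 0 ≤ γ' → C * γ' ≤ 1 / 2 →
      (∀ t, ‖U' t‖ ≤ R) → Continuous w → (∀ t, HasDerivAt U' (w t) t) →
      (∀ t, ‖w t - tangentFast b' N' V i (z i z₀ t, U' t)‖ ≤ D * Real.cosh (γ' * t)) →
      ∀ t, ‖U i z₀ t - U' t‖ ≤ 4 * (C * D) * Real.cosh (γ' * t) := by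
    intro i z₀ U' w γ' D hγ' hCγ' hU'R hw hU' hD t
    have hU'c := htc i z₀ U' (continuous_of_hasDerivAt hU')
    refine (hdich i z₀).compare hC hγ' hCγ' hκ'0 (by linarith)
      (N := fun t U => tangentFast b' N' V i (z i z₀ t, U)) (s := closedBall 0 R)
      (h := fun t => w t - tangentFast b' N' V i (z i z₀ t, U' t)) (B := 2 * R)
      (fun t X hX Y hY => H.tangentFast_lip hV hb' hN' i _ (mem_closedBall_zero_iff.1 hX)
        (mem_closedBall_zero_iff.1 hY))
      (fun t => mem_closedBall_zero_iff.2 (hUR i z₀ t).le)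
      (fun t => mem_closedBall_zero_iff.2 (hU'R t)) (htc i z₀ _ (hUc i z₀)) hU'c
      (hw.sub hU'c) hD (fun t => ?_) (hU i z₀) (fun t => (hU' t).congr_deriv (by abel)) t
    have h1 := one_le_cosh_mul γ' t
    calc _ ≤ 2 * R := (norm_sub_le _ _).trans (by linarith [hUR i z₀ t, hU'R t])
      _ ≤ _ := le_mul_of_one_le_right (by positivity) h1
  set W : ι → Z → Z →L[ℝ] E := fun i z₀ => U i z₀ 0 with hW
  have hflow : ∀ i z₀ s t, z i (z i z₀ s) t = z i z₀ (t + s) := fun i z₀ s t =>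
    (H.orbit_unique hc (hor i _) ((hor i z₀).shift s) (by simp [h0]) t).1
  -- Shifting the orbit shifts the candidate, again by uniqueness of bounded solutions; hence it
  -- depends only on the current slow value.
  have hUW : ∀ i z₀ s, U i z₀ s = W i (z i z₀ s) := by
    intro i z₀ s
    have hw : Continuous fun t => tangentFast b' N' V i (z i z₀ (t + s), U i z₀ (t + s)) :=
      (htc i z₀ _ (hUc i z₀)).comp (continuous_id.add continuous_const)
    have := hcompare i (z i z₀ s) (fun t => U i z₀ (t + s)) _ 0 0 le_rfl (by simp)
      (fun t => (hUR i z₀ _).le) hw (fun t => (hU i z₀ (t + s)).comp_add_const t s)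
      (fun t => by rw [hflow]; simp) 0
    simp only [zero_add, mul_zero, zero_mul] at this
    exact (sub_eq_zero.1 (norm_le_zero_iff.1 this)).symm
  refine ⟨W, fun i z₀ => ⟨z i z₀, U i z₀, ⟨hUR i z₀, fun t => ?_, hU i z₀⟩, h0 i z₀,
    hUW i z₀⟩, ⟨⟨R, fun i z₀ _ => (hUR i z₀ 0).le⟩, ?_⟩, fun i z₀ => ?_⟩
  · have := (hor i z₀).dz t
    rwa [hv] at this
  · -- joint uniform continuity
    intro η hη
    set P := 4 * C * (4 * C * σv + 1) with hP
    have hP0 : 0 < P := by positivity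
    set L := 2 * (1 + P) + 4 * C * (2 * K * (1 + P) + 1) with hL
    have hL0 : 0 < L := by positivity
    set T := 4 * (C * (1 + R) ^ 2) with hT
    have hT0 : 0 < T := by positivity
    -- The two orbits diverge like `L d cosh(γ t)`, so the coefficients of the two tangent equations
    -- differ by at most `η / (2 T) + Q L d cosh(γ t)`. The choice of `d` below makes `Q L d ≤ η /
    -- (2 T)`.
    obtain ⟨Q₁, hQ₁, e₁, he₁, M₁⟩ := UC.modulus hbC.1 hbC.2 (η / (2 * T)) (by positivity)
    obtain ⟨Q₂, hQ₂, e₂, he₂, M₂⟩ := UC.modulus hNC.1 hNC.2 (η / (2 * T)) (by positivity)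
    set Q := Q₁ + Q₂ with hQ
    set d := η / (2 * T * (Q * L + 1)) with hd
    have hd0 : 0 < d := by positivity
    obtain ⟨d₁, hd₁, H₁⟩ := H.b_ucont d hd0
    obtain ⟨d₂, hd₂, H₂⟩ := H.N_ucont d hd0
    refine ⟨min (min (min d₁ d₂) d) (min e₁ e₂), by positivity,
      fun i i' z₁ z₂ _ _ hi hz => ?_⟩
    have hi₁ : dist i i' < d₁ := hi.trans_le
      ((min_le_left _ _).trans ((min_le_left _ _).trans (min_le_left _ _)))
    have hi₂ : dist i i' < d₂ := hi.trans_le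
      ((min_le_left _ _).trans ((min_le_left _ _).trans (min_le_right _ _)))
    have hi₃ : dist i' i < e₁ := by
      rw [dist_comm]; exact hi.trans_le ((min_le_right _ _).trans (min_le_left _ _))
    have hi₄ : dist i' i < e₂ := by
      rw [dist_comm]; exact hi.trans_le ((min_le_right _ _).trans (min_le_right _ _))
    have hz' : ‖z₁ - z₂‖ ≤ d := by
      rw [← dist_eq_norm]
      exact (hz.trans_le ((min_le_left _ _).trans (min_le_right _ _))).le
    have hx : ∀ t, ‖(z i' z₂ t, V i' (z i' z₂ t)) - (z i z₁ t, V i (z i z₁ t))‖ ≤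
        L * d * Real.cosh (γ * t) := by
      intro t
      obtain ⟨a₁, a₂⟩ := H.compare_orbits hc (hor i z₁) (hor i' z₂) hd0.le
        (fun x hx => H₁ i i' x x hx hx hi₁ (by simpa using hd₁))
        (fun x hx => H₂ i i' x x hx hx hi₂ (by simpa using hd₂)) t
      rw [h0, h0] at a₁ a₂
      rw [hv, hv] at a₂
      rw [norm_sub_rev, Prod.norm_def]
      refine max_le (a₁.trans ?_) (a₂.trans ?_)
      · have : 2 * (‖z₁ - z₂‖ + P * d) ≤ L * d := by
          rw [hL]
          have h5 : 0 ≤ 4 * C * (2 * K * (1 + P) + 1) * d := by positivity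
          have h6 : 2 * (‖z₁ - z₂‖ + P * d) ≤ 2 * (d + P * d) := by gcongr
          refine h6.trans ?_
          rw [add_mul]
          refine le_trans (le_of_eq ?_) (le_add_of_nonneg_right h5)
          ring
        exact mul_le_mul_of_nonneg_right this (Real.cosh_pos _).le
      · have h3 : 4 * (C * (K * (2 * (‖z₁ - z₂‖ + P * d)) + d)) ≤
            4 * (C * (K * (2 * (d + P * d)) + d)) := by gcongr
        have h4 : 4 * (C * (K * (2 * (d + P * d)) + d)) ≤ L * d := by
          rw [hL]
          have h5 : 0 ≤ 2 * (1 + P) * d := by positivity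
          rw [add_mul]
          refine le_trans (le_of_eq ?_) (le_add_of_nonneg_left h5)
          ring
        exact mul_le_mul_of_nonneg_right (h3.trans h4) (Real.cosh_pos _).le
    have hQd : Q * (L * d) ≤ η / (2 * T) := by
      rw [hd, mul_div_assoc', mul_div_assoc', div_le_div_iff₀ (by positivity) (by positivity)]
      have : 0 ≤ η * (2 * T) := by positivity
      nlinarith
    have := hcompare i z₁ (U i' z₂) _ γ ((1 + R) ^ 2 * (η / T)) hγ0.le (by linarith)
      (fun t => (hUR i' z₂ t).le) (htc i' z₂ _ (hUc i' z₂)) (hU i' z₂) (fun t => by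
        have h1 := one_le_cosh_mul γ t
        have key : ∀ Q' ≤ Q, 0 ≤ Q' → η / (2 * T) + Q' *
            ‖(z i' z₂ t, V i' (z i' z₂ t)) - (z i z₁ t, V i (z i z₁ t))‖ ≤
            η / T * Real.cosh (γ * t) := by
          intro Q' hQ' hQ'0
          calc _ ≤ η / (2 * T) * Real.cosh (γ * t) + Q * (L * d * Real.cosh (γ * t)) := by
                gcongr
                · exact le_mul_of_one_le_right (by positivity) h1
                · exact hx t
            _ = (η / (2 * T) + Q * (L * d)) * Real.cosh (γ * t) := by ring
            _ ≤ (η / (2 * T) + η / (2 * T)) * Real.cosh (γ * t) := by gcongr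
            _ = _ := by
                congr 1
                field_simp
                norm_num
        refine (tangentField_sub_le (hUR i' z₂ t).le
          ((M₂ i' i hi₄ _ (hV.mem_tube i' _) _ (hV.mem_tube i _)).trans
            (key Q₂ (by linarith) hQ₂))
          ((M₁ i' i hi₃ _ (hV.mem_tube i' _) _ (hV.mem_tube i _)).trans
            (key Q₁ (by linarith) hQ₁))).trans (le_of_eq (by ring))) 0
    simp only [mul_zero, Real.cosh_zero, mul_one] at this
    refine this.trans (le_of_eq ?_)
    calc _ = T * (η / T) := by rw [hT]; ring
      _ = η := by field_simp
  · -- differentiability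
    rw [hasFDerivAt_iff_isLittleO, Asymptotics.isLittleO_iff]
    intro η hη
    set L := 2 + 8 * C * K with hL
    have hL0 : 0 < L := by positivity
    set T := 4 * (C * ((1 + R) * L)) with hT
    have hT0 : 0 < T := by positivity
    obtain ⟨Q₁, hQ₁, M₁⟩ := UC.remainder (convex_tube ρ) hb' hbC (η / (2 * T)) (by positivity)
    obtain ⟨Q₂, hQ₂, M₂⟩ := UC.remainder (convex_tube ρ) hN' hNC (η / (2 * T)) (by positivity)
    set Q := Q₁ + Q₂ with hQ
    set d := η / (2 * T * (Q * L + 1)) with hd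
    have hd0 : 0 < d := by positivity
    filter_upwards [ball_mem_nhds z₀ hd0] with z₁ hz₁
    rw [mem_ball, dist_eq_norm] at hz₁
    set m := ‖z₁ - z₀‖ with hm
    have hm0 : 0 ≤ m := norm_nonneg _
    set x₀ : ℝ → Z × E := fun t => (z i z₀ t, v i z₀ t) with hx₀
    set x₁ : ℝ → Z × E := fun t => (z i z₁ t, v i z₁ t) with hx₁
    have hmem₀ : ∀ t, x₀ t ∈ tube Z E ρ := (hor i z₀).mem_tube
    have hmem₁ : ∀ t, x₁ t ∈ tube Z E ρ := (hor i z₁).mem_tube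
    have hΔ : ∀ t, ‖x₁ t - x₀ t‖ ≤ L * m * Real.cosh (γ * t) := by
      intro t
      obtain ⟨a₁, a₂⟩ := H.compare_same hc (hor i z₁) (hor i z₀) t
      rw [h0, h0] at a₁ a₂
      rw [Prod.norm_def]
      refine max_le (a₁.trans ?_) (a₂.trans ?_)
      · have : 2 * m ≤ L * m := by rw [hL]; gcongr; linarith [show 0 < 8 * C * K by positivity]
        gcongr
      · have : 8 * C * K * m ≤ L * m := by rw [hL]; gcongr; linarith
        gcongr
    -- The error of the linear approximation, followed along both orbits. It solves `e' = A e + p +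
    -- r`, where `p` is linear in `e` with small coefficient and `r` collects the first-order
    -- remainders of the two fields; at time `0` it is the remainder to be estimated.
    set e : ℝ → E := fun t => v i z₁ t - v i z₀ t - U i z₀ t (z i z₁ t - z i z₀ t) with he
    set r : ℝ → E := fun t => (N i (x₁ t) - N i (x₀ t) - N' i (x₀ t) (x₁ t - x₀ t)) -
      U i z₀ t (b i (x₁ t) - b i (x₀ t) - b' i (x₀ t) (x₁ t - x₀ t)) with hr
    set D := (1 + R) * (η / T) * L * m with hD
    have hD0 : 0 ≤ D := by positivity
    have hcosh : ∀ t, Real.cosh (γ * t) ≤ Real.cosh (2 * γ * t) := fun t => by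
      have h1 := one_le_cosh_mul γ t
      have h2 := cosh_sq_le γ t
      nlinarith
    -- The remainders are partly quadratic in the distance of the orbits, hence the doubled rate. It
    -- is still admissible, because `C · 2 γ = 1 / 2`.
    have hrb : ∀ t, ‖r t‖ ≤ D * Real.cosh (2 * γ * t) := by
      intro t
      have hq : Q * (L * m) ≤ η / (2 * T) := by
        calc Q * (L * m) ≤ Q * (L * d) := by gcongr
          _ ≤ _ := by
            rw [hd, mul_div_assoc', mul_div_assoc',
              div_le_div_iff₀ (by positivity) (by positivity)]
            have : 0 ≤ η * (2 * T) := by positivity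
            nlinarith
      have key : ∀ Q' ≤ Q, 0 ≤ Q' → η / (2 * T) * ‖x₁ t - x₀ t‖ + Q' * ‖x₁ t - x₀ t‖ ^ 2 ≤
          η / T * L * m * Real.cosh (2 * γ * t) := by
        intro Q' hQ' hQ'0
        have c1 := one_le_cosh_mul γ t
        calc _ ≤ η / (2 * T) * (L * m * Real.cosh (γ * t)) +
              Q * (L * m * Real.cosh (γ * t)) ^ 2 := by
              gcongr
              · exact hΔ t
              · exact hΔ t
          _ = η / (2 * T) * (L * m * Real.cosh (γ * t)) +
              Q * (L * m) * (L * m * Real.cosh (γ * t) ^ 2) := by ring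
          _ ≤ η / (2 * T) * (L * m * Real.cosh (2 * γ * t)) +
              η / (2 * T) * (L * m * Real.cosh (2 * γ * t)) := by
              gcongr
              · exact hcosh t
              · exact cosh_sq_le γ t
          _ = _ := by
              field_simp
              ring
      have k₁ := (M₁ i _ (hmem₀ t) _ (hmem₁ t)).trans (key Q₁ (by linarith) hQ₁)
      have k₂ := (M₂ i _ (hmem₀ t) _ (hmem₁ t)).trans (key Q₂ (by linarith) hQ₂)
      have k₃ := ContinuousLinearMap.le_of_opNorm_le _ (hUR i z₀ t).le
        (b i (x₁ t) - b i (x₀ t) - b' i (x₀ t) (x₁ t - x₀ t))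
      calc ‖r t‖ ≤ η / T * L * m * Real.cosh (2 * γ * t) +
            R * (η / T * L * m * Real.cosh (2 * γ * t)) :=
            (norm_sub_le _ _).trans (add_le_add k₂ (k₃.trans (by gcongr)))
        _ = _ := by rw [hD]; ring
    set p : ℝ → E := fun t => (N' i (x₀ t) (0, e t) - A i (z i z₀ t) (e t)) -
      U i z₀ t (b' i (x₀ t) (0, e t)) with hp
    have hde : ∀ t, HasDerivAt e (A i (z i z₀ t) (e t) + (p t + r t)) t := by
      intro t
      have d1 := ((hor i z₁).dv t).sub ((hor i z₀).dv t)
      have d2 := (hU i z₀ t).clm_apply (((hor i z₁).dz t).sub ((hor i z₀).dz t))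
      refine (d1.sub d2).congr_deriv ?_
      simp only [hp, hr, he, tangentFast, tangentField_apply, ← hv]
      have e1 : ∀ {G : Type} [NormedAddCommGroup G] [NormedSpace ℝ G] (L : Z × E →L[ℝ] G),
          L (x₁ t - x₀ t) = L (z i z₁ t - z i z₀ t, U i z₀ t (z i z₁ t - z i z₀ t)) +
            L (0, v i z₁ t - v i z₀ t - U i z₀ t (z i z₁ t - z i z₀ t)) := by
        intro G _ _ L
        rw [← map_add]
        congr 1
        ext <;> simp [hx₁, hx₀]
      rw [e1, e1]
      simp only [map_sub, map_add, Pi.sub_apply, hx₁, hx₀]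
      abel
    have hec := continuous_of_hasDerivAt hde
    have hNc := hNC.2.ucont.continuous_comp i (hor i z₀).continuous (hor i z₀).mem_tube
    have hbc := hbC.2.ucont.continuous_comp i (hor i z₀).continuous (hor i z₀).mem_tube
    have hpc : Continuous p :=
      ((hNc.clm_apply (continuous_const.prodMk hec)).sub
        ((H.isDich (hor i z₀)).cont.clm_apply hec)).sub
        ((hUc i z₀).clm_apply (hbc.clm_apply (continuous_const.prodMk hec)))
    have hrc : Continuous r := by
      have f1 := H.N_ucont.continuous_comp i (hor i z₁).continuous (hor i z₁).mem_tube
      have f0 := H.N_ucont.continuous_comp i (hor i z₀).continuous (hor i z₀).mem_tube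
      have g1 := H.b_ucont.continuous_comp i (hor i z₁).continuous (hor i z₁).mem_tube
      have g0 := H.b_ucont.continuous_comp i (hor i z₀).continuous (hor i z₀).mem_tube
      have hx := (hor i z₁).continuous.sub (hor i z₀).continuous
      exact ((f1.sub f0).sub (hNc.clm_apply hx)).sub
        ((hUc i z₀).clm_apply ((g1.sub g0).sub (hbc.clm_apply hx)))
    have heb : ∀ t, ‖e t‖ ≤ (1 + R) * (L * m) * Real.cosh (2 * γ * t) := by
      intro t
      have a₁ : ‖v i z₁ t - v i z₀ t‖ ≤ L * m * Real.cosh (2 * γ * t) :=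
        (norm_snd_le (x₁ t - x₀ t)).trans ((hΔ t).trans (by gcongr ?_ * ?_; exact hcosh t))
      have a₂ : ‖z i z₁ t - z i z₀ t‖ ≤ L * m * Real.cosh (2 * γ * t) :=
        (norm_fst_le (x₁ t - x₀ t)).trans ((hΔ t).trans (by gcongr ?_ * ?_; exact hcosh t))
      have a₃ := ContinuousLinearMap.le_of_opNorm_le _ (hUR i z₀ t).le (z i z₁ t - z i z₀ t)
      calc _ ≤ L * m * Real.cosh (2 * γ * t) + R * (L * m * Real.cosh (2 * γ * t)) :=
            (norm_sub_le _ _).trans (add_le_add a₁ (a₃.trans (by gcongr)))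
        _ = _ := by ring
    have hpb : ∀ t, ‖p t‖ ≤ (κ + R * σv) * ‖e t‖ := by
      intro t
      have a₁ := H.norm_dn_fast_le (hmem₀ t) (hN' i _ (hmem₀ t)) (e t)
      have a₂ := H.norm_db_le (hmem₀ t) (hb' i _ (hmem₀ t)) 0 (e t)
      rw [norm_zero, mul_zero, zero_add] at a₂
      have a₃ := ContinuousLinearMap.le_of_opNorm_le _ (hUR i z₀ t).le (b' i (x₀ t) (0, e t))
      calc ‖p t‖ ≤ κ * ‖e t‖ + R * (σv * ‖e t‖) :=
            (norm_sub_le _ _).trans (add_le_add a₁ (a₃.trans (by gcongr)))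
        _ = _ := by ring
    have hsmall : C * (κ + R * σv) ≤ 10 * c := by
      refine le_trans ?_ hCκ'
      have h5 : 0 ≤ R * σv := by positivity
      rw [hκ']
      exact mul_le_mul_of_nonneg_left (by linarith) hC.le
    have hfin := le_of_forall_le_half (g := fun t => ‖e t‖)
      (w := fun t => Real.cosh (2 * γ * t)) (c := 2 * (C * D)) (fun t => Real.cosh_pos _)
      ⟨_, heb⟩ (fun X hX0 hX t => by
        have := (H.isDich (hor i z₀)).weighted hC (γ := 2 * γ) (B := X)
          (H := (κ + R * σv) * X + D) (by positivity) (by linarith) (hpc.add hrc)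
          (fun t => (norm_add_le _ _).trans (by
            rw [add_mul, mul_assoc]
            exact add_le_add ((hpb t).trans (by gcongr; exact hX t)) (hrb t))) hX hde t
        refine this.trans ?_
        have := Real.cosh_pos (2 * γ * t)
        gcongr
        nlinarith) (by positivity) 0
    simp only [mul_zero, Real.cosh_zero, mul_one] at hfin
    have e0 : e 0 = V i z₁ - V i z₀ - W i z₀ (z₁ - z₀) := by
      simp only [he, hv, h0, hW]
    rw [← e0]
    refine hfin.trans (le_of_eq ?_)
    calc _ = T * (η / T) * m := by rw [hD, hT]; ring
      _ = η * m := by field_simp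

end TangentSystem

/-! ### Higher derivatives of the section, by induction -/

section SectionSmoothness

variable {ι : Type} [PseudoMetricSpace ι]
variable {Z : Type} [NormedAddCommGroup Z] [NormedSpace ℝ Z]

theorem UCont.congr {E : Type} [NormedAddCommGroup E] {S : Set Z} {h g : ι → Z → E}
    (hh : UCont S h) (hg : ∀ i, ∀ z ∈ S, h i z = g i z) : UCont S g := fun η hη =>
  let ⟨d, hd, H⟩ := hh η hη
  ⟨d, hd, fun i i' z z' hz hz' h1 h2 => by
    rw [← hg i z hz, ← hg i' z' hz']
    exact H i i' z z' hz hz' h1 h2⟩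

theorem UG.congr {E : Type} [NormedAddCommGroup E] [NormedSpace ℝ E] {S : Set Z} (hS : IsOpen S)
    {n : ℕ} {h g : ι → Z → E} (hh : UG S n h) (hg : ∀ i, ∀ z ∈ S, h i z = g i z) : UG S n g := by
  cases n with
  | zero => exact UCont.congr hh hg
  | succ n =>
    obtain ⟨h1, h', h2, h3⟩ := hh
    refine ⟨h1.congr hg, h', fun i z hz => (h2 i z hz).congr_of_eventuallyEq ?_, h3⟩
    filter_upwards [hS.mem_nhds hz] with y hy using (hg i y hy).symm

theorem UC.congr {E : Type} [NormedAddCommGroup E] [NormedSpace ℝ E] {S : Set Z} (hS : IsOpen S)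
    {n : ℕ} {h g : ι → Z → E} (hh : UC S n h) (hg : ∀ i, ∀ z ∈ S, h i z = g i z) : UC S n g :=
  ⟨let ⟨C, hC⟩ := hh.1; ⟨C, fun i z hz => hg i z hz ▸ hC i z hz⟩, hh.2.congr hS hg⟩

theorem UC.graph_comp {E F : Type} [NormedAddCommGroup E] [NormedSpace ℝ E] [NormedAddCommGroup F]
    [NormedSpace ℝ F] {X : Type} [NormedAddCommGroup X] [NormedSpace ℝ X] {n : ℕ} {ρ : ℝ}
    {g : ι → Z × E → F} (hg : UC (tube Z E ρ) n g) {V : ι → Z → E} (hV : UC univ n V)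
    (hm : ∀ i z, ‖V i z‖ < ρ) (S : Set (Z × X)) :
    UC S n fun i x => g i (x.1, V i x.1) := by
  have h1 : UG S n fun (_ : ι) (x : Z × X) => x.1 := UG.linear (ContinuousLinearMap.fst ℝ Z X)
  exact hg.comp (h1.prodMk (hV.comp h1 fun _ _ _ => mem_univ _).2)
    fun i x _ => LDS.mem_tube.2 (hm i x.1)

theorem UC.tangentField {E : Type} [NormedAddCommGroup E] [NormedSpace ℝ E]
    {X : Type} [NormedAddCommGroup X] [NormedSpace ℝ X] {n : ℕ} {S : Set X}
    {dn : ι → X → Z × E →L[ℝ] E} {db : ι → X → Z × E →L[ℝ] Z} {w : ι → X → Z →L[ℝ] E}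
    (hn : UC S n dn) (hb : UC S n db) (hw : UC S n w) :
    UC S n fun i x => tangentField (dn i x) (db i x) (w i x) := by
  have hg : UC S n fun i x => graphL (w i x) := by
    have := (UC.const (ι := ι) (S := S) (n := n) (ContinuousLinearMap.inl ℝ Z E)).add
      (hw.clm (ContinuousLinearMap.compL ℝ Z E (Z × E) (ContinuousLinearMap.inr ℝ Z E)))
    have e : (fun i x => graphL (w i x)) = fun i x => ContinuousLinearMap.inl ℝ Z E +
        ContinuousLinearMap.compL ℝ Z E (Z × E) (ContinuousLinearMap.inr ℝ Z E) (w i x) := by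
      funext i x
      ext ζ <;> simp
    rwa [e]
  exact (UC.bilin (ContinuousLinearMap.compL ℝ Z (Z × E) E) hn hg).sub
    (UC.bilin (ContinuousLinearMap.compL ℝ Z Z E) hw
      (UC.bilin (ContinuousLinearMap.compL ℝ Z (Z × E) Z) hb hg))

/-- Sections of smooth systems are smooth, if the fast and slow rates are well separated. -/
theorem SlowFast.section_UC : ∀ (n : ℕ) {E : Type} [NormedAddCommGroup E] [NormedSpace ℝ E]
    [CompleteSpace E] {b : ι → Z × E → Z} {N : ι → Z × E → E} {A : ι → Z → E →L[ℝ] E} {S : Set Z}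
    {C ρ κ σz σv K ν : ℝ} {V : ι → Z → E},
    SlowFast b N A S C ρ κ σz σv K ν (1 / (80 * 10 ^ n)) → UC (tube Z E ρ) (n + 1) b →
    UC (tube Z E ρ) (n + 1) N → IsSection b N ρ V → UC univ (n + 1) V
  | 0, E, _, _, _, b, N, A, S, C, ρ, κ, σz, σv, K, ν, V, H, hb, hN, hV => by
    obtain ⟨b', hb', hbC⟩ := hb.exists_deriv
    obtain ⟨N', hN', hNC⟩ := hN.exists_deriv
    have hc : (1 : ℝ) / (80 * 10 ^ 0) ≤ 1 / 80 := by norm_num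
    obtain ⟨W, -, hW, hd⟩ := H.section_deriv hc hV hb' hN' hbC hNC
    exact UC.succ ⟨⟨ρ, fun i z _ => (hV.mem i z).le⟩, H.section_ucont hc hV⟩
      (fun i z _ => hd i z) hW
  | n + 1, E, _, _, _, b, N, A, S, C, ρ, κ, σz, σv, K, ν, V, H, hb, hN, hV => by
    have hpow : (1 : ℝ) ≤ 10 ^ n := one_le_pow₀ (by norm_num)
    have hc0 : (0 : ℝ) < 1 / (80 * 10 ^ (n + 1)) := by positivity
    have h10 : 10 * ((1 : ℝ) / (80 * 10 ^ (n + 1))) = 1 / (80 * 10 ^ n) := by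
      rw [pow_succ]
      field_simp
    have hle : (1 : ℝ) / (80 * 10 ^ (n + 1)) ≤ 1 / (80 * 10 ^ n) := by linarith
    have hc : (1 : ℝ) / (80 * 10 ^ (n + 1)) ≤ 1 / 80 :=
      hle.trans (one_div_le_one_div_of_le (by norm_num) (by linarith))
    -- The tangent system contains the section itself, so the section must already have one
    -- derivative less before its derivative can be treated as a section of a smooth system.
    have hVn := SlowFast.section_UC n (H.mono hle) (hb.of_le (Nat.le_succ _))
      (hN.of_le (Nat.le_succ _)) hV
    obtain ⟨b', hb', hbC⟩ := hb.exists_deriv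
    obtain ⟨N', hN', hNC⟩ := hN.exists_deriv
    obtain ⟨W, hWs, hW, hd⟩ := H.section_deriv hc hV hb' hN' (hbC.of_le (Nat.zero_le _))
      (hNC.of_le (Nat.zero_le _))
    have hC := H.C_pos
    have hK := H.K_pos
    have hσz := H.σz_nonneg
    have hσv := H.σv_nonneg
    have hκ := H.κ_nonneg
    have hmem := hV.mem
    have hslow : UC (tube Z (Z →L[ℝ] E) (4 * C * K)) (n + 1) (tangentSlow b V) :=
      (hb.of_le (Nat.le_succ _)).graph_comp hVn hmem _
    have hfast : UC (tube Z (Z →L[ℝ] E) (4 * C * K)) (n + 1) (tangentFast b' N' V) :=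
      (hNC.graph_comp hVn hmem _).tangentField (hbC.graph_comp hVn hmem _)
        (UC.linear (ContinuousLinearMap.snd ℝ Z (Z →L[ℝ] E))
          ⟨4 * C * K, fun x hx => (LDS.mem_tube.1 hx).le⟩)
    obtain ⟨K', hK'0, hK'⟩ := hfast.2.exists_lipschitz (convex_tube _)
    refine UC.succ (hVn.of_le (Nat.zero_le _)) (fun i z _ => hd i z)
      -- In the tangent system the slow field does not involve `W`, so its `σv` is `0`. The slope of
      -- the fast field in the slow variable, for which no smallness is known, is therefore
      -- harmless. The dichotomy constant `C` is unchanged.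
      (SlowFast.section_UC n (S := S) (C := C) (κ := κ + σz + 2 * (4 * C * K) * σv)
        (σz := σz + σv * (8 * C * K)) (σv := 0) (K := K' + 1) (ν := K)
        (A := fun i z => ContinuousLinearMap.compL ℝ Z E E (A i z)) ?_ hslow hfast hWs)
    exact {
      C_pos := hC
      ρ_pos := by positivity
      κ_nonneg := by positivity
      σz_nonneg := by positivity
      σv_nonneg := le_rfl
      K_pos := by positivity
      closed := H.closed
      b_mem := fun i x _ => H.b_mem i _ (hV.mem_tube i x.1)
      b_bdd := hslow.1
      b_ucont := hslow.2.ucont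
      N_ucont := hfast.2.ucont
      dich := fun i z q hq hqS hz => (H.dich i z q hq hqS hz).operator Z hC
      lip_b := fun i x _ y _ => by
        refine (H.lip_b i _ (hV.mem_tube i x.1) _ (hV.mem_tube i y.1)).trans ?_
        rw [zero_mul, add_zero, add_mul, mul_assoc σv]
        gcongr
        exact H.section_lipschitz hc hV i _ _
      lip_z := fun i z z' v hv => by
        have hv' := mem_ball_zero_iff.1 hv
        refine (hK' i (z', v) (LDS.mem_tube.2 hv') (z, v) (LDS.mem_tube.2 hv')).trans ?_
        have : ‖((z, v) : Z × (Z →L[ℝ] E)) - (z', v)‖ = ‖z - z'‖ := by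
          simp [Prod.norm_def]
        rw [this]
        gcongr
        linarith
      lip_v := fun i z v hv v' hv' => H.tangentFast_lip hV hb' hN' i z
        (mem_ball_zero_iff.1 hv).le (mem_ball_zero_iff.1 hv').le
      zero := fun i z => H.tangentFast_zero hV hN' i z
      small_κ := H.tangent_small.trans h10.le
      small_σz := by
        have h1 := H.small_σz
        have h2 := H.small_σv
        have h3 : C * (σz + σv * (8 * C * K)) = C * σz + 8 * (C * (C * (σv * K))) := by ring
        rw [h3]
        linarith
      small_σv := by
        rw [zero_mul, mul_zero, mul_zero]
        positivity
      small_ν := le_of_eq (by ring) }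

end SectionSmoothness

/-! ### Continuous dependence and limits of solutions -/

section LimitsOfSolutions

variable {X : Type} [NormedAddCommGroup X] [NormedSpace ℝ X]

theorem dist_le_of_solutions_of_le {B : ℝ → X → X} {K : ℝ} (hK : 0 ≤ K)
    (hLip : ∀ t x y, ‖B t x - B t y‖ ≤ K * ‖x - y‖) {u w : ℝ → X} {a b : ℝ} (hab : a ≤ b)
    (hu : ∀ t ∈ Icc a b, HasDerivAt u (B t (u t)) t)
    (hw : ∀ t ∈ Icc a b, HasDerivAt w (B t (w t)) t) :
    ‖u b - w b‖ ≤ ‖u a - w a‖ * Real.exp (K * (b - a)) := by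
  have hL : ∀ t, LipschitzWith ⟨K, hK⟩ (B t) := fun t => LipschitzWith.of_dist_le_mul fun x y => by
    rw [dist_eq_norm, dist_eq_norm]
    exact hLip t x y
  have := dist_le_of_trajectories_ODE (δ := ‖u a - w a‖) hL
    (fun t ht => (hu t ht).continuousAt.continuousWithinAt)
    (fun t ht => (hu t (Ico_subset_Icc_self ht)).hasDerivWithinAt)
    (fun t ht => (hw t ht).continuousAt.continuousWithinAt)
    (fun t ht => (hw t (Ico_subset_Icc_self ht)).hasDerivWithinAt) (dist_eq_norm _ _).le b
    (right_mem_Icc.2 hab)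
  rwa [dist_eq_norm] at this

theorem dist_le_of_solutions {B : ℝ → X → X} {K : ℝ} (hK : 0 ≤ K)
    (hLip : ∀ t x y, ‖B t x - B t y‖ ≤ K * ‖x - y‖) {u w : ℝ → X} {a b : ℝ}
    (hu : ∀ t ∈ uIcc a b, HasDerivAt u (B t (u t)) t)
    (hw : ∀ t ∈ uIcc a b, HasDerivAt w (B t (w t)) t) :
    ‖u b - w b‖ ≤ ‖u a - w a‖ * Real.exp (K * |b - a|) := by
  rcases le_total a b with hab | hab
  · rw [uIcc_of_le hab] at hu hw
    rw [abs_of_nonneg (sub_nonneg.2 hab)]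
    exact dist_le_of_solutions_of_le hK hLip hab hu hw
  · rw [uIcc_of_ge hab] at hu hw
    have hrev : ∀ {v : ℝ → X}, (∀ t ∈ Icc b a, HasDerivAt v (B t (v t)) t) →
        ∀ t ∈ Icc (-a) (-b), HasDerivAt (fun s => v (-s)) (-B (-t) (v (-t))) t := by
      intro v hv t ht
      have := (hv (-t) ⟨by linarith [ht.2], by linarith [ht.1]⟩).scomp t (hasDerivAt_neg t)
      simpa [Function.comp_def] using this
    have := dist_le_of_solutions_of_le (B := fun t x => -B (-t) x) hK
      (fun t x y => by rw [neg_sub_neg, norm_sub_rev]; exact hLip _ _ _) (neg_le_neg hab)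
      (hrev hu) (hrev hw)
    simp only [neg_neg] at this
    rw [abs_of_nonpos (sub_nonpos.2 hab)]
    refine this.trans (le_of_eq ?_)
    ring_nf

/-- A sequence of solutions on growing time intervals with bounded initial values subconverges to a
solution on the whole time axis. -/
theorem exists_limit_solution [ProperSpace X] [CompleteSpace X] {B : ℝ → X → X}
    (hB : Continuous fun p : ℝ × X => B p.1 p.2) {K B₀ R : ℝ} (hK : 0 ≤ K)
    (hLip : ∀ t x y, ‖B t x - B t y‖ ≤ K * ‖x - y‖) (hB₀ : ∀ t, ‖B t 0‖ ≤ B₀) {z : ℕ → ℝ → X}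
    (hz : ∀ (N : ℕ) (t : ℝ), |t| ≤ N → HasDerivAt (z N) (B t (z N t)) t) (hR : ∀ N, ‖z N 0‖ ≤ R) :
    ∃ (w : ℝ → X) (φ : ℕ → ℕ), StrictMono φ ∧ (∀ t, HasDerivAt w (B t (w t)) t) ∧
      ∀ t, Tendsto (fun j => z (φ j) t) atTop (𝓝 (w t)) := by
  -- Compactness is used for the initial values only; Gronwall's inequality carries the convergence
  -- to every time.
  obtain ⟨x, -, φ, hφ, hx⟩ := (isCompact_closedBall (0 : X) R).tendsto_subseq
    (x := fun N => z N 0) fun N => mem_closedBall_zero_iff.2 (hR N)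
  obtain ⟨w, hw0, hw⟩ := exists_global_solution B hB hK hLip hB₀ x
  refine ⟨w, φ, hφ, hw, fun t => ?_⟩
  rw [tendsto_iff_norm_sub_tendsto_zero] at hx ⊢
  have h1 := hx.mul_const (Real.exp (K * |t - 0|))
  rw [zero_mul] at h1
  refine squeeze_zero' (Eventually.of_forall fun _ => norm_nonneg _) ?_ h1
  obtain ⟨N, hN⟩ := exists_nat_ge |t|
  filter_upwards [eventually_ge_atTop N] with j hj
  have hj' : |t| ≤ (φ j : ℝ) := hN.trans (by exact_mod_cast hj.trans (hφ.id_le j))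
  have := dist_le_of_solutions hK hLip (u := z (φ j)) (w := w) (a := 0) (b := t)
    (fun s hs => hz _ s ((?_ : |s| ≤ |t|).trans hj')) (fun s _ => hw s)
  · simpa [hw0] using this
  · have := abs_sub_left_of_mem_uIcc hs
    simpa using this

end LimitsOfSolutions

/-! ### Dichotomy of the normal equation along one orbit -/

section OrbitDichotomy

variable {E : Type} [NormedAddCommGroup E] [InnerProductSpace ℝ E] [FiniteDimensional ℝ E]

/-- The operator `v ↦ A(t) v - ⟨ys, v⟩ u`. -/
def normalOp (A : ℝ → E →L[ℝ] E) (ys u : ℝ → E) (t : ℝ) : E →L[ℝ] E :=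
  A t - (innerSL ℝ (ys t)).smulRight (u t)

theorem normalOp_apply (A : ℝ → E →L[ℝ] E) (ys u : ℝ → E) (t : ℝ) (v : E) :
    normalOp A ys u t v = A t v - inner ℝ (ys t) v • u t := by
  simp [normalOp]

theorem inner_adjoint_const {A : ℝ → E →L[ℝ] E} {ys w : ℝ → E}
    (hys : ∀ t, HasDerivAt ys (-(ContinuousLinearMap.adjoint (A t) (ys t))) t)
    (hw : ∀ t, HasDerivAt w (A t (w t)) t) (s t : ℝ) :
    inner ℝ (ys s) (w s) = inner ℝ (ys t) (w t) := by
  have hd : ∀ t, HasDerivAt (fun t => inner ℝ (ys t) (w t)) 0 t := fun t => by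
    refine ((hys t).inner ℝ (hw t)).congr_deriv ?_
    rw [inner_neg_left, ContinuousLinearMap.adjoint_inner_left]
    ring
  exact is_const_of_deriv_eq_zero (fun t => (hd t).differentiableAt) (fun t => (hd t).deriv) s t

/-- The pairing with the bounded adjoint solution is constant in time and tends to zero. Hence
decaying solutions of `v' = A v` also solve the equation with the term `⟨ys, v⟩ u` subtracted. -/
theorem inner_adjoint_eq_zero {A : ℝ → E →L[ℝ] E} {ys w : ℝ → E} {C : ℝ}
    (hys : ∀ t, HasDerivAt ys (-(ContinuousLinearMap.adjoint (A t) (ys t))) t)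
    (hw : ∀ t, HasDerivAt w (A t (w t)) t) (hC : ∀ t, ‖ys t‖ ≤ C) {l : Filter ℝ} [l.NeBot]
    (hl : Tendsto w l (𝓝 0)) (t : ℝ) : inner ℝ (ys t) (w t) = 0 := by
  have h1 : Tendsto (fun s => C * ‖w s‖) l (𝓝 0) := by
    simpa using hl.norm.const_mul C
  have h2 : |inner ℝ (ys t) (w t)| ≤ 0 := by
    refine ge_of_tendsto' h1 fun s => ?_
    rw [inner_adjoint_const hys hw t s]
    exact (abs_real_inner_le_norm _ _).trans (by gcongr; exact hC s)
  exact abs_nonpos_iff.1 h2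

/-- Every vector is, at every time, a sum of values of a solution of `v' = A(t) v` that decays in
positive time, of one that decays in negative time, and of a multiple of `u`. -/
def HasSplitting (A : ℝ → E →L[ℝ] E) (u : ℝ → E) : Prop :=
  ∀ T x, ∃ ws wu : ℝ → E, ∃ c : ℝ, x = ws T + wu T + c • u T ∧
    (∀ t, HasDerivAt ws (A t (ws t)) t) ∧ (∀ t, HasDerivAt wu (A t (wu t)) t) ∧
    Tendsto ws atTop (𝓝 0) ∧ Tendsto wu atBot (𝓝 0)

/-- The estimate is assumed, so the point is existence. For compactly supported `h`, a solution
vanishing before the support is corrected by the backward decaying component of its value after the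
support; what remains there is forward decaying plus a multiple of `u`. A general `h` is cut off,
and the uniform estimate allows a limit. -/
theorem isDich_normalOp {A : ℝ → E →L[ℝ] E} {ys u : ℝ → E} {C Cs K U : ℝ} (hA : Continuous A)
    (hK : ∀ t, ‖A t‖ ≤ K)
    (hys : ∀ t, HasDerivAt ys (-(ContinuousLinearMap.adjoint (A t) (ys t))) t)
    (hu : ∀ t, HasDerivAt u (A t (u t)) t) (hn : ∀ t, inner ℝ (ys t) (u t) = (1 : ℝ))
    (hCs : ∀ t, ‖ys t‖ ≤ Cs) (hU : ∀ t, ‖u t‖ ≤ U)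
    (hsplit : HasSplitting A u)
    (hest : ∀ (h v : ℝ → E) (M : ℝ), Continuous h → (∀ t, ‖h t‖ ≤ M) → (∃ B, ∀ t, ‖v t‖ ≤ B) →
      (∀ t, HasDerivAt v (A t (v t) - inner ℝ (ys t) (v t) • u t + h t) t) →
      ∀ t, ‖v t‖ ≤ C * M) :
    IsDich (normalOp A ys u) C := by
  have hysc := continuous_of_hasDerivAt hys
  have huc := continuous_of_hasDerivAt hu
  have hcont : Continuous (normalOp A ys u) := by
    unfold normalOp
    have : Continuous fun t => (innerSL ℝ (ys t)).smulRight (u t) :=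
      (ContinuousLinearMap.smulRightL ℝ E E).isBoundedBilinearMap.continuous.comp
        (((innerSL ℝ).continuous.comp hysc).prodMk huc)
    exact hA.sub this
  have hCs0 : 0 ≤ Cs := (norm_nonneg _).trans (hCs 0)
  have hU0 : 0 ≤ U := (norm_nonneg _).trans (hU 0)
  have hK0 : 0 ≤ K := (norm_nonneg _).trans (hK 0)
  have hbdd : ∀ t, ‖normalOp A ys u t‖ ≤ K + Cs * U := fun t => by
    refine (norm_sub_le _ _).trans (add_le_add (hK t) ?_)
    rw [ContinuousLinearMap.norm_smulRight_apply, innerSL_apply_norm]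
    exact mul_le_mul (hCs t) (hU t) (norm_nonneg _) hCs0
  have hest' : ∀ (h v : ℝ → E) (M : ℝ), Continuous h → (∀ t, ‖h t‖ ≤ M) →
      (∃ B, ∀ t, ‖v t‖ ≤ B) → (∀ t, HasDerivAt v (normalOp A ys u t (v t) + h t) t) →
      ∀ t, ‖v t‖ ≤ C * M := fun h v M hh hM hB hv =>
    hest h v M hh hM hB fun t => (hv t).congr_deriv (by rw [normalOp_apply])
  have hlip : ∀ (h : ℝ → E) t x y, ‖normalOp A ys u t x + h t - (normalOp A ys u t y + h t)‖ ≤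
      (K + Cs * U) * ‖x - y‖ := fun h t x y => by
    rw [add_sub_add_right_eq_sub, ← map_sub]
    exact ContinuousLinearMap.le_of_opNorm_le _ (hbdd t) _
  have hKU : 0 ≤ K + Cs * U := by positivity
  have hfc : ∀ {h : ℝ → E}, Continuous h →
      Continuous fun p : ℝ × E => normalOp A ys u p.1 p.2 + h p.1 := fun hh =>
    ((hcont.comp continuous_fst).clm_apply continuous_snd).add (hh.comp continuous_fst)
  have hcompact : ∀ (h : ℝ → E) (M T : ℝ), Continuous h → (∀ t, ‖h t‖ ≤ M) → 0 ≤ T →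
      (∀ t, T ≤ |t| → h t = 0) →
      ∃ v : ℝ → E, (∃ B, ∀ t, ‖v t‖ ≤ B) ∧ ∀ t, HasDerivAt v (normalOp A ys u t (v t) + h t) t := by
    intro h M T hh hM hT0 hT
    obtain ⟨v', hv'0, hv'⟩ := exists_global_solution
      (fun t x => normalOp A ys u (t - T) x + h (t - T))
      ((hfc hh).comp ((continuous_fst.sub continuous_const).prodMk continuous_snd)) hKU
      (fun t => hlip h (t - T)) (fun t => by simpa using hM (t - T)) 0
    set v : ℝ → E := fun t => v' (t + T) with hvdef
    have hv0 : v (-T) = 0 := by simpa [hvdef] using hv'0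
    have hv : ∀ t, HasDerivAt v (normalOp A ys u t (v t) + h t) t := fun t => by
      have := (hv' (t + T)).comp_add_const t T
      simpa using this
    have hleft : ∀ t ≤ -T, v t = 0 := by
      intro t ht
      have := dist_le_of_solutions hKU (hlip h) (u := v) (w := fun _ => 0) (a := -T) (b := t)
        (fun s _ => hv s) (fun s hs => by
          rw [uIcc_of_ge ht] at hs
          rw [hT s (by rw [abs_of_nonpos (by linarith [hs.2])]; linarith [hs.2]), map_zero,
            add_zero]
          exact hasDerivAt_const _ _)
      rw [hv0] at this
      simpa using this
    obtain ⟨ws, wu, c, hx, hws, hwu, hls, hlu⟩ := hsplit T (v T)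
    have hi : ∀ {w : ℝ → E} {l : Filter ℝ} [l.NeBot], (∀ t, HasDerivAt w (A t (w t)) t) →
        Tendsto w l (𝓝 0) → ∀ t, HasDerivAt w (normalOp A ys u t (w t)) t := fun hw hl t => by
      rw [normalOp_apply, inner_adjoint_eq_zero hys hw hCs hl t, zero_smul, sub_zero]
      exact hw t
    have hws' := hi hws hls
    have hwu' := hi hwu hlu
    -- Since `⟨ys, u⟩ = 1`, the modified equation turns the neutral solution `u` into `exp(-t) u`.
    have hright : ∀ t, T ≤ t → v t - wu t = ws t + (c * Real.exp (T - t)) • u t := by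
      intro t ht
      have h1 : ∀ s, HasDerivAt (fun s => ws s + (c * Real.exp (T - s)) • u s)
          (normalOp A ys u s (ws s + (c * Real.exp (T - s)) • u s)) s := fun s => by
        have e1 : HasDerivAt (fun s => c * Real.exp (T - s)) (-(c * Real.exp (T - s))) s := by
          have := (((hasDerivAt_id s).const_sub T).exp).const_mul c
          simpa using this
        refine ((hws' s).add (e1.smul (hu s))).congr_deriv ?_
        rw [map_add, map_smul, normalOp_apply A ys u s (u s), hn]
        simp only [one_smul, smul_sub, neg_smul]
        abel
      have := dist_le_of_solutions hKU (hlip fun _ => 0) (u := fun s => v s - wu s)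
        (w := fun s => ws s + (c * Real.exp (T - s)) • u s) (a := T) (b := t)
        (fun s hs => by
          rw [uIcc_of_le ht] at hs
          have h2 := (hv s).sub (hwu' s)
          rw [hT s (le_abs.2 (Or.inl hs.1))] at h2
          refine h2.congr_deriv ?_
          simp) (fun s _ => by simpa using h1 s)
      have h0 : v T - wu T - (ws T + (c * Real.exp (T - T)) • u T) = 0 := by
        rw [hx, sub_self, Real.exp_zero, mul_one]
        abel
      rw [h0, norm_zero, zero_mul] at this
      exact sub_eq_zero.1 (norm_le_zero_iff.1 this)
    refine ⟨fun t => v t - wu t, ?_, fun t => ((hv t).sub (hwu' t)).congr_deriv ?_⟩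
    · have hc : Continuous fun t => v t - wu t :=
        (continuous_of_hasDerivAt hv).sub (continuous_of_hasDerivAt hwu)
      obtain ⟨B₁, hB₁⟩ := (hls.norm.isBoundedUnder_le).eventually_le
      obtain ⟨T₁, hT₁⟩ := eventually_atTop.1 hB₁
      obtain ⟨B₂, hB₂⟩ := (hlu.norm.isBoundedUnder_le).eventually_le
      obtain ⟨T₂, hT₂⟩ := eventually_atBot.1 hB₂
      obtain ⟨B₃, hB₃⟩ := (isCompact_Icc (a := min T₂ (-T)) (b := max T₁ T)).exists_bound_of_continuousOn
        hc.continuousOn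
      refine ⟨max (B₁ + |c| * U) (max B₂ B₃), fun t => ?_⟩
      by_cases h1 : max T₁ T ≤ t
      · refine le_max_of_le_left ?_
        change ‖v t - wu t‖ ≤ _
        rw [hright t ((le_max_right _ _).trans h1)]
        refine (norm_add_le _ _).trans (add_le_add (hT₁ t ((le_max_left _ _).trans h1)) ?_)
        rw [norm_smul, Real.norm_eq_abs, abs_mul, Real.abs_exp]
        have : Real.exp (T - t) ≤ 1 := Real.exp_le_one_iff.2 (by linarith [le_max_right T₁ T])
        refine mul_le_mul ?_ (hU t) (norm_nonneg _) (abs_nonneg _)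
        exact mul_le_of_le_one_right (abs_nonneg _) this
      · refine le_max_of_le_right ?_
        by_cases h2 : t ≤ min T₂ (-T)
        · refine le_max_of_le_left ?_
          change ‖v t - wu t‖ ≤ _
          rw [hleft t (h2.trans (min_le_right _ _)), zero_sub, norm_neg]
          exact hT₂ t (h2.trans (min_le_left _ _))
        · push Not at h1 h2
          exact le_max_of_le_right (hB₃ t ⟨h2.le, h1.le⟩)
    · rw [map_sub]
      abel
  refine ⟨hcont, ⟨_, hbdd⟩, hest', fun h M hh hM => ?_⟩
  have hM0 : 0 ≤ M := (norm_nonneg _).trans (hM 0)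
  have hcut : ∀ N : ℕ, ∃ χ : ℝ → ℝ, Continuous χ ∧ (∀ t, |χ t| ≤ 1) ∧ (∀ t : ℝ, |t| ≤ N → χ t = 1) ∧
      ∀ t, (N : ℝ) + 1 ≤ |t| → χ t = 0 := fun N => by
    refine ⟨fun t => max 0 (min 1 (N + 1 - |t|)), by fun_prop, fun t => ?_, fun t ht => ?_,
      fun t ht => ?_⟩
    · rw [abs_of_nonneg (le_max_left _ _)]
      exact max_le zero_le_one (min_le_left _ _)
    · beta_reduce
      rw [min_eq_left (by linarith), max_eq_right zero_le_one]
    · beta_reduce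
      rw [max_eq_left ((min_le_right _ _).trans (by linarith))]
  choose χ hχc hχ1 hχin hχout using hcut
  have hχM : ∀ N t, ‖χ N t • h t‖ ≤ M := fun N t => by
    rw [norm_smul, Real.norm_eq_abs]
    exact (mul_le_of_le_one_left (norm_nonneg _) (hχ1 N t)).trans (hM t)
  choose v hvB hv using fun N : ℕ => hcompact (fun t => χ N t • h t) M (N + 1)
    ((hχc N).smul hh) (hχM N) (by positivity) (fun t ht => by rw [hχout N t ht, zero_smul])
  have hvM : ∀ N t, ‖v N t‖ ≤ C * M := fun N =>
    hest' _ _ _ ((hχc N).smul hh) (hχM N) (hvB N) (hv N)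
  -- The solution for the `N`-th cut-off solves the true equation on `|t| ≤ N`, and all are bounded
  -- by `C * M`.
  obtain ⟨w, φ, -, hw, hlim⟩ := exists_limit_solution
    (B := fun t x => normalOp A ys u t x + h t) (hfc hh) hKU (hlip h) (B₀ := M)
    (fun t => by simpa using hM t) (z := v)
    (fun N t ht => by have := hv N t; rwa [hχin N t ht, one_smul] at this) (fun N => hvM N 0)
  exact ⟨w, ⟨C * M, fun t => le_of_tendsto' (hlim t).norm fun j => hvM _ t⟩, hw⟩

end OrbitDichotomy

/-! ### Rescaling: from a core system with coupling to a slow-fast system -/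

section ScaledSystems

variable {ι : Type} [PseudoMetricSpace ι]

theorem UCont.of_lipschitz {X F : Type} [PseudoMetricSpace X] [SeminormedAddCommGroup F]
    {S : Set X} {h : X → F} {K : ℝ} (hK : ∀ x ∈ S, ∀ y ∈ S, ‖h x - h y‖ ≤ K * dist x y) :
    UCont S fun (_ : ι) x => h x := by
  intro η hη
  refine ⟨η / (|K| + 1), by positivity, fun i i' x y hx hy _ hxy => (hK x hx y hy).trans ?_⟩
  calc K * dist x y ≤ (|K| + 1) * (η / (|K| + 1)) :=
        mul_le_mul ((le_abs_self K).trans (by linarith)) hxy.le dist_nonneg (by positivity)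
    _ = η := by field_simp

theorem UC.sin_cos (n : ℕ) : UC univ n (fun (_ : ι) => Real.sin) ∧
    UC univ n (fun (_ : ι) => Real.cos) := by
  have hs : UC univ 0 (fun (_ : ι) => Real.sin) :=
    ⟨⟨1, fun _ x _ => Real.abs_sin_le_one x⟩, UCont.of_lipschitz (K := 1) fun x _ y _ => by
      simpa [dist_eq_norm] using Real.lipschitzWith_sin.dist_le_mul x y⟩
  have hc : UC univ 0 (fun (_ : ι) => Real.cos) :=
    ⟨⟨1, fun _ x _ => Real.abs_cos_le_one x⟩, UCont.of_lipschitz (K := 1) fun x _ y _ => by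
      simpa [dist_eq_norm] using Real.lipschitzWith_cos.dist_le_mul x y⟩
  induction n with
  | zero => exact ⟨hs, hc⟩
  | succ n ih =>
    refine ⟨⟨hs.1, UG.succ_of_hasDerivAt hs.2 (fun _ t _ => Real.hasDerivAt_sin t) ih.2⟩,
      ⟨hc.1, UG.succ_of_hasDerivAt hc.2 (fun _ t _ => Real.hasDerivAt_cos t) ?_⟩⟩
    simpa using ih.1.clm (-ContinuousLinearMap.id ℝ ℝ)

variable {Φ Q E F : Type} [NormedAddCommGroup Φ] [NormedSpace ℝ Φ] [NormedAddCommGroup Q]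
  [NormedSpace ℝ Q] [NormedAddCommGroup E] [NormedSpace ℝ E] [NormedAddCommGroup F]
  [NormedSpace ℝ F]

/-- As `h` vanishes identically at `v = 0`, so does its derivative in `φ`, and uniform continuity
keeps this derivative small for small `v`. This is why the phase is slow and the fast field has
small slope in the phase. -/
theorem UC.small_slope {h : ι → Φ × E → F} (hh : UC (tube Φ E 1) 1 h)
    (h0 : ∀ i φ, h i (φ, 0) = 0) {η : ℝ} (hη : 0 < η) :
    ∃ ρ > 0, ρ ≤ 1 ∧ ∀ i φ φ', ∀ v ∈ ball (0 : E) ρ,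
      ‖h i (φ, v) - h i (φ', v)‖ ≤ η * ‖φ - φ'‖ := by
  obtain ⟨h', hd, hC⟩ := hh.exists_deriv
  obtain ⟨d, hd0, H⟩ := hC.2.ucont η hη
  refine ⟨min d 1, by positivity, min_le_right _ _, fun i φ φ' v hv => ?_⟩
  have hv' : ‖v‖ < min d 1 := by simpa using hv
  have hv1 : ∀ φ : Φ, (φ, v) ∈ tube Φ E 1 := fun φ =>
    LDS.mem_tube.2 (hv'.trans_le (min_le_right _ _))
  have hz1 : ∀ φ : Φ, (φ, (0 : E)) ∈ tube Φ E 1 := fun φ => LDS.mem_tube.2 (by simp)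
  have hin : ∀ (v : E) (φ : Φ), HasFDerivAt (fun φ : Φ => (φ, v)) (.inl ℝ Φ E) φ := fun v φ =>
    hasFDerivAt_prodMk_left φ v
  have hz : ∀ φ, (h' i (φ, 0)).comp (.inl ℝ Φ E) = 0 := fun φ => by
    have e1 := (hd i _ (hz1 φ)).comp φ (hin 0 φ)
    have e2 : (h i ∘ fun φ : Φ => (φ, (0 : E))) = fun _ => 0 := funext (h0 i)
    rw [e2] at e1
    exact e1.unique (hasFDerivAt_const _ _)
  refine lipschitz_of_deriv_le (f := fun φ => h i (φ, v)) convex_univ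
    (fun φ _ => (hd i _ (hv1 φ)).comp φ (hin v φ)) (fun φ _ => ?_) (mem_univ φ') (mem_univ φ)
  have e : (h' i (φ, v)).comp (.inl ℝ Φ E) =
      (h' i (φ, v) - h' i (φ, 0)).comp (.inl ℝ Φ E) := by
    rw [ContinuousLinearMap.sub_comp, hz, sub_zero]
  rw [e]
  refine (ContinuousLinearMap.opNorm_comp_le _ _).trans ?_
  refine (mul_le_of_le_one_right (norm_nonneg _) (ContinuousLinearMap.norm_inl_le_one ℝ Φ E)).trans
    (H i i _ _ (hv1 φ) (hz1 φ) (by simpa using hd0) ?_)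
  rw [dist_eq_norm]
  simpa [Prod.norm_def, hd0] using hv'.trans_le (min_le_left _ _)

theorem UC.small_remainder {h : ι → Φ × E → F} (hh : UC (tube Φ E 1) 1 h)
    {A : ι → Φ → E →L[ℝ] F} (hA : ∀ i φ, HasFDerivAt (fun v => h i (φ, v)) (A i φ) 0)
    {η : ℝ} (hη : 0 < η) :
    ∃ ρ > 0, ρ ≤ 1 ∧ ∀ i φ, ∀ v ∈ ball (0 : E) ρ, ∀ v' ∈ ball (0 : E) ρ,
      ‖h i (φ, v) - h i (φ, v') - A i φ (v - v')‖ ≤ η * ‖v - v'‖ := by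
  obtain ⟨h', hd, hC⟩ := hh.exists_deriv
  obtain ⟨d, hd0, H⟩ := hC.2.ucont η hη
  refine ⟨min d 1, by positivity, min_le_right _ _, fun i φ v hv v' hv' => ?_⟩
  have hin : ∀ v : E, HasFDerivAt (fun v : E => (φ, v)) (.inr ℝ Φ E) v := fun v =>
    hasFDerivAt_prodMk_right φ v
  have hm : ∀ v ∈ ball (0 : E) (min d 1), (φ, v) ∈ tube Φ E 1 := fun v hv =>
    LDS.mem_tube.2 ((mem_ball_zero_iff.1 hv).trans_le (min_le_right _ _))
  have h0 : (0 : E) ∈ ball (0 : E) (min d 1) := mem_ball_self (by positivity)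
  have e : A i φ = (h' i (φ, 0)).comp (.inr ℝ Φ E) :=
    (hA i φ).unique ((hd i _ (hm 0 h0)).comp 0 (hin 0))
  rw [e]
  refine Convex.norm_image_sub_le_of_norm_hasFDerivWithin_le' (s := ball (0 : E) (min d 1))
    (f := fun v => h i (φ, v))
    (fun v hv => ((hd i _ (hm v hv)).comp v (hin v)).hasFDerivWithinAt) (fun v hv => ?_)
    (convex_ball _ _) hv' hv
  rw [← ContinuousLinearMap.sub_comp]
  refine (ContinuousLinearMap.opNorm_comp_le _ _).trans ?_
  refine (mul_le_of_le_one_right (norm_nonneg _) (ContinuousLinearMap.norm_inr_le_one ℝ Φ E)).trans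
    (H i i _ _ (hm v hv) (hm 0 h0) (by simpa using hd0) ?_)
  rw [dist_eq_norm]
  simpa [Prod.norm_def, hd0] using (mem_ball_zero_iff.1 hv).trans_le (min_le_left _ _)

/-- Phases and rescaled parameters, and a variable `η` that carries the size of the perturbation. -/
abbrev SlowVar (Φ Q : Type) : Type := (Φ × Q) × ℝ

/-- The fast field with perturbation `ε₁ sin η`. -/
def fastField (nc : ι → Φ × E → E) (Fp : ι → (Φ × Q) × E → E) (μ ε₁ : ℝ) (i : ι)
    (x : SlowVar Φ Q × E) : E :=
  nc i (x.1.1.1, x.2) + (ε₁ * Real.sin x.1.2) • Fp i ((x.1.1.1, μ⁻¹ • x.1.1.2), x.2)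

/-- The slow field with perturbation `ε₁ sin η`. -/
def slowField (e₀ : Φ) (cc : ι → Φ × E → Φ) (gc : ι → Φ × E → Q) (Gp : ι → (Φ × Q) × E → Q)
    (μ ε₁ : ℝ) (i : ι) (x : SlowVar Φ Q × E) : SlowVar Φ Q :=
  ((e₀ + cc i (x.1.1.1, x.2),
    μ • (gc i (x.1.1.1, x.2) +
      (ε₁ * Real.sin x.1.2) • Gp i ((x.1.1.1, μ⁻¹ • x.1.1.2), x.2))), 0)

/-- The map `(((φ, q), η), v) ↦ (φ, v)`. -/
def coreL (Φ Q E : Type) [NormedAddCommGroup Φ] [NormedSpace ℝ Φ] [NormedAddCommGroup Q]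
    [NormedSpace ℝ Q] [NormedAddCommGroup E] [NormedSpace ℝ E] :
    SlowVar Φ Q × E →L[ℝ] Φ × E :=
  ((ContinuousLinearMap.fst ℝ Φ Q).comp ((ContinuousLinearMap.fst ℝ (Φ × Q) ℝ).comp
    (ContinuousLinearMap.fst ℝ _ _))).prod (ContinuousLinearMap.snd ℝ _ _)

/-- The map `(((φ, q), η), v) ↦ ((φ, μ⁻¹ q), v)`. -/
def pertL (Φ Q E : Type) [NormedAddCommGroup Φ] [NormedSpace ℝ Φ] [NormedAddCommGroup Q]
    [NormedSpace ℝ Q] [NormedAddCommGroup E] [NormedSpace ℝ E] (μ : ℝ) :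
    SlowVar Φ Q × E →L[ℝ] (Φ × Q) × E :=
  ((((ContinuousLinearMap.fst ℝ Φ Q).comp ((ContinuousLinearMap.fst ℝ (Φ × Q) ℝ).comp
    (ContinuousLinearMap.fst ℝ _ _)))).prod
    (μ⁻¹ • ((ContinuousLinearMap.snd ℝ Φ Q).comp ((ContinuousLinearMap.fst ℝ (Φ × Q) ℝ).comp
    (ContinuousLinearMap.fst ℝ _ _))))).prod (ContinuousLinearMap.snd ℝ _ _)

theorem UC.comp_coreL {n : ℕ} {h : ι → Φ × E → F} (hh : UC (tube Φ E 1) n h) :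
    UC (tube (SlowVar Φ Q) E 1) n fun i x => h i (x.1.1.1, x.2) :=
  hh.comp (UG.linear (coreL Φ Q E)) fun _ _ hx => LDS.mem_tube.2 (LDS.mem_tube.1 hx)

theorem UC.sin_smul_pertL {n : ℕ} {h : ι → (Φ × Q) × E → F} (hh : UC (tube (Φ × Q) E 1) n h)
    (μ : ℝ) : UC (tube (SlowVar Φ Q) E 1) n fun i x =>
      Real.sin x.1.2 • h i ((x.1.1.1, μ⁻¹ • x.1.1.2), x.2) := by
  have h1 : UC (tube (SlowVar Φ Q) E 1) n fun (_ : ι) x => Real.sin x.1.2 :=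
    (UC.sin_cos n).1.comp (UG.linear ((ContinuousLinearMap.snd ℝ (Φ × Q) ℝ).comp
      (ContinuousLinearMap.fst ℝ _ E))) fun _ _ _ => mem_univ _
  exact h1.smul (hh.comp (UG.linear (pertL Φ Q E μ))
    fun _ _ hx => LDS.mem_tube.2 (LDS.mem_tube.1 hx))

theorem UC.fastField {n : ℕ} {nc : ι → Φ × E → E} {Fp : ι → (Φ × Q) × E → E}
    (hn : UC (tube Φ E 1) n nc) (hF : UC (tube (Φ × Q) E 1) n Fp) (μ ε₁ : ℝ) :
    UC (tube (SlowVar Φ Q) E 1) n (fastField nc Fp μ ε₁) := by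
  have := hn.comp_coreL.add ((hF.sin_smul_pertL μ).clm (ε₁ • ContinuousLinearMap.id ℝ E))
  refine this.congr (isOpen_tube _) fun i x _ => ?_
  rw [LDS.fastField, mul_smul]
  rfl

theorem UC.slowField {n : ℕ} (e₀ : Φ) {cc : ι → Φ × E → Φ} {gc : ι → Φ × E → Q}
    {Gp : ι → (Φ × Q) × E → Q} (hc : UC (tube Φ E 1) n cc) (hg : UC (tube Φ E 1) n gc)
    (hG : UC (tube (Φ × Q) E 1) n Gp) (μ ε₁ : ℝ) :
    UC (tube (SlowVar Φ Q) E 1) n (slowField e₀ cc gc Gp μ ε₁) := by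
  have h1 := (UC.const (ι := ι) (S := tube (SlowVar Φ Q) E 1) (n := n) e₀).add
    (hc.comp_coreL (Q := Q))
  have h2 := (hg.comp_coreL.add ((hG.sin_smul_pertL μ).clm
    (ε₁ • ContinuousLinearMap.id ℝ Q))).clm (μ • ContinuousLinearMap.id ℝ Q)
  have := (h1.prodMk h2).prodMk (UC.const (0 : ℝ))
  refine this.congr (isOpen_tube _) fun i x _ => ?_
  rw [LDS.slowField, mul_smul]
  rfl

theorem UC.exists_lipschitz_add {n : ℕ} {ρ : ℝ} {h : ι → Φ × E → F}
    (hh : UC (tube Φ E ρ) (n + 1) h) : ∃ L, 0 < L ∧ ∀ i, ∀ x ∈ tube Φ E ρ, ∀ y ∈ tube Φ E ρ,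
      ‖h i x - h i y‖ ≤ L * (‖x.1 - y.1‖ + ‖x.2 - y.2‖) := by
  obtain ⟨L, hL0, hL⟩ := hh.2.exists_lipschitz (convex_tube ρ)
  refine ⟨L + 1, by positivity, fun i x hx y hy => (hL i y hy x hx).trans ?_⟩
  have : ‖x - y‖ ≤ ‖x.1 - y.1‖ + ‖x.2 - y.2‖ := by
    rw [Prod.norm_def]
    exact max_le (le_add_of_nonneg_right (norm_nonneg _)) (le_add_of_nonneg_left (norm_nonneg _))
  gcongr
  linarith

/-- The order of the choices matters: `σv` is given and not small, then `K` is prescribed to make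
`σv K` small, then `ρ` to achieve `K` and `κ`, then `μ` to slow down the parameters, and last `ε₁`,
which depends on `μ` because the coupling is evaluated at `μ⁻¹ q`. -/
theorem exists_slowFast {n : ℕ} (e₀ : Φ) {cc : ι → Φ × E → Φ} {nc : ι → Φ × E → E}
    {gc : ι → Φ × E → Q} {Fp : ι → (Φ × Q) × E → E} {Gp : ι → (Φ × Q) × E → Q}
    (hc : UC (tube Φ E 1) (n + 1) cc) (hn : UC (tube Φ E 1) (n + 1) nc)
    (hg : UC (tube Φ E 1) (n + 1) gc) (hF : UC (tube (Φ × Q) E 1) (n + 1) Fp)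
    (hG : UC (tube (Φ × Q) E 1) (n + 1) Gp) (hc0 : ∀ i φ, cc i (φ, 0) = 0)
    (hn0 : ∀ i φ, nc i (φ, 0) = 0) {A : ι → Φ → E →L[ℝ] E}
    (hA : ∀ i φ, HasFDerivAt (fun v => nc i (φ, v)) (A i φ) 0) {C κ₀ c a ρ₀ K₀ : ℝ} (hC : 0 < C)
    (hκ₀ : 0 < κ₀) (hcpos : 0 < c) (ha : 0 < a) (hρ₀ : 0 < ρ₀) (hK₀ : 0 < K₀)
    (hdich : ∀ i (φ q : ℝ → Φ), Continuous q → (∀ t, ‖q t - e₀‖ ≤ κ₀) →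
      (∀ t, HasDerivAt φ (q t) t) → IsDich (fun t => A i (φ t)) C) :
    ∃ ρ μ ε₁ κ σz σv K ν, ρ ≤ ρ₀ ∧ ρ ≤ 1 ∧ 0 < μ ∧ μ ≤ 1 ∧ 0 < ε₁ ∧ ε₁ ≤ a ∧ K ≤ K₀ ∧
      SlowFast (slowField e₀ cc gc Gp μ ε₁) (fastField nc Fp μ ε₁) (fun i z => A i z.1.1)
        {q | ‖q.1.1 - e₀‖ ≤ κ₀} C ρ κ σz σv K ν c := by
  obtain ⟨Lc, hLc0, hLc⟩ := hc.exists_lipschitz_add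
  obtain ⟨Lg, hLg0, hLg⟩ := (hg.comp_coreL (Q := Q)).exists_lipschitz_add
  set σv := Lc + 1 with hσv
  set K := min K₀ (c / (C * C * σv)) with hK
  set κ := c / C with hκ
  have hσv0 : 0 < σv := by positivity
  have hK0 : 0 < K := by positivity
  have hκ0 : 0 < κ := by positivity
  have hη : 0 < min κ K / 2 := by positivity
  obtain ⟨ρ₁, hρ₁, hρ₁', H₁⟩ := (hc.of_le (by omega)).small_slope hc0 (η := κ / 2) (by positivity)
  obtain ⟨ρ₂, hρ₂, hρ₂', H₂⟩ := (hn.of_le (by omega)).small_slope hn0 (η := K / 2) (by positivity)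
  obtain ⟨ρ₃, hρ₃, hρ₃', H₃⟩ := (hn.of_le (by omega)).small_remainder hA (η := κ / 2)
    (by positivity)
  -- The bound `κ₀ / Lc` keeps the phase velocity within `κ₀` of `e₀`, where the dichotomy is
  -- available.
  set ρ := min (min ρ₀ (κ₀ / Lc)) (min ρ₁ (min ρ₂ ρ₃)) with hρ
  have hρ0 : 0 < ρ := by positivity
  have hρ1 : ρ ≤ ρ₁ := (min_le_right _ _).trans (min_le_left _ _)
  have hρ2 : ρ ≤ ρ₂ := (min_le_right _ _).trans ((min_le_right _ _).trans (min_le_left _ _))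
  have hρ3 : ρ ≤ ρ₃ := (min_le_right _ _).trans ((min_le_right _ _).trans (min_le_right _ _))
  have hρone : ρ ≤ 1 := hρ1.trans hρ₁'
  have hρκ : Lc * ρ ≤ κ₀ := by
    have : ρ ≤ κ₀ / Lc := (min_le_left _ _).trans (min_le_right _ _)
    rwa [le_div_iff₀ hLc0, mul_comm] at this
  set σ := min (κ / 2) 1 with hσ
  have hσ0 : 0 < σ := by positivity
  set μ := min 1 (σ / 2 / Lg) with hμ
  have hμ0 : 0 < μ := by positivity
  have hμL : μ * Lg ≤ σ / 2 := by
    have : μ ≤ σ / 2 / Lg := min_le_right _ _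
    rwa [le_div_iff₀ hLg0] at this
  obtain ⟨LF, hLF0, hLF⟩ := (hF.sin_smul_pertL μ).exists_lipschitz_add
  obtain ⟨LG, hLG0, hLG⟩ := (hG.sin_smul_pertL μ).exists_lipschitz_add
  obtain ⟨MF', hMF'⟩ := (hF.sin_smul_pertL μ).1
  set MF := |MF'| + 1 with hMF
  have hMF0 : 0 < MF := by positivity
  -- Besides `a`, the terms bound the coupling's share in the slow slopes, its share in the fast
  -- slopes, and the fast field at `v = 0`.
  set ε₁ := min (min a (σ / 2 / LG)) (min (min κ K / 2 / LF) (ρ / (4 * C) / MF)) with hε₁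
  have hε₁0 : 0 < ε₁ := by positivity
  have hεG : ε₁ * LG ≤ σ / 2 := by
    have : ε₁ ≤ σ / 2 / LG := (min_le_left _ _).trans (min_le_right _ _)
    rwa [le_div_iff₀ hLG0] at this
  have hεF : ε₁ * LF ≤ min κ K / 2 := by
    have : ε₁ ≤ min κ K / 2 / LF := (min_le_right _ _).trans (min_le_left _ _)
    rwa [le_div_iff₀ hLF0] at this
  have hεM : ε₁ * MF ≤ ρ / (4 * C) := by
    have : ε₁ ≤ ρ / (4 * C) / MF := (min_le_right _ _).trans (min_le_right _ _)
    rwa [le_div_iff₀ hMF0] at this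
  have hεFκ : ε₁ * LF ≤ κ / 2 := hεF.trans (by gcongr; exact min_le_left _ _)
  have hεFK : ε₁ * LF ≤ K / 2 := hεF.trans (by gcongr; exact min_le_right _ _)
  have hsub : tube (SlowVar Φ Q) E ρ ⊆ tube (SlowVar Φ Q) E 1 := fun x hx =>
    LDS.mem_tube.2 ((LDS.mem_tube.1 hx).trans_le hρone)
  have hb := (UC.slowField e₀ hc hg hG μ ε₁).mono hsub
  have hN := (UC.fastField hn hF μ ε₁).mono hsub
  have hfast : ∀ i x, LDS.fastField nc Fp μ ε₁ i x = nc i (x.1.1.1, x.2) +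
      ε₁ • (Real.sin x.1.2 • Fp i ((x.1.1.1, μ⁻¹ • x.1.1.2), x.2)) := fun i x => by
    rw [smul_smul]; rfl
  have hccv : ∀ i φ, ∀ v ∈ ball (0 : E) ρ, ‖cc i (φ, v)‖ ≤ κ₀ := fun i φ v hv => by
    have hv' := mem_ball_zero_iff.1 hv
    have := hLc i (φ, v) (LDS.mem_tube.2 (hv'.trans_le hρone)) (φ, 0)
      (LDS.mem_tube.2 (by simp))
    rw [hc0, sub_zero] at this
    simp only [sub_self, norm_zero, zero_add, sub_zero] at this
    exact this.trans ((mul_le_mul_of_nonneg_left hv'.le hLc0.le).trans hρκ)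
  refine ⟨ρ, μ, ε₁, κ, κ, σv, K, ε₁ * MF, (min_le_left _ _).trans (min_le_left _ _), hρone, hμ0,
    min_le_left _ _, hε₁0, (min_le_left _ _).trans (min_le_left _ _), min_le_left _ _, ?_⟩
  exact {
    C_pos := hC
    ρ_pos := hρ0
    κ_nonneg := hκ0.le
    σz_nonneg := hκ0.le
    σv_nonneg := hσv0.le
    K_pos := hK0
    closed := isClosed_le (by fun_prop) continuous_const
    b_mem := fun i x hx => by
      change ‖e₀ + cc i (x.1.1.1, x.2) - e₀‖ ≤ κ₀
      rw [add_sub_cancel_left]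
      exact hccv i _ _ (mem_ball_zero_iff.2 (LDS.mem_tube.1 hx))
    b_bdd := hb.1
    b_ucont := hb.2.ucont
    N_ucont := hN.2.ucont
    dich := fun i z q hq hqS hz => hdich i (fun t => (z t).1.1) (fun t => (q t).1.1)
      (by fun_prop) hqS fun t =>
        (((ContinuousLinearMap.fst ℝ Φ Q).comp
          (ContinuousLinearMap.fst ℝ (Φ × Q) ℝ)).hasFDerivAt.comp_hasDerivAt t (hz t))
    lip_b := fun i x hx y hy => by
      have hz : 0 ≤ ‖x.1 - y.1‖ := norm_nonneg _
      have hv : 0 ≤ ‖x.2 - y.2‖ := norm_nonneg _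
      have k1 : ‖x.1.1.1 - y.1.1.1‖ ≤ ‖x.1 - y.1‖ :=
        (norm_fst_le (x.1.1 - y.1.1)).trans (norm_fst_le (x.1 - y.1))
      have hx' := LDS.mem_tube.1 hx
      have hy' := LDS.mem_tube.1 hy
      have e1 : ‖cc i (x.1.1.1, x.2) - cc i (y.1.1.1, y.2)‖ ≤
          κ * ‖x.1 - y.1‖ + σv * ‖x.2 - y.2‖ := by
        have a1 := H₁ i x.1.1.1 y.1.1.1 x.2 (mem_ball_zero_iff.2 (hx'.trans_le hρ1))
        have a2 := hLc i (y.1.1.1, x.2) (LDS.mem_tube.2 (hx'.trans_le hρone)) (y.1.1.1, y.2)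
          (LDS.mem_tube.2 (hy'.trans_le hρone))
        simp only [sub_self, norm_zero, zero_add] at a2
        calc _ ≤ ‖cc i (x.1.1.1, x.2) - cc i (y.1.1.1, x.2)‖ +
              ‖cc i (y.1.1.1, x.2) - cc i (y.1.1.1, y.2)‖ := norm_sub_le_norm_sub_add_norm_sub _ _ _
          _ ≤ κ / 2 * ‖x.1 - y.1‖ + Lc * ‖x.2 - y.2‖ :=
              add_le_add (a1.trans (by gcongr)) a2
          _ ≤ _ := by
              gcongr
              · linarith
              · rw [hσv]; linarith
      have e2 : ‖μ • (gc i (x.1.1.1, x.2) +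
          (ε₁ * Real.sin x.1.2) • Gp i ((x.1.1.1, μ⁻¹ • x.1.1.2), x.2)) -
          μ • (gc i (y.1.1.1, y.2) +
          (ε₁ * Real.sin y.1.2) • Gp i ((y.1.1.1, μ⁻¹ • y.1.1.2), y.2))‖ ≤
          κ * ‖x.1 - y.1‖ + σv * ‖x.2 - y.2‖ := by
        have a1 := hLg i x (hsub hx) y (hsub hy)
        have a2 := hLG i x (hsub hx) y (hsub hy)
        have e : gc i (x.1.1.1, x.2) +
            (ε₁ * Real.sin x.1.2) • Gp i ((x.1.1.1, μ⁻¹ • x.1.1.2), x.2) -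
            (gc i (y.1.1.1, y.2) +
            (ε₁ * Real.sin y.1.2) • Gp i ((y.1.1.1, μ⁻¹ • y.1.1.2), y.2)) =
            (gc i (x.1.1.1, x.2) - gc i (y.1.1.1, y.2)) +
            ε₁ • (Real.sin x.1.2 • Gp i ((x.1.1.1, μ⁻¹ • x.1.1.2), x.2) -
              Real.sin y.1.2 • Gp i ((y.1.1.1, μ⁻¹ • y.1.1.2), y.2)) := by
          rw [smul_sub, smul_smul, smul_smul]; abel
        rw [← smul_sub, e, norm_smul, Real.norm_of_nonneg hμ0.le]
        have a3 := norm_add_le (gc i (x.1.1.1, x.2) - gc i (y.1.1.1, y.2))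
          (ε₁ • (Real.sin x.1.2 • Gp i ((x.1.1.1, μ⁻¹ • x.1.1.2), x.2) -
              Real.sin y.1.2 • Gp i ((y.1.1.1, μ⁻¹ • y.1.1.2), y.2)))
        rw [norm_smul, Real.norm_of_nonneg hε₁0.le] at a3
        have hs : 0 ≤ ‖x.1 - y.1‖ + ‖x.2 - y.2‖ := by positivity
        calc _ ≤ μ * (Lg * (‖x.1 - y.1‖ + ‖x.2 - y.2‖) +
              ε₁ * (LG * (‖x.1 - y.1‖ + ‖x.2 - y.2‖))) := by
              gcongr
              exact a3.trans (by gcongr)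
          _ = (μ * Lg + μ * (ε₁ * LG)) * (‖x.1 - y.1‖ + ‖x.2 - y.2‖) := by ring
          _ ≤ (σ / 2 + 1 * (σ / 2)) * (‖x.1 - y.1‖ + ‖x.2 - y.2‖) := by
              gcongr
              exact min_le_left _ _
          _ = σ * ‖x.1 - y.1‖ + σ * ‖x.2 - y.2‖ := by ring
          _ ≤ _ := by
              have s1 : σ ≤ κ / 2 := min_le_left _ _
              have s2 : σ ≤ 1 := min_le_right _ _
              gcongr
              · linarith
              · rw [hσv]; linarith
      change ‖(((e₀ + cc i (x.1.1.1, x.2)) - (e₀ + cc i (y.1.1.1, y.2)), _), (0 : ℝ) - 0)‖ ≤ _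
      rw [add_sub_add_left_eq_sub, Prod.norm_def, Prod.norm_def]
      refine max_le (max_le e1 e2) ?_
      simp only [sub_self, norm_zero]
      positivity
    lip_z := fun i z z' v hv => by
      have hv' := mem_ball_zero_iff.1 hv
      have k1 : ‖z.1.1 - z'.1.1‖ ≤ ‖z - z'‖ :=
        (norm_fst_le (z.1 - z'.1)).trans (norm_fst_le (z - z'))
      have a1 := H₂ i z.1.1 z'.1.1 v (mem_ball_zero_iff.2 (hv'.trans_le hρ2))
      have a2 := hLF i (z, v) (LDS.mem_tube.2 (hv'.trans_le hρone)) (z', v)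
        (LDS.mem_tube.2 (hv'.trans_le hρone))
      simp only [sub_self, norm_zero, add_zero] at a2
      rw [hfast, hfast, add_sub_add_comm, ← smul_sub]
      refine (norm_add_le _ _).trans ?_
      rw [norm_smul, Real.norm_of_nonneg hε₁0.le]
      calc _ ≤ K / 2 * ‖z - z'‖ + ε₁ * (LF * ‖z - z'‖) :=
            add_le_add (a1.trans (by gcongr)) (by gcongr)
        _ = (K / 2 + ε₁ * LF) * ‖z - z'‖ := by ring
        _ ≤ _ := by gcongr; linarith
    lip_v := fun i z v hv v' hv' => by
      have hv1 := mem_ball_zero_iff.1 hv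
      have hv1' := mem_ball_zero_iff.1 hv'
      have a1 := H₃ i z.1.1 v (ball_subset_ball hρ3 hv) v' (ball_subset_ball hρ3 hv')
      have a2 := hLF i (z, v) (LDS.mem_tube.2 (hv1.trans_le hρone)) (z, v')
        (LDS.mem_tube.2 (hv1'.trans_le hρone))
      simp only [sub_self, norm_zero, zero_add] at a2
      rw [hfast, hfast, add_sub_add_comm, ← smul_sub, add_sub_right_comm]
      refine (norm_add_le _ _).trans ?_
      rw [norm_smul, Real.norm_of_nonneg hε₁0.le]
      calc _ ≤ κ / 2 * ‖v - v'‖ + ε₁ * (LF * ‖v - v'‖) :=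
            add_le_add a1 (by gcongr)
        _ = (κ / 2 + ε₁ * LF) * ‖v - v'‖ := by ring
        _ ≤ _ := by gcongr; linarith
    zero := fun i z => by
      rw [hfast, hn0, zero_add, norm_smul, Real.norm_of_nonneg hε₁0.le]
      gcongr
      refine (hMF' i (z, 0) (LDS.mem_tube.2 (by simp))).trans ?_
      exact (le_abs_self _).trans (by linarith)
    small_κ := by
      rw [hκ]
      exact le_of_eq (by field_simp)
    small_σz := by
      rw [hκ]
      exact le_of_eq (by field_simp)
    small_σv := by
      have : K ≤ c / (C * C * σv) := min_le_right _ _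
      rw [le_div_iff₀ (by positivity)] at this
      linarith
    small_ν := by
      calc C * (ε₁ * MF) ≤ C * (ρ / (4 * C)) := by gcongr
        _ = ρ / 4 := by field_simp }

end ScaledSystems

/-! ### Discrete index sets -/

section DiscreteIndex

/-- A type with the discrete metric. -/
def Disc (α : Type) : Type := α

open Classical in
instance (α : Type) : PseudoMetricSpace (Disc α) where
  dist a b := if a = b then 0 else 1
  dist_self a := by simp
  dist_comm a b := by simp only [eq_comm]
  dist_triangle a b c := by
    by_cases h1 : a = b <;> by_cases h2 : b = c <;> by_cases h3 : a = c <;> simp_all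

theorem Disc.eq_of_dist_lt {α : Type} {a b : Disc α} (h : dist a b < 1) : a = b := by
  by_contra hab
  have : dist a b = 1 := if_neg hab
  linarith

theorem uIndex_of_eq {ι' ι : Type} [PseudoMetricSpace ι'] [PseudoMetricSpace ι] {e : ι' → ι}
    (h : ∀ i i', dist i i' < 1 → e i = e i') : UIndex e := fun η hη =>
  ⟨1, one_pos, fun i i' hi => by rw [h i i' hi, dist_self]; exact hη⟩

/-- Indices at distance below `1` coincide, so joint uniform continuity reduces to one modulus for
all indices. In this way uniformity over all orbits is part of the smoothness classes. -/
theorem UCont.of_disc {J X F : Type} [PseudoMetricSpace X] [SeminormedAddCommGroup F] {S : Set X}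
    {h : Disc J → X → F}
    (hh : ∀ η > 0, ∃ d > 0, ∀ j, ∀ x ∈ S, ∀ y ∈ S, dist x y < d → ‖h j x - h j y‖ ≤ η) :
    UCont S h := fun η hη => by
  obtain ⟨d, hd, H⟩ := hh η hη
  refine ⟨min d 1, by positivity, fun i i' x y hx hy hi hxy => ?_⟩
  rw [Disc.eq_of_dist_lt (hi.trans_le (min_le_right _ _))]
  exact H _ x hx y hy (hxy.trans_le (min_le_left _ _))

end DiscreteIndex

/-! ### Families of hyperbolic orbits and the fields in phase coordinates -/

section HyperbolicFamilies

variable {J : Type} {E P : Type} [NormedAddCommGroup E] [InnerProductSpace ℝ E]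
  [FiniteDimensional ℝ E] [NormedAddCommGroup P] [NormedSpace ℝ P]

/-- The real inner product as a continuous bilinear map. -/
def innerB (E : Type) [NormedAddCommGroup E] [InnerProductSpace ℝ E] : E →L[ℝ] E →L[ℝ] ℝ :=
  (isBoundedBilinearMap_inner (𝕜 := ℝ) (E := E)).toContinuousLinearMap

/-- Taking adjoints as a continuous linear map. -/
def adjointL (E : Type) [NormedAddCommGroup E] [InnerProductSpace ℝ E] [FiniteDimensional ℝ E] :
    (E →L[ℝ] E) →L[ℝ] E →L[ℝ] E :=
  LinearMap.mkContinuous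
    { toFun := fun A => ContinuousLinearMap.adjoint A
      map_add' := fun A B => map_add _ A B
      map_smul' := fun c A => by simp } 1 fun A => by simp

/-- A family of bounded orbits `y j` of `y' = f j (y)` with normalized adjoint solutions `ys j`, and
uniformly hyperbolic in the directions normal to the flow. -/
structure HypFamily (r : ℕ) (f : Disc J → E → E) (y ys : Disc J → ℝ → E) (R C : ℝ) : Prop where
  C_pos : 0 < C
  sol : ∀ j t, HasDerivAt (y j) (f j (y j t)) t
  bdd : ∀ j t, ‖y j t‖ ≤ R
  smooth : UC (ball 0 (R + 2)) r f
  adj : ∀ j t,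
    HasDerivAt (ys j) (-(ContinuousLinearMap.adjoint (fderiv ℝ (f j) (y j t)) (ys j t))) t
  normalized : ∀ j t, inner ℝ (ys j t) (f j (y j t)) = (1 : ℝ)
  ys_bdd : ∀ j t, ‖ys j t‖ ≤ C
  dich : ∀ j, IsDich (normalOp (fun t => fderiv ℝ (f j) (y j t)) (ys j) fun t => f j (y j t)) C

variable {r : ℕ} {f : Disc J → E → E} {y ys : Disc J → ℝ → E} {R C : ℝ}

theorem UCont.of_deriv_bdd {y y' : Disc J → ℝ → E} (hy : ∀ j t, HasDerivAt (y j) (y' j t) t)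
    (hb : UBdd univ y') : UCont univ y := by
  obtain ⟨U, hU⟩ := hb
  have h1 : ∀ j s t, ‖y j s - y j t‖ ≤ |U| * |s - t| := fun j s t => by
    have := lipschitz_of_deriv_le (convex_univ (𝕜 := ℝ) (E := ℝ)) (f := y j)
      (fun s _ => (hy j s).hasFDerivAt) (C := |U|) (fun s _ => by
        simpa using (hU j s (mem_univ s)).trans (le_abs_self U)) (mem_univ t) (mem_univ s)
    simpa using this
  refine UCont.of_disc fun η hη => ⟨η / (|U| + 1), by positivity, fun j s _ t _ hst => ?_⟩
  rw [Real.dist_eq] at hst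
  refine (h1 j s t).trans ?_
  calc |U| * |s - t| ≤ (|U| + 1) * (η / (|U| + 1)) := by gcongr; linarith
    _ = η := by field_simp

theorem HypFamily.mem (H : HypFamily r f y ys R C) (j : Disc J) (t : ℝ) :
    y j t ∈ ball (0 : E) (R + 2) := mem_ball_zero_iff.2 (by linarith [H.bdd j t])

theorem HypFamily.exists_speed (H : HypFamily r f y ys R C) :
    ∃ U, 0 ≤ U ∧ ∀ j t, ‖f j (y j t)‖ ≤ U :=
  let ⟨U, hU⟩ := H.smooth.1
  ⟨|U|, abs_nonneg U, fun j t => (hU j _ (H.mem j t)).trans (le_abs_self U)⟩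

/-- Bootstrapping through `y' = f(y)`: each order of smoothness of the orbit yields the next, as
long as `f` allows it. -/
theorem HypFamily.orbit_UC (H : HypFamily r f y ys R C) : UC univ r y := by
  obtain ⟨U, -, hU⟩ := H.exists_speed
  have h0 : UC univ 0 y := ⟨⟨R, fun j t _ => H.bdd j t⟩,
    UCont.of_deriv_bdd H.sol ⟨U, fun j t _ => hU j t⟩⟩
  have : ∀ n ≤ r, UC univ n y := by
    intro n
    induction n with
    | zero => exact fun _ => h0
    | succ n ih =>
      intro hn
      exact ⟨h0.1, UG.succ_of_hasDerivAt h0.2 (fun j t _ => H.sol j t)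
        ((H.smooth.of_le (by omega)).comp (ih (by omega)).2 fun j t _ => H.mem j t)⟩
  exact this r le_rfl

theorem HypFamily.velocity_UC (H : HypFamily r f y ys R C) :
    UC univ r fun j t => f j (y j t) :=
  H.smooth.comp H.orbit_UC.2 fun j t _ => H.mem j t

theorem HypFamily.fderiv_UC {n : ℕ} (H : HypFamily (n + 1) f y ys R C) :
    UC (ball 0 (R + 2)) n fun j x => fderiv ℝ (f j) x := by
  obtain ⟨f', hd, hC⟩ := H.smooth.exists_deriv
  exact hC.congr isOpen_ball fun j x hx => (hd j x hx).fderiv.symm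

theorem HypFamily.hasFDerivAt {n : ℕ} (H : HypFamily (n + 1) f y ys R C) (j : Disc J) {x : E}
    (hx : x ∈ ball (0 : E) (R + 2)) : HasFDerivAt (f j) (fderiv ℝ (f j) x) x := by
  obtain ⟨f', hd, -⟩ := H.smooth.exists_deriv
  exact (hd j x hx).differentiableAt.hasFDerivAt

/-- The coefficient `f'(y(t))` is only of class `n`, but the linear equation gains one order. Hence
the phase coordinates lose no smoothness. -/
theorem HypFamily.adjoint_UC {n : ℕ} (H : HypFamily (n + 1) f y ys R C) :
    UC univ (n + 1) ys := by
  have hA : UC univ n fun j t => adjointL E (fderiv ℝ (f j) (y j t)) :=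
    (H.fderiv_UC.comp (H.orbit_UC.of_le n.le_succ).2 fun j t _ => H.mem j t).clm _
  have hstep : ∀ m ≤ n, UC univ m ys →
      UC univ m fun j t => -(ContinuousLinearMap.adjoint (fderiv ℝ (f j) (y j t)) (ys j t)) :=
    fun m hm hys => (UC.bilin (ContinuousLinearMap.id ℝ (E →L[ℝ] E)) (hA.of_le hm) hys).clm
      (-ContinuousLinearMap.id ℝ E)
  have hys : UBdd univ ys := ⟨C, fun j t _ => H.ys_bdd j t⟩
  have hbd : UBdd univ fun j t =>
      -(ContinuousLinearMap.adjoint (fderiv ℝ (f j) (y j t)) (ys j t)) := by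
    obtain ⟨K, hK⟩ := hA.1
    refine ⟨K * C, fun j t ht => ?_⟩
    rw [norm_neg]
    exact (ContinuousLinearMap.le_opNorm _ _).trans
      (mul_le_mul (hK j t ht) (H.ys_bdd j t) (norm_nonneg _) ((norm_nonneg _).trans (hK j t ht)))
  have h0 : UC univ 0 ys := ⟨hys, UCont.of_deriv_bdd H.adj hbd⟩
  have : ∀ m ≤ n + 1, UC univ m ys := by
    intro m
    induction m with
    | zero => exact fun _ => h0
    | succ m ih =>
      intro hm
      exact ⟨hys, UG.succ_of_hasDerivAt h0.2 (fun j t _ => H.adj j t)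
        (hstep m (by omega) (ih (by omega)))⟩
  exact this _ le_rfl

/-- Deviation of the phase velocity from `1`. -/
def phaseCore (ys : Disc J → ℝ → E) (j : Disc J) (x : ℝ × E) : ℝ := inner ℝ (ys j x.1) x.2

/-- Velocity of the deviation from the orbit. -/
def fastCore (f : Disc J → E → E) (y ys : Disc J → ℝ → E) (j : Disc J) (x : ℝ × E) : E :=
  f j (y j x.1 + x.2) - (1 + phaseCore ys j x) • f j (y j x.1)

/-- A field near the orbit in the coordinates phase and deviation. -/
def parCore (g : Disc J → E → P) (y : Disc J → ℝ → E) (j : Disc J) (x : ℝ × E) : P :=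
  g j (y j x.1 + x.2)

theorem HypFamily.mem_add (H : HypFamily r f y ys R C) (j : Disc J) (t : ℝ) {v : E}
    (hv : ‖v‖ < 2) : y j t + v ∈ ball (0 : E) (R + 2) :=
  mem_ball_zero_iff.2 ((norm_add_le _ _).trans_lt (by linarith [H.bdd j t]))

theorem UC.comp_phase {W : Type} [NormedAddCommGroup W] [NormedSpace ℝ W] {n : ℕ}
    {h : Disc J → ℝ → W} (hh : UC univ n h) :
    UC (tube ℝ E 1) n fun j (x : ℝ × E) => h j x.1 :=
  hh.comp (UG.linear (ContinuousLinearMap.fst ℝ ℝ E)) fun _ _ _ => mem_univ _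

theorem UC.snd_tube {n : ℕ} : UC (tube ℝ E 1) n fun (_ : Disc J) (x : ℝ × E) => x.2 :=
  UC.linear (ContinuousLinearMap.snd ℝ ℝ E) ⟨1, fun _ hx => (LDS.mem_tube.1 hx).le⟩

theorem HypFamily.phaseCore_UC {n : ℕ} (H : HypFamily (n + 1) f y ys R C) :
    UC (tube ℝ E 1) (n + 1) (phaseCore ys) :=
  UC.bilin (innerB E) H.adjoint_UC.comp_phase UC.snd_tube

theorem HypFamily.parCore_UC (H : HypFamily r f y ys R C) {g : Disc J → E → P}
    (hg : UC (ball 0 (R + 2)) r g) : UC (tube ℝ E 1) r (parCore g y) :=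
  hg.comp (H.orbit_UC.comp_phase.add UC.snd_tube).2 fun j x hx =>
    H.mem_add j _ (by linarith [LDS.mem_tube.1 hx])

theorem HypFamily.fastCore_UC {n : ℕ} (H : HypFamily (n + 1) f y ys R C) :
    UC (tube ℝ E 1) (n + 1) (fastCore f y ys) :=
  (H.parCore_UC H.smooth).sub (((UC.const (1 : ℝ)).add H.phaseCore_UC).smul
    H.velocity_UC.comp_phase)

end HyperbolicFamilies

/-! ### The same fields acting on sequences, and the coupling -/

section LatticeCores

/-- The constant sequence. -/
def constLinf {X : Type} [NormedAddCommGroup X] (x : X) : Linf X := toLinf fun _ => x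

theorem constLinf_apply {X : Type} [NormedAddCommGroup X] (x : X) (k : ℤ) :
    constLinf x k = x := toLinf_apply ⟨‖x‖, fun _ => le_rfl⟩ k

/-- The operator on bounded sequences that applies `L` to every component. -/
def mapL {X Y : Type} [NormedAddCommGroup X] [NormedSpace ℝ X] [NormedAddCommGroup Y]
    [NormedSpace ℝ Y] (L : X →L[ℝ] Y) : Linf X →L[ℝ] Linf Y := diagL X Y (constLinf L)

theorem mapL_apply {X Y : Type} [NormedAddCommGroup X] [NormedSpace ℝ X] [NormedAddCommGroup Y]
    [NormedSpace ℝ Y] (L : X →L[ℝ] Y) (u : Linf X) (k : ℤ) : mapL L u k = L (u k) := by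
  rw [mapL, diagL_apply, constLinf_apply]

/-- A pair of bounded sequences as a bounded sequence of pairs. -/
def pairL (X Y : Type) [NormedAddCommGroup X] [NormedSpace ℝ X] [NormedAddCommGroup Y]
    [NormedSpace ℝ Y] : Linf X × Linf Y →L[ℝ] Linf (X × Y) :=
  (mapL (.inl ℝ X Y)).comp (.fst ℝ _ _) + (mapL (.inr ℝ X Y)).comp (.snd ℝ _ _)

theorem pairL_apply {X Y : Type} [NormedAddCommGroup X] [NormedSpace ℝ X] [NormedAddCommGroup Y]
    [NormedSpace ℝ Y] (u : Linf X × Linf Y) (k : ℤ) : pairL X Y u k = (u.1 k, u.2 k) := by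
  change mapL (.inl ℝ X Y) u.1 k + mapL (.inr ℝ X Y) u.2 k = _
  rw [mapL_apply, mapL_apply]
  simp

variable {J Ω I : Type} [PseudoMetricSpace I]
variable {E P W : Type} [NormedAddCommGroup E] [NormedSpace ℝ E]
  [NormedAddCommGroup P] [NormedSpace ℝ P] [NormedAddCommGroup W] [NormedSpace ℝ W]

/-- The index of the component `k` of the lattice. -/
def latIdx (κ : Ω → ℤ → J) (i : (Disc Ω × I) × ℤ) : Disc J := κ i.1.1 i.2

theorem uIndex_latIdx (κ : Ω → ℤ → J) : UIndex (latIdx (I := I) κ) :=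
  uIndex_of_eq fun i i' h => by
    rw [Prod.dist_eq, Prod.dist_eq] at h
    have h1 := ((le_max_left _ _).trans (le_max_left _ _)).trans_lt h
    have h2 := (le_max_right _ _).trans_lt h
    have e2 : i.2 = i'.2 := by
      rw [Int.dist_eq'] at h2
      have : |i.2 - i'.2| < 1 := by exact_mod_cast h2
      have := Int.abs_lt_one_iff.1 this
      omega
    rw [latIdx, latIdx, Disc.eq_of_dist_lt h1, e2]

/-- A family of maps acting componentwise on phases and deviations. -/
def latCore (κ : Ω → ℤ → J) (h : Disc J → ℝ × E → W) (i : Disc Ω × I) (x : Linf ℝ × Linf E) :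
    Linf W := superpos (fun ik => h (latIdx κ ik)) i (pairL ℝ E x)

/-- A family of curves acting componentwise on phases. -/
def latCurve (κ : Ω → ℤ → J) (y : Disc J → ℝ → E) (i : Disc Ω × I) (φ : Linf ℝ) : Linf E :=
  superpos (fun ik => y (latIdx κ ik)) i φ

variable {κ : Ω → ℤ → J}

theorem latCore_apply {h : Disc J → ℝ × E → W} {n : ℕ} (hh : UC (tube ℝ E 1) n h)
    {i : Disc Ω × I} {x : Linf ℝ × Linf E} (hx : ‖x.2‖ < 1) (k : ℤ) :
    latCore κ h i x k = h (κ i.1 k) (x.1 k, x.2 k) := by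
  have hb : UBdd (tube ℝ E 1) fun ik => h (latIdx (I := I) κ ik) := hh.1.reindex _
  rw [latCore, superpos_apply hb, pairL_apply]
  · rfl
  · intro k
    rw [pairL_apply]
    exact LDS.mem_tube.2 ((linf_norm_apply_le x.2 k).trans_lt hx)

theorem UC.latCore {h : Disc J → ℝ × E → W} {n : ℕ} (hh : UC (tube ℝ E 1) n h) :
    UC (tube (Linf ℝ) (Linf E) 1) n (latCore (I := I) κ h) := by
  have h1 : UC (tube ℝ E 1) n fun ik => h (latIdx (I := I) κ ik) := hh.reindex (uIndex_latIdx κ)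
  have h2 : ∀ x : Linf ℝ × Linf E, mapL (.snd ℝ ℝ E) (pairL ℝ E x) = x.2 := fun x =>
    linf_ext fun k => by rw [mapL_apply, pairL_apply]; rfl
  refine (h1.superpos (convex_tube 1) (T := {u | ‖mapL (.snd ℝ ℝ E) u‖ < 1})
    (isOpen_lt (by fun_prop) continuous_const) fun u hu k => ?_).comp (UG.linear (pairL ℝ E))
    fun i x hx => ?_
  · refine LDS.mem_tube.2 (lt_of_le_of_lt ?_ hu)
    have := linf_norm_apply_le (mapL (.snd ℝ ℝ E) u) k
    rwa [mapL_apply] at this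
  · change ‖_‖ < (1 : ℝ)
    rw [h2]
    exact LDS.mem_tube.1 hx

theorem latCurve_apply {y : Disc J → ℝ → E} {n : ℕ} (hy : UC univ n y) (i : Disc Ω × I)
    (φ : Linf ℝ) (k : ℤ) : latCurve κ y i φ k = y (κ i.1 k) (φ k) := by
  have hb : UBdd univ fun ik => y (latIdx (I := I) κ ik) := hy.1.reindex _
  rw [latCurve, superpos_apply hb fun _ => mem_univ _]
  rfl

theorem UC.latCurve {y : Disc J → ℝ → E} {n : ℕ} (hy : UC univ n y) :
    UC univ n (latCurve (I := I) κ y) := by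
  have h1 : UC univ n fun ik => y (latIdx (I := I) κ ik) := hy.reindex (uIndex_latIdx κ)
  exact h1.superpos convex_univ isOpen_univ fun _ _ _ => mem_univ _

/-- The coupling in the coordinates phase, parameter and deviation. -/
def latPert (κ : Ω → ℤ → J) (y : Disc J → ℝ → E) (F : I → Linf E × Linf P → W) (i : Disc Ω × I)
    (x : (Linf ℝ × Linf P) × Linf E) : W := F i.2 (latCurve κ y i x.1.1 + x.2, x.1.2)

theorem UC.latPert {y : Disc J → ℝ → E} {n : ℕ} (hy : UC univ n y)
    {F : I → Linf E × Linf P → W} (hF : UC univ n F) (S : Set ((Linf ℝ × Linf P) × Linf E)) :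
    UC S n (latPert κ y F) := by
  have hs : UIndex fun i : Disc Ω × I => i.2 := fun η hη =>
    ⟨η, hη, fun i i' h => (le_max_right _ _).trans_lt h⟩
  have h1 : UG S n fun (i : Disc Ω × I) (x : (Linf ℝ × Linf P) × Linf E) =>
      LDS.latCurve κ y i x.1.1 := (hy.latCurve.comp (UG.linear ((ContinuousLinearMap.fst ℝ _ _).comp
      (ContinuousLinearMap.fst ℝ (Linf ℝ × Linf P) (Linf E)))) fun _ _ _ => mem_univ _).2
  have h2 : UG S n fun (_ : Disc Ω × I) (x : (Linf ℝ × Linf P) × Linf E) => x.2 :=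
    UG.linear (ContinuousLinearMap.snd ℝ (Linf ℝ × Linf P) (Linf E))
  have h3 : UG S n fun (_ : Disc Ω × I) (x : (Linf ℝ × Linf P) × Linf E) => x.1.2 :=
    UG.linear ((ContinuousLinearMap.snd ℝ (Linf ℝ) (Linf P)).comp
      (ContinuousLinearMap.fst ℝ (Linf ℝ × Linf P) (Linf E)))
  exact (hF.reindex hs).comp ((h1.add h2).prodMk h3) fun _ _ _ => mem_univ _

end LatticeCores

/-! ### Dichotomy for the linearization on the lattice -/

section LatticeDichotomy

variable {J Ω I : Type} [PseudoMetricSpace I] {E : Type} [NormedAddCommGroup E]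
  [InnerProductSpace ℝ E] [FiniteDimensional ℝ E] {n : ℕ} {f : Disc J → E → E}
  {y ys : Disc J → ℝ → E} {R C : ℝ} {κ : Ω → ℤ → J}

/-- The linearization of the equation for the deviation along the orbit `j`. -/
def orbitOp (f : Disc J → E → E) (y ys : Disc J → ℝ → E) (j : Disc J) (t : ℝ) : E →L[ℝ] E :=
  normalOp (fun t => fderiv ℝ (f j) (y j t)) (ys j) (fun t => f j (y j t)) t

theorem HypFamily.orbitOp_bdd (H : HypFamily (n + 1) f y ys R C) :
    ∃ K, 0 ≤ K ∧ ∀ j t, ‖orbitOp f y ys j t‖ ≤ K := by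
  obtain ⟨K, hK⟩ := H.fderiv_UC.1
  obtain ⟨U, hU0, hU⟩ := H.exists_speed
  have hC := H.C_pos
  refine ⟨|K| + C * U, by positivity, fun j t => ?_⟩
  refine (norm_sub_le _ _).trans (add_le_add ((hK j _ (H.mem j t)).trans (le_abs_self K)) ?_)
  rw [ContinuousLinearMap.norm_smulRight_apply, innerSL_apply_norm]
  exact mul_le_mul (H.ys_bdd j t) (hU j t) (norm_nonneg _) hC.le

/-- This identity is the reason for the phase velocity `1 + ⟨ys, v⟩`: the linearization becomes the
operator of the hyperbolicity hypothesis. -/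
theorem HypFamily.fastCore_hasFDerivAt (H : HypFamily (n + 1) f y ys R C) (j : Disc J) (s : ℝ) :
    HasFDerivAt (fun v => fastCore f y ys j (s, v)) (orbitOp f y ys j s) 0 := by
  have h1 : HasFDerivAt (fun v => f j (y j s + v)) (fderiv ℝ (f j) (y j s)) 0 := by
    have h2 : HasFDerivAt (f j) (fderiv ℝ (f j) (y j s)) (y j s + 0) := by
      rw [add_zero]
      exact H.hasFDerivAt j (H.mem j s)
    exact (h2.comp (0 : E) ((hasFDerivAt_id (0 : E)).const_add (y j s)))
  have h3 : HasFDerivAt (fun v => (1 + phaseCore ys j (s, v)) • f j (y j s))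
      ((innerSL ℝ (ys j s)).smulRight (f j (y j s))) 0 :=
    ((innerSL ℝ (ys j s)).hasFDerivAt.const_add 1).smul_const _
  exact h1.sub h3

theorem HypFamily.exists_latticeOp (H : HypFamily (n + 1) f y ys R C) (κ : Ω → ℤ → J) :
    ∃ A : Disc Ω × I → Linf ℝ → Linf E →L[ℝ] Linf E,
      (∀ i φ, HasFDerivAt (fun v => latCore κ (fastCore f y ys) i (φ, v)) (A i φ) 0) ∧
      (∀ i φ v k, A i φ v k = orbitOp f y ys (κ i.1 k) (φ k) (v k)) ∧ UC univ 0 A := by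
  obtain ⟨N', hd, hN'⟩ := (H.fastCore_UC.latCore (I := I) (κ := κ)).exists_deriv
  have hz : ∀ φ : Linf ℝ, (φ, (0 : Linf E)) ∈ tube (Linf ℝ) (Linf E) 1 := fun φ =>
    LDS.mem_tube.2 (by simp)
  have h1 : ∀ i φ, HasFDerivAt (fun v => latCore κ (fastCore f y ys) i (φ, v))
      ((N' i (φ, 0)).comp (.inr ℝ _ _)) 0 := fun i φ =>
    (hd i _ (hz φ)).comp (0 : Linf E) (hasFDerivAt_prodMk_right φ 0)
  refine ⟨fun i φ => (N' i (φ, 0)).comp (.inr ℝ _ _), h1, fun i φ v k => ?_, ?_⟩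
  · have hline : ∀ {V : Type} [NormedAddCommGroup V] [NormedSpace ℝ V] (w : V),
        HasDerivAt (fun t : ℝ => t • w) w 0 := fun w => by
      simpa using (hasDerivAt_id (0 : ℝ)).smul_const w
    have e1 : HasDerivAt (fun t : ℝ => latCore κ (fastCore f y ys) i (φ, t • v) k)
        (((N' i (φ, 0)).comp (.inr ℝ _ _)) v k) 0 := by
      have h2 : HasFDerivAt (fun v => latCore κ (fastCore f y ys) i (φ, v))
        ((N' i (φ, 0)).comp (.inr ℝ _ _)) ((0 : ℝ) • v) := by rw [zero_smul]; exact h1 i φ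
      exact hasDerivAt_linf_apply (h2.comp_hasDerivAt (0 : ℝ) (hline v)) k
    have e2 : HasDerivAt (fun t : ℝ => fastCore f y ys (κ i.1 k) (φ k, t • v k))
        (orbitOp f y ys (κ i.1 k) (φ k) (v k)) 0 := by
      have h2 : HasFDerivAt (fun v => fastCore f y ys (κ i.1 k) (φ k, v))
        (orbitOp f y ys (κ i.1 k) (φ k)) ((0 : ℝ) • v k) := by
        rw [zero_smul]; exact H.fastCore_hasFDerivAt _ _
      exact h2.comp_hasDerivAt (0 : ℝ) (hline (v k))
    refine e1.unique (e2.congr_of_eventuallyEq ?_)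
    have hc : ContinuousAt (fun t : ℝ => ‖t • v‖) 0 := by fun_prop
    filter_upwards [hc.eventually_lt (continuousAt_const (y := (1 : ℝ))) (by simp)] with t ht
    rw [latCore_apply H.fastCore_UC ht]
    rfl
  · have h2 : UC univ 0 fun (i : Disc Ω × I) (φ : Linf ℝ) => N' i (φ, 0) :=
      (hN'.of_le (Nat.zero_le _)).comp (S := univ) (h := fun _ φ => (φ, (0 : Linf E)))
        (UG.linear (ContinuousLinearMap.inl ℝ (Linf ℝ) (Linf E))) fun _ φ _ => hz φ
    exact h2.clm ((ContinuousLinearMap.compL ℝ (Linf E) (Linf ℝ × Linf E) (Linf E)).flip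
      (.inr ℝ _ _))

/-- Each component is the operator of one orbit read at a phase of speed near `1`. The time change
gives a dichotomy for `q` times this operator, and removing the factor `q` is a small perturbation;
each of the two steps doubles the constant. -/
theorem HypFamily.exists_lattice_dich (H : HypFamily (n + 1) f y ys R C) :
    ∃ κ₀ > 0, κ₀ ≤ 1 / 2 ∧ ∀ {A : Disc Ω × I → Linf ℝ → Linf E →L[ℝ] Linf E},
      (∀ i φ v k, A i φ v k = orbitOp f y ys (κ i.1 k) (φ k) (v k)) → UC univ 0 A →
      ∀ i (φ q : ℝ → Linf ℝ), Continuous q → (∀ t, ‖q t - constLinf 1‖ ≤ κ₀) →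
        (∀ t, HasDerivAt φ (q t) t) → IsDich (fun t => A i (φ t)) (2 * (2 * C)) := by
  have hC := H.C_pos
  obtain ⟨K, hK0, hK⟩ := H.orbitOp_bdd
  -- The first bound keeps speeds between `1 / 2` and `2`, the second makes the perturbation at most
  -- half of what `2 * C` tolerates up to norm `1`.
  refine ⟨min (1 / 2) (1 / (4 * C * (K + 1))), by positivity, min_le_left _ _,
    fun {A} hA hAC i φ q hq hqκ hφ => ?_⟩
  obtain ⟨KA, hKA⟩ := hAC.1
  have hφc := continuous_of_hasDerivAt hφ
  refine isDich_linf (A := fun k t => orbitOp f y ys (κ i.1 k) (φ t k)) (K := KA) (fun k => ?_)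
    (hAC.2.ucont.continuous_comp i hφc fun _ => mem_univ _) (fun t => hKA i _ (mem_univ _))
    fun t v k => hA i _ v k
  have hqk : ∀ t, |q t k - 1| ≤ min (1 / 2) (1 / (4 * C * (K + 1))) := fun t => by
    have := linf_norm_apply_le (q t - constLinf (1 : ℝ)) k
    have e : (q t - constLinf (1 : ℝ) : Linf ℝ) k = q t k - 1 := by
      change q t k - constLinf (1 : ℝ) k = _
      rw [constLinf_apply]
    rw [e] at this
    exact this.trans (hqκ t)
  have hq1 : ∀ t, 1 / 2 ≤ q t k := fun t => by
    have := (abs_le.1 ((hqk t).trans (min_le_left _ _))).1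
    linarith
  have hq2 : ∀ t, q t k ≤ 2 := fun t => by
    have := (abs_le.1 ((hqk t).trans (min_le_left _ _))).2
    linarith
  have hφk : ∀ t, HasDerivAt (fun t => φ t k) (q t k) t := fun t => hasDerivAt_linf_apply (hφ t) k
  have hd := H.dich (κ i.1 k)
  have hcont : Continuous fun t => orbitOp f y ys (κ i.1 k) (φ t k) :=
    hd.cont.comp (continuous_of_hasDerivAt hφk)
  refine (hd.timeChange (q := fun t => q t k) ((evalL ℝ k).continuous.comp hq) hφk hq1
    hq2).perturb (by positivity) hcont ⟨K, fun t => hK _ _⟩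
    (κ := 1 / (4 * C * (K + 1)) * K) (fun t => ?_) ?_
  · have e : orbitOp f y ys (κ i.1 k) (φ t k) - q t k • orbitOp f y ys (κ i.1 k) (φ t k) =
        (1 - q t k) • orbitOp f y ys (κ i.1 k) (φ t k) := by rw [sub_smul, one_smul]
    change ‖orbitOp f y ys (κ i.1 k) (φ t k) - q t k • orbitOp f y ys (κ i.1 k) (φ t k)‖ ≤ _
    rw [e, norm_smul, Real.norm_eq_abs, abs_sub_comm]
    exact mul_le_mul ((hqk t).trans (min_le_right _ _)) (hK _ _) (norm_nonneg _) (by positivity)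
  · have : 2 * C * (1 / (4 * C * (K + 1)) * K) = 1 / 2 * (K / (K + 1)) := by
      field_simp
      norm_num
    rw [this]
    have : K / (K + 1) ≤ 1 := by rw [div_le_one (by positivity)]; linarith
    linarith

variable {P : Type} [NormedAddCommGroup P] [NormedSpace ℝ P]

/-- The slow field of the lattice system near a product of orbits. -/
def latSlow (κ : Ω → ℤ → J) (y ys : Disc J → ℝ → E) (g : Disc J → E → P)
    (G : I → Linf E × Linf P → Linf P) (μ ε₁ : ℝ) :
    Disc Ω × I → SlowVar (Linf ℝ) (Linf P) × Linf E → SlowVar (Linf ℝ) (Linf P) :=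
  slowField (constLinf 1) (latCore κ (phaseCore ys)) (latCore κ (parCore g y)) (latPert κ y G)
    μ ε₁

/-- The fast field of the lattice system near a product of orbits. -/
def latFast (κ : Ω → ℤ → J) (f : Disc J → E → E) (y ys : Disc J → ℝ → E)
    (F : I → Linf E × Linf P → Linf E) (μ ε₁ : ℝ) :
    Disc Ω × I → SlowVar (Linf ℝ) (Linf P) × Linf E → Linf E :=
  fastField (latCore κ (fastCore f y ys)) (latPert κ y F) μ ε₁

theorem HypFamily.exists_slowFast (H : HypFamily (n + 1) f y ys R C) (κ : Ω → ℤ → J)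
    {g : Disc J → E → P} (hg : UC (ball 0 (R + 2)) (n + 1) g) {F : I → Linf E × Linf P → Linf E}
    {G : I → Linf E × Linf P → Linf P} (hF : UC univ (n + 1) F) (hG : UC univ (n + 1) G)
    {a c ρ₀ K₀ : ℝ} (hc : 0 < c) (ha : 0 < a) (hρ₀ : 0 < ρ₀) (hK₀ : 0 < K₀) :
    ∃ ρ μ ε₁ κ₁ σz σv K ν A S, ρ ≤ ρ₀ ∧ ρ ≤ 1 ∧ 0 < μ ∧ μ ≤ 1 ∧ 0 < ε₁ ∧ ε₁ ≤ a ∧ K ≤ K₀ ∧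
      SlowFast (latSlow κ y ys g G μ ε₁) (latFast κ f y ys F μ ε₁) A S (2 * (2 * C)) ρ κ₁ σz σv
        K ν c := by
  obtain ⟨A, hA1, hA2, hA3⟩ := H.exists_latticeOp (I := I) κ
  obtain ⟨κ₀, hκ₀, -, hdich⟩ := H.exists_lattice_dich (I := I) (κ := κ)
  have hC := H.C_pos
  have h0 : ∀ φ : Linf ℝ, ‖((φ, 0) : Linf ℝ × Linf E).2‖ < 1 := fun φ => by simp
  obtain ⟨ρ, μ, ε₁, κ₁, σz, σv, K, ν, h1, h2, h3, h4, h5, h6, h7, h8⟩ :=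
    LDS.exists_slowFast (constLinf (1 : ℝ)) H.phaseCore_UC.latCore H.fastCore_UC.latCore
      (H.parCore_UC hg).latCore (H.orbit_UC.latPert hF _) (H.orbit_UC.latPert hG _)
      (fun i φ => linf_ext fun k => by
        rw [latCore_apply H.phaseCore_UC (h0 φ)]
        change inner ℝ (ys (κ i.1 k) (φ k)) (0 : E) = 0
        rw [inner_zero_right])
      (fun i φ => linf_ext fun k => by
        rw [latCore_apply H.fastCore_UC (h0 φ)]
        change f _ (y _ _ + (0 : E)) - (1 + inner ℝ (ys (κ i.1 k) (φ k)) (0 : E)) • _ = 0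
        rw [inner_zero_right, add_zero, add_zero, one_smul, sub_self]) hA1
      (C := 2 * (2 * C)) (by positivity) hκ₀ hc ha hρ₀ hK₀ (fun i => hdich hA2 hA3 i)
  exact ⟨ρ, μ, ε₁, κ₁, σz, σv, K, ν, _, _, h1, h2, h3, h4, h5, h6, h7, h8⟩

theorem HypFamily.latSlow_UC (H : HypFamily (n + 1) f y ys R C) {g : Disc J → E → P}
    (hg : UC (ball 0 (R + 2)) (n + 1) g) {G : I → Linf E × Linf P → Linf P}
    (hG : UC univ (n + 1) G) (μ ε₁ : ℝ) :
    UC (tube (SlowVar (Linf ℝ) (Linf P)) (Linf E) 1) (n + 1) (latSlow κ y ys g G μ ε₁) :=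
  UC.slowField _ H.phaseCore_UC.latCore (H.parCore_UC hg).latCore (H.orbit_UC.latPert hG _) μ ε₁

theorem HypFamily.latFast_UC (H : HypFamily (n + 1) f y ys R C)
    {F : I → Linf E × Linf P → Linf E} (hF : UC univ (n + 1) F) (μ ε₁ : ℝ) :
    UC (tube (SlowVar (Linf ℝ) (Linf P)) (Linf E) 1) (n + 1) (latFast κ f y ys F μ ε₁) :=
  UC.fastField H.fastCore_UC.latCore (H.orbit_UC.latPert hF _) μ ε₁

end LatticeDichotomy

/-! ### Correspondence between lattice solutions and slow-fast orbits -/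

section LatticeSolutions

variable {J Ω I : Type} [PseudoMetricSpace I] {E P : Type} [NormedAddCommGroup E]
  [InnerProductSpace ℝ E] [FiniteDimensional ℝ E] [NormedAddCommGroup P] [NormedSpace ℝ P]
  {n : ℕ} {f : Disc J → E → E} {g : Disc J → E → P}
  {y ys : Disc J → ℝ → E} {R C : ℝ} {κ : Ω → ℤ → J} {F : I → Linf E × Linf P → Linf E}
  {G : I → Linf E × Linf P → Linf P} {μ ε₁ : ℝ}

theorem HypFamily.latSlow_phase (H : HypFamily (n + 1) f y ys R C) (i : Disc Ω × I)
    {x : SlowVar (Linf ℝ) (Linf P) × Linf E} (hx : ‖x.2‖ < 1) (k : ℤ) :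
    (latSlow κ y ys g G μ ε₁ i x).1.1 k =
      1 + inner ℝ (ys (κ i.1 k) (x.1.1.1 k)) (x.2 k) := by
  change constLinf (1 : ℝ) k + latCore κ (phaseCore ys) i (x.1.1.1, x.2) k = _
  rw [constLinf_apply, latCore_apply H.phaseCore_UC hx]
  rfl

theorem HypFamily.latSlow_par (H : HypFamily (n + 1) f y ys R C)
    (hg : UC (ball 0 (R + 2)) (n + 1) g) (i : Disc Ω × I)
    {x : SlowVar (Linf ℝ) (Linf P) × Linf E} (hx : ‖x.2‖ < 1) (k : ℤ) :
    (latSlow κ y ys g G μ ε₁ i x).1.2 k =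
      μ • (g (κ i.1 k) (y (κ i.1 k) (x.1.1.1 k) + x.2 k) +
        (ε₁ * Real.sin x.1.2) • G i.2 (latCurve κ y i x.1.1.1 + x.2, μ⁻¹ • x.1.1.2) k) := by
  change μ • (latCore κ (parCore g y) i (x.1.1.1, x.2) k +
    (ε₁ * Real.sin x.1.2) • G i.2 _ k) = _
  rw [latCore_apply (H.parCore_UC hg) hx]
  rfl

theorem HypFamily.latFast_apply (H : HypFamily (n + 1) f y ys R C) (i : Disc Ω × I)
    {x : SlowVar (Linf ℝ) (Linf P) × Linf E} (hx : ‖x.2‖ < 1) (k : ℤ) :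
    latFast κ f y ys F μ ε₁ i x k =
      f (κ i.1 k) (y (κ i.1 k) (x.1.1.1 k) + x.2 k) -
        (1 + inner ℝ (ys (κ i.1 k) (x.1.1.1 k)) (x.2 k)) • f (κ i.1 k) (y (κ i.1 k) (x.1.1.1 k)) +
        (ε₁ * Real.sin x.1.2) • F i.2 (latCurve κ y i x.1.1.1 + x.2, μ⁻¹ • x.1.1.2) k := by
  change latCore κ (fastCore f y ys) i (x.1.1.1, x.2) k +
    (ε₁ * Real.sin x.1.2) • F i.2 _ k = _
  rw [latCore_apply H.fastCore_UC hx]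
  rfl

theorem HypFamily.latCurve_hasDerivAt (H : HypFamily (n + 1) f y ys R C) (i : Disc Ω × I)
    {Φ : ℝ → Linf ℝ} {q : Linf ℝ} {t : ℝ} (hΦ : HasDerivAt Φ q t) :
    ∃ D, HasDerivAt (fun s => latCurve κ y i (Φ s)) D t ∧
      ∀ k, D k = q k • f (κ i.1 k) (y (κ i.1 k) (Φ t k)) := by
  obtain ⟨Y', hd, -⟩ := (H.orbit_UC.latCurve (I := I) (κ := κ)).exists_deriv
  have h1 := (hd i (Φ t) (mem_univ _)).comp_hasDerivAt t hΦ
  refine ⟨_, h1, fun k => ?_⟩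
  have h2 := hasDerivAt_linf_apply h1 k
  have h3 := (H.sol (κ i.1 k) (Φ t k)).scomp t (hasDerivAt_linf_apply hΦ k)
  refine h2.unique (h3.congr_of_eventuallyEq (Eventually.of_forall fun s => ?_))
  exact latCurve_apply H.orbit_UC i (Φ s) k

/-- `X` is the field of the lattice with components `f`, `g` and coupling `ε F`, `ε G`, at least
near the orbits. -/
def IsLatticeField (κ : Ω → ℤ → J) (f : Disc J → E → E) (g : Disc J → E → P)
    (F : I → Linf E × Linf P → Linf E) (G : I → Linf E × Linf P → Linf P) (R ε : ℝ)
    (i : Disc Ω × I) (X : Linf E × Linf P → Linf E × Linf P) : Prop :=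
  ∀ x : Linf E × Linf P, (∀ k, x.1 k ∈ ball (0 : E) (R + 2)) →
    (∀ k, (X x).1 k = f (κ i.1 k) (x.1 k) + ε • F i.2 x k) ∧
    ∀ k, (X x).2 k = g (κ i.1 k) (x.1 k) + ε • G i.2 x k

/-- The point of the lattice with given phases, parameters and deviation. -/
def latPoint (κ : Ω → ℤ → J) (y : Disc J → ℝ → E) (μ : ℝ) (i : Disc Ω × I)
    (z : SlowVar (Linf ℝ) (Linf P)) (v : Linf E) : Linf E × Linf P :=
  (latCurve κ y i z.1.1 + v, μ⁻¹ • z.1.2)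

theorem IsOrbit.snd_const {ρ : ℝ} {i : Disc Ω × I} {z : ℝ → SlowVar (Linf ℝ) (Linf P)}
    {v : ℝ → Linf E}
    (h : IsOrbit (latSlow κ y ys g G μ ε₁) (latFast κ f y ys F μ ε₁) ρ i z v) (t : ℝ) :
    (z t).2 = (z 0).2 := by
  have h1 : ∀ t, HasDerivAt (fun s => (z s).2) 0 t := fun t =>
    (ContinuousLinearMap.snd ℝ (Linf ℝ × Linf P) ℝ).hasFDerivAt.comp_hasDerivAt t (h.dz t)
  exact is_const_of_deriv_eq_zero (fun t => (h1 t).differentiableAt) (fun t => (h1 t).deriv) t 0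

/-- The term `(1 + ⟨ys, v⟩) f(y)` is both the velocity of the base point and what the fast field
subtracts, so it cancels in the sum. -/
theorem HypFamily.solution_of_isOrbit (H : HypFamily (n + 1) f y ys R C)
    (hg : UC (ball 0 (R + 2)) (n + 1) g) {ρ ε : ℝ} (hρ : ρ ≤ 1) (hμ : μ ≠ 0) {i : Disc Ω × I}
    {X : Linf E × Linf P → Linf E × Linf P} (hX : IsLatticeField κ f g F G R ε i X)
    {z : ℝ → SlowVar (Linf ℝ) (Linf P)} {v : ℝ → Linf E}
    (h : IsOrbit (latSlow κ y ys g G μ ε₁) (latFast κ f y ys F μ ε₁) ρ i z v)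
    (hε : ε₁ * Real.sin (z 0).2 = ε) : IsSolution X fun t => latPoint κ y μ i (z t) (v t) := by
  intro t
  have hv1 : ‖v t‖ < 1 := (h.mem t).trans_le hρ
  have hsin : ε₁ * Real.sin (z t).2 = ε := by rw [h.snd_const t, hε]
  have hΦ : HasDerivAt (fun s => (z s).1.1) (latSlow κ y ys g G μ ε₁ i (z t, v t)).1.1 t :=
    ((ContinuousLinearMap.fst ℝ (Linf ℝ) (Linf P)).comp
      (ContinuousLinearMap.fst ℝ (Linf ℝ × Linf P) ℝ)).hasFDerivAt.comp_hasDerivAt t (h.dz t)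
  have hp : HasDerivAt (fun s => (z s).1.2) (latSlow κ y ys g G μ ε₁ i (z t, v t)).1.2 t :=
    ((ContinuousLinearMap.snd ℝ (Linf ℝ) (Linf P)).comp
      (ContinuousLinearMap.fst ℝ (Linf ℝ × Linf P) ℝ)).hasFDerivAt.comp_hasDerivAt t (h.dz t)
  obtain ⟨D, hD, hDk⟩ := H.latCurve_hasDerivAt (κ := κ) i hΦ
  have hk : ∀ k, (latPoint κ y μ i (z t) (v t)).1 k =
      y (κ i.1 k) ((z t).1.1 k) + v t k := fun k => by
    change latCurve κ y i (z t).1.1 k + v t k = _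
    rw [latCurve_apply H.orbit_UC]
  obtain ⟨hX1, hX2⟩ := hX (latPoint κ y μ i (z t) (v t)) fun k => by
    rw [hk]
    exact H.mem_add _ _ (by linarith [linf_norm_apply_le (v t) k])
  refine ((hD.add (h.dv t)).prodMk (hp.const_smul μ⁻¹)).congr_deriv ?_
  refine Prod.ext (linf_ext fun k => ?_) (linf_ext fun k => ?_)
  · change D k + latFast κ f y ys F μ ε₁ i (z t, v t) k = _
    rw [hX1, hDk, H.latSlow_phase i hv1, H.latFast_apply i hv1, hsin, hk]
    simp only [latPoint]
    abel
  · change μ⁻¹ • (latSlow κ y ys g G μ ε₁ i (z t, v t)).1.2 k = _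
    rw [hX2, H.latSlow_par hg i hv1, hsin, hk, smul_smul, inv_mul_cancel₀ hμ, one_smul]
    rfl

/-- Only componentwise phases are given. They start at `0` and have uniformly bounded speed, so they
form a Lipschitz curve of bounded sequences; continuity of the slow field then upgrades
coordinatewise derivatives to a derivative in the supremum norm. -/
theorem HypFamily.isOrbit_of_solution (H : HypFamily (n + 1) f y ys R C)
    (hg : UC (ball 0 (R + 2)) (n + 1) g) (hG : UC univ (n + 1) G)
    {ρ ε η : ℝ} (hρ0 : 0 < ρ) (hρ : ρ ≤ 1) (hμ : μ ≠ 0) {i : Disc Ω × I}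
    {X : Linf E × Linf P → Linf E × Linf P} (hX : IsLatticeField κ f g F G R ε i X)
    (hε : ε₁ * Real.sin η = ε) {x : ℝ → Linf E × Linf P} (hx : IsSolution X x)
    {φ : ℤ → ℝ → ℝ} (hφ0 : ∀ k, φ k 0 = 0)
    (hφ : ∀ k t, HasDerivAt (φ k) (1 + inner ℝ (ys (κ i.1 k) (φ k t))
      ((x t).1 k - y (κ i.1 k) (φ k t))) t)
    (hclose : ∀ k t, ‖(x t).1 k - y (κ i.1 k) (φ k t)‖ ≤ ρ / 2) :
    ∃ z v, IsOrbit (latSlow κ y ys g G μ ε₁) (latFast κ f y ys F μ ε₁) ρ i z v ∧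
      z 0 = ((0, μ • (x 0).2), η) ∧ ∀ t k, (x t).1 k = y (κ i.1 k) (φ k t) + v t k := by
  have hC := H.C_pos
  have hvel : ∀ k t, |1 + inner ℝ (ys (κ i.1 k) (φ k t))
      ((x t).1 k - y (κ i.1 k) (φ k t))| ≤ 1 + C * (ρ / 2) := fun k t => by
    refine (abs_add_le _ _).trans ?_
    rw [abs_one]
    gcongr
    exact (abs_real_inner_le_norm _ _).trans
      (mul_le_mul (H.ys_bdd _ _) (hclose k t) (norm_nonneg _) hC.le)
  have hlip : ∀ k s t, |φ k s - φ k t| ≤ (1 + C * (ρ / 2)) * |s - t| := fun k s t => by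
    have := lipschitz_of_deriv_le (convex_univ (𝕜 := ℝ) (E := ℝ)) (f := φ k)
      (fun s _ => (hφ k s).hasFDerivAt) (C := 1 + C * (ρ / 2)) (fun s _ => by
        simpa using hvel k s) (mem_univ t) (mem_univ s)
    simpa using this
  set Φ : ℝ → Linf ℝ := fun t => toLinf fun k => φ k t with hΦdef
  have hΦk : ∀ t k, Φ t k = φ k t := fun t k =>
    toLinf_apply ⟨(1 + C * (ρ / 2)) * |t|, fun k => by
      have := hlip k t 0
      rwa [hφ0, sub_zero, sub_zero] at this⟩ k
  have hΦc : Continuous Φ := by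
    refine (LipschitzWith.of_dist_le_mul (K := ⟨1 + C * (ρ / 2), by positivity⟩)
      fun s t => ?_).continuous
    rw [dist_eq_norm, Real.dist_eq]
    refine linf_norm_le fun k => ?_
    change ‖Φ s k - Φ t k‖ ≤ _
    rw [hΦk, hΦk]
    exact hlip k s t
  have hxc := continuous_of_hasDerivAt hx
  have hYc : Continuous fun t => latCurve κ y i (Φ t) :=
    (H.orbit_UC.latCurve (I := I) (κ := κ)).2.ucont.continuous_comp i hΦc fun _ => mem_univ _
  set v : ℝ → Linf E := fun t => (x t).1 - latCurve κ y i (Φ t) with hv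
  have hvk : ∀ t k, v t k = (x t).1 k - y (κ i.1 k) (φ k t) := fun t k => by
    change (x t).1 k - latCurve κ y i (Φ t) k = _
    rw [latCurve_apply H.orbit_UC, hΦk]
  have hvρ : ∀ t, ‖v t‖ < ρ := fun t =>
    lt_of_le_of_lt (linf_norm_le fun k => by rw [hvk]; exact hclose k t) (by linarith)
  set z : ℝ → SlowVar (Linf ℝ) (Linf P) := fun t => ((Φ t, μ • (x t).2), η) with hz
  have hvc : Continuous v := (continuous_fst.comp hxc).sub hYc
  have hzc : Continuous z :=
    (hΦc.prodMk ((continuous_snd.comp hxc).const_smul μ)).prodMk continuous_const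
  have hsc : Continuous fun t => latSlow κ y ys g G μ ε₁ i (z t, v t) :=
    (H.latSlow_UC hg hG μ ε₁).2.ucont.continuous_comp i (hzc.prodMk hvc)
      fun t => LDS.mem_tube.2 ((hvρ t).trans_le hρ)
  have hv1 : ∀ t, ‖v t‖ < 1 := fun t => (hvρ t).trans_le hρ
  have hΦ' : ∀ t, HasDerivAt Φ (latSlow κ y ys g G μ ε₁ i (z t, v t)).1.1 t := by
    refine hasDerivAt_linf (continuous_fst.comp (continuous_fst.comp hsc)) fun k t => ?_
    rw [H.latSlow_phase i (hv1 t)]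
    change HasDerivAt (fun s => Φ s k)
      (1 + inner ℝ (ys (κ i.1 k) (Φ t k)) (v t k)) t
    simp only [hΦk, hvk]
    exact hφ k t
  have hmem : ∀ t k, (x t).1 k ∈ ball (0 : E) (R + 2) := fun t k => by
    have := H.mem_add (κ i.1 k) (φ k t) (v := v t k)
      (by linarith [linf_norm_apply_le (v t) k, hv1 t])
    rw [hvk] at this
    simpa using this
  have hpt : ∀ t, latPoint κ y μ i (z t) (v t) = x t := fun t =>
    Prod.ext (add_sub_cancel _ _) (by
      change μ⁻¹ • μ • (x t).2 = _
      rw [smul_smul, inv_mul_cancel₀ hμ, one_smul])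
  refine ⟨z, v, ⟨hvρ, fun t => ?_, fun t => ?_⟩, ?_, fun t k => ?_⟩
  · obtain ⟨-, hX2⟩ := hX (x t) (hmem t)
    have hp : HasDerivAt (fun s => μ • (x s).2) (μ • (X (x t)).2) t :=
      ((ContinuousLinearMap.snd ℝ (Linf E) (Linf P)).hasFDerivAt.comp_hasDerivAt t
        (hx t)).const_smul μ
    refine (((hΦ' t).prodMk hp).prodMk (hasDerivAt_const t η)).congr_deriv ?_
    refine Prod.ext (Prod.ext rfl (linf_ext fun k => ?_)) rfl
    rw [H.latSlow_par hg i (hv1 t)]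
    change μ • (X (x t)).2 k = μ • (g (κ i.1 k) (y (κ i.1 k) (Φ t k) + v t k) +
      (ε₁ * Real.sin η) • G i.2 (latPoint κ y μ i (z t) (v t)) k)
    rw [hX2, hε, hpt, hΦk, hvk, add_sub_cancel]
  · obtain ⟨hX1, -⟩ := hX (x t) (hmem t)
    obtain ⟨D, hD, hDk⟩ := H.latCurve_hasDerivAt (κ := κ) i (hΦ' t)
    have hx1 : HasDerivAt (fun s => (x s).1) (X (x t)).1 t :=
      (ContinuousLinearMap.fst ℝ (Linf E) (Linf P)).hasFDerivAt.comp_hasDerivAt t (hx t)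
    refine (hx1.sub hD).congr_deriv (linf_ext fun k => ?_)
    rw [H.latFast_apply i (hv1 t)]
    change (X (x t)).1 k - D k = f (κ i.1 k) (y (κ i.1 k) (Φ t k) + v t k) -
      (1 + inner ℝ (ys (κ i.1 k) (Φ t k)) (v t k)) • f (κ i.1 k) (y (κ i.1 k) (Φ t k)) +
      (ε₁ * Real.sin η) • F i.2 (latPoint κ y μ i (z t) (v t)) k
    rw [hX1, hDk, H.latSlow_phase i (hv1 t), hε, hpt, hvk]
    change _ - (1 + inner ℝ (ys (κ i.1 k) (Φ t k)) _) • _ = _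
    rw [hΦk, add_sub_cancel]
    abel
  · have : Φ 0 = 0 := linf_ext fun k => by rw [hΦk, hφ0]; rfl
    simp only [hz, this]
  · rw [hvk]
    abel

end LatticeSolutions

/-! ### Phases of shadowing solutions -/

section PhaseTracking

theorem abs_le_of_deriv_eq_neg_add {c B : ℝ → ℝ} {M a b : ℝ} (hab : a ≤ b)
    (hc : ∀ t ∈ Icc a b, HasDerivAt c (-c t + B t) t) (hB : ∀ t ∈ Icc a b, |B t| ≤ M)
    (ha : |c a| ≤ M) : |c b| ≤ M := by
  have hd : ∀ t ∈ Icc a b, HasDerivAt (fun t => Real.exp t * c t) (Real.exp t * B t) t :=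
    fun t ht => ((Real.hasDerivAt_exp t).mul (hc t ht)).congr_deriv (by ring)
  have hM : ∀ t, HasDerivAt (fun t => Real.exp t * M) (Real.exp t * M) t := fun t =>
    (Real.hasDerivAt_exp t).mul_const M
  have := image_norm_le_of_norm_deriv_right_le_deriv_boundary'
    (f := fun t => Real.exp t * c t) (B := fun t => Real.exp t * M)
    (fun t ht => (hd t ht).continuousAt.continuousWithinAt)
    (fun t ht => (hd t (Ico_subset_Icc_self ht)).hasDerivWithinAt)
    (by
      rw [norm_mul, Real.norm_eq_abs, Real.norm_eq_abs, Real.abs_exp]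
      gcongr)
    (fun t _ => (hM t).continuousAt.continuousWithinAt)
    (fun t _ => (hM t).hasDerivWithinAt) (fun t ht => by
      rw [norm_mul, Real.norm_eq_abs, Real.norm_eq_abs, Real.abs_exp]
      gcongr
      exact hB t (Ico_subset_Icc_self ht)) (right_mem_Icc.2 hab)
  rw [norm_mul, Real.norm_eq_abs, Real.norm_eq_abs, Real.abs_exp] at this
  exact le_of_mul_le_mul_left this (Real.exp_pos b)

/-- A continuous quantity that starts below `s` stays below `s` if it cannot come close to `s` as
long as it has not exceeded `s`. -/
theorem abs_le_of_improvement {d : ℝ → ℝ} {a s s' : ℝ} (hd : Continuous d) (hs' : s' < s)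
    (ha : |d a| < s) (h : ∀ t, a ≤ t → (∀ τ ∈ Icc a t, |d τ| ≤ s) → |d t| ≤ s') (t : ℝ)
    (hat : a ≤ t) : |d t| ≤ s := by
  by_contra hcon
  push Not at hcon
  have hcomp : IsCompact (Icc a t ∩ {τ | s ≤ |d τ|}) :=
    isCompact_Icc.inter_right (isClosed_le continuous_const hd.abs)
  obtain ⟨t₀, ht₀, hmin⟩ := hcomp.exists_isLeast ⟨t, right_mem_Icc.2 hat, hcon.le⟩
  have hne : a ≠ t₀ := fun e => by
    have := ht₀.2
    rw [← e] at this
    exact absurd this (not_le.2 ha)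
  have hlt : ∀ τ ∈ Ico a t₀, |d τ| ≤ s := fun τ hτ => by
    by_contra hc
    push Not at hc
    exact absurd (hmin ⟨⟨hτ.1, hτ.2.le.trans ht₀.1.2⟩, hc.le⟩) (not_le.2 hτ.2)
  have hlt' : Ico a t₀ ⊆ {τ | |d τ| ≤ s'} := fun τ hτ =>
    h τ hτ.1 fun σ hσ => hlt σ ⟨hσ.1, hσ.2.trans_lt hτ.2⟩
  have hcl := (isClosed_le hd.abs continuous_const).closure_subset_iff.2 hlt'
  rw [closure_Ico hne] at hcl
  have h1 : |d t₀| ≤ s' := hcl (right_mem_Icc.2 ht₀.1.1)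
  have h2 : s ≤ |d t₀| := ht₀.2
  linarith

variable {J : Type} {E : Type} [NormedAddCommGroup E] [InnerProductSpace ℝ E]
  [FiniteDimensional ℝ E] {n : ℕ} {f : Disc J → E → E} {y ys : Disc J → ℝ → E} {R C : ℝ}

theorem HypFamily.orbit_remainder (H : HypFamily (n + 1) f y ys R C) {η : ℝ} (hη : 0 < η) :
    ∃ d > 0, ∀ j s t, |s - t| < d → ‖y j s - y j t - (s - t) • f j (y j t)‖ ≤ η * |s - t| := by
  obtain ⟨y', hd, hC⟩ := H.orbit_UC.exists_deriv
  obtain ⟨d, hd0, hrem⟩ := uniform_remainder convex_univ hd hC.2.ucont η hη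
  refine ⟨d, hd0, fun j s t hst => ?_⟩
  have := hrem j t (mem_univ t) s (mem_univ s) hst
  have e : y' j t (s - t) = (s - t) • f j (y j t) := by
    have h1 := (hd j t (mem_univ t)).hasDerivAt.unique (H.sol j t)
    rw [← h1, ← map_smul, smul_eq_mul, mul_one]
  rwa [e] at this

theorem HypFamily.orbit_lipschitz (H : HypFamily (n + 1) f y ys R C) {U : ℝ}
    (hU : ∀ j t, ‖f j (y j t)‖ ≤ U) (j : Disc J) (s t : ℝ) : ‖y j s - y j t‖ ≤ U * |s - t| := by
  have := lipschitz_of_deriv_le (convex_univ (𝕜 := ℝ) (E := ℝ)) (f := y j)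
    (fun s _ => (H.sol j s).hasFDerivAt) (C := U) (fun s _ => by simpa using hU j s)
    (mem_univ t) (mem_univ s)
  simpa using this

/-- The derivative of `s ↦ ⟨ys(s), x - y(s)⟩`. -/
theorem HypFamily.phase_hasDerivAt (H : HypFamily (n + 1) f y ys R C) (j : Disc J) (x : E)
    (s : ℝ) : HasDerivAt (fun s => (inner ℝ (ys j s) (x - y j s) : ℝ))
      (-inner ℝ (ys j s) (fderiv ℝ (f j) (y j s) (x - y j s)) - 1) s := by
  refine ((H.adj j s).inner ℝ ((hasDerivAt_const s x).sub (H.sol j s))).congr_deriv ?_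
  rw [zero_sub, inner_neg_right, H.normalized, inner_neg_left,
    ContinuousLinearMap.adjoint_inner_left, Pi.sub_apply]
  ring

theorem HypFamily.exists_fderiv_bound (H : HypFamily (n + 1) f y ys R C) :
    ∃ K, 0 ≤ K ∧ ∀ j t, ‖fderiv ℝ (f j) (y j t)‖ ≤ K :=
  let ⟨K, hK⟩ := H.fderiv_UC.1
  ⟨|K|, abs_nonneg K, fun j t => (hK j _ (H.mem j t)).trans (le_abs_self K)⟩

/-- The quantity `c = ⟨ys(φ), x - y(φ)⟩` measures `ψ - φ` up to small errors and satisfies `c' = -c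
+ B` with `B` small while `φ` is near `ψ`. Thus a phase solving the phase equation is attracted,
forward in time, to the shadowing phase. -/
theorem HypFamily.exists_tracking_constants (H : HypFamily (n + 1) f y ys R C) {s₀ : ℝ}
    (hs₀ : 0 < s₀) : ∃ s > 0, s ≤ s₀ ∧ ∃ δ > 0, δ ≤ s ∧ ∃ m > 0, ∀ j (x e : ℝ → E) (ψ φ : ℝ → ℝ)
      (a : ℝ), (∀ t, HasDerivAt x (f j (x t) + e t) t) → (∀ t, ‖e t‖ ≤ m) → Continuous ψ →
      (∀ t, ‖x t - y j (ψ t)‖ ≤ δ) →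
      (∀ t, HasDerivAt φ (1 + inner ℝ (ys j (φ t)) (x t - y j (φ t))) t) → φ a = ψ a →
      ∀ t, a ≤ t → |φ t - ψ t| ≤ s := by
  have hC := H.C_pos
  obtain ⟨U, hU0, hU⟩ := H.exists_speed
  obtain ⟨K, hK0, hK⟩ := H.exists_fderiv_bound
  obtain ⟨d₁, hd₁, hrem₁⟩ := H.orbit_remainder (η := 1 / (4 * C)) (by positivity)
  obtain ⟨f', hf', hfC⟩ := H.smooth.exists_deriv
  obtain ⟨d₂, hd₂, hrem₂⟩ := uniform_remainder (convex_ball _ _) hf' hfC.2.ucont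
    (1 / (16 * C * (U + 1))) (by positivity)
  have hrem₂' : ∀ j t v, ‖v‖ < d₂ → ‖v‖ < 2 →
      ‖f j (y j t + v) - f j (y j t) - fderiv ℝ (f j) (y j t) v‖ ≤
        1 / (16 * C * (U + 1)) * ‖v‖ := by
    intro j t v hv hv2
    have := hrem₂ j _ (H.mem j t) _ (H.mem_add j t hv2) (by rwa [add_sub_cancel_left])
    rwa [add_sub_cancel_left, ← (hf' j _ (H.mem j t)).fderiv] at this
  set s := min (min s₀ (d₁ / 2)) (min (min (d₂ / (2 * (U + 1))) (1 / (U + 1)))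
    (1 / (16 * (C * C * (K + 1) * (U + 1) * (U + 1))))) with hs
  have hs0 : 0 < s := by positivity
  have hsd₁ : s ≤ d₁ / 2 := (min_le_left _ _).trans (min_le_right _ _)
  have hsd₂ : (U + 1) * s ≤ d₂ / 2 := by
    have : s ≤ d₂ / (2 * (U + 1)) :=
      (min_le_right _ _).trans ((min_le_left _ _).trans (min_le_left _ _))
    rw [le_div_iff₀ (by positivity)] at this
    linarith
  have hs1 : (U + 1) * s ≤ 1 := by
    have : s ≤ 1 / (U + 1) := (min_le_right _ _).trans ((min_le_left _ _).trans (min_le_right _ _))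
    rw [le_div_iff₀ (by positivity)] at this
    linarith
  have hsK : C * C * (K + 1) * (U + 1) * (U + 1) * s ≤ 1 / 16 := by
    have : s ≤ 1 / (16 * (C * C * (K + 1) * (U + 1) * (U + 1))) :=
      (min_le_right _ _).trans (min_le_right _ _)
    rw [le_div_iff₀ (by positivity)] at this
    linarith
  set δ := min s (s / (8 * C)) with hδ
  have hδ0 : 0 < δ := by positivity
  have hδs : δ ≤ s := min_le_left _ _
  have hCδ : C * δ ≤ s / 8 := by
    have : δ ≤ s / (8 * C) := min_le_right _ _
    rw [le_div_iff₀ (by positivity)] at this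
    linarith
  refine ⟨s, hs0, (min_le_left _ _).trans (min_le_left _ _), δ, hδ0, hδs, s / (8 * C),
    by positivity, fun j x e ψ φ a hx he hψ hclose hφ ha t hat => ?_⟩
  have hφc : Continuous φ := continuous_of_hasDerivAt hφ
  -- The improved bound is `s / 4` from `c` plus `s / 8 + s / 4` from the error in replacing `φ - ψ`
  -- by `-c`.
  refine abs_le_of_improvement (d := fun t => φ t - ψ t) (s' := 5 / 8 * s) (hφc.sub hψ)
    (by linarith) (by simpa [ha] using hs0) (fun b hab hb => ?_) t hat
  set v : ℝ → E := fun t => x t - y j (φ t) with hv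
  set c : ℝ → ℝ := fun t => inner ℝ (ys j (φ t)) (v t) with hc
  have hvb : ∀ τ ∈ Icc a b, ‖v τ‖ ≤ (U + 1) * s := fun τ hτ => by
    have h1 := H.orbit_lipschitz hU j (ψ τ) (φ τ)
    rw [abs_sub_comm] at h1
    calc ‖v τ‖ ≤ ‖x τ - y j (ψ τ)‖ + ‖y j (ψ τ) - y j (φ τ)‖ := norm_sub_le_norm_sub_add_norm_sub _ _ _
      _ ≤ δ + U * s := add_le_add (hclose τ) (h1.trans (by gcongr; exact hb τ hτ))
      _ ≤ _ := by linarith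
  -- Linearization of the orbit at `φ` with `⟨ys, f(y)⟩ = 1`; `C * δ` is the shadowing error.
  have hcd : ∀ τ ∈ Icc a b, |c τ + (φ τ - ψ τ)| ≤ C * δ + 1 / 4 * |φ τ - ψ τ| := fun τ hτ => by
    have h1 : c τ + (φ τ - ψ τ) = inner ℝ (ys j (φ τ)) (x τ - y j (ψ τ)) +
        inner ℝ (ys j (φ τ)) (y j (ψ τ) - y j (φ τ) - (ψ τ - φ τ) • f j (y j (φ τ))) := by
      rw [← inner_add_right]
      have h2 : x τ - y j (ψ τ) + (y j (ψ τ) - y j (φ τ) - (ψ τ - φ τ) • f j (y j (φ τ))) =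
        v τ - (ψ τ - φ τ) • f j (y j (φ τ)) := by simp only [hv]; abel
      rw [h2, inner_sub_right, inner_smul_right, H.normalized]
      simp only [hc]
      ring
    have h3 := hrem₁ j (ψ τ) (φ τ) (by
      rw [abs_sub_comm]; exact (hb τ hτ).trans_lt (by linarith))
    rw [abs_sub_comm (ψ τ)] at h3
    rw [h1]
    refine (abs_add_le _ _).trans (add_le_add ?_ ?_)
    · exact (abs_real_inner_le_norm _ _).trans
        (mul_le_mul (H.ys_bdd _ _) (hclose τ) (norm_nonneg _) hC.le)
    · refine (abs_real_inner_le_norm _ _).trans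
        ((mul_le_mul (H.ys_bdd _ _) h3 (norm_nonneg _) hC.le).trans (le_of_eq ?_))
      field_simp
  set B : ℝ → ℝ := fun t =>
    inner ℝ (ys j (φ t)) (f j (y j (φ t) + v t) - f j (y j (φ t)) -
      fderiv ℝ (f j) (y j (φ t)) (v t)) -
      c t * inner ℝ (ys j (φ t)) (fderiv ℝ (f j) (y j (φ t)) (v t)) +
      inner ℝ (ys j (φ t)) (e t) with hB
  -- The adjoint equation cancels the linear term `⟨ys, f'(y) v⟩`, except for the factor `c` in the
  -- phase velocity; this same factor leaves `-c`.
  have hcder : ∀ t, HasDerivAt c (-c t + B t) t := fun t => by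
    have h1 := (H.adj j (φ t)).scomp t (hφ t)
    have h2 := (hx t).sub ((H.sol j (φ t)).scomp t (hφ t))
    refine (h1.inner ℝ h2).congr_deriv ?_
    have h3 : y j (φ t) + v t = x t := add_sub_cancel _ _
    simp only [Function.comp_apply, hB, h3, inner_sub_right, inner_add_right, inner_smul_right,
      inner_smul_left, inner_neg_left, ContinuousLinearMap.adjoint_inner_left, H.normalized,
      Pi.sub_apply]
    simp only [hc, hv, inner_sub_right, map_sub, RCLike.conj_to_real]
    ring
  have hBb : ∀ τ ∈ Icc a b, |B τ| ≤ s / 4 := fun τ hτ => by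
    have hvτ := hvb τ hτ
    have b1 : |inner ℝ (ys j (φ τ)) (f j (y j (φ τ) + v τ) - f j (y j (φ τ)) -
        fderiv ℝ (f j) (y j (φ τ)) (v τ))| ≤ s / 16 := by
      refine (abs_real_inner_le_norm _ _).trans ((mul_le_mul (H.ys_bdd _ _)
        (hrem₂' j (φ τ) (v τ) (hvτ.trans_lt (by linarith)) (hvτ.trans_lt (by linarith)))
        (norm_nonneg _) hC.le).trans ?_)
      calc C * (1 / (16 * C * (U + 1)) * ‖v τ‖) ≤ C * (1 / (16 * C * (U + 1)) * ((U + 1) * s)) := by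
            gcongr
        _ = s / 16 := by field_simp
    have b2 : |c τ * inner ℝ (ys j (φ τ)) (fderiv ℝ (f j) (y j (φ τ)) (v τ))| ≤ s / 16 := by
      have e1 : |c τ| ≤ C * ((U + 1) * s) := (abs_real_inner_le_norm _ _).trans
        (mul_le_mul (H.ys_bdd _ _) hvτ (norm_nonneg _) hC.le)
      have e2 : |inner ℝ (ys j (φ τ)) (fderiv ℝ (f j) (y j (φ τ)) (v τ))| ≤
          C * ((K + 1) * ((U + 1) * s)) := (abs_real_inner_le_norm _ _).trans
        (mul_le_mul (H.ys_bdd _ _) ((ContinuousLinearMap.le_opNorm _ _).trans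
          (mul_le_mul ((hK _ _).trans (by linarith)) hvτ (norm_nonneg _) (by positivity)))
          (norm_nonneg _) hC.le)
      rw [abs_mul]
      calc _ ≤ C * ((U + 1) * s) * (C * ((K + 1) * ((U + 1) * s))) :=
            mul_le_mul e1 e2 (abs_nonneg _) (by positivity)
        _ = C * C * (K + 1) * (U + 1) * (U + 1) * s * s := by ring
        _ ≤ 1 / 16 * s := by gcongr
        _ = s / 16 := by ring
    have b3 : |inner ℝ (ys j (φ τ)) (e τ)| ≤ s / 8 := by
      refine (abs_real_inner_le_norm _ _).trans
        ((mul_le_mul (H.ys_bdd _ _) (he τ) (norm_nonneg _) hC.le).trans (le_of_eq ?_))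
      field_simp
    refine (abs_add_le _ _).trans ((add_le_add ((abs_sub _ _).trans (add_le_add b1 b2)) b3).trans
      (le_of_eq (by ring)))
  have hca : |c a| ≤ s / 4 := by
    have := hcd a (left_mem_Icc.2 hab)
    rw [ha, sub_self, add_zero, abs_zero, mul_zero, add_zero] at this
    linarith
  have hcb := abs_le_of_deriv_eq_neg_add hab (fun t _ => hcder t) hBb hca
  have h1 := hcd b (right_mem_Icc.2 hab)
  have h2 := hb b (right_mem_Icc.2 hab)
  have h3 : |φ b - ψ b| ≤ |c b + (φ b - ψ b)| + |c b| := by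
    have := abs_sub (c b + (φ b - ψ b)) (c b)
    rwa [add_sub_cancel_left] at this
  change |φ b - ψ b| ≤ 5 / 8 * s
  change |φ b - ψ b| ≤ s at h2
  linarith

/-- A perturbed orbit that stays close to an orbit of the family can be assigned a phase that solves
the phase equation. -/
theorem HypFamily.exists_tracking (H : HypFamily (n + 1) f y ys R C) {s₀ : ℝ} (hs₀ : 0 < s₀) :
    ∃ δ > 0, δ ≤ s₀ ∧ ∃ m > 0, ∀ j (x e : ℝ → E) (ψ : ℝ → ℝ),
      (∀ t, HasDerivAt x (f j (x t) + e t) t) → (∀ t, ‖e t‖ ≤ m) → Continuous ψ →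
      (∀ t, ‖x t - y j (ψ t)‖ ≤ δ) → ∃ φ : ℝ → ℝ,
        (∀ t, HasDerivAt φ (1 + inner ℝ (ys j (φ t)) (x t - y j (φ t))) t) ∧
        ∀ t, |φ t - ψ t| ≤ s₀ := by
  have hC := H.C_pos
  obtain ⟨s, hs0, hss₀, δ, hδ0, hδs, m, hm0, htrack⟩ := H.exists_tracking_constants hs₀
  obtain ⟨K, hK0, hK⟩ := H.exists_fderiv_bound
  refine ⟨δ, hδ0, hδs.trans hss₀, m, hm0, fun j x e ψ hx he hψ hclose => ?_⟩
  have hR0 : 0 ≤ R := (norm_nonneg _).trans (H.bdd j 0)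
  have hxc := continuous_of_hasDerivAt hx
  have hyc := continuous_of_hasDerivAt (H.sol j)
  have hysc := continuous_of_hasDerivAt (H.adj j)
  have hxb : ∀ t σ, ‖x t - y j σ‖ ≤ δ + 2 * R := fun t σ => by
    calc ‖x t - y j σ‖ ≤ ‖x t - y j (ψ t)‖ + ‖y j (ψ t) - y j σ‖ :=
          norm_sub_le_norm_sub_add_norm_sub _ _ _
      _ ≤ δ + (R + R) := add_le_add (hclose t)
          ((norm_sub_le _ _).trans (add_le_add (H.bdd j _) (H.bdd j _)))
      _ = _ := by ring
  set B : ℝ → ℝ → ℝ := fun t σ => 1 + inner ℝ (ys j σ) (x t - y j σ) with hB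
  have hBc : Continuous fun p : ℝ × ℝ => B p.1 p.2 := by
    simp only [hB]
    exact continuous_const.add ((hysc.comp continuous_snd).inner
      ((hxc.comp continuous_fst).sub (hyc.comp continuous_snd)))
  set L := C * (K * (δ + 2 * R)) + 1 with hL
  have hL0 : 0 ≤ L := by positivity
  have hlip : ∀ t σ τ, ‖B t σ - B t τ‖ ≤ L * ‖σ - τ‖ := fun t σ τ => by
    refine lipschitz_of_deriv_le (convex_univ (𝕜 := ℝ) (E := ℝ)) (f := B t)
      (fun σ _ => ((H.phase_hasDerivAt j (x t) σ).const_add 1).hasFDerivAt) (fun σ _ => ?_)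
      (mem_univ τ) (mem_univ σ)
    have : ‖-inner ℝ (ys j σ) (fderiv ℝ (f j) (y j σ) (x t - y j σ)) - 1‖ ≤ L := by
      refine (norm_sub_le _ _).trans (add_le_add ?_ norm_one.le)
      rw [norm_neg]
      exact (norm_inner_le_norm _ _).trans (mul_le_mul (H.ys_bdd _ _)
        ((ContinuousLinearMap.le_opNorm _ _).trans
          (mul_le_mul (hK _ _) (hxb _ _) (norm_nonneg _) hK0)) (norm_nonneg _) hC.le)
    simpa using this
  have hB0 : ∀ t, ‖B t 0‖ ≤ 1 + C * (δ + 2 * R) := fun t => by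
    refine (norm_add_le _ _).trans (add_le_add norm_one.le ?_)
    exact (norm_inner_le_norm _ _).trans
      (mul_le_mul (H.ys_bdd _ _) (hxb _ _) (norm_nonneg _) hC.le)
  -- Tracking works only forward in time. Phases started on `ψ` at time `-N` stay close to it on
  -- `[-N, ∞)`, and a limit as `N → ∞` is close on the whole line.
  have hstart : ∀ N : ℕ, ∃ z : ℝ → ℝ, z (-N) = ψ (-N) ∧ ∀ t, HasDerivAt z (B t (z t)) t := by
    intro N
    obtain ⟨z, hz0, hz⟩ := exists_global_solution (fun t => B (t - N))
      (hBc.comp ((continuous_fst.sub continuous_const).prodMk continuous_snd)) hL0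
      (fun t => hlip (t - N)) (fun t => hB0 (t - N)) (ψ (-N))
    refine ⟨fun t => z (t + N), by simpa using hz0, fun t => ?_⟩
    have := (hz (t + N)).comp_add_const t (N : ℝ)
    simpa using this
  choose z hz0 hz using hstart
  have hzs : ∀ (N : ℕ) t, -(N : ℝ) ≤ t → |z N t - ψ t| ≤ s := fun N =>
    htrack j x e ψ (z N) (-N) hx he hψ hclose (hz N) (hz0 N)
  obtain ⟨φ, sub, hsub, hφ, hlim⟩ := exists_limit_solution hBc hL0 hlip hB0 (z := z)
    (R := |ψ 0| + s) (fun N t _ => hz N t) (fun N => by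
      have h1 := hzs N 0 (by simp)
      have h2 := abs_add_le (ψ 0) (z N 0 - ψ 0)
      rw [add_sub_cancel] at h2
      rw [Real.norm_eq_abs]
      linarith)
  refine ⟨φ, hφ, fun t => ?_⟩
  refine le_of_tendsto ((hlim t).sub_const (ψ t)).abs ?_
  obtain ⟨N, hN⟩ := exists_nat_ge (-t)
  filter_upwards [eventually_ge_atTop N] with i hi
  refine (hzs _ t ?_).trans hss₀
  have : (N : ℝ) ≤ sub i := by exact_mod_cast hi.trans (hsub.id_le i)
  linarith

end PhaseTracking

/-! ### The hypotheses on `f`, `g`, `F`, `G` in the uniform smoothness classes -/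

section UniformFamilies

variable {E F : Type} [NormedAddCommGroup E] [NormedSpace ℝ E] [NormedAddCommGroup F]
  [NormedSpace ℝ F] {r : ℕ}

theorem IsUniformFamily.UG {h : ℤ → E → F} (hh : IsUniformFamily r h) :
    UG univ r fun k : Disc ℤ => h k := by
  obtain ⟨C, hC⟩ := hh.bounded_deriv
  refine UG.of_iteratedFDeriv (fun k => hh.contDiff k)
    (fun j hj hj1 => ⟨C, fun k z => hC k j hj1 hj z⟩) fun j hj => UCont.of_disc fun η hη => ?_
  obtain ⟨d, hd, H⟩ := Metric.uniformEquicontinuous_iff.1 (hh.unifCont j hj) η hη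
  exact ⟨d, hd, fun k x _ z _ hxz => by
    rw [← dist_eq_norm]
    exact (H x z hxz k).le⟩

theorem IsUniformFamily.UC (hr : 1 ≤ r) {h : ℤ → E → F} (hh : IsUniformFamily r h) (ρ : ℝ) :
    UC (ball 0 ρ) r fun k : Disc ℤ => h k := by
  obtain ⟨n, rfl⟩ : ∃ n, r = n + 1 := ⟨r - 1, by omega⟩
  obtain ⟨L, hL0, hL⟩ := hh.UG.exists_lipschitz convex_univ
  obtain ⟨C, hC⟩ := hh.bounded_zero
  refine ⟨⟨C + L * ρ, fun k z hz => ?_⟩, hh.UG.mono (subset_univ _)⟩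
  have h1 := hL k 0 (mem_univ _) z (mem_univ _)
  rw [sub_zero] at h1
  calc ‖h k z‖ ≤ ‖h k 0‖ + ‖h k z - h k 0‖ := by
        have := norm_add_le (h k 0) (h k z - h k 0)
        rwa [add_sub_cancel] at this
    _ ≤ C + L * ρ := add_le_add (hC k)
        (h1.trans (by gcongr; exact (mem_ball_zero_iff.1 hz).le))

/-- Values of the perturbation parameter. -/
abbrev ParamIcc (a : ℝ) : Type := {ε : ℝ // ε ∈ Icc (-a) a}

/-- Compactness of `[-b, b]` turns bounds and moduli near each parameter value into uniform ones;
this is why the parameter is confined to a closed interval strictly inside `(-a, a)`. -/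
theorem IsCrContinuousFamily.UC {a b : ℝ} (hba : b < a) {h : ℝ → E → F}
    (hh : IsCrContinuousFamily r a h) : UC univ r fun ε : ParamIcc b => h ε := by
  have hlt : ∀ ε ∈ Icc (-b) b, |ε| < a := fun ε hε => (abs_le.2 hε).trans_lt hba
  have hbd : ∀ j ≤ r, ∃ C, ∀ ε ∈ Icc (-b) b, ∀ x, ‖iteratedFDeriv ℝ j (h ε) x‖ ≤ C := by
    intro j hj
    refine (isCompact_Icc (a := -b) (b := b)).induction_on
      (p := fun s => ∃ C, ∀ ε ∈ s ∩ Icc (-b) b, ∀ x, ‖iteratedFDeriv ℝ j (h ε) x‖ ≤ C)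
      ⟨0, by simp⟩ (fun s t hst ⟨C, hC⟩ => ⟨C, fun ε hε => hC ε ⟨hst hε.1, hε.2⟩⟩)
      (fun s t ⟨C, hC⟩ ⟨C', hC'⟩ => ⟨max C C', fun ε hε x => ?_⟩) (fun ε₁ hε₁ => ?_) |>.imp
      fun C hC ε hε => hC ε ⟨hε, hε⟩
    · rcases hε.1 with h1 | h1
      · exact (hC ε ⟨h1, hε.2⟩ x).trans (le_max_left _ _)
      · exact (hC' ε ⟨h1, hε.2⟩ x).trans (le_max_right _ _)
    · obtain ⟨C, hC⟩ := (hh.isCr ε₁ (hlt ε₁ hε₁)).bounded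
      obtain ⟨d, hd, H⟩ := hh.continuous ε₁ (hlt ε₁ hε₁) 1 one_pos
      refine ⟨ball ε₁ d, mem_nhdsWithin_of_mem_nhds (ball_mem_nhds _ hd), 1 + C, fun ε hε x => ?_⟩
      have h1 := H ε (hlt ε hε.2) (by rw [← Real.dist_eq]; exact hε.1) j hj x
      have h2 := norm_add_le (iteratedFDeriv ℝ j (h ε) x - iteratedFDeriv ℝ j (h ε₁) x)
        (iteratedFDeriv ℝ j (h ε₁) x)
      rw [sub_add_cancel] at h2
      exact h2.trans (add_le_add h1 (hC j hj x))
  have hu : ∀ j ≤ r, ∀ η > 0, ∃ d > 0, ∀ ε ∈ Icc (-b) b, ∀ ε' ∈ Icc (-b) b, dist ε ε' < d →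
      ∀ x x', dist x x' < d →
      ‖iteratedFDeriv ℝ j (h ε) x - iteratedFDeriv ℝ j (h ε') x'‖ ≤ η := by
    intro j hj η hη
    refine (?_ : ∃ d > 0, ∀ ε ∈ Icc (-b) b ∩ Icc (-b) b, ∀ ε' ∈ Icc (-b) b, dist ε ε' < d →
        ∀ x x', dist x x' < d →
        ‖iteratedFDeriv ℝ j (h ε) x - iteratedFDeriv ℝ j (h ε') x'‖ ≤ η).imp
      fun d H => ⟨H.1, fun ε hε => H.2 ε ⟨hε, hε⟩⟩
    refine (isCompact_Icc (a := -b) (b := b)).induction_on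
      (p := fun s => ∃ d > 0, ∀ ε ∈ s ∩ Icc (-b) b, ∀ ε' ∈ Icc (-b) b, dist ε ε' < d →
        ∀ x x', dist x x' < d →
        ‖iteratedFDeriv ℝ j (h ε) x - iteratedFDeriv ℝ j (h ε') x'‖ ≤ η)
      ⟨1, one_pos, by simp⟩
      (fun s t hst ⟨d, hd, H⟩ => ⟨d, hd, fun ε hε => H ε ⟨hst hε.1, hε.2⟩⟩)
      (fun s t ⟨d, hd, H⟩ ⟨d', hd', H'⟩ => ⟨min d d', lt_min hd hd',
        fun ε hε ε' hε' h1 x x' h2 => ?_⟩) (fun ε₁ hε₁ => ?_)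
    · rcases hε.1 with h3 | h3
      · exact H ε ⟨h3, hε.2⟩ ε' hε' (h1.trans_le (min_le_left _ _)) x x'
          (h2.trans_le (min_le_left _ _))
      · exact H' ε ⟨h3, hε.2⟩ ε' hε' (h1.trans_le (min_le_right _ _)) x x'
          (h2.trans_le (min_le_right _ _))
    · obtain ⟨d, hd, H⟩ := hh.continuous ε₁ (hlt ε₁ hε₁) (η / 3) (by positivity)
      obtain ⟨d', hd', H'⟩ := Metric.uniformContinuous_iff.1
        ((hh.isCr ε₁ (hlt ε₁ hε₁)).unifCont j hj) (η / 3) (by positivity)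
      refine ⟨ball ε₁ (d / 2), mem_nhdsWithin_of_mem_nhds (ball_mem_nhds _ (by positivity)),
        min (d / 2) d', by positivity, fun ε hε ε' hε' h1 x x' h2 => ?_⟩
      have e1 : dist ε ε₁ < d / 2 := hε.1
      have e2 : dist ε' ε₁ < d := by
        have := dist_triangle ε' ε ε₁
        rw [dist_comm ε' ε] at this
        linarith [h1.trans_le (min_le_left _ _)]
      have k1 := H ε (hlt ε hε.2) (by rw [← Real.dist_eq]; linarith) j hj x
      have k2 := H ε' (hlt ε' hε') (by rw [← Real.dist_eq]; exact e2) j hj x'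
      have k3 := (H' (h2.trans_le (min_le_right _ _))).le
      rw [dist_eq_norm] at k3
      rw [norm_sub_rev] at k2
      calc _ ≤ ‖iteratedFDeriv ℝ j (h ε) x - iteratedFDeriv ℝ j (h ε₁) x‖ +
            (‖iteratedFDeriv ℝ j (h ε₁) x - iteratedFDeriv ℝ j (h ε₁) x'‖ +
            ‖iteratedFDeriv ℝ j (h ε₁) x' - iteratedFDeriv ℝ j (h ε') x'‖) :=
            (norm_sub_le_norm_sub_add_norm_sub _ _ _).trans
              (add_le_add le_rfl (norm_sub_le_norm_sub_add_norm_sub _ _ _))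
        _ ≤ η := by linarith
  refine ⟨?_, UG.of_iteratedFDeriv (fun ε => (hh.isCr ε (hlt ε ε.2)).contDiff)
    (fun j hj _ => let ⟨C, hC⟩ := hbd j hj; ⟨C, fun ε x => hC ε ε.2 x⟩) fun j hj η hη => ?_⟩
  · obtain ⟨C, hC⟩ := hbd 0 (Nat.zero_le _)
    refine ⟨C, fun ε x _ => ?_⟩
    rw [← norm_iteratedFDeriv_zero (𝕜 := ℝ) (f := h ε)]
    exact hC ε ε.2 x
  · obtain ⟨d, hd, H⟩ := hu j hj η hη
    exact ⟨d, hd, fun ε ε' x x' _ _ h1 h2 => H ε ε.2 ε' ε'.2 h1 x x' h2⟩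

end UniformFamilies

/-! ### The family of all orbits of all the hyperbolic sets -/

section OrbitFamilies

variable {n : ℕ}

/-- Orbits in one of the sets `Λ k`. -/
def OrbitIndex (f : ℤ → EuclideanSpace ℝ (Fin n) → EuclideanSpace ℝ (Fin n))
    (Λ : ℤ → Set (EuclideanSpace ℝ (Fin n))) : Type :=
  {q : ℤ × (ℝ → EuclideanSpace ℝ (Fin n)) // IsOrbitIn (f q.1) (Λ q.1) q.2}

variable {f : ℤ → EuclideanSpace ℝ (Fin n) → EuclideanSpace ℝ (Fin n)}
  {Λ : ℤ → Set (EuclideanSpace ℝ (Fin n))}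

/-- The lattice site of an orbit. -/
def orbitSite (j : Disc (OrbitIndex f Λ)) : ℤ := j.1.1

/-- The orbit itself. -/
def orbitCurve (j : Disc (OrbitIndex f Λ)) : ℝ → EuclideanSpace ℝ (Fin n) := j.1.2

theorem orbitCurve_isOrbitIn (j : Disc (OrbitIndex f Λ)) :
    IsOrbitIn (f (orbitSite j)) (Λ (orbitSite j)) (orbitCurve j) := j.2

theorem uIndex_orbitSite :
    UIndex (ι := Disc ℤ) fun j : Disc (OrbitIndex f Λ) => orbitSite j :=
  uIndex_of_eq fun _ _ h => by rw [Disc.eq_of_dist_lt h]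

theorem IsOrbitIn.shift {f : EuclideanSpace ℝ (Fin n) → EuclideanSpace ℝ (Fin n)}
    {Λ : Set (EuclideanSpace ℝ (Fin n))} {y : ℝ → EuclideanSpace ℝ (Fin n)}
    (h : IsOrbitIn f Λ y) (θ : ℝ) : IsOrbitIn f Λ fun t => y (θ + t) :=
  ⟨fun t => (h.1 (θ + t)).comp_const_add θ t, fun _ => h.2 _⟩

theorem IsNormalizedAdjoint.shift {f : EuclideanSpace ℝ (Fin n) → EuclideanSpace ℝ (Fin n)}
    {C : ℝ} {y ys : ℝ → EuclideanSpace ℝ (Fin n)} (h : IsNormalizedAdjoint f C y ys) (θ : ℝ) :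
    IsNormalizedAdjoint f C (fun t => y (θ + t)) fun t => ys (θ + t) :=
  ⟨fun t => (h.solves (θ + t)).comp_const_add θ t, fun _ => h.normalized _,
    fun _ => h.bounded _⟩

theorem exists_linear_solution {E : Type} [NormedAddCommGroup E] [NormedSpace ℝ E]
    [CompleteSpace E] {A : ℝ → E →L[ℝ] E} (hA : Continuous A) {K : ℝ} (hK : ∀ t, ‖A t‖ ≤ K)
    (T : ℝ) (x : E) : ∃ w : ℝ → E, w T = x ∧ ∀ t, HasDerivAt w (A t (w t)) t := by
  obtain ⟨w, hw0, hw⟩ := exists_global_solution (fun t x => A (t + T) x)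
    ((hA.comp (continuous_fst.add continuous_const)).clm_apply continuous_snd)
    ((norm_nonneg _).trans (hK 0)) (fun t x y => by
      rw [← map_sub]
      exact ContinuousLinearMap.le_of_opNorm_le _ (hK _) _) (B₀ := 0) (by simp) x
  refine ⟨fun t => w (t - T), by simpa using hw0, fun t => ?_⟩
  have := (hw (t - T)).comp_sub_const t T
  simpa using this

theorem IsHyperbolicSplitting.exists_split
    {f : EuclideanSpace ℝ (Fin n) → EuclideanSpace ℝ (Fin n)}
    {Λ : Set (EuclideanSpace ℝ (Fin n))}
    {Ns Nu : EuclideanSpace ℝ (Fin n) → Submodule ℝ (EuclideanSpace ℝ (Fin n))}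
    (h : IsHyperbolicSplitting f Λ Ns Nu) {y : ℝ → EuclideanSpace ℝ (Fin n)}
    (hy : IsOrbitIn f Λ y) (hA : Continuous fun t => fderiv ℝ f (y t)) {K : ℝ}
    (hK : ∀ t, ‖fderiv ℝ f (y t)‖ ≤ K) :
    HasSplitting (fun t => fderiv ℝ f (y t)) fun t => f (y t) := by
  intro T x
  have htop := (h.directSum (y T) (hy.2 T)).submodule_iSup_eq_top
  have hle : (⊤ : Submodule ℝ (EuclideanSpace ℝ (Fin n))) ≤
      Ns (y T) ⊔ Nu (y T) ⊔ Submodule.span ℝ {f (y T)} := by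
    rw [← htop]
    refine iSup_le fun i => ?_
    fin_cases i
    · exact le_sup_of_le_left le_sup_left
    · exact le_sup_of_le_left le_sup_right
    · exact le_sup_right
  obtain ⟨ab, hab, d, hd, hx⟩ := Submodule.mem_sup.1 (hle (Submodule.mem_top (x := x)))
  obtain ⟨a, ha, b, hb, rfl⟩ := Submodule.mem_sup.1 hab
  obtain ⟨c, rfl⟩ := Submodule.mem_span_singleton.1 hd
  obtain ⟨ws, hwsT, hws⟩ := exists_linear_solution hA hK T a
  obtain ⟨wu, hwuT, hwu⟩ := exists_linear_solution hA hK T b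
  refine ⟨ws, wu, c, by rw [hwsT, hwuT, hx], hws, hwu, ?_, ?_⟩
  · obtain ⟨D, α, hα, hD⟩ := h.contracts_stable y hy
    have hmem := h.invariant_stable y hy ws hws T (by rwa [hwsT])
    have h1 : Tendsto (fun t => D * Real.exp (-α * (t - T)) * ‖ws T‖) atTop (𝓝 0) := by
      have e : Tendsto (fun t => -α * (t - T)) atTop atBot :=
        (tendsto_atTop_add_const_right _ (-T) tendsto_id).const_mul_atTop_of_neg (by linarith)
      simpa using ((Real.tendsto_exp_atBot.comp e).const_mul D).mul_const ‖ws T‖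
    refine squeeze_zero_norm' ?_ h1
    filter_upwards [eventually_ge_atTop T] with t ht
    exact hD ws hws hmem T t ht
  · obtain ⟨D, α, hα, hD⟩ := h.contracts_unstable y hy
    have hmem := h.invariant_unstable y hy wu hwu T (by rwa [hwuT])
    have h1 : Tendsto (fun s => D * Real.exp (-α * (T - s)) * ‖wu T‖) atBot (𝓝 0) := by
      have e : Tendsto (fun s => -α * (T - s)) atBot atBot := by
        have : Tendsto (fun s : ℝ => α * (s - T)) atBot atBot :=
          (tendsto_atBot_add_const_right _ (-T) tendsto_id).const_mul_atBot hα
        refine this.congr fun s => by ring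
      simpa using ((Real.tendsto_exp_atBot.comp e).const_mul D).mul_const ‖wu T‖
    refine squeeze_zero_norm' ?_ h1
    filter_upwards [eventually_le_atBot T] with s hs
    exact hD wu hwu hmem s T hs

/-- Its pairing is `0` with the values of decaying solutions and `1` with the flow direction, and
these span. Consequently adjoint solutions chosen separately for two time translates of an orbit are
translates of each other. -/
theorem IsNormalizedAdjoint.unique {f : EuclideanSpace ℝ (Fin n) → EuclideanSpace ℝ (Fin n)}
    {C C' : ℝ} {y ys ys' : ℝ → EuclideanSpace ℝ (Fin n)} (h : IsNormalizedAdjoint f C y ys)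
    (h' : IsNormalizedAdjoint f C' y ys')
    (hsplit : HasSplitting (fun t => fderiv ℝ f (y t)) fun t => f (y t)) : ys = ys' := by
  funext T
  refine ext_inner_right ℝ fun x => ?_
  obtain ⟨ws, wu, c, rfl, hws, hwu, hls, hlu⟩ := hsplit T x
  have key : ∀ {C : ℝ} {ys : ℝ → EuclideanSpace ℝ (Fin n)}, IsNormalizedAdjoint f C y ys →
      inner ℝ (ys T) (ws T + wu T + c • f (y T)) = c := fun h => by
    rw [inner_add_right, inner_add_right,
      inner_adjoint_eq_zero (A := fun t => fderiv ℝ f (y t)) h.solves hws h.bounded hls,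
      inner_adjoint_eq_zero (A := fun t => fderiv ℝ f (y t)) h.solves hwu h.bounded hlu,
      inner_smul_right, h.normalized]
    ring
  rw [key h, key h']

/-- The last clause, compatibility with time shifts, makes the sections of shifted orbits fit
together into one manifold. -/
theorem exists_hypFamily {r : ℕ} (hr : 1 ≤ r) (hf : IsUniformFamily r f)
    (hΛ : ∃ R : ℝ, ∀ k, ∀ y ∈ Λ k, ‖y‖ ≤ R) (hyp : UniformlyHyperbolic f Λ) :
    ∃ (ys : Disc (OrbitIndex f Λ) → ℝ → EuclideanSpace ℝ (Fin n)) (R C : ℝ),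
      HypFamily r (fun j => f (orbitSite j)) orbitCurve ys R C ∧
      ∀ (i j : Disc (OrbitIndex f Λ)) (θ : ℝ), orbitSite i = orbitSite j →
        (∀ t, orbitCurve i t = orbitCurve j (θ + t)) → ∀ t, ys i t = ys j (θ + t) := by
  obtain ⟨R, hR⟩ := hΛ
  obtain ⟨hsplit, C, hC⟩ := hyp
  choose ys hys hest using fun j : Disc (OrbitIndex f Λ) => hC _ _ (orbitCurve_isOrbitIn j)
  have hsmooth : UC (ball 0 (R + 2)) r fun j : Disc (OrbitIndex f Λ) => f (orbitSite j) :=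
    UC.reindex (ι := Disc ℤ) (e := fun j => orbitSite j) uIndex_orbitSite (hf.UC hr (R + 2))
  have hbdd : ∀ (j : Disc (OrbitIndex f Λ)) t, ‖orbitCurve j t‖ ≤ R := fun j t =>
    hR _ _ ((orbitCurve_isOrbitIn j).2 t)
  have hmem : ∀ (j : Disc (OrbitIndex f Λ)) t, orbitCurve j t ∈
      ball (0 : EuclideanSpace ℝ (Fin n)) (R + 2) := fun j t =>
    mem_ball_zero_iff.2 (by linarith [hbdd j t])
  have hdiff : ∀ k, ContDiff ℝ 1 (f k) := fun k =>
    (hf.contDiff k).of_le (by exact_mod_cast hr)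
  have hAc : ∀ j : Disc (OrbitIndex f Λ),
      Continuous fun t => fderiv ℝ (f (orbitSite j)) (orbitCurve j t) := fun j =>
    ((hdiff _).continuous_fderiv one_ne_zero).comp
      (continuous_of_hasDerivAt (orbitCurve_isOrbitIn j).1)
  obtain ⟨K, hK⟩ := hf.bounded_deriv
  have hAK : ∀ (j : Disc (OrbitIndex f Λ)) t,
      ‖fderiv ℝ (f (orbitSite j)) (orbitCurve j t)‖ ≤ K := fun j t => by
    have := hK (orbitSite j) 1 le_rfl hr (orbitCurve j t)
    rwa [← norm_iteratedFDeriv_fderiv, norm_iteratedFDeriv_zero] at this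
  have hsp : ∀ j : Disc (OrbitIndex f Λ), HasSplitting
      (fun t => fderiv ℝ (f (orbitSite j)) (orbitCurve j t))
      fun t => f (orbitSite j) (orbitCurve j t) := fun j => by
    obtain ⟨Ns, Nu, h⟩ := hsplit (orbitSite j)
    exact h.exists_split (orbitCurve_isOrbitIn j) (hAc j) (hAK j)
  obtain ⟨U, hU⟩ := hsmooth.1
  refine ⟨ys, R, max C 1, ⟨by positivity, fun j => (orbitCurve_isOrbitIn j).1, hbdd, hsmooth,
    fun j => (hys j).solves, fun j => (hys j).normalized,
    fun j t => ((hys j).bounded t).trans (le_max_left _ _), fun j => ?_⟩, ?_⟩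
  · refine isDich_normalOp (hAc j) (hAK j) (hys j).solves (fun t => ?_) (hys j).normalized
      (hys j).bounded (fun t => hU j _ (hmem j t)) (hsp j) fun h v M hh hM hB hv t => ?_
    · exact ((hdiff _).differentiable one_ne_zero _).hasFDerivAt.comp_hasDerivAt t
        ((orbitCurve_isOrbitIn j).1 t)
    · have hM0 : 0 ≤ M := (norm_nonneg _).trans (hM 0)
      exact (hest j h v M hh hM hB hv t).trans (by gcongr; exact le_max_left _ _)
  · intro i j θ hij hcurve t
    have h1 := (hys j).shift θ
    have h2 : (fun t => orbitCurve j (θ + t)) = orbitCurve i := funext fun t => (hcurve t).symm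
    rw [h2, ← hij] at h1
    rw [(hys i).unique h1 (hsp i)]

end OrbitFamilies

/-! ### Families vanishing at parameter zero -/

section VanishingFamilies

variable {ι : Type} [PseudoMetricSpace ι] {X : Type} [NormedAddCommGroup X] [NormedSpace ℝ X]

/-- Derivatives in `x` also vanish at `η = 0`, and those of order below `n` are Lipschitz in `η`.
The order spent on this is why only the `C^{r-1}` norm is `O(ε)`. -/
theorem UC.exists_linear_bound : ∀ {j n : ℕ} {E : Type} [NormedAddCommGroup E] [NormedSpace ℝ E]
    {h : ι → X × ℝ → E}, j < n → UC univ n h → (∀ i x, h i (x, 0) = 0) →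
    ∃ K, 0 ≤ K ∧ ∀ i x η, ‖iteratedFDeriv ℝ j (fun x => h i (x, η)) x‖ ≤ K * |η|
  | 0, n, E, _, _, h, hj, hh, h0 => by
    obtain ⟨K, hK0, hK⟩ := (hh.2.of_le (show 0 + 1 ≤ n by omega)).exists_lipschitz convex_univ
    refine ⟨K, hK0, fun i x η => ?_⟩
    have := hK i (x, 0) (mem_univ _) (x, η) (mem_univ _)
    rw [norm_iteratedFDeriv_zero]
    simpa [h0, Prod.norm_def] using this
  | j + 1, n + 1, E, _, _, h, hj, hh, h0 => by
    obtain ⟨h', hd, hh'⟩ := hh.exists_deriv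
    have hx : ∀ i x η, HasFDerivAt (fun x => h i (x, η))
        ((h' i (x, η)).comp (.inl ℝ X ℝ)) x := fun i x η =>
      (hd i (x, η) (mem_univ _)).comp x (hasFDerivAt_prodMk_left x η)
    have hg : UC univ n fun i z => (h' i z).comp (.inl ℝ X ℝ) :=
      hh'.clm ((ContinuousLinearMap.compL ℝ X (X × ℝ) E).flip (.inl ℝ X ℝ))
    obtain ⟨K, hK0, hK⟩ := UC.exists_linear_bound (Nat.lt_of_succ_lt_succ hj) hg fun i x => by
      have h1 := hx i x 0
      simp only [h0] at h1
      exact h1.unique (hasFDerivAt_const 0 x)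
    refine ⟨K, hK0, fun i x η => ?_⟩
    rw [← norm_iteratedFDeriv_fderiv]
    have : fderiv ℝ (fun x => h i (x, η)) = fun x => (h' i (x, η)).comp (.inl ℝ X ℝ) :=
      funext fun x => (hx i x η).fderiv
    rw [this]
    exact hK i x η

end VanishingFamilies

/-! ### Equivariance under phase shifts -/

section ShiftedPhases

variable {J Ω I : Type} [PseudoMetricSpace I] {E P : Type} [NormedAddCommGroup E]
  [InnerProductSpace ℝ E] [FiniteDimensional ℝ E] [NormedAddCommGroup P] [NormedSpace ℝ P]
  {f : Disc J → E → E} {g : Disc J → E → P}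
  {y ys : Disc J → ℝ → E} {κ : Ω → ℤ → J} {F : I → Linf E × Linf P → Linf E}
  {G : I → Linf E × Linf P → Linf P} {μ ε₁ : ℝ}

/-- The data of the lattice `i'` are those of `i`, with all phases shifted by `Φ`. -/
structure IsShift (κ : Ω → ℤ → J) (f : Disc J → E → E) (g : Disc J → E → P)
    (y ys : Disc J → ℝ → E) (Φ : Linf ℝ) (i' i : Disc Ω × I) : Prop where
  par : i'.2 = i.2
  field : ∀ k, f (κ i'.1 k) = f (κ i.1 k)
  field_par : ∀ k, g (κ i'.1 k) = g (κ i.1 k)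
  curve : ∀ k t, y (κ i'.1 k) t = y (κ i.1 k) (Φ k + t)
  adjoint : ∀ k t, ys (κ i'.1 k) t = ys (κ i.1 k) (Φ k + t)

theorem latCore_shift {W : Type} [NormedAddCommGroup W] {h : Disc J → ℝ × E → W} {Φ : Linf ℝ}
    {i' i : Disc Ω × I}
    (hs : ∀ k s v, h (κ i'.1 k) (s, v) = h (κ i.1 k) (Φ k + s, v)) (φ : Linf ℝ) (v : Linf E) :
    latCore κ h i' (φ, v) = latCore κ h i (Φ + φ, v) := by
  refine congrArg toLinf (funext fun k => ?_)
  rw [pairL_apply, pairL_apply]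
  exact hs k _ _

theorem latCurve_shift {Φ : Linf ℝ} {i' i : Disc Ω × I}
    (hs : ∀ k t, y (κ i'.1 k) t = y (κ i.1 k) (Φ k + t)) (φ : Linf ℝ) :
    latCurve κ y i' φ = latCurve κ y i (Φ + φ) :=
  congrArg toLinf (funext fun k => hs k _)

theorem IsShift.latPert {Φ : Linf ℝ} {i' i : Disc Ω × I} (h : IsShift κ f g y ys Φ i' i)
    {W : Type} (F : I → Linf E × Linf P → W) (φ : Linf ℝ) (p : Linf P) (v : Linf E) :
    latPert κ y F i' ((φ, p), v) = latPert κ y F i ((Φ + φ, p), v) := by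
  rw [LDS.latPert, LDS.latPert, h.par, latCurve_shift h.curve]

theorem IsShift.latSlow {Φ : Linf ℝ} {i' i : Disc Ω × I} (h : IsShift κ f g y ys Φ i' i)
    (φ : Linf ℝ) (q : Linf P) (η : ℝ) (v : Linf E) :
    latSlow κ y ys g G μ ε₁ i' (((φ, q), η), v) =
      latSlow κ y ys g G μ ε₁ i (((Φ + φ, q), η), v) := by
  have h1 := latCore_shift (κ := κ) (h := phaseCore ys) (Φ := Φ) (i' := i') (i := i)
    (fun k s v => by simp only [phaseCore, h.adjoint]) φ v
  have h2 := latCore_shift (κ := κ) (h := parCore g y) (Φ := Φ) (i' := i') (i := i)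
    (fun k s v => by simp only [parCore, h.field_par, h.curve]) φ v
  have h3 := h.latPert G φ (μ⁻¹ • q) v
  simp only [LDS.latSlow, slowField, h1, h2, h3]

theorem IsShift.latFast {Φ : Linf ℝ} {i' i : Disc Ω × I} (h : IsShift κ f g y ys Φ i' i)
    (φ : Linf ℝ) (q : Linf P) (η : ℝ) (v : Linf E) :
    latFast κ f y ys F μ ε₁ i' (((φ, q), η), v) =
      latFast κ f y ys F μ ε₁ i (((Φ + φ, q), η), v) := by
  have h1 := latCore_shift (κ := κ) (h := fastCore f y ys) (Φ := Φ) (i' := i') (i := i)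
    (fun k s v => by simp only [fastCore, phaseCore, h.adjoint, h.field, h.curve]) φ v
  have h3 := h.latPert F φ (μ⁻¹ • q) v
  simp only [LDS.latFast, fastField, h1, h3]

theorem IsShift.isOrbit {ρ : ℝ} {Φ : Linf ℝ} {i' i : Disc Ω × I}
    (h : IsShift κ f g y ys Φ i' i) {z : ℝ → SlowVar (Linf ℝ) (Linf P)} {v : ℝ → Linf E}
    (hz : IsOrbit (LDS.latSlow κ y ys g G μ ε₁) (LDS.latFast κ f y ys F μ ε₁) ρ i z v) :
    IsOrbit (LDS.latSlow κ y ys g G μ ε₁) (LDS.latFast κ f y ys F μ ε₁) ρ i'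
      (fun t => (((z t).1.1 - Φ, (z t).1.2), (z t).2)) v := by
  have e : ∀ t, (((Φ + ((z t).1.1 - Φ), (z t).1.2), (z t).2) : SlowVar (Linf ℝ) (Linf P)) = z t :=
    fun t => by rw [add_sub_cancel]
  have e2 : ∀ t, (((z t).1.1 - Φ, (z t).1.2), (z t).2) = z t - ((Φ, 0), 0) := fun t =>
    Prod.ext (Prod.ext rfl (sub_zero _).symm) (sub_zero _).symm
  refine ⟨hz.mem, fun t => ?_, fun t => ?_⟩
  · rw [h.latSlow, e]
    simp only [e2]
    exact (hz.dz t).sub_const _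
  · rw [h.latFast, e]
    exact hz.dv t

end ShiftedPhases

/-! ### The normal form near products of orbits and its section -/

section NormalForms

variable {d m : ℕ} {f : ℤ → EuclideanSpace ℝ (Fin d) → EuclideanSpace ℝ (Fin d)}
  {g : ℤ → EuclideanSpace ℝ (Fin d) → EuclideanSpace ℝ (Fin m)}
  {Λ : ℤ → Set (EuclideanSpace ℝ (Fin d))}
  {F : ℝ → Linf (EuclideanSpace ℝ (Fin d)) × Linf (EuclideanSpace ℝ (Fin m)) →
    Linf (EuclideanSpace ℝ (Fin d))}
  {G : ℝ → Linf (EuclideanSpace ℝ (Fin d)) × Linf (EuclideanSpace ℝ (Fin m)) →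
    Linf (EuclideanSpace ℝ (Fin m))}

/-- The sequences of orbits. -/
abbrev ProductOrbit (f : ℤ → EuclideanSpace ℝ (Fin d) → EuclideanSpace ℝ (Fin d))
    (Λ : ℤ → Set (EuclideanSpace ℝ (Fin d))) : Type :=
  {y₀ : ℤ → ℝ → EuclideanSpace ℝ (Fin d) // IsProductOrbit f Λ y₀}

/-- The orbit at a site of the lattice. -/
def ProductOrbit.at (ω : ProductOrbit f Λ) (k : ℤ) : OrbitIndex f Λ := ⟨(k, ω.1 k), ω.2 k⟩

/-- The sequence of orbits with shifted phases. -/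
def ProductOrbit.shift (ω : ProductOrbit f Λ) (θ : ℤ → ℝ) : ProductOrbit f Λ :=
  ⟨fun k t => ω.1 k (θ k + t), fun k => (ω.2 k).shift (θ k)⟩

/-- The lattice system near the products of orbits, as a slow-fast system together with its invariant
section. -/
structure NormalForm (n : ℕ) (f : ℤ → EuclideanSpace ℝ (Fin d) → EuclideanSpace ℝ (Fin d))
    (g : ℤ → EuclideanSpace ℝ (Fin d) → EuclideanSpace ℝ (Fin m))
    (Λ : ℤ → Set (EuclideanSpace ℝ (Fin d)))
    (F : ℝ → Linf (EuclideanSpace ℝ (Fin d)) × Linf (EuclideanSpace ℝ (Fin m)) →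
      Linf (EuclideanSpace ℝ (Fin d)))
    (G : ℝ → Linf (EuclideanSpace ℝ (Fin d)) × Linf (EuclideanSpace ℝ (Fin m)) →
      Linf (EuclideanSpace ℝ (Fin m))) (b : ℝ) where
  ys : Disc (OrbitIndex f Λ) → ℝ → EuclideanSpace ℝ (Fin d)
  R : ℝ
  C : ℝ
  hyp : HypFamily (n + 1) (fun j : Disc (OrbitIndex f Λ) => f (orbitSite j)) orbitCurve ys R C
  ys_shift : ∀ (i j : Disc (OrbitIndex f Λ)) (θ : ℝ), orbitSite i = orbitSite j →
    (∀ t, orbitCurve i t = orbitCurve j (θ + t)) → ∀ t, ys i t = ys j (θ + t)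
  g_smooth : UC (ball 0 (R + 2)) (n + 1) fun j : Disc (OrbitIndex f Λ) => g (orbitSite j)
  F_smooth : UC univ (n + 1) fun ε : ParamIcc b => F ε
  G_smooth : UC univ (n + 1) fun ε : ParamIcc b => G ε
  ρ : ℝ
  μ : ℝ
  ε₁ : ℝ
  κ : ℝ
  σz : ℝ
  σv : ℝ
  K : ℝ
  ν : ℝ
  A : Disc (ProductOrbit f Λ) × ParamIcc b → SlowVar (Linf ℝ) (Linf (EuclideanSpace ℝ (Fin m))) →
    Linf (EuclideanSpace ℝ (Fin d)) →L[ℝ] Linf (EuclideanSpace ℝ (Fin d))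
  S : Set (SlowVar (Linf ℝ) (Linf (EuclideanSpace ℝ (Fin m))))
  ρ_le : ρ ≤ 1
  μ_pos : 0 < μ
  μ_le : μ ≤ 1
  ε₁_pos : 0 < ε₁
  ε₁_le : ε₁ ≤ b
  K_small : C * (8 * (2 * (2 * C)) * K) ≤ 1 / 4
  slowFast : SlowFast
    (latSlow ProductOrbit.at orbitCurve ys (fun j => g (orbitSite j))
      (fun ε : ParamIcc b => G ε) μ ε₁)
    (latFast ProductOrbit.at (fun j => f (orbitSite j)) orbitCurve ys
      (fun ε : ParamIcc b => F ε) μ ε₁) A S (2 * (2 * C)) ρ κ σz σv K ν (1 / 80)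
  sec : Disc (ProductOrbit f Λ) × ParamIcc b →
    SlowVar (Linf ℝ) (Linf (EuclideanSpace ℝ (Fin m))) → Linf (EuclideanSpace ℝ (Fin d))
  isSection : IsSection
    (latSlow ProductOrbit.at orbitCurve ys (fun j => g (orbitSite j))
      (fun ε : ParamIcc b => G ε) μ ε₁)
    (latFast ProductOrbit.at (fun j => f (orbitSite j)) orbitCurve ys
      (fun ε : ParamIcc b => F ε) μ ε₁) ρ sec
  smooth : UC univ (n + 1) sec

theorem exists_normalForm {n : ℕ} (hf : IsUniformFamily (n + 1) f) (hg : IsUniformFamily (n + 1) g)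
    (hΛ : ∃ R : ℝ, ∀ k, ∀ y ∈ Λ k, ‖y‖ ≤ R) (hyp : UniformlyHyperbolic f Λ) {a b : ℝ} (hb : 0 < b)
    (hba : b < a) (hF : IsCrContinuousFamily (n + 1) a F) (hG : IsCrContinuousFamily (n + 1) a G) :
    Nonempty (NormalForm n f g Λ F G b) := by
  obtain ⟨ys, R, C, H, hshift⟩ := exists_hypFamily (by omega) hf hΛ hyp
  have hC := H.C_pos
  have hg' : UC (ball 0 (R + 2)) (n + 1) fun j : Disc (OrbitIndex f Λ) => g (orbitSite j) :=
    UC.reindex (ι := Disc ℤ) (e := fun j => orbitSite j) uIndex_orbitSite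
      (hg.UC (by omega) (R + 2))
  -- The value of `c` allows `n + 1` derivatives of the section. `K₀` makes `C` times its Lipschitz
  -- constant `8 · 4 C · K` at most `1 / 4`, as needed for the immersion property and for
  -- uniqueness.
  obtain ⟨ρ, μ, ε₁, κ, σz, σv, K, ν, A, S, -, hρ, hμ, hμ1, hε, hεb, hK, hSF⟩ :=
    H.exists_slowFast (ProductOrbit.at (f := f) (Λ := Λ)) hg' (hF.UC hba) (hG.UC hba)
      (c := 1 / (80 * 10 ^ n)) (a := b) (ρ₀ := 1)
      (K₀ := 1 / (4 * (C * (8 * (2 * (2 * C)))))) (by positivity) hb one_pos (by positivity)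
  have hc : (1 : ℝ) / (80 * 10 ^ n) ≤ 1 / 80 := by
    have h1 : (1 : ℝ) ≤ 10 ^ n := one_le_pow₀ (by norm_num)
    exact one_div_le_one_div_of_le (by norm_num) (by linarith)
  obtain ⟨V, hV⟩ := (hSF.mono hc).exists_section le_rfl
  have htube : tube (SlowVar (Linf ℝ) (Linf (EuclideanSpace ℝ (Fin m))))
      (Linf (EuclideanSpace ℝ (Fin d))) ρ ⊆ tube _ _ 1 := fun x hx =>
    LDS.mem_tube.2 ((LDS.mem_tube.1 hx).trans_le hρ)
  refine ⟨⟨ys, R, C, H, hshift, hg', hF.UC hba, hG.UC hba, ρ, μ, ε₁, κ, σz, σv, K, ν, A, S, hρ, hμ,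
    hμ1, hε, hεb, ?_, hSF.mono hc, V, hV, SlowFast.section_UC n hSF
      ((H.latSlow_UC hg' (hG.UC hba) μ ε₁).mono htube)
      ((H.latFast_UC (hF.UC hba) μ ε₁).mono htube) hV⟩⟩
  calc C * (8 * (2 * (2 * C)) * K) ≤
        C * (8 * (2 * (2 * C)) * (1 / (4 * (C * (8 * (2 * (2 * C))))))) := by gcongr
    _ = 1 / 4 := by field_simp

variable {n : ℕ} {b : ℝ} (D : NormalForm n f g Λ F G b)

theorem NormalForm.isShift (ω : ProductOrbit f Λ) (ε : ParamIcc b) (θ : ℤ → ℝ) (Φ : Linf ℝ) :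
    IsShift (ProductOrbit.at (f := f) (Λ := Λ)) (fun j : Disc (OrbitIndex f Λ) => f (orbitSite j))
      (fun j => g (orbitSite j)) orbitCurve D.ys Φ
      ((ω.shift fun k => θ k + Φ k, ε) : Disc (ProductOrbit f Λ) × ParamIcc b)
      ((ω.shift θ, ε) : Disc (ProductOrbit f Λ) × ParamIcc b) := by
  have hcurve : ∀ k t, orbitCurve ((ω.shift fun k => θ k + Φ k).at k) t =
      orbitCurve ((ω.shift θ).at k) (Φ k + t) := fun k t => by
    change ω.1 k (θ k + Φ k + t) = ω.1 k (θ k + (Φ k + t))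
    rw [add_assoc]
  exact ⟨rfl, fun k => rfl, fun k => rfl, hcurve, fun k t =>
    D.ys_shift ((ω.shift fun k => θ k + Φ k).at k) ((ω.shift θ).at k) (Φ k) rfl (hcurve k) t⟩

/-- An orbit of one system is, after translating phases, an orbit of the other, and orbits in the
tube lie on the section. -/
theorem NormalForm.sec_shift (ω : ProductOrbit f Λ) (ε : ParamIcc b) (θ : ℤ → ℝ) (Φ : Linf ℝ)
    (q : Linf (EuclideanSpace ℝ (Fin m))) (η : ℝ) :
    D.sec (ω.shift fun k => θ k + Φ k, ε) ((0, q), η) = D.sec (ω.shift θ, ε) ((Φ, q), η) := by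
  obtain ⟨z, v, h, h0, hv⟩ := D.isSection (ω.shift θ, ε) ((Φ, q), η)
  have h1 := (D.isShift ω ε θ Φ).isOrbit h
  have h2 := D.slowFast.section_eq le_rfl D.isSection h1 0
  rw [h0, sub_self] at h2
  rw [← h2, hv 0, h0]

/-- At `η = 0` the coupling is switched off for all times and the fast field vanishes at `v = 0`, so
an orbit in the tube has zero deviation. -/
theorem NormalForm.sec_zero (i : Disc (ProductOrbit f Λ) × ParamIcc b)
    (x : Linf ℝ × Linf (EuclideanSpace ℝ (Fin m))) : D.sec i (x, 0) = 0 := by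
  obtain ⟨z, v, h, h0, hv⟩ := D.isSection i (x, 0)
  have h1 : ∀ t, ‖latFast ProductOrbit.at (fun j => f (orbitSite j)) orbitCurve D.ys
      (fun ε : ParamIcc b => F ε) D.μ D.ε₁ i (z t, 0)‖ ≤ 0 := fun t => by
    have hz : (z t).2 = 0 := by rw [h.snd_const t, h0]
    rw [norm_le_zero_iff]
    refine linf_ext fun k => ?_
    rw [D.hyp.latFast_apply i (by simp), hz, Real.sin_zero, mul_zero, zero_smul]
    change f _ (_ + (0 : EuclideanSpace ℝ (Fin d))) -
      (1 + inner ℝ _ (0 : EuclideanSpace ℝ (Fin d))) • _ + 0 = 0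
    rw [inner_zero_right, add_zero, add_zero, add_zero, one_smul, sub_self]
  have h2 := D.slowFast.orbit_small le_rfl h h1 0
  rw [hv 0, h0, mul_zero, mul_zero] at h2
  exact norm_le_zero_iff.1 h2

/-- The section over phases and parameters. -/
def NormalForm.chart (i : Disc (ProductOrbit f Λ) × ParamIcc b)
    (x : Linf ℝ × Linf (EuclideanSpace ℝ (Fin m))) : Linf (EuclideanSpace ℝ (Fin d)) :=
  D.sec i ((x.1, D.μ • x.2), Real.arcsin (i.2 / D.ε₁))

theorem NormalForm.ext_UC : UC univ (n + 1)
    fun i (x : (Linf ℝ × Linf (EuclideanSpace ℝ (Fin m))) × ℝ) =>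
      D.sec i ((x.1.1, D.μ • x.1.2), x.2) :=
  D.smooth.comp (h := fun _ (x : (Linf ℝ × Linf (EuclideanSpace ℝ (Fin m))) × ℝ) =>
      ((x.1.1, D.μ • x.1.2), x.2))
    (UG.linear ((((ContinuousLinearMap.fst ℝ (Linf ℝ) (Linf (EuclideanSpace ℝ (Fin m)))).comp
      (.fst ℝ _ ℝ)).prod (D.μ • (ContinuousLinearMap.snd ℝ (Linf ℝ)
        (Linf (EuclideanSpace ℝ (Fin m)))).comp (.fst ℝ _ ℝ))).prod (.snd ℝ _ ℝ)))
    fun _ _ _ => mem_univ _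

theorem UC.arcsin_div {Ω X : Type} [NormedAddCommGroup X] [NormedSpace ℝ X] (S : Set X) (n : ℕ)
    (b c : ℝ) : UC S n fun (i : Disc Ω × ParamIcc b) (_ : X) => Real.arcsin (i.2 / c) := by
  refine UC.const_index ⟨Real.pi / 2, fun i => ?_⟩ fun η hη => ?_
  · rw [Real.norm_eq_abs, abs_le]
    exact ⟨Real.neg_pi_div_two_le_arcsin _, Real.arcsin_le_pi_div_two _⟩
  · have hu : UniformContinuous fun ε : ParamIcc b => Real.arcsin (ε / c) :=
      CompactSpace.uniformContinuous_of_continuous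
        (Real.continuous_arcsin.comp (continuous_subtype_val.div_const c))
    obtain ⟨e, he, H⟩ := Metric.uniformContinuous_iff.1 hu η hη
    exact ⟨e, he, fun i i' h => by
      rw [← dist_eq_norm]
      exact (H ((le_max_right _ _).trans_lt h)).le⟩

theorem UC.prod_param {ι X E : Type} [PseudoMetricSpace ι] [NormedAddCommGroup X]
    [NormedSpace ℝ X] [NormedAddCommGroup E] [NormedSpace ℝ E] {n : ℕ} {h : ι → X × ℝ → E}
    (hh : UC univ n h) {c : ι → ℝ} (hc : UC (univ : Set X) n fun i _ => c i) :
    UC univ n fun i x => h i (x, c i) :=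
  hh.comp (h := fun i x => (x, c i)) ((UG.linear (ContinuousLinearMap.id ℝ X)).prodMk hc.2)
    fun _ _ _ => mem_univ _

theorem NormalForm.chart_UC : UC univ (n + 1) D.chart :=
  D.ext_UC.prod_param (UC.arcsin_div univ (n + 1) b D.ε₁)

theorem abs_arcsin_le (x : ℝ) : |Real.arcsin x| ≤ Real.pi / 2 * |x| := by
  have key : ∀ x : ℝ, 0 ≤ x → Real.arcsin x ≤ Real.pi / 2 * x := fun x hx => by
    rcases le_total 1 x with h1 | h1
    · have := Real.pi_pos
      nlinarith [Real.arcsin_le_pi_div_two x]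
    · have h2 := Real.mul_le_sin (Real.arcsin_nonneg.2 hx) (Real.arcsin_le_pi_div_two x)
      rw [Real.sin_arcsin (by linarith) h1] at h2
      have := Real.pi_pos
      calc Real.arcsin x = Real.pi / 2 * (2 / Real.pi * Real.arcsin x) := by field_simp
        _ ≤ _ := by gcongr
  rcases le_total 0 x with h | h
  · rw [abs_of_nonneg h, abs_of_nonneg (Real.arcsin_nonneg.2 h)]
    exact key x h
  · rw [abs_of_nonpos h, ← abs_neg, ← Real.arcsin_neg,
      abs_of_nonneg (Real.arcsin_nonneg.2 (by linarith))]
    exact key _ (by linarith)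

theorem NormalForm.exists_chart_bound : ∃ K, 0 ≤ K ∧ ∀ i, ∀ j < n + 1, ∀ x,
    ‖iteratedFDeriv ℝ j (D.chart i) x‖ ≤ K * |(i.2 : ℝ)| := by
  have h0 := D.ε₁_pos
  have hpi := Real.pi_pos
  choose K hK0 hK using fun j : Fin (n + 1) => UC.exists_linear_bound j.2 D.ext_UC
    fun i x => D.sec_zero i _
  refine ⟨(∑ j, K j) * (Real.pi / 2 / D.ε₁),
    mul_nonneg (Finset.sum_nonneg fun j _ => hK0 j) (by positivity), fun i j hj x => ?_⟩
  refine (hK ⟨j, hj⟩ i x _).trans ?_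
  calc K ⟨j, hj⟩ * |Real.arcsin (i.2 / D.ε₁)| ≤
        (∑ j, K j) * (Real.pi / 2 * |i.2 / D.ε₁|) := by
        gcongr
        · exact Finset.sum_nonneg fun j _ => hK0 j
        · exact Finset.single_le_sum (f := K) (fun j _ => hK0 j) (Finset.mem_univ _)
        · exact abs_arcsin_le _
    _ = _ := by
        rw [abs_div, abs_of_pos h0]
        ring

end NormalForms

/-! ### The manifold: smoothness, immersion, invariance, shadowing -/

section InvariantManifold

variable {d m : ℕ} {f : ℤ → EuclideanSpace ℝ (Fin d) → EuclideanSpace ℝ (Fin d)}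
  {g : ℤ → EuclideanSpace ℝ (Fin d) → EuclideanSpace ℝ (Fin m)}
  {Λ : ℤ → Set (EuclideanSpace ℝ (Fin d))}
  {F : ℝ → Linf (EuclideanSpace ℝ (Fin d)) × Linf (EuclideanSpace ℝ (Fin m)) →
    Linf (EuclideanSpace ℝ (Fin d))}
  {G : ℝ → Linf (EuclideanSpace ℝ (Fin d)) × Linf (EuclideanSpace ℝ (Fin m)) →
    Linf (EuclideanSpace ℝ (Fin m))} {n : ℕ} {b : ℝ}

theorem IsUniformFamily.bdd_apply {E E' : Type} [NormedAddCommGroup E] [NormedSpace ℝ E]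
    [NormedAddCommGroup E'] [NormedSpace ℝ E'] {r : ℕ} (hr : 1 ≤ r) {h : ℤ → E → E'}
    (hh : IsUniformFamily r h) (u : Linf E) : ∃ C, ∀ k, ‖h k (u k)‖ ≤ C :=
  let ⟨C, hC⟩ := (hh.UC hr (‖u‖ + 1)).1
  ⟨C, fun k => hC k _ (mem_ball_zero_iff.2 (by linarith [linf_norm_apply_le u k]))⟩

theorem isLatticeField_coupledField (hf : IsUniformFamily (n + 1) f)
    (hg : IsUniformFamily (n + 1) g) (R : ℝ) (ω : ProductOrbit f Λ) (ε : ParamIcc b) :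
    IsLatticeField (ProductOrbit.at (f := f) (Λ := Λ)) (fun j => f (orbitSite j))
      (fun j => g (orbitSite j)) (fun ε : ParamIcc b => F ε) (fun ε : ParamIcc b => G ε) R ε
      ((ω, ε) : Disc (ProductOrbit f Λ) × ParamIcc b) (coupledField f g F G ε) := by
  refine fun x _ => ⟨fun k => ?_, fun k => ?_⟩
  · change toLinf (fun k => f k (x.1 k)) k + (ε : ℝ) • F ε x k = _
    rw [toLinf_apply (hf.bdd_apply (by omega) x.1)]
    rfl
  · change toLinf (fun k => g k (x.1 k)) k + (ε : ℝ) • G ε x k = _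
    rw [toLinf_apply (hg.bdd_apply (by omega) x.1)]
    rfl

variable (D : NormalForm n f g Λ F G b)

open Classical in
/-- The deviation of the invariant manifold from the product of the orbits. -/
def NormalForm.manifold (y₀ : ℤ → ℝ → EuclideanSpace ℝ (Fin d)) (ε : ℝ) (φ : ℤ → ℝ)
    (p : Linf (EuclideanSpace ℝ (Fin m))) : Linf (EuclideanSpace ℝ (Fin d)) :=
  if h : IsProductOrbit f Λ y₀ ∧ ε ∈ Icc (-b) b then
    D.chart (ProductOrbit.shift ⟨y₀, h.1⟩ φ, ⟨ε, h.2⟩) (0, p)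
  else 0

theorem NormalForm.manifold_apply (ω : ProductOrbit f Λ) (ε : ParamIcc b) (φ : ℤ → ℝ)
    (p : Linf (EuclideanSpace ℝ (Fin m))) :
    D.manifold ω.1 ε φ p = D.chart (ω.shift φ, ε) (0, p) :=
  dif_pos ⟨ω.2, ε.2⟩

/-- Phase sequences may be unbounded, so the manifold is defined by absorbing all phases into the
orbits and reading the section at phase `0`. Equivariance identifies each Banach chart with the
smooth section of one shifted orbit. -/
theorem NormalForm.phaseChart_manifold (ω : ProductOrbit f Λ) (ε : ParamIcc b) (θ : ℤ → ℝ) :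
    phaseChart (D.manifold ω.1 ε) θ = D.chart (ω.shift θ, ε) := by
  funext x
  rw [phaseChart, D.manifold_apply]
  exact D.sec_shift ω ε θ x.1 _ _

theorem NormalForm.graphParam_manifold (ω : ProductOrbit f Λ) (ε : ParamIcc b) (θ : ℤ → ℝ)
    (x : Linf ℝ × Linf (EuclideanSpace ℝ (Fin m))) :
    graphParam ω.1 (D.manifold ω.1 ε) θ x =
      (latCurve ProductOrbit.at orbitCurve
        ((ω.shift θ, ε) : Disc (ProductOrbit f Λ) × ParamIcc b) x.1 +
        D.chart (ω.shift θ, ε) x, x.2) := by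
  rw [graphParam, D.phaseChart_manifold]
  rfl

theorem NormalForm.chart_zero (ω : Disc (ProductOrbit f Λ)) (ε : ParamIcc b) (hε : (ε : ℝ) = 0)
    (x : Linf ℝ × Linf (EuclideanSpace ℝ (Fin m))) : D.chart (ω, ε) x = 0 := by
  rw [NormalForm.chart, hε, zero_div, Real.arcsin_zero, D.sec_zero]

theorem NormalForm.chart_lipschitz (i : Disc (ProductOrbit f Λ) × ParamIcc b)
    (x x' : Linf ℝ × Linf (EuclideanSpace ℝ (Fin m))) :
    ‖D.chart i x - D.chart i x'‖ ≤ 8 * (2 * (2 * D.C)) * D.K * ‖x - x'‖ := by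
  have hC := D.hyp.C_pos
  have hK := D.slowFast.K_pos
  refine (D.slowFast.section_lipschitz le_rfl D.isSection i _ _).trans ?_
  gcongr
  have h1 : ((x.1, D.μ • x.2), Real.arcsin (i.2 / D.ε₁)) - ((x'.1, D.μ • x'.2),
      Real.arcsin (i.2 / D.ε₁)) = (((x - x').1, D.μ • (x - x').2), (0 : ℝ)) :=
    Prod.ext (Prod.ext rfl (smul_sub _ _ _).symm) (sub_self _)
  rw [h1, Prod.norm_def, Prod.norm_def, norm_zero, norm_smul, Real.norm_eq_abs,
    abs_of_pos D.μ_pos]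
  refine max_le (max_le (norm_fst_le (x - x')) ?_) (norm_nonneg _)
  exact (mul_le_of_le_one_left (norm_nonneg _) D.μ_le).trans (norm_snd_le (x - x'))

theorem NormalForm.isCr_phaseChart (ω : ProductOrbit f Λ) (ε : ParamIcc b) (θ : ℤ → ℝ) :
    IsCr (n + 1) (phaseChart (D.manifold ω.1 ε) θ) := by
  rw [D.phaseChart_manifold]
  exact D.chart_UC.isCr (ω.shift θ, ε)

/-- Applying `ℓ` to the first component gives the identity plus an operator of norm below `1`, which
a Neumann series inverts. -/
theorem exists_leftInverse_of_perturbation {X Q V : Type} [NormedAddCommGroup X] [NormedSpace ℝ X]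
    [CompleteSpace X] [NormedAddCommGroup Q] [NormedSpace ℝ Q] [CompleteSpace Q]
    [NormedAddCommGroup V] [NormedSpace ℝ V] (Y : X →L[ℝ] V) (B : X × Q →L[ℝ] V) (ℓ : V →L[ℝ] X)
    (hY : ∀ x, ℓ (Y x) = x) (hB : ‖ℓ.comp B‖ < 1) :
    ∃ L : V × Q →L[ℝ] X × Q,
      L.comp ((Y.comp (.fst ℝ X Q) + B).prod (.snd ℝ X Q)) = ContinuousLinearMap.id ℝ _ := by
  set T : X × Q →L[ℝ] X × Q := -(ℓ.comp B).prod 0 with hT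
  have hT1 : ‖T‖ < 1 := by
    refine lt_of_le_of_lt (ContinuousLinearMap.opNorm_le_bound _ (norm_nonneg _) fun x => ?_) hB
    rw [hT, neg_apply, norm_neg]
    change ‖((ℓ.comp B) x, (0 : Q))‖ ≤ _
    rw [Prod.norm_def, norm_zero, max_eq_left (norm_nonneg _)]
    exact ContinuousLinearMap.le_opNorm _ _
  obtain ⟨u, hu⟩ := isUnit_one_sub_of_norm_lt_one hT1
  refine ⟨(↑u⁻¹ : X × Q →L[ℝ] X × Q).comp ((ℓ.comp (.fst ℝ V Q)).prod (.snd ℝ V Q)), ?_⟩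
  have h1 : ((ℓ.comp (.fst ℝ V Q)).prod (.snd ℝ V Q)).comp
      ((Y.comp (.fst ℝ X Q) + B).prod (.snd ℝ X Q)) = (u : X × Q →L[ℝ] X × Q) := by
    rw [hu]
    refine ContinuousLinearMap.ext fun x => Prod.ext ?_ ?_
    · change ℓ (Y x.1 + B x) = x.1 - -(ℓ (B x))
      rw [map_add, hY, sub_neg_eq_add]
    · change x.2 = x.2 - -(0 : Q)
      rw [neg_zero, sub_zero]
  rw [ContinuousLinearMap.comp_assoc, h1]
  exact u.inv_mul

theorem HypFamily.exists_adjointOp {J Ω I E : Type} [NormedAddCommGroup E]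
    [InnerProductSpace ℝ E] [FiniteDimensional ℝ E] {r : ℕ} {f : Disc J → E → E}
    {y ys : Disc J → ℝ → E} {R C : ℝ} (H : HypFamily r f y ys R C) (κ : Ω → ℤ → J)
    (i : Disc Ω × I) (φ : Linf ℝ) :
    ∃ l : Linf E →L[ℝ] Linf ℝ, (∀ u k, l u k = inner ℝ (ys (κ i.1 k) (φ k)) (u k)) ∧
      ∀ u, ‖l u‖ ≤ C * ‖u‖ := by
  have hC := H.C_pos
  have hbdd : ∃ C, ∀ k, ‖innerSL ℝ (ys (κ i.1 k) (φ k))‖ ≤ C :=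
    ⟨C, fun k => by
      rw [innerSL_apply_norm]
      exact H.ys_bdd _ _⟩
  have hap : ∀ u k, diagL E ℝ (toLinf fun k => innerSL ℝ (ys (κ i.1 k) (φ k))) u k =
      inner ℝ (ys (κ i.1 k) (φ k)) (u k) := fun u k => by
    rw [diagL_apply, toLinf_apply hbdd]
    rfl
  refine ⟨_, hap, fun u => linf_norm_le fun k => ?_⟩
  rw [hap]
  exact (norm_inner_le_norm _ _).trans (mul_le_mul (H.ys_bdd _ _) (linf_norm_apply_le u k)
    (norm_nonneg _) hC.le)

/-- Pairing componentwise with the adjoint solutions inverts the derivative of the orbit curves from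
the left, and the derivative of the section perturbs this by at most `1 / 4`. -/
theorem NormalForm.isCrImmersion_graphParam (ω : ProductOrbit f Λ) (ε : ParamIcc b)
    (θ : ℤ → ℝ) : IsCrImmersion (n + 1) (graphParam ω.1 (D.manifold ω.1 ε) θ) := by
  have hC := D.hyp.C_pos
  have hK := D.slowFast.K_pos
  set i : Disc (ProductOrbit f Λ) × ParamIcc b := (ω.shift θ, ε)
  have e : graphParam ω.1 (D.manifold ω.1 ε) θ = fun x =>
      (latCurve ProductOrbit.at orbitCurve i x.1 + D.chart i x, x.2) :=
    funext (D.graphParam_manifold ω ε θ)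
  have hcurve : UC univ (n + 1) (latCurve (I := ParamIcc b) (ProductOrbit.at (f := f) (Λ := Λ))
      orbitCurve) := D.hyp.orbit_UC.latCurve
  have hc1 := hcurve.2.contDiff i
  have hc2 := D.chart_UC.2.contDiff i
  rw [e]
  refine ⟨((hc1.comp contDiff_fst).add hc2).prodMk contDiff_snd, fun x => ?_⟩
  have hn : ((n + 1 : ℕ) : WithTop ℕ∞) ≠ 0 := by exact_mod_cast Nat.succ_ne_zero n
  have hd1 := (hc1.differentiable hn x.1).hasFDerivAt
  have hd2 := (hc2.differentiable hn x).hasFDerivAt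
  set Y := fderiv ℝ (latCurve ProductOrbit.at orbitCurve i) x.1
  set B := fderiv ℝ (D.chart i) x
  have hB : ‖B‖ ≤ 8 * (2 * (2 * D.C)) * D.K :=
    hd2.le_of_lip' (by positivity) (Eventually.of_forall fun x' => D.chart_lipschitz i x' x)
  obtain ⟨l, hap, hl⟩ := D.hyp.exists_adjointOp ProductOrbit.at i x.1
  obtain ⟨L, hL⟩ := exists_leftInverse_of_perturbation Y B l (fun q => linf_ext fun k => by
      have hline : HasDerivAt (fun t : ℝ => x.1 + t • q) q 0 := by
        simpa using ((hasDerivAt_id (0 : ℝ)).smul_const q).const_add x.1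
      obtain ⟨v, hv, hvk⟩ := D.hyp.latCurve_hasDerivAt (κ := ProductOrbit.at) i hline
      have hd1' : HasFDerivAt (latCurve ProductOrbit.at orbitCurve i) Y (x.1 + (0 : ℝ) • q) := by
        rwa [zero_smul, add_zero]
      have : Y q = v := (hd1'.comp_hasDerivAt (0 : ℝ) hline).unique hv
      rw [hap, this, hvk, inner_smul_right, zero_smul, add_zero]
      exact (congrArg (q k * ·) (D.hyp.normalized (i.1.at k) (x.1 k))).trans (mul_one _)) (by
    refine lt_of_le_of_lt (b := 1 / 4) (ContinuousLinearMap.opNorm_le_bound _ (by norm_num)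
      fun q => (hl (B q)).trans ?_) (by norm_num)
    calc _ ≤ D.C * (8 * (2 * (2 * D.C)) * D.K * ‖q‖) := by gcongr; exact B.le_of_opNorm_le hB q
      _ = D.C * (8 * (2 * (2 * D.C)) * D.K) * ‖q‖ := by ring
      _ ≤ _ := by gcongr; exact D.K_small)
  refine ⟨L, ?_⟩
  rw [← hL]
  congr 1
  exact (((hd1.comp x hasFDerivAt_fst).add hd2).prodMk hasFDerivAt_snd).fderiv

theorem NormalForm.isInvariantGraph (hf : IsUniformFamily (n + 1) f)
    (hg : IsUniformFamily (n + 1) g) (ω : ProductOrbit f Λ) (ε : ParamIcc b)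
    (hε : |(ε : ℝ)| ≤ D.ε₁) :
    IsInvariantGraph (coupledField f g F G ε) ω.1 (D.manifold ω.1 ε) := by
  intro θ p
  have h0 := D.ε₁_pos
  obtain ⟨z, v, h, hz, hv⟩ := D.isSection (ω.shift θ, ε)
    ((0, D.μ • p), Real.arcsin (ε / D.ε₁))
  have hsin : D.ε₁ * Real.sin (z 0).2 = ε := by
    have h1 := abs_le.1 hε
    rw [hz, Real.sin_arcsin]
    · field_simp
    · rw [le_div_iff₀ h0]; linarith
    · rw [div_le_one h0]; linarith
  have hsol := D.hyp.solution_of_isOrbit D.g_smooth D.ρ_le D.μ_pos.ne'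
    (isLatticeField_coupledField hf hg D.R (ω.shift θ) ε) h hsin
  refine ⟨_, fun t => (z t).1.1, hsol, ?_, by simp only [hz], ?_, fun t => ?_⟩
  · exact continuous_fst.comp (continuous_fst.comp (continuous_of_hasDerivAt h.dz))
  · change D.μ⁻¹ • (z 0).1.2 = p
    rw [hz, smul_smul, inv_mul_cancel₀ D.μ_pos.ne', one_smul]
  · rw [D.graphParam_manifold]
    refine Prod.ext ?_ rfl
    change latCurve _ _ _ (z t).1.1 + v t = latCurve _ _ _ (z t).1.1 +
      D.sec (ω.shift θ, ε) (((z t).1.1, D.μ • D.μ⁻¹ • (z t).1.2), Real.arcsin (ε / D.ε₁))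
    rw [smul_smul, mul_inv_cancel₀ D.μ_pos.ne', one_smul, hv t]
    congr 2
    exact Prod.ext rfl (by rw [h.snd_const t, hz])

/-- Each component is a perturbed orbit of its own equation with error `ε F`, so it can be given
phases solving the phase equation. With these the solution is an orbit in the tube and lies on the
section. -/
theorem NormalForm.exists_phase_of_shadowing (hf : IsUniformFamily (n + 1) f)
    (hg : IsUniformFamily (n + 1) g) {s₁ : ℝ} (hs₁ : 0 < s₁) :
    ∃ δ > 0, δ ≤ s₁ ∧ ∃ M > 0, ∀ (ω : ProductOrbit f Λ) (ε : ParamIcc b), |(ε : ℝ)| ≤ D.ε₁ →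
      (∀ x, ‖(ε : ℝ) • F ε x‖ ≤ M) → ∀ x, IsSolution (coupledField f g F G ε) x →
      ∀ ψ : ℤ → ℝ → ℝ, (∀ k, Continuous (ψ k)) →
      (∀ t k, ‖(x t).1 k - ω.1 k (ψ k t)‖ ≤ δ) → ∃ φ : ℤ → ℝ, (∀ k, |φ k - ψ k 0| ≤ s₁) ∧
        ∀ k, (x 0).1 k = ω.1 k (φ k) + D.manifold ω.1 ε φ (x 0).2 k := by
  obtain ⟨U, hU0, hU⟩ := D.hyp.exists_speed
  have hρ := D.slowFast.ρ_pos
  have hρ1 := D.ρ_le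
  have h0 := D.ε₁_pos
  set s₀ := min s₁ (D.ρ / (2 * (U + 1))) with hs₀
  have hs₀0 : 0 < s₀ := by positivity
  have hs₀ρ : (U + 1) * s₀ ≤ D.ρ / 2 := by
    calc (U + 1) * s₀ ≤ (U + 1) * (D.ρ / (2 * (U + 1))) := by gcongr; exact min_le_right _ _
      _ = D.ρ / 2 := by field_simp
  obtain ⟨δ, hδ, hδs, M, hM, htrack⟩ := D.hyp.exists_tracking hs₀0
  refine ⟨δ, hδ, hδs.trans (min_le_left _ _), M, hM,
    fun ω ε hε hFM x hx ψ hψ hclose => ?_⟩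
  have hδρ : δ ≤ D.ρ / 2 := by nlinarith
  have hcoup := isLatticeField_coupledField (F := F) (G := G) hf hg D.R ω ε
  have hmem : ∀ t k, (x t).1 k ∈ ball (0 : EuclideanSpace ℝ (Fin d)) (D.R + 2) := fun t k => by
    have := D.hyp.mem_add (ω.at k) (ψ k t) (v := (x t).1 k - ω.1 k (ψ k t))
      ((hclose t k).trans_lt (by linarith))
    change ω.1 k (ψ k t) + ((x t).1 k - ω.1 k (ψ k t)) ∈ _ at this
    rwa [add_sub_cancel] at this
  have hxk : ∀ k t, HasDerivAt (fun s => (x s).1 k)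
      (f k ((x t).1 k) + ((ε : ℝ) • F ε (x t) : Linf (EuclideanSpace ℝ (Fin d))) k) t :=
    fun k t => by
      have h1 : HasDerivAt (fun s => (x s).1) (coupledField f g F G ε (x t)).1 t :=
        (ContinuousLinearMap.fst ℝ (Linf (EuclideanSpace ℝ (Fin d)))
          (Linf (EuclideanSpace ℝ (Fin m)))).hasFDerivAt.comp_hasDerivAt t (hx t)
      exact (hasDerivAt_linf_apply h1 k).congr_deriv ((hcoup (x t) (hmem t)).1 k)
  choose φ hφ hφψ using fun k => htrack (ω.at k) (fun s => (x s).1 k) _ (ψ k) (hxk k)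
    (fun t => (linf_norm_apply_le _ k).trans (hFM _)) (hψ k) fun t => hclose t k
  have hφψ' : ∀ k t, |φ k t - ψ k t| ≤ s₀ := hφψ
  have hcl : ∀ k t, ‖(x t).1 k - ω.1 k (φ k t)‖ ≤ D.ρ / 2 := fun k t => by
    have h1 := D.hyp.orbit_lipschitz hU (ω.at k) (ψ k t) (φ k t)
    rw [abs_sub_comm] at h1
    calc _ ≤ ‖(x t).1 k - ω.1 k (ψ k t)‖ + ‖ω.1 k (ψ k t) - ω.1 k (φ k t)‖ :=
          norm_sub_le_norm_sub_add_norm_sub _ _ _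
      _ ≤ s₀ + U * s₀ := add_le_add ((hclose t k).trans hδs)
          (h1.trans (by gcongr; exact hφψ' k t))
      _ ≤ _ := by linarith
  -- The initial phases may be unbounded in `k`; shifting the orbits by them leaves phases that
  -- start at `0`.
  set θ : ℤ → ℝ := fun k => φ k 0 with hθ
  have hcurve : ∀ k t, orbitCurve ((ω.shift θ).at k) t = orbitCurve (ω.at k) (θ k + t) :=
    fun k t => rfl
  have hys : ∀ k t, D.ys ((ω.shift θ).at k) t = D.ys (ω.at k) (θ k + t) := fun k =>
    D.ys_shift ((ω.shift θ).at k) (ω.at k) (θ k) rfl (hcurve k)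
  have hsin : D.ε₁ * Real.sin (Real.arcsin (ε / D.ε₁)) = ε := by
    have h1 := abs_le.1 hε
    rw [Real.sin_arcsin]
    · field_simp
    · rw [le_div_iff₀ h0]; linarith
    · rw [div_le_one h0]; linarith
  obtain ⟨z, v, h, hz, hv⟩ := D.hyp.isOrbit_of_solution D.g_smooth D.G_smooth hρ hρ1
    D.μ_pos.ne' (isLatticeField_coupledField (F := F) (G := G) hf hg D.R (ω.shift θ) ε) hsin hx
    (φ := fun k t => φ k t - θ k) (fun k => sub_self _) (fun k t => by
      change HasDerivAt (fun t => φ k t - θ k) (1 + inner ℝ (D.ys ((ω.shift θ).at k) (φ k t - θ k))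
        ((x t).1 k - orbitCurve ((ω.shift θ).at k) (φ k t - θ k))) t
      rw [hys, hcurve, add_sub_cancel]
      exact (hφ k t).sub_const _) (fun k t => by
      change ‖(x t).1 k - orbitCurve ((ω.shift θ).at k) (φ k t - θ k)‖ ≤ _
      rw [hcurve, add_sub_cancel]
      exact hcl k t)
  refine ⟨θ, fun k => (hφψ' k 0).trans (min_le_left _ _), fun k => ?_⟩
  have h1 := D.slowFast.section_eq le_rfl D.isSection h 0
  have h2 := hv 0 k
  rw [h1, hz] at h2
  rw [D.manifold_apply, h2]
  congr 1
  change ω.1 k (θ k + (φ k 0 - θ k)) = _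
  rw [add_sub_cancel]

end InvariantManifold

/-! ### Uniqueness among invariant graphs -/

section Uniqueness

variable {d m : ℕ} {f : ℤ → EuclideanSpace ℝ (Fin d) → EuclideanSpace ℝ (Fin d)}
  {g : ℤ → EuclideanSpace ℝ (Fin d) → EuclideanSpace ℝ (Fin m)}
  {Λ : ℤ → Set (EuclideanSpace ℝ (Fin d))}
  {F : ℝ → Linf (EuclideanSpace ℝ (Fin d)) × Linf (EuclideanSpace ℝ (Fin m)) →
    Linf (EuclideanSpace ℝ (Fin d))}
  {G : ℝ → Linf (EuclideanSpace ℝ (Fin d)) × Linf (EuclideanSpace ℝ (Fin m)) →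
    Linf (EuclideanSpace ℝ (Fin m))} {n : ℕ} {b : ℝ}

theorem HypFamily.exists_orbit_linearization {J E : Type} [NormedAddCommGroup E]
    [InnerProductSpace ℝ E] [FiniteDimensional ℝ E] {f : Disc J → E → E}
    {y ys : Disc J → ℝ → E} {R C : ℝ} (H : HypFamily (n + 1) f y ys R C) {η : ℝ} (hη : 0 < η) :
    ∃ s₁ > 0, ∀ j t s s', |s| ≤ s₁ → |s'| ≤ s₁ →
      ‖y j (t + s) - y j (t + s') - (s - s') • f j (y j t)‖ ≤ η * |s - s'| := by
  obtain ⟨d, hd, hu⟩ := H.velocity_UC.2.ucont η hη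
  refine ⟨d / 2, by positivity, fun j t s s' hs hs' => ?_⟩
  have hder : ∀ σ, HasDerivAt (fun σ => y j (t + σ) - σ • f j (y j t))
      (f j (y j (t + σ)) - f j (y j t)) σ := fun σ =>
    (((H.sol j (t + σ)).comp_const_add t σ).sub ((hasDerivAt_id σ).smul_const _)).congr_deriv
      (by rw [one_smul])
  have h1 := lipschitz_of_deriv_le (convex_closedBall (0 : ℝ) (d / 2))
    (fun σ _ => (hder σ).hasFDerivAt) (C := η) (fun σ hσ => by
      have h2 : |σ| ≤ d / 2 := by simpa using hσ
      have := hu j j (t + σ) t (mem_univ _) (mem_univ _) (by simpa using hd)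
        (by rw [Real.dist_eq, add_sub_cancel_left]; linarith)
      simpa using this) (x := s') (y := s) (by simpa using hs') (by simpa using hs)
  rw [Real.norm_eq_abs] at h1
  refine le_of_eq_of_le (congrArg _ ?_) h1
  rw [sub_smul]
  abel

theorem IsInvariantGraph.exists_shadowing
    {X : Linf (EuclideanSpace ℝ (Fin d)) × Linf (EuclideanSpace ℝ (Fin m)) →
      Linf (EuclideanSpace ℝ (Fin d)) × Linf (EuclideanSpace ℝ (Fin m))}
    {y₀ : ℤ → ℝ → EuclideanSpace ℝ (Fin d)}
    {V : (ℤ → ℝ) → Linf (EuclideanSpace ℝ (Fin m)) → Linf (EuclideanSpace ℝ (Fin d))} {δ : ℝ}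
    (h : IsInvariantGraph X y₀ V) (hy : ∃ R, ∀ k t, ‖y₀ k t‖ ≤ R)
    (hδ : ∀ θ z, ‖phaseChart V θ z‖ ≤ δ) (θ : ℤ → ℝ) (p : Linf (EuclideanSpace ℝ (Fin m))) :
    ∃ x, ∃ ψ : ℤ → ℝ → ℝ, IsSolution X x ∧ (∀ k, Continuous (ψ k)) ∧ (∀ k, ψ k 0 = θ k) ∧
      (x 0).2 = p ∧ (∀ k, (x 0).1 k = y₀ k (θ k) + V θ p k) ∧
      ∀ t k, ‖(x t).1 k - y₀ k (ψ k t)‖ ≤ δ := by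
  obtain ⟨R, hR⟩ := hy
  obtain ⟨x, Φ, hx, hΦ, hΦ0, hp, hxΦ⟩ := h θ p
  have hk : ∀ t k, (x t).1 k =
      y₀ k (θ k + Φ t k) + phaseChart V θ (Φ t, (x t).2) k := fun t k => by
    have h1 : (x t).1 = toLinf (fun k => y₀ k (θ k + Φ t k)) + phaseChart V θ (Φ t, (x t).2) :=
      congrArg Prod.fst (hxΦ t)
    rw [h1]
    change toLinf (fun k => y₀ k (θ k + Φ t k)) k + _ = _
    rw [toLinf_apply ⟨R, fun k => hR k _⟩]
  refine ⟨x, fun k t => θ k + Φ t k, hx,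
    fun k => continuous_const.add ((evalL ℝ k).continuous.comp hΦ), fun k => ?_, hp, fun k => ?_,
    fun t k => ?_⟩
  · change θ k + Φ 0 k = θ k
    rw [hΦ0]
    exact add_zero _
  · have e : ∀ k, θ k + (0 : Linf ℝ) k = θ k := fun k => add_zero _
    rw [hk, hΦ0, hp, phaseChart]
    simp only [e]
  · rw [hk, add_sub_cancel_left]
    exact (linf_norm_apply_le _ k).trans (hδ θ _)

theorem exists_eq_of_half_lipschitz {X : Type} [NormedAddCommGroup X] [CompleteSpace X]
    {T : X → X} {s : ℝ} (hs : 0 ≤ s) (h0 : ‖T 0‖ ≤ s / 2)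
    (hT : ∀ x x', ‖x‖ ≤ s → ‖x'‖ ≤ s → ‖T x - T x'‖ ≤ 1 / 2 * ‖x - x'‖) :
    ∃ x, ‖x‖ ≤ s ∧ T x = x := by
  have hmaps : MapsTo T (closedBall 0 s) (closedBall 0 s) := fun x hx => by
    rw [mem_closedBall_zero_iff] at hx ⊢
    have h1 := hT x 0 hx (by simpa using hs)
    have h2 := norm_add_le (T x - T 0) (T 0)
    rw [sub_add_cancel] at h2
    rw [sub_zero] at h1
    linarith
  have hc : ContractingWith (1 / 2) (hmaps.restrict T _ _) := by
    refine ⟨by norm_num, LipschitzWith.of_dist_le_mul fun x x' => ?_⟩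
    rw [Subtype.dist_eq, Subtype.dist_eq, dist_eq_norm, dist_eq_norm]
    exact hT x x' (mem_closedBall_zero_iff.1 x.2) (mem_closedBall_zero_iff.1 x'.2)
  obtain ⟨x, hx, hfix, -⟩ := hc.exists_fixedPoint' isClosed_closedBall.isComplete hmaps
    (x := 0) (by simpa using hs) (edist_ne_top _ _)
  exact ⟨x, mem_closedBall_zero_iff.1 hx, hfix⟩

variable (D : NormalForm n f g Λ F G b)

/-- If every point of a graph `V'` lies on the invariant manifold, with nearby phases, then `V'`
covers the invariant manifold. -/
theorem NormalForm.exists_phase_of_subset {s₁ δ : ℝ} (hs₁ : 0 < s₁)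
    (hlin : ∀ (j : Disc (OrbitIndex f Λ)) t s s', |s| ≤ s₁ → |s'| ≤ s₁ →
      ‖orbitCurve j (t + s) - orbitCurve j (t + s') - (s - s') • f (orbitSite j) (orbitCurve j t)‖ ≤
        1 / (4 * D.C) * |s - s'|)
    (hδ : D.C * δ ≤ 1 / 4) (hδs : D.C * (δ + δ) ≤ s₁ / 4) (ω : ProductOrbit f Λ) (ε : ParamIcc b)
    {V' : (ℤ → ℝ) → Linf (EuclideanSpace ℝ (Fin m)) → Linf (EuclideanSpace ℝ (Fin d))}
    (hV : ∀ θ z, ‖phaseChart (D.manifold ω.1 ε) θ z‖ ≤ δ) (hV' : ∀ θ z, ‖phaseChart V' θ z‖ ≤ δ)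
    (hV'lip : ∀ θ z z', ‖phaseChart V' θ z - phaseChart V' θ z'‖ ≤ δ * ‖z - z'‖)
    (hsub : ∀ φ' p, ∃ φ : ℤ → ℝ, (∀ k, |φ k - φ' k| ≤ s₁ / 2) ∧
      ∀ k, ω.1 k (φ' k) + V' φ' p k = ω.1 k (φ k) + D.manifold ω.1 ε φ p k)
    (φ : ℤ → ℝ) (p : Linf (EuclideanSpace ℝ (Fin m))) :
    ∃ φ' : ℤ → ℝ, ∀ k, ω.1 k (φ k) + D.manifold ω.1 ε φ p k = ω.1 k (φ' k) + V' φ' p k := by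
  have hC := D.hyp.C_pos
  set i : Disc (ProductOrbit f Λ) × ParamIcc b := (ω.shift φ, ε)
  set Y := latCurve ProductOrbit.at orbitCurve i
  have hY : ∀ s k, Y s k = ω.1 k (φ k + s k) := fun s k =>
    latCurve_apply D.hyp.orbit_UC i s k
  obtain ⟨l, hl, hln⟩ := D.hyp.exists_adjointOp ProductOrbit.at i 0
  have hlY : ∀ s s' : Linf ℝ, ‖s‖ ≤ s₁ → ‖s'‖ ≤ s₁ →
      ‖s - s' - l (Y s - Y s')‖ ≤ 1 / 4 * ‖s - s'‖ := fun s s' hs hs' => linf_norm_le fun k => by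
    have e1 : (s - s' - l (Y s - Y s')) k = s k - s' k - l (Y s - Y s') k := rfl
    have e2 : (Y s - Y s') k = Y s k - Y s' k := rfl
    have h1 := hlin (i.1.at k) 0 (s k) (s' k) ((linf_norm_apply_le s k).trans hs)
      ((linf_norm_apply_le s' k).trans hs')
    have h2 : orbitCurve (i.1.at k) (0 + s k) = Y s k := by
      rw [zero_add, hY]; rfl
    have h3 : orbitCurve (i.1.at k) (0 + s' k) = Y s' k := by
      rw [zero_add, hY]; rfl
    rw [h2, h3] at h1
    have h4 : inner ℝ (D.ys (i.1.at k) 0) (f (orbitSite (i.1.at k)) (orbitCurve (i.1.at k) 0)) =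
        (1 : ℝ) := D.hyp.normalized (i.1.at k) 0
    have h5 : s k - s' k - l (Y s - Y s') k = -inner ℝ (D.ys (i.1.at k) 0)
        (Y s k - Y s' k - (s k - s' k) • f (orbitSite (i.1.at k)) (orbitCurve (i.1.at k) 0)) := by
      rw [inner_sub_right, inner_smul_right, h4, hl, e2]
      change s k - s' k - inner ℝ (D.ys (i.1.at k) 0) _ = _
      ring
    rw [e1, h5, norm_neg]
    calc _ ≤ D.C * (1 / (4 * D.C) * ‖s - s'‖) := (norm_inner_le_norm _ _).trans
          (mul_le_mul (D.hyp.ys_bdd _ _) (h1.trans (by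
            gcongr
            exact linf_norm_apply_le (s - s') k)) (norm_nonneg _) hC.le)
      _ = 1 / 4 * ‖s - s'‖ := by field_simp
  have hφ0 : ∀ k, φ k + (0 : Linf ℝ) k = φ k := fun k => add_zero _
  have hchart : ∀ s : Linf ℝ, D.chart i (s, p) = D.manifold ω.1 ε (fun k => φ k + s k) p :=
    fun s => congrFun (D.phaseChart_manifold ω ε φ).symm (s, p)
  have hchartδ : ‖D.chart i (0, p)‖ ≤ δ := by
    rw [← D.phaseChart_manifold]
    exact hV φ _
  -- A phase shift `s` is sought for which the point of `V'` at `φ + s` and the point of the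
  -- manifold at `φ` have the same projection under `l`. Only this projected equation has as many
  -- unknowns as conditions. The factor `1 / 2` is `1 / 4` from the curvature of the orbits and `1 /
  -- 4` from `V'`.
  obtain ⟨s, hs, hfix⟩ := exists_eq_of_half_lipschitz (s := s₁ / 2)
    (T := fun s => s - l (Y s - Y 0 + (phaseChart V' φ (s, p) - D.chart i (0, p))))
    (by positivity) (by
      rw [sub_self, zero_add, zero_sub, norm_neg]
      refine (hln _).trans ?_
      calc _ ≤ D.C * (δ + δ) := by
            gcongr
            exact (norm_sub_le _ _).trans (add_le_add (hV' _ _) hchartδ)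
        _ ≤ _ := by linarith) fun s s' hs hs' => by
      have e : s - l (Y s - Y 0 + (phaseChart V' φ (s, p) - D.chart i (0, p))) -
          (s' - l (Y s' - Y 0 + (phaseChart V' φ (s', p) - D.chart i (0, p)))) =
          (s - s' - l (Y s - Y s')) - l (phaseChart V' φ (s, p) - phaseChart V' φ (s', p)) := by
        simp only [map_add, map_sub]
        abel
      rw [e]
      have h1 := hlY s s' (by linarith) (by linarith)
      have h2 := (hln (phaseChart V' φ (s, p) - phaseChart V' φ (s', p))).trans
        (mul_le_mul_of_nonneg_left (hV'lip φ (s, p) (s', p)) hC.le)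
      have h3 : ‖((s, p) : Linf ℝ × Linf (EuclideanSpace ℝ (Fin m))) - (s', p)‖ = ‖s - s'‖ := by
        simp [Prod.norm_def]
      rw [h3, ← mul_assoc] at h2
      have h4 : D.C * δ * ‖s - s'‖ ≤ 1 / 4 * ‖s - s'‖ := by gcongr
      exact (norm_sub_le _ _).trans (by linarith)
  have hzero : l (Y s - Y 0 + (phaseChart V' φ (s, p) - D.chart i (0, p))) = 0 :=
    sub_eq_self.1 hfix
  -- The point of `V'` found above lies on the manifold at some nearby phases `φ + u`. There the
  -- projection under `l` is injective, so the equal projections force `u = 0` and the two points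
  -- coincide.
  obtain ⟨φ₂, hφ₂, heq⟩ := hsub (fun k => φ k + s k) p
  have hub : ∀ k, ‖φ₂ k - φ k‖ ≤ s₁ := fun k => by
    have h1 := hφ₂ k
    have h2 := (linf_norm_apply_le s k).trans hs
    have h3 := abs_add_le (φ₂ k - (φ k + s k)) (s k)
    have h4 : φ₂ k - (φ k + s k) + s k = φ₂ k - φ k := by ring
    rw [h4] at h3
    rw [Real.norm_eq_abs] at h2 ⊢
    linarith
  set u : Linf ℝ := toLinf fun k => φ₂ k - φ k with hu
  have huk : ∀ k, u k = φ₂ k - φ k := fun k => toLinf_apply ⟨s₁, hub⟩ k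
  have hus : ‖u‖ ≤ s₁ := linf_norm_le fun k => by rw [huk]; exact hub k
  have hφu : (fun k => φ k + u k) = φ₂ := funext fun k => by rw [huk]; ring
  have heq' : Y s + phaseChart V' φ (s, p) = Y u + D.chart i (u, p) := linf_ext fun k => by
    change Y s k + V' (fun k => φ k + s k) p k = Y u k + D.chart i (u, p) k
    have e3 : φ k + (φ₂ k - φ k) = φ₂ k := by ring
    rw [hY, hY, hchart, hφu, huk, e3]
    exact heq k
  have hzero' : l (Y u - Y 0) + l (D.chart i (u, p) - D.chart i (0, p)) = 0 := by
    refine (map_add l _ _).symm.trans ((congrArg l ?_).trans hzero)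
    rw [sub_add_sub_comm, sub_add_sub_comm, heq']
  have hu0 : u = 0 := by
    have h1 := hlY u 0 hus (by simpa using hs₁.le)
    have h2 := (hln (D.chart i (u, p) - D.chart i (0, p))).trans
      (mul_le_mul_of_nonneg_left (D.chart_lipschitz i (u, p) (0, p)) hC.le)
    have h3 : ‖((u, p) : Linf ℝ × Linf (EuclideanSpace ℝ (Fin m))) - (0, p)‖ = ‖u‖ := by
      simp [Prod.norm_def]
    rw [h3, ← mul_assoc] at h2
    have h4 : D.C * (8 * (2 * (2 * D.C)) * D.K) * ‖u‖ ≤ 1 / 4 * ‖u‖ := by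
      gcongr
      exact D.K_small
    have h5 : u = (u - 0 - l (Y u - Y 0)) - l (D.chart i (u, p) - D.chart i (0, p)) := by
      rw [sub_zero, sub_sub, hzero', sub_zero]
    have h6 : ‖u‖ ≤ ‖u - 0 - l (Y u - Y 0)‖ + ‖l (D.chart i (u, p) - D.chart i (0, p))‖ := by
      conv_lhs => rw [h5]
      exact norm_sub_le _ _
    rw [sub_zero u] at h1 h6
    exact norm_le_zero_iff.1 (by linarith)
  refine ⟨fun k => φ k + s k, fun k => ?_⟩
  rw [heq k, ← hφu, hu0]
  simp only [hφ0]

theorem UG.exists_iteratedFDeriv_modulus {ι Z E : Type} [PseudoMetricSpace ι]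
    [NormedAddCommGroup Z] [NormedSpace ℝ Z] [NormedAddCommGroup E] [NormedSpace ℝ E] {n : ℕ}
    {h : ι → Z → E} (hh : UG univ n h) {η : ℝ} (hη : 0 < η) :
    ∃ d > 0, ∀ i i', dist i i' < d → ∀ j ≤ n, ∀ z,
      ‖iteratedFDeriv ℝ j (h i) z - iteratedFDeriv ℝ j (h i') z‖ ≤ η := by
  have key : ∀ N ≤ n, ∃ d > 0, ∀ i i', dist i i' < d → ∀ j ≤ N, ∀ z,
      ‖iteratedFDeriv ℝ j (h i) z - iteratedFDeriv ℝ j (h i') z‖ ≤ η := by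
    intro N
    induction N with
    | zero =>
      intro hN
      obtain ⟨d, hd, H⟩ := hh.iteratedFDeriv_ucont 0 hN η hη
      refine ⟨d, hd, fun i i' hi j hj z => ?_⟩
      obtain rfl := Nat.le_zero.1 hj
      exact H i i' z z (mem_univ _) (mem_univ _) hi (by simpa using hd)
    | succ N ih =>
      intro hN
      obtain ⟨d, hd, H⟩ := ih (by omega)
      obtain ⟨d', hd', H'⟩ := hh.iteratedFDeriv_ucont (N + 1) hN η hη
      refine ⟨min d d', lt_min hd hd', fun i i' hi j hj z => ?_⟩
      rcases Nat.le_succ_iff.1 hj with hj | rfl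
      · exact H i i' (hi.trans_le (min_le_left _ _)) j hj z
      · exact H' i i' z z (mem_univ _) (mem_univ _) (hi.trans_le (min_le_right _ _))
          (by simpa using hd')
  exact key n le_rfl

end Uniqueness

end LDS

end

theorem theorem4 {n m : ℕ} (r : ℕ) (hr : 1 ≤ r)
    (f : ℤ → EuclideanSpace ℝ (Fin n) → EuclideanSpace ℝ (Fin n))
    (g : ℤ → EuclideanSpace ℝ (Fin n) → EuclideanSpace ℝ (Fin m))
    (hf : LDS.IsUniformFamily r f) (hg : LDS.IsUniformFamily r g)
    (Λ : ℤ → Set (EuclideanSpace ℝ (Fin n)))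
    (hΛ_bounded : ∃ R : ℝ, ∀ k, ∀ y ∈ Λ k, ‖y‖ ≤ R)
    (hΛ_invariant : ∀ k, LDS.IsInvariantSet (f k) (Λ k))
    (hΛ_hyperbolic : LDS.UniformlyHyperbolic f Λ)
    (a : ℝ) (ha : 0 < a)
    (F : ℝ → LDS.Linf (EuclideanSpace ℝ (Fin n)) × LDS.Linf (EuclideanSpace ℝ (Fin m)) →
      LDS.Linf (EuclideanSpace ℝ (Fin n)))
    (G : ℝ → LDS.Linf (EuclideanSpace ℝ (Fin n)) × LDS.Linf (EuclideanSpace ℝ (Fin m)) →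
      LDS.Linf (EuclideanSpace ℝ (Fin m)))
    (hF : LDS.IsCrContinuousFamily r a F) (hG : LDS.IsCrContinuousFamily r a G) :
    ∃ ε₀ > 0, ε₀ ≤ a ∧ ∃ δ > 0,
    ∃ V : (ℤ → ℝ → EuclideanSpace ℝ (Fin n)) → ℝ → (ℤ → ℝ) →
        LDS.Linf (EuclideanSpace ℝ (Fin m)) → LDS.Linf (EuclideanSpace ℝ (Fin n)),
      -- for every small `ε` and every orbit, `y0 + V` is an invariant `C^r` manifold
      (∀ ε, |ε| < ε₀ → ∀ y0, LDS.IsProductOrbit f Λ y0 →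
        (∀ θ, LDS.IsCr r (LDS.phaseChart (V y0 ε) θ)) ∧
        (∀ θ, LDS.IsCrImmersion r (LDS.graphParam y0 (V y0 ε) θ)) ∧
        LDS.IsInvariantGraph (LDS.coupledField f g F G ε) y0 (V y0 ε) ∧
        -- it is uniquely defined: it consists of all solutions which stay close to the orbit up to
        -- time reparametrizations, and it is the only invariant manifold of this form
        LDS.phaseGraph y0 (V y0 ε) = LDS.shadowingSet (LDS.coupledField f g F G ε) y0 δ ∧
        (∀ V' : (ℤ → ℝ) → LDS.Linf (EuclideanSpace ℝ (Fin m)) →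
            LDS.Linf (EuclideanSpace ℝ (Fin n)),
          (∀ θ, LDS.IsCr r (LDS.phaseChart V' θ)) →
          (∀ θ, ∀ j ≤ 1, ∀ z, ‖iteratedFDeriv ℝ j (LDS.phaseChart V' θ) z‖ ≤ δ) →
          LDS.IsInvariantGraph (LDS.coupledField f g F G ε) y0 V' →
          LDS.phaseGraph y0 V' = LDS.phaseGraph y0 (V y0 ε))) ∧
      -- at `ε = 0` it is the product of the orbit curves times `ℓ∞(P)`
      (∀ y0, LDS.IsProductOrbit f Λ y0 → LDS.phaseGraph y0 (V y0 0) = LDS.orbitProduct y0) ∧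
      -- continuous dependence on `ε` in `C^r`, uniformly in the orbit
      (∀ ε₁, |ε₁| < ε₀ → ∀ η > 0, ∃ ρ > 0, ∀ ε, |ε| < ε₀ → |ε - ε₁| < ρ →
        ∀ y0, LDS.IsProductOrbit f Λ y0 → ∀ θ, ∀ j ≤ r, ∀ z,
          ‖iteratedFDeriv ℝ j (LDS.phaseChart (V y0 ε) θ) z -
            iteratedFDeriv ℝ j (LDS.phaseChart (V y0 ε₁) θ) z‖ ≤ η) ∧
      -- `V = O(ε)` in `C^{r-1}`, uniformly
      (∃ K : ℝ, ∀ ε, |ε| < ε₀ → ∀ y0, LDS.IsProductOrbit f Λ y0 → ∀ θ, ∀ j < r, ∀ z,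
        ‖iteratedFDeriv ℝ j (LDS.phaseChart (V y0 ε) θ) z‖ ≤ K * |ε|) ∧
      -- `V = o(1)` in `C^r`, uniformly
      (∀ η > 0, ∃ ρ > 0, ∀ ε, |ε| < ε₀ → |ε| < ρ →
        ∀ y0, LDS.IsProductOrbit f Λ y0 → ∀ θ, ∀ j ≤ r, ∀ z,
          ‖iteratedFDeriv ℝ j (LDS.phaseChart (V y0 ε) θ) z‖ ≤ η) := by
  obtain ⟨l, rfl⟩ : ∃ l, r = l + 1 := ⟨r - 1, by omega⟩
  -- Any closed interval inside `(-a, a)` would serve.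
  obtain ⟨D⟩ := LDS.exists_normalForm (b := a / 2) hf hg hΛ_bounded hΛ_hyperbolic (by linarith)
    (by linarith) hF hG
  have hC := D.hyp.C_pos
  have hε₁ := D.ε₁_pos
  obtain ⟨K, hK0, hK⟩ := D.exists_chart_bound
  obtain ⟨s₁, hs₁, hlin⟩ := D.hyp.exists_orbit_linearization (η := 1 / (4 * D.C)) (by positivity)
  obtain ⟨δ, hδ, hδs, M, hM, hphase⟩ := D.exists_phase_of_shadowing hf hg
    -- The first bound is the closeness of phases required in the covering argument. The other two
    -- limit `δ` to meet its conditions `D.C * (δ + δ) ≤ s₁ / 4` and `D.C * δ ≤ 1 / 4`.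
    (s₁ := min (s₁ / 2) (min (s₁ / (8 * D.C)) (1 / (4 * D.C)))) (by positivity)
  obtain ⟨MF, hMF⟩ := D.F_smooth.1
  have hδ1 : D.C * δ ≤ 1 / 4 := by
    calc D.C * δ ≤ D.C * (1 / (4 * D.C)) := by
          gcongr
          exact hδs.trans ((min_le_right _ _).trans (min_le_right _ _))
      _ = 1 / 4 := by field_simp
  have hδ2 : D.C * (δ + δ) ≤ s₁ / 4 := by
    have h1 : δ ≤ s₁ / (8 * D.C) := hδs.trans ((min_le_right _ _).trans (min_le_left _ _))
    calc D.C * (δ + δ) ≤ D.C * (s₁ / (8 * D.C) + s₁ / (8 * D.C)) := by gcongr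
      _ = s₁ / 4 := by field_simp; norm_num
  -- The three bounds serve the substitution `ε = ε₁ sin η`, the estimate `‖V‖ ≤ δ` that makes the
  -- manifold itself shadow the orbits, and the size of `ε F` allowed in phase tracking.
  set ε₀ := min D.ε₁ (min (δ / (K + 1)) (M / (|MF| + 1))) with hε₀
  have hε₀pos : 0 < ε₀ := by positivity
  have hε₀1 : ε₀ ≤ D.ε₁ := min_le_left _ _
  have hε₀b : ε₀ ≤ a / 2 := hε₀1.trans D.ε₁_le
  have hmem : ∀ ε, |ε| < ε₀ → ε ∈ Set.Icc (-(a / 2)) (a / 2) := fun ε hε =>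
    abs_le.1 (hε.le.trans hε₀b)
  have hKδ : ∀ ε, |ε| < ε₀ → K * |ε| ≤ δ := fun ε hε => by
    have h1 : |ε| ≤ δ / (K + 1) := hε.le.trans ((min_le_right _ _).trans (min_le_left _ _))
    calc K * |ε| ≤ (K + 1) * (δ / (K + 1)) := by gcongr; linarith
      _ = δ := by field_simp
  have hFM : ∀ ε, |ε| < ε₀ → ∀ x, ‖ε • F ε x‖ ≤ M := fun ε hε x => by
    have h1 : |ε| ≤ M / (|MF| + 1) := hε.le.trans ((min_le_right _ _).trans (min_le_right _ _))
    have h2 : ‖F ε x‖ ≤ MF := hMF ⟨ε, hmem ε hε⟩ x (Set.mem_univ _)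
    rw [norm_smul, Real.norm_eq_abs]
    calc |ε| * ‖F ε x‖ ≤ M / (|MF| + 1) * (|MF| + 1) := by
          gcongr
          linarith [le_abs_self MF]
      _ = M := by field_simp
  have hchart : ∀ ε (hε : |ε| < ε₀) y0 (hy0 : LDS.IsProductOrbit f Λ y0) θ,
      LDS.phaseChart (D.manifold y0 ε) θ =
        D.chart (LDS.ProductOrbit.shift ⟨y0, hy0⟩ θ, ⟨ε, hmem ε hε⟩) := fun ε hε y0 hy0 θ =>
    D.phaseChart_manifold ⟨y0, hy0⟩ ⟨ε, hmem ε hε⟩ θ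
  have hsmall : ∀ ε, |ε| < ε₀ → ∀ y0, LDS.IsProductOrbit f Λ y0 → ∀ θ, ∀ j < l + 1, ∀ z,
      ‖iteratedFDeriv ℝ j (LDS.phaseChart (D.manifold y0 ε) θ) z‖ ≤ K * |ε| :=
    fun ε hε y0 hy0 θ j hj z => by
      rw [hchart ε hε y0 hy0]
      exact hK (LDS.ProductOrbit.shift ⟨y0, hy0⟩ θ, ⟨ε, hmem ε hε⟩) j hj z
  have hVδ : ∀ ε, |ε| < ε₀ → ∀ y0, LDS.IsProductOrbit f Λ y0 → ∀ θ z,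
      ‖LDS.phaseChart (D.manifold y0 ε) θ z‖ ≤ δ := fun ε hε y0 hy0 θ z => by
    rw [← norm_iteratedFDeriv_zero (𝕜 := ℝ) (f := LDS.phaseChart (D.manifold y0 ε) θ)]
    exact (hsmall ε hε y0 hy0 θ 0 (by omega) z).trans (hKδ ε hε)
  have hzero : ∀ y0, LDS.IsProductOrbit f Λ y0 → ∀ θ,
      LDS.phaseChart (D.manifold y0 0) θ = fun _ => 0 := fun y0 hy0 θ => by
    rw [hchart 0 (by rwa [abs_zero]) y0 hy0 θ]
    exact funext fun z => D.chart_zero _ _ rfl z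
  have hybdd : ∀ y0, LDS.IsProductOrbit f Λ y0 → ∃ R, ∀ k t, ‖y0 k t‖ ≤ R := fun y0 hy0 =>
    let ⟨R, hR⟩ := hΛ_bounded
    ⟨R, fun k t => hR k _ ((hy0 k).2 t)⟩
  have hcont : ∀ ε₁, |ε₁| < ε₀ → ∀ η > 0, ∃ ρ > 0, ∀ ε, |ε| < ε₀ → |ε - ε₁| < ρ →
      ∀ y0, LDS.IsProductOrbit f Λ y0 → ∀ θ, ∀ j ≤ l + 1, ∀ z,
        ‖iteratedFDeriv ℝ j (LDS.phaseChart (D.manifold y0 ε) θ) z -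
          iteratedFDeriv ℝ j (LDS.phaseChart (D.manifold y0 ε₁) θ) z‖ ≤ η := by
    intro ε₁ hε₁ η hη
    obtain ⟨ρ, hρ, H⟩ := D.chart_UC.2.exists_iteratedFDeriv_modulus hη
    refine ⟨ρ, hρ, fun ε hε hd y0 hy0 θ j hj z => ?_⟩
    rw [hchart ε hε y0 hy0, hchart ε₁ hε₁ y0 hy0]
    refine H (LDS.ProductOrbit.shift ⟨y0, hy0⟩ θ, ⟨ε, hmem ε hε⟩)
      (LDS.ProductOrbit.shift ⟨y0, hy0⟩ θ, ⟨ε₁, hmem ε₁ hε₁⟩) ?_ j hj z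
    rw [Prod.dist_eq, dist_self, Subtype.dist_eq, Real.dist_eq]
    exact max_lt hρ hd
  refine ⟨ε₀, hε₀pos, hε₀b.trans (by linarith), δ, hδ, D.manifold, fun ε hε y0 hy0 => ?_,
    fun y0 hy0 => ?_, hcont, ⟨K, hsmall⟩, fun η hη => ?_⟩
  · have hεε : |ε| ≤ D.ε₁ := hε.le.trans hε₀1
    have hinv := D.isInvariantGraph hf hg ⟨y0, hy0⟩ ⟨ε, hmem ε hε⟩ hεε
    have hph := hphase ⟨y0, hy0⟩ ⟨ε, hmem ε hε⟩ hεε (hFM ε hε)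
    refine ⟨fun θ => D.isCr_phaseChart ⟨y0, hy0⟩ ⟨ε, hmem ε hε⟩ θ,
      fun θ => D.isCrImmersion_graphParam ⟨y0, hy0⟩ ⟨ε, hmem ε hε⟩ θ, hinv, ?_,
      fun V' hV'C hV'δ hV' => ?_⟩
    · refine Set.Subset.antisymm ?_ ?_
      · rintro x ⟨φ, hφ⟩
        obtain ⟨X, ψ, hX, hψ, -, hp, hx, hcl⟩ :=
          hinv.exists_shadowing (hybdd y0 hy0) (hVδ ε hε y0 hy0) φ x.2
        refine ⟨X, hX, Prod.ext (LDS.linf_ext fun k => ?_) hp, ψ, hψ, hcl⟩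
        rw [hx, hφ]
      · rintro x ⟨X, hX, rfl, ψ, hψ, hcl⟩
        obtain ⟨φ, -, hφ⟩ := hph X hX ψ hψ hcl
        exact ⟨φ, hφ⟩
    · have hV'0 : ∀ θ z, ‖LDS.phaseChart V' θ z‖ ≤ δ := fun θ z => by
        rw [← norm_iteratedFDeriv_zero (𝕜 := ℝ) (f := LDS.phaseChart V' θ)]
        exact hV'δ θ 0 (by omega) z
      have hV'lip : ∀ θ z z',
          ‖LDS.phaseChart V' θ z - LDS.phaseChart V' θ z'‖ ≤ δ * ‖z - z'‖ := fun θ z z' => by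
        have hd : Differentiable ℝ (LDS.phaseChart V' θ) :=
          (hV'C θ).contDiff.differentiable (by exact_mod_cast Nat.succ_ne_zero l)
        refine LDS.lipschitz_of_deriv_le convex_univ (fun z _ => (hd z).hasFDerivAt)
          (fun z _ => ?_) (Set.mem_univ z') (Set.mem_univ z)
        have := hV'δ θ 1 le_rfl z
        rwa [← norm_iteratedFDeriv_fderiv, norm_iteratedFDeriv_zero] at this
      -- Solutions on a competing graph stay within `δ` of the orbits, hence lie on the manifold.
      -- Their shadowing phases start at `φ'`, which gives closeness of the phases.
      have hsub : ∀ φ' p, ∃ φ : ℤ → ℝ, (∀ k, |φ k - φ' k| ≤ s₁ / 2) ∧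
          ∀ k, y0 k (φ' k) + V' φ' p k = y0 k (φ k) + D.manifold y0 ε φ p k := fun φ' p => by
        obtain ⟨X, ψ, hX, hψ, hψ0, hp, hx, hcl⟩ :=
          hV'.exists_shadowing (hybdd y0 hy0) hV'0 φ' p
        obtain ⟨φ, hφψ, hφ⟩ := hph X hX ψ hψ hcl
        refine ⟨φ, fun k => ?_, fun k => ?_⟩
        · rw [← hψ0]
          exact (hφψ k).trans (min_le_left _ _)
        · rw [← hx, hφ, hp]
      refine Set.Subset.antisymm ?_ ?_
      · rintro x ⟨φ', hφ'⟩
        obtain ⟨φ, -, hφ⟩ := hsub φ' x.2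
        exact ⟨φ, fun k => (hφ' k).trans (hφ k)⟩
      · rintro x ⟨φ, hφ⟩
        obtain ⟨φ', hφ'⟩ := D.exists_phase_of_subset hs₁ hlin hδ1 hδ2 ⟨y0, hy0⟩
          ⟨ε, hmem ε hε⟩ (hVδ ε hε y0 hy0) hV'0 hV'lip hsub φ x.2
        exact ⟨φ', fun k => (hφ k).trans (hφ' k)⟩
  · have h0 : ∀ φ p, D.manifold y0 0 φ p = 0 := fun φ p => by
      have := congrFun (hzero y0 hy0 φ) (0, p)
      rw [LDS.phaseChart] at this
      refine Eq.trans (congrArg (D.manifold y0 0 · p) (funext fun k => ?_)) this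
      exact (add_zero (φ k)).symm
    have h1 : ∀ φ p k, y0 k (φ k) + D.manifold y0 0 φ p k = y0 k (φ k) := fun φ p k => by
      rw [h0]
      exact add_zero _
    refine Set.ext fun x => exists_congr fun φ => forall_congr' fun k => ?_
    rw [h1]
  · obtain ⟨ρ, hρ, H⟩ := hcont 0 (by rwa [abs_zero]) η hη
    refine ⟨ρ, hρ, fun ε hε hd y0 hy0 θ j hj z => ?_⟩
    have := H ε hε (by rwa [sub_zero]) y0 hy0 θ j hj z
    rw [hzero y0 hy0] at this
    simpa using this
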